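/- Let $n\ge 0$ be an integer. For an associative unital algebra $A$ over $\mathbb C$, let $HH_k(A)=HH_k(A,A)$, $k\ge 0$, denote its Hochschild homology, that is, the homology of the Hochschild complex with terms $A^{\otimes (k+1)}$ and differential $b=\sum_{i=0}^{k}(-1)^i d_i$, where $d_i(a_0\otimes\cdots\otimes a_k)=a_0\otimes\cdots\otimes a_ia_{i+1}\otimes\cdots\otimes a_k$ for $i<k$ and $d_k(a_0\otimes\cdots\otimes a_k)=a_ka_0\otimes a_1\otimes\cdots\otimes a_{k-1}$ (and $b=0$ in degree $0$). Regard $HH_*(A)=\bigoplus_{k\ge 0}HH_k(A)$ as a graded super vector space in which $HH_k(A)$ has parity $(-1)^k$. Let $A(n)=\mathbb C[S_n]\ltimes A^{\otimes n}$ be the crossed product algebra for the action of $S_n$ on $A^{\otimes n}$ by permutation of the tensor factors. Then there is an isomorphism of graded super vector spaces $$ HH_*(A(n))\;\cong\;\bigoplus_{\lambda\vdash n}\;\bigotimes_{i\ge 1}S^{p_i(\lambda)}HH_*(A), $$ where $\lambda$ runs over the partitions of $n$, $p_i(\lambda)$ is the multiplicity of $i$ as a part of $\lambda$, and $S^p V$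 is the $p$-th symmetric power in the category of super vector spaces, i.e. the coinvariants of $S_p$ acting on $V^{\otimes p}$ by permutation of the factors with the Koszul sign rule ($S^0V=\mathbb C$ in degree $0$). The isomorphism preserves the grading by homological degree (on the right-hand side, the total degree), and it is natural in $A$: for every homomorphism $f:A\to B$ of unital $\mathbb C$-algebras it intertwines the map $HH_*(A(n))\to HH_*(B(n))$ induced by $f$ with the map on the right-hand sides induced by $HH_*(f):HH_*(A)\to HH_*(B)$. -/

import Mathlib

open scoped TensorProduct DirectSum

universe u

noncomputable section

namespace HochschildWreath

/-! ### The Hochschild complex and Hochschild homology `HH_k(A) = HH_k(A, A)` -/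

/-- The `i`-th face of the Hochschild complex on a pure tensor `a₀ ⊗ ⋯ ⊗ a_{k+1}`:
for `i ≤ k` it is `a₀ ⊗ ⋯ ⊗ aᵢ aᵢ₊₁ ⊗ ⋯ ⊗ a_{k+1}`, and for `i = k + 1` it is
`a_{k+1} a₀ ⊗ a₁ ⊗ ⋯ ⊗ a_k`. -/
def faceTuple {A : Type u} [Mul A] {k : ℕ} (i : Fin (k + 2)) (a : Fin (k + 2) → A) :
    Fin (k + 1) → A := fun j =>
  if (i : ℕ) = k + 1 ∧ (j : ℕ) = 0 then a (Fin.last (k + 1)) * a 0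
  else if (j : ℕ) < i then a j.castSucc
  else if (j : ℕ) = i then a j.castSucc * a j.succ
  else a j.succ

/-- Auxiliary version of `faceTuple` for sequences indexed by `ℕ`. -/
def faceSeq {A : Type u} [Mul A] (n i : ℕ) (b : ℕ → A) (j : ℕ) : A :=
  if i = n ∧ j = 0 then b n * b 0
  else if j < i then b j
  else if j = i then b j * b (j + 1)
  else b (j + 1)

theorem faceTuple_eq_faceSeq {A : Type u} [Mul A] {k : ℕ} (i : Fin (k + 2))
    (a : Fin (k + 2) → A) (b : ℕ → A) (h : ∀ p, a p = b p) (j) :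
    faceTuple i a j = faceSeq (k + 1) i b j := by
  simp [faceTuple, faceSeq, h]

theorem faceSeq_comp {A : Type u} [Semigroup A] (k i j m : ℕ) (b : ℕ → A) (hij : i < j)
    (hj : j ≤ k + 2) (hm : m ≤ k) :
    faceSeq (k + 1) i (faceSeq (k + 2) j b) m =
      faceSeq (k + 1) (j - 1) (faceSeq (k + 2) i b) m := by
  obtain ⟨j, rfl⟩ : ∃ j', j = j' + 1 := ⟨j - 1, by omega⟩
  have e (p q) (h : p = q) : b p = b q := congrArg b h
  have e2 (p q r) (h : p = q) (h' : q + 1 = r) : b p * b r = b q * b (q + 1) := by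
    subst h h'; rfl
  simp only [faceSeq, Nat.add_sub_cancel]
  grind [mul_assoc]

theorem faceTuple_comp {A : Type u} [Semigroup A] {k : ℕ} (a : Fin (k + 3) → A)
    (i : Fin (k + 2)) (j : Fin (k + 2)) (hij : i ≤ j) :
    faceTuple i (faceTuple j.succ a) = faceTuple j (faceTuple i.castSucc a) := by
  funext m
  let b : ℕ → A := fun p => if h : p < k + 3 then a ⟨p, h⟩ else a 0
  have hb : ∀ p, a p = b p := fun p => by simp [b]
  have hb' : ∀ t p, faceTuple t a p = faceSeq (k + 2) t b p :=
    fun t p => faceTuple_eq_faceSeq t a b hb p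
  rw [faceTuple_eq_faceSeq _ _ _ (hb' _), faceTuple_eq_faceSeq _ _ _ (hb' _)]
  exact faceSeq_comp k i (j + 1) m b (by simpa [Nat.lt_succ_iff] using hij) (by omega) (by omega)

/-- The tensor slot of the `i`-th face in which the `m`-th entry of the input ends up. -/
def faceSlot {k : ℕ} (i m : Fin (k + 2)) : Fin (k + 1) :=
  ⟨if (m : ℕ) = k + 1 ∧ (i : ℕ) = k + 1 then 0 else if (m : ℕ) ≤ i then m else m - 1, by
    split_ifs <;> omega⟩

theorem faceTuple_update {A : Type u} [Mul A] {k : ℕ} (i m : Fin (k + 2))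
    (a : Fin (k + 2) → A) (x : A) :
    faceTuple i (Function.update a m x) = Function.update (faceTuple i a) (faceSlot i m)
      (faceTuple i (Function.update a m x) (faceSlot i m)) := by
  funext j
  by_cases hj : j = faceSlot i m
  · subst hj; simp
  rw [Function.update_of_ne hj]
  have h1 : ∀ p : Fin (k + 2), p ≠ m → Function.update a m x p = a p := fun p hp =>
    Function.update_of_ne hp _ _
  have hj' : (j : ℕ) ≠ faceSlot i m := fun h => hj (Fin.ext h)
  simp only [faceSlot] at hj'
  unfold faceTuple
  split_ifs with c1 c2 c3
  · rw [h1, h1] <;> (rw [Ne, Fin.ext_iff]; simp; split_ifs at hj' <;> omega)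
  · rw [h1]; (rw [Ne, Fin.ext_iff]; simp; split_ifs at hj' <;> omega)
  · rw [h1, h1] <;> (rw [Ne, Fin.ext_iff]; simp; split_ifs at hj' <;> omega)
  · rw [h1]; (rw [Ne, Fin.ext_iff]; simp; split_ifs at hj' <;> omega)

theorem faceTuple_update_slot {A : Type u} [Ring A] {k : ℕ} (i m : Fin (k + 2))
    (a : Fin (k + 2) → A) :
    ∃ c d : A, ∀ x, faceTuple i (Function.update a m x) (faceSlot i m) = c * x * d := by
  have h1 : ∀ p : Fin (k + 2), (p : ℕ) ≠ m → ∀ x, Function.update a m x p = a p :=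
    fun p hp x => Function.update_of_ne (fun h => hp (congrArg _ h)) _ _
  have h2 : ∀ p : Fin (k + 2), (p : ℕ) = m → ∀ x, Function.update a m x p = x :=
    fun p hp x => by rw [Fin.ext hp]; simp
  unfold faceTuple
  by_cases c1 : (i : ℕ) = k + 1 ∧ (faceSlot i m : ℕ) = 0
  · simp only [if_pos c1]
    by_cases hm : (m : ℕ) = k + 1
    · refine ⟨1, a 0, fun x => ?_⟩
      rw [h2 _ (by simp [hm]), h1 0 (by simp [hm])]; simp
    · refine ⟨a (Fin.last _), 1, fun x => ?_⟩
      rw [h1 (Fin.last _) (by simp; omega),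
        h2 0 (by simp [faceSlot] at c1 ⊢; split_ifs at c1 <;> omega)]
      simp
  simp only [if_neg c1]
  by_cases c2 : (faceSlot i m : ℕ) < i
  · refine ⟨1, 1, fun x => ?_⟩
    rw [if_pos c2, h2]; simp
    simp [faceSlot] at c1 c2 ⊢; split_ifs at * <;> omega
  simp only [if_neg c2]
  by_cases c3 : (faceSlot i m : ℕ) = i
  · simp only [if_pos c3]
    by_cases hm : (m : ℕ) = i
    · refine ⟨1, a (faceSlot i m).succ, fun x => ?_⟩
      rw [h2 _ (by simp; omega), h1 _ (by simp; omega)]; simp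
    · refine ⟨a (faceSlot i m).castSucc, 1, fun x => ?_⟩
      rw [h1 _ (by simp; omega),
        h2 _ (by simp [faceSlot] at c3 ⊢; split_ifs at * <;> omega)]
      simp
  simp only [if_neg c3]
  refine ⟨1, 1, fun x => ?_⟩
  rw [h2]; simp
  simp [faceSlot] at c1 c2 c3 ⊢; split_ifs at * <;> omega

section Complex

variable (A : Type u) [Ring A] [Algebra ℂ A]

/-- The tensor power `A^{⊗ n}` over `ℂ`, with its componentwise algebra structure. -/
abbrev TPow (n : ℕ) : Type u := ⨂[ℂ] _ : Fin n, A

/-- The `i`-th face `A^{⊗ (k+2)} → A^{⊗ (k+1)}` as a multilinear map. -/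
def faceMultilinear (k : ℕ) (i : Fin (k + 2)) :
    MultilinearMap ℂ (fun _ : Fin (k + 2) => A) (TPow A (k + 1)) where
  toFun a := PiTensorProduct.tprod ℂ (faceTuple i a)
  map_update_add' {inst} a m x y := by
    obtain rfl : inst = instDecidableEqFin _ := Subsingleton.elim _ _
    obtain ⟨c, d, h⟩ := faceTuple_update_slot i m a
    rw [faceTuple_update i m a (x + y), faceTuple_update i m a x, faceTuple_update i m a y,
      h, h, h, mul_add, add_mul, MultilinearMap.map_update_add]
  map_update_smul' {inst} a m r x := by
    obtain rfl : inst = instDecidableEqFin _ := Subsingleton.elim _ _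
    obtain ⟨c, d, h⟩ := faceTuple_update_slot i m a
    rw [faceTuple_update i m a (r • x), faceTuple_update i m a x,
      h, h, mul_smul_comm, smul_mul_assoc, MultilinearMap.map_update_smul]

/-- The `i`-th face `A^{⊗ (k+2)} → A^{⊗ (k+1)}` of the Hochschild complex. -/
def face (k : ℕ) (i : Fin (k + 2)) : TPow A (k + 2) →ₗ[ℂ] TPow A (k + 1) :=
  PiTensorProduct.lift (faceMultilinear A k i)

@[simp]
theorem face_tprod (k : ℕ) (i : Fin (k + 2)) (a : Fin (k + 2) → A) :
    face A k i (PiTensorProduct.tprod ℂ a) = PiTensorProduct.tprod ℂ (faceTuple i a) := by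
  simp [face, faceMultilinear]

theorem face_comp (k : ℕ) (i j : Fin (k + 2)) (hij : i ≤ j) :
    face A k i ∘ₗ face A (k + 1) j.succ = face A k j ∘ₗ face A (k + 1) i.castSucc := by
  ext a
  simp [faceTuple_comp a i j hij]

/-- The Hochschild differential `b = ∑ᵢ (-1)ⁱ dᵢ : A^{⊗ (k+2)} → A^{⊗ (k+1)}`. -/
def hochschildD (k : ℕ) : TPow A (k + 2) →ₗ[ℂ] TPow A (k + 1) :=
  ∑ i : Fin (k + 2), (-1 : ℂ) ^ (i : ℕ) • face A k i

theorem hochschildD_comp (k : ℕ) : hochschildD A k ∘ₗ hochschildD A (k + 1) = 0 := by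
  have expand : hochschildD A k ∘ₗ hochschildD A (k + 1) =
      ∑ i : Fin (k + 2), ∑ j : Fin (k + 3),
        ((-1 : ℂ) ^ (i : ℕ) * (-1) ^ (j : ℕ)) • (face A k i ∘ₗ face A (k + 1) j) := by
    ext a
    simp [hochschildD, Finset.smul_sum, smul_smul]
  rw [expand]
  simp only [← Finset.sum_product']
  let P := Fin (k + 2) × Fin (k + 3)
  let S : Finset P := {ij : P | (ij.2 : ℕ) ≤ (ij.1 : ℕ)}
  rw [Finset.univ_product_univ, ← Finset.sum_add_sum_compl S, ← eq_neg_iff_add_eq_zero,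
    ← Finset.sum_neg_distrib]
  let φ : ∀ ij : P, ij ∈ S → P := fun ij hij =>
    (Fin.castLT ij.2 (lt_of_le_of_lt (Finset.mem_filter.mp hij).right (Fin.is_lt ij.1)),
      ij.1.succ)
  apply Finset.sum_bij φ
  · intro ij hij
    simp_rw [S, φ, Finset.compl_filter, Finset.mem_filter_univ, Fin.val_succ,
      Fin.val_castLT] at hij ⊢
    lia
  · rintro ⟨i, j⟩ hij ⟨i', j'⟩ hij' h
    rw [Prod.mk_inj]
    exact ⟨by simpa [φ] using! congr_arg Prod.snd h,
      by simpa [φ, Fin.castSucc_castLT] using! congr_arg Fin.castSucc (congr_arg Prod.fst h)⟩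
  · rintro ⟨i', j'⟩ hij'
    simp_rw [S, Finset.compl_filter, Finset.mem_filter_univ, not_le] at hij'
    refine ⟨(j'.pred <| ?_, Fin.castSucc i'), ?_, ?_⟩
    · rintro rfl
      simp only [Fin.val_zero, not_lt_zero] at hij'
    · simpa [S] using! Nat.le_sub_one_of_lt hij'
    · simp only [φ, Fin.castLT_castSucc, Fin.succ_pred]
  · rintro ⟨i, j⟩ hij
    have hij' : (j : ℕ) ≤ i := by simpa [S] using hij
    dsimp only [φ]
    rw [face_comp A k _ i (by simpa [Fin.le_def] using hij')]
    refine Eq.trans ?_ (neg_smul _ _)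
    congr 1
    simp only [Fin.val_succ, Fin.val_castLT, pow_succ]
    ring

open CategoryTheory in
/-- The Hochschild chain complex `⋯ → A^{⊗ 3} → A^{⊗ 2} → A` of `A` with coefficients in `A`
(degree `k` is `A^{⊗ (k+1)}`). -/
def hochschildComplex : ChainComplex (ModuleCat.{u} ℂ) ℕ :=
  ChainComplex.of (fun k => ModuleCat.of ℂ (TPow A (k + 1)))
    (fun k => ModuleCat.ofHom (hochschildD A k))
    (fun k => by rw [← ModuleCat.ofHom_comp, hochschildD_comp]; rfl)

/-- Hochschild homology `HH_k(A) = HH_k(A, A)`. -/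
abbrev HH (k : ℕ) : Type u := (hochschildComplex A).homology k

variable {A} {B : Type u} [Ring B] [Algebra ℂ B]

theorem faceTuple_map (f : A →ₐ[ℂ] B) {k : ℕ} (i : Fin (k + 2)) (a : Fin (k + 2) → A) :
    faceTuple i (fun j => f (a j)) = fun j => f (faceTuple i a j) := by
  funext j
  unfold faceTuple
  split_ifs <;> simp

/-- The map `f^{⊗ n} : A^{⊗ n} → B^{⊗ n}`. -/
def tpowMap (f : A →ₐ[ℂ] B) (n : ℕ) : TPow A n →ₗ[ℂ] TPow B n :=
  PiTensorProduct.map fun _ => f.toLinearMap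

@[simp]
theorem tpowMap_tprod (f : A →ₐ[ℂ] B) (n : ℕ) (a : Fin n → A) :
    tpowMap f n (PiTensorProduct.tprod ℂ a) = PiTensorProduct.tprod ℂ fun i => f (a i) := by
  simp [tpowMap]

theorem hochschildD_map (f : A →ₐ[ℂ] B) (k : ℕ) :
    hochschildD B k ∘ₗ tpowMap f (k + 2) = tpowMap f (k + 1) ∘ₗ hochschildD A k := by
  ext a
  simp [hochschildD, faceTuple_map]

open CategoryTheory in
/-- The chain map of Hochschild complexes induced by an algebra homomorphism. -/
def hochschildComplexMap (f : A →ₐ[ℂ] B) : hochschildComplex A ⟶ hochschildComplex B :=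
  ChainComplex.ofHom (fun k => ModuleCat.ofHom (tpowMap f (k + 1)))
    (fun k => by
      dsimp only [hochschildComplex]
      rw [ChainComplex.of_d, ChainComplex.of_d, ← ModuleCat.ofHom_comp, ← ModuleCat.ofHom_comp,
        hochschildD_map])

/-- The map `HH_k(A) → HH_k(B)` induced by an algebra homomorphism `A → B`. -/
def HHMap (f : A →ₐ[ℂ] B) (k : ℕ) : HH A k →ₗ[ℂ] HH B k :=
  (HomologicalComplex.homologyMap (hochschildComplexMap f) k).hom

end Complex

/-! ### The crossed product `A(n) = ℂ[S_n] ⋉ A^{⊗ n}` -/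

section CrossedProduct

variable (A : Type u) [Ring A] [Algebra ℂ A] (n : ℕ)

/-- `S_n` acts on `A^{⊗ n}` by permuting the tensor factors: `σ` moves the factor in position `i`
to position `σ i`. -/
instance permAction : MulSemiringAction (Equiv.Perm (Fin n)) (TPow A n) where
  smul σ x := PiTensorProduct.reindex ℂ (fun _ => A) σ x
  one_smul x := by
    change PiTensorProduct.reindex ℂ (fun _ => A) (Equiv.refl _) x = x
    rw [PiTensorProduct.reindex_refl]; rfl
  mul_smul σ τ x :=
    (PiTensorProduct.reindex_reindex (R := ℂ) (s := fun _ : Fin n => A) τ σ x).symm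
  smul_zero σ := map_zero (PiTensorProduct.reindex ℂ (fun _ => A) σ)
  smul_add σ := map_add (PiTensorProduct.reindex ℂ (fun _ => A) σ)
  smul_one σ := PiTensorProduct.reindex_tprod (R := ℂ) (s := fun _ : Fin n => A) σ 1
  smul_mul σ x y := by
    change PiTensorProduct.reindex ℂ (fun _ => A) σ (x * y) =
      PiTensorProduct.reindex ℂ (fun _ => A) σ x * PiTensorProduct.reindex ℂ (fun _ => A) σ y
    induction x using PiTensorProduct.induction_on with
    | add x x' hx hx' => simp only [add_mul, map_add, hx, hx']
    | smul_tprod r a =>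
      induction y using PiTensorProduct.induction_on with
      | add y y' hy hy' => simp only [mul_add, map_add, hy, hy']
      | smul_tprod s b =>
        simp only [PiTensorProduct.smul_tprod_mul_smul_tprod, map_smul,
          PiTensorProduct.reindex_tprod]
        rfl

theorem perm_smul_def (σ : Equiv.Perm (Fin n)) (x : TPow A n) :
    σ • x = PiTensorProduct.reindex ℂ (fun _ => A) σ x := rfl

instance permAction_smulComm : SMulCommClass (Equiv.Perm (Fin n)) ℂ (TPow A n) where
  smul_comm σ r x := map_smul (PiTensorProduct.reindex ℂ (fun _ => A) σ) r x

/-- The crossed product algebra `A(n) = ℂ[S_n] ⋉ A^{⊗ n}`: finite sums of elements `x σ` with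
`x ∈ A^{⊗ n}`, `σ ∈ S_n`, multiplied by `(x σ) (y τ) = x (σ • y) (σ τ)`. -/
abbrev CrossedProduct : Type u := SkewMonoidAlgebra (TPow A n) (Equiv.Perm (Fin n))

variable {A} {B : Type u} [Ring B] [Algebra ℂ B]

/-- The algebra homomorphism `f^{⊗ n} : A^{⊗ n} → B^{⊗ n}`. -/
def tpowAlgHom (f : A →ₐ[ℂ] B) : TPow A n →ₐ[ℂ] TPow B n :=
  AlgHom.ofLinearMap (tpowMap f n)
    (by
      change tpowMap f n (PiTensorProduct.tprod ℂ 1) = PiTensorProduct.tprod ℂ 1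
      rw [tpowMap_tprod]; congr 1; funext i; simp)
    (by
      intro x y
      induction x using PiTensorProduct.induction_on with
      | add x x' hx hx' => simp only [add_mul, map_add, hx, hx']
      | smul_tprod r a =>
        induction y using PiTensorProduct.induction_on with
        | add y y' hy hy' => simp only [mul_add, map_add, hy, hy']
        | smul_tprod s b =>
          simp only [PiTensorProduct.smul_tprod_mul_smul_tprod, map_smul, tpowMap_tprod]
          congr 2; funext i; simp)

theorem tpowAlgHom_smul (f : A →ₐ[ℂ] B) (σ : Equiv.Perm (Fin n)) (x : TPow A n) :
    tpowAlgHom n f (σ • x) = σ • tpowAlgHom n f x :=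
  PiTensorProduct.map_reindex (R := ℂ) (s := fun _ : Fin n => A) (t := fun _ : Fin n => B)
    (fun _ => f.toLinearMap) σ x

/-- The inclusion `y ↦ y 1` of `B^{⊗ n}` into the crossed product, as an algebra homomorphism. -/
def crossedIncl (B : Type u) [Ring B] [Algebra ℂ B] : TPow B n →ₐ[ℂ] CrossedProduct B n :=
  { SkewMonoidAlgebra.singleOneRingHom with commutes' := fun _ => rfl }

/-- The algebra homomorphism `A(n) → B(n)`, `x σ ↦ f^{⊗ n}(x) σ`, induced by an algebra
homomorphism `f : A → B`. -/
def crossedMap (f : A →ₐ[ℂ] B) : CrossedProduct A n →ₐ[ℂ] CrossedProduct B n :=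
  SkewMonoidAlgebra.liftNCAlgHom ((crossedIncl n B).comp (tpowAlgHom n f))
    (SkewMonoidAlgebra.of (TPow B n) (Equiv.Perm (Fin n)))
    (by
      intro x σ
      change SkewMonoidAlgebra.single 1 (tpowAlgHom n f (σ • x)) * SkewMonoidAlgebra.single σ 1 =
        SkewMonoidAlgebra.single σ 1 * SkewMonoidAlgebra.single 1 (tpowAlgHom n f x)
      simp [SkewMonoidAlgebra.single_mul_single, tpowAlgHom_smul])

theorem crossedMap_single (f : A →ₐ[ℂ] B) (σ : Equiv.Perm (Fin n)) (x : TPow A n) :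
    crossedMap n f (SkewMonoidAlgebra.single σ x) =
      SkewMonoidAlgebra.single σ (tpowAlgHom n f x) := by
  change SkewMonoidAlgebra.liftNC _ _ _ = _
  rw [SkewMonoidAlgebra.liftNC_single]
  change SkewMonoidAlgebra.single 1 (tpowAlgHom n f x) * SkewMonoidAlgebra.single σ 1 = _
  simp [SkewMonoidAlgebra.single_mul_single]

end CrossedProduct

/-! ### Graded tensor products and symmetric powers in super vector spaces -/

section Graded

/-- The degree vectors `(dᵢ)` with `∑ dᵢ = k`. -/
abbrev Degrees (ι : Type) [Fintype ι] (k : ℕ) : Type := {d : ι → ℕ // ∑ i, d i = k}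

/-- The degree `k` part `⨁_{∑ dᵢ = k} ⨂ᵢ (Wᵢ)_{dᵢ}` of the tensor product of a finite family of
`ℕ`-graded vector spaces `Wᵢ = ⨁_d (Wᵢ)_d`. -/
abbrev GTensor {ι : Type} [Fintype ι] (W : ι → ℕ → Type u)
    [∀ i d, AddCommGroup (W i d)] [∀ i d, Module ℂ (W i d)] (k : ℕ) : Type u :=
  ⨁ d : Degrees ι k, ⨂[ℂ] i, W i (d.1 i)

/-- The map of graded tensor products induced by degree preserving linear maps. -/
def GTensor.map {ι : Type} [Fintype ι] {W W' : ι → ℕ → Type u}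
    [∀ i d, AddCommGroup (W i d)] [∀ i d, Module ℂ (W i d)]
    [∀ i d, AddCommGroup (W' i d)] [∀ i d, Module ℂ (W' i d)]
    (f : ∀ i d, W i d →ₗ[ℂ] W' i d) (k : ℕ) : GTensor W k →ₗ[ℂ] GTensor W' k :=
  DirectSum.lmap fun d => PiTensorProduct.map fun i => f i (d.1 i)

/-- Permutation of a degree vector: the entry in position `i` moves to position `σ i`. -/
def permDegrees {p k : ℕ} (σ : Equiv.Perm (Fin p)) (d : Degrees (Fin p) k) :
    Degrees (Fin p) k :=
  ⟨fun j => d.1 (σ.symm j), by rw [Equiv.sum_comp σ.symm]; exact d.2⟩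

/-- The Koszul sign `∏ (-1)^{dᵢ dⱼ}` over all `i < j` with `σ j < σ i`: the sign of permuting
homogeneous factors of degrees `dᵢ` by `σ`. -/
def koszulSign {p : ℕ} (σ : Equiv.Perm (Fin p)) (d : Fin p → ℕ) : ℂ :=
  ∏ i : Fin p, ∏ j : Fin p, if i < j ∧ σ j < σ i then (-1) ^ (d i * d j) else 1

/-- Permuting tensor factors: the factor in position `i` is moved to position `σ i`. -/
def permTensor {p k : ℕ} (V : ℕ → Type u) [∀ d, AddCommGroup (V d)] [∀ d, Module ℂ (V d)]
    (σ : Equiv.Perm (Fin p)) (d : Degrees (Fin p) k) :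
    (⨂[ℂ] i, V (d.1 i)) ≃ₗ[ℂ] ⨂[ℂ] i, V ((permDegrees σ d).1 i) :=
  PiTensorProduct.reindex ℂ (fun i => V (d.1 i)) σ

variable (p : ℕ) (V : ℕ → Type u) [∀ d, AddCommGroup (V d)] [∀ d, Module ℂ (V d)]

/-- The span of the elements `σ(x) - x`, where `σ ∈ S_p` acts on `V^{⊗ p}` by permuting the
factors with the Koszul sign, in degree `k`. -/
def symRelations (k : ℕ) : Submodule ℂ (GTensor (fun _ : Fin p => V) k) :=
  Submodule.span ℂ {z | ∃ (σ : Equiv.Perm (Fin p)) (d : Degrees (Fin p) k)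
    (x : ⨂[ℂ] i, V (d.1 i)),
    z = koszulSign σ d.1 •
          DirectSum.lof ℂ (Degrees (Fin p) k) (fun e => ⨂[ℂ] i, V (e.1 i)) (permDegrees σ d)
            (permTensor V σ d x) -
        DirectSum.lof ℂ (Degrees (Fin p) k) (fun e => ⨂[ℂ] i, V (e.1 i)) d x}

/-- The degree `k` part of the symmetric power `S^p V` of the `ℕ`-graded vector space
`V = ⨁_d V_d`, regarded as a super vector space with `V_d` of parity `(-1)^d`: the coinvariants
of `S_p` acting on `V^{⊗ p}` with Koszul signs. -/
abbrev GSym (k : ℕ) : Type u := GTensor (fun _ : Fin p => V) k ⧸ symRelations p V k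

variable {V} {V' : ℕ → Type u} [∀ d, AddCommGroup (V' d)] [∀ d, Module ℂ (V' d)]

theorem permTensor_map (f : ∀ d, V d →ₗ[ℂ] V' d) {k : ℕ} (σ : Equiv.Perm (Fin p))
    (d : Degrees (Fin p) k) (x : ⨂[ℂ] i, V (d.1 i)) :
    PiTensorProduct.map (fun i => f ((permDegrees σ d).1 i)) (permTensor V σ d x) =
      permTensor V' σ d (PiTensorProduct.map (fun i => f (d.1 i)) x) :=
  PiTensorProduct.map_reindex (fun i => f (d.1 i)) σ x

theorem symRelations_le_comap (f : ∀ d, V d →ₗ[ℂ] V' d) (k : ℕ) :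
    symRelations p V k ≤ (symRelations p V' k).comap (GTensor.map (fun _ => f) k) := by
  refine Submodule.span_le.2 ?_
  rintro _ ⟨σ, d, x, rfl⟩
  refine Submodule.subset_span ⟨σ, d, PiTensorProduct.map (fun i => f (d.1 i)) x, ?_⟩
  rw [map_sub, map_smul, GTensor.map, DirectSum.lmap_lof, DirectSum.lmap_lof, permTensor_map]

/-- The map `S^p V → S^p V'` induced by a degree preserving linear map, in degree `k`. -/
def GSym.map (f : ∀ d, V d →ₗ[ℂ] V' d) (k : ℕ) : GSym p V k →ₗ[ℂ] GSym p V' k :=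
  Submodule.mapQ _ _ (GTensor.map (fun _ => f) k) (symRelations_le_comap p f k)

end Graded

/-! ### The right hand side -/

section RHS

/-- `p_i(λ)`: the multiplicity of `i` as a part of the partition `λ`. -/
def mult {n : ℕ} (lam : n.Partition) (i : ℕ) : ℕ := lam.parts.count i

/-- The degree `k` part of `⨁_{λ ⊢ n} ⨂_{i ≥ 1} S^{p_i(λ)} V`. All parts of `λ ⊢ n` lie in
`{1, …, n}`, so the factors with `i > n` are `S^0 V = ℂ` and the product is taken over
`i = 1, …, n` (that is, `i = j + 1` with `j : Fin n`). -/
abbrev PartitionSum (n : ℕ) (V : ℕ → Type u) [∀ d, AddCommGroup (V d)] [∀ d, Module ℂ (V d)]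
    (k : ℕ) : Type u :=
  ⨁ lam : n.Partition, GTensor (fun j : Fin n => GSym (mult lam ((j : ℕ) + 1)) V) k

/-- The map on `⨁_{λ ⊢ n} ⨂_{i ≥ 1} S^{p_i(λ)} V` induced by a degree preserving linear map. -/
def PartitionSum.map (n : ℕ) {V V' : ℕ → Type u} [∀ d, AddCommGroup (V d)]
    [∀ d, Module ℂ (V d)] [∀ d, AddCommGroup (V' d)] [∀ d, Module ℂ (V' d)]
    (f : ∀ d, V d →ₗ[ℂ] V' d) (k : ℕ) : PartitionSum n V k →ₗ[ℂ] PartitionSum n V' k :=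
  DirectSum.lmap fun lam =>
    GTensor.map (fun (j : Fin n) d => GSym.map (mult lam ((j : ℕ) + 1)) f d) k

end RHS

end HochschildWreath

end

/-! The Hochschild homology of the crossed product `A(n)` splits over the conjugacy classes of
`S_n`. As a bimodule over itself, `A(n)` is resolved by `WrQ`, the crossed product of `S_n` with the
`n`-th tensor power of the bar resolution of `A`. Since `n!` is invertible, this resolution is
relatively projective (`bimodHom_wrSplit`), so its commutator quotient computes `HH_*(A(n))`
(`hcBottom_homology`). Dividing by commutators identifies the coefficients of conjugate
permutations. In the coefficient of `g` it glues the right end of the bar resolution at position `i`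
to the left end of the one at position `g⁻¹ i`. What remains of a class is the complex `closeD c` of
bar resolutions closed up along a representative `c`, modulo the centralizer of `c`. In
characteristic zero these coinvariants are the image of an averaging operator and pass to homology
(`Classifies.bijective`).

A closed-up complex is the tensor product of those of the cycles of `c` (`nestT_closeD`). Within one
cycle every site but one can be contracted, because the bar resolution contracts onto `A`
(`cycDrop_bijective`). A cycle of any length thus contributes one Hochschild complex of `A`
(`cycContract_bijective`), and Künneth gives one tensor factor `HH_*(A)` per cycle
(`beadHom_bijective`, `cycTHom_bijective`). The centralizer is made of rotations of the cycles and
permutations of cycles of equal length (`exists_beadPerm`). Rotations act trivially on homology: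
concatenation of bar resolutions is a homotopy between the contractions of a two-site cycle to
either site, and longer cycles reduce to this one (`cycContract_rotate`). Permutations of cycles act
with the Koszul sign (`beadContract_beadPerm`). Taking coinvariants leaves one symmetric power of
`HH_*(A)` for each length.

Complexes are handled as ungraded spaces with a differential. The grading is remembered by operators
acting as `w ^ k` in degree `k`: `w = -1` supplies the parity in all Koszul signs, and `w = 2` has
distinct eigenvalues in distinct degrees, so commutation with it recovers the grading at the end
(`gradedPart_bijective`). Filtration arguments are replaced by one principle: if `d h + h d = 1 + N`
and `N` lowers an auxiliary degree, then `N` is locally nilpotent and every cycle is a boundary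
(`exists_primitive_of_unipotent`). All comparison maps commute with the maps induced by `f : A → B`,
which gives naturality. -/

noncomputable section

/-! ### Homological algebra of differential vector spaces with parity -/

namespace HochschildWreath

/-! ### Homology of differential vector spaces -/

section Homology

variable {V V' V'' : Type u} [AddCommGroup V] [Module ℂ V] [AddCommGroup V'] [Module ℂ V']
  [AddCommGroup V''] [Module ℂ V'']

/-- The homology `ker d / im d` of a differential vector space. -/
abbrev Homology (d : V →ₗ[ℂ] V) : Type u :=
  LinearMap.ker d ⧸ (LinearMap.range d).comap (LinearMap.ker d).subtype

/-- The homology class of a cycle. -/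
def Homology.mk (d : V →ₗ[ℂ] V) (x : V) (hx : d x = 0) : Homology d :=
  Submodule.Quotient.mk ⟨x, hx⟩

theorem Homology.exists_rep {d : V →ₗ[ℂ] V} (c : Homology d) :
    ∃ x, ∃ hx : d x = 0, c = Homology.mk d x hx := by
  obtain ⟨⟨x, hx⟩, rfl⟩ := Submodule.Quotient.mk_surjective _ c
  exact ⟨x, hx, rfl⟩

theorem Homology.mk_eq_mk {d : V →ₗ[ℂ] V} {x y : V} {hx : d x = 0} {hy : d y = 0} :
    Homology.mk d x hx = Homology.mk d y hy ↔ ∃ z, d z = x - y := by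
  unfold Homology.mk
  rw [Submodule.Quotient.eq]
  simp

theorem Homology.mk_eq_zero {d : V →ₗ[ℂ] V} {x : V} {hx : d x = 0} :
    Homology.mk d x hx = 0 ↔ ∃ z, d z = x := by
  unfold Homology.mk
  rw [Submodule.Quotient.mk_eq_zero]
  simp

/-- Linear maps preserving cycles and boundaries. -/
structure HCompat (d : V →ₗ[ℂ] V) (d' : V' →ₗ[ℂ] V') (f : V →ₗ[ℂ] V') : Prop where
  cycle : ∀ x, d x = 0 → d' (f x) = 0
  boundary : ∀ x, ∃ y, f (d x) = d' y

theorem HCompat.of_comm {d : V →ₗ[ℂ] V} {d' : V' →ₗ[ℂ] V'} {f : V →ₗ[ℂ] V'}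
    (h : ∀ x, f (d x) = d' (f x)) : HCompat d d' f :=
  ⟨fun x hx => by rw [← h, hx, map_zero], fun x => ⟨f x, h x⟩⟩

/-- The operator `w ^ k` in degree `k` commutes with a differential of degree `-1` only up to the
factor `w`. It still acts on homology when `w ≠ 0`, and this is why `HCompat` asks for less than a
chain map. -/
theorem HCompat.of_smul_comm {d : V →ₗ[ℂ] V} {d' : V' →ₗ[ℂ] V'} {f : V →ₗ[ℂ] V'} (c : ℂ)
    (h : ∀ x, d' (f x) = c • f (d x)) (hc : c ≠ 0) : HCompat d d' f :=
  ⟨fun x hx => by rw [h, hx, map_zero, smul_zero],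
    fun x => ⟨c⁻¹ • f x, by rw [map_smul, h, smul_smul, inv_mul_cancel₀ hc, one_smul]⟩⟩

theorem HCompat.id (d : V →ₗ[ℂ] V) : HCompat d d LinearMap.id := .of_comm fun _ => rfl

theorem HCompat.comp {d : V →ₗ[ℂ] V} {d' : V' →ₗ[ℂ] V'} {d'' : V'' →ₗ[ℂ] V''}
    {g : V' →ₗ[ℂ] V''} {f : V →ₗ[ℂ] V'} (hg : HCompat d' d'' g) (hf : HCompat d d' f) :
    HCompat d d'' (g ∘ₗ f) :=
  ⟨fun x hx => hg.cycle _ (hf.cycle x hx), fun x => by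
    obtain ⟨y, hy⟩ := hf.boundary x
    obtain ⟨z, hz⟩ := hg.boundary y
    exact ⟨z, by simp [hy, hz]⟩⟩

/-- The map induced on homology. -/
def Homology.map {d : V →ₗ[ℂ] V} {d' : V' →ₗ[ℂ] V'} (f : V →ₗ[ℂ] V') (hf : HCompat d d' f) :
    Homology d →ₗ[ℂ] Homology d' :=
  Submodule.mapQ _ _ (f.restrict (p := LinearMap.ker d) (q := LinearMap.ker d') hf.cycle) (by
    rintro ⟨x, hx⟩ ⟨y, hy⟩
    obtain ⟨z, hz⟩ := hf.boundary y
    refine ⟨z, ?_⟩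
    rw [← hz, hy]; rfl)

@[simp]
theorem Homology.map_mk {d : V →ₗ[ℂ] V} {d' : V' →ₗ[ℂ] V'} (f : V →ₗ[ℂ] V')
    (hf : HCompat d d' f) (x : V) (hx : d x = 0) :
    Homology.map f hf (Homology.mk d x hx) = Homology.mk d' (f x) (hf.cycle x hx) := rfl

theorem Homology.map_comp {d : V →ₗ[ℂ] V} {d' : V' →ₗ[ℂ] V'} {d'' : V'' →ₗ[ℂ] V''}
    (g : V' →ₗ[ℂ] V'') (f : V →ₗ[ℂ] V') (hg : HCompat d' d'' g) (hf : HCompat d d' f)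
    (c : Homology d) :
    Homology.map g hg (Homology.map f hf c) = Homology.map (g ∘ₗ f) (hg.comp hf) c := by
  obtain ⟨x, hx, rfl⟩ := c.exists_rep
  simp

theorem Homology.map_id {d : V →ₗ[ℂ] V} (h : HCompat d d LinearMap.id) (c : Homology d) :
    Homology.map LinearMap.id h c = c := by
  obtain ⟨x, hx, rfl⟩ := c.exists_rep
  simp

theorem Homology.map_congr {d : V →ₗ[ℂ] V} {d' : V' →ₗ[ℂ] V'} {f g : V →ₗ[ℂ] V'}
    (h : f = g) (hf : HCompat d d' f) (hg : HCompat d d' g) (c : Homology d) :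
    Homology.map f hf c = Homology.map g hg c := by
  subst h; rfl

theorem Homology.map_square {V₃ : Type u} [AddCommGroup V₃] [Module ℂ V₃]
    {d : V →ₗ[ℂ] V} {d' : V' →ₗ[ℂ] V'} {d'' : V'' →ₗ[ℂ] V''} {d₃ : V₃ →ₗ[ℂ] V₃}
    {f : V →ₗ[ℂ] V'} {g : V' →ₗ[ℂ] V''} {f' : V →ₗ[ℂ] V₃} {g' : V₃ →ₗ[ℂ] V''}
    (hf : HCompat d d' f) (hg : HCompat d' d'' g) (hf' : HCompat d d₃ f') (hg' : HCompat d₃ d'' g')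
    (h : ∀ x, g (f x) = g' (f' x)) (c : Homology d) :
    Homology.map g hg (Homology.map f hf c) = Homology.map g' hg' (Homology.map f' hf' c) := by
  rw [Homology.map_comp, Homology.map_comp]
  exact Homology.map_congr (LinearMap.ext h) _ _ c

/-- Maps that differ by a homotopy on cycles agree on homology. -/
theorem Homology.map_eq_of_homotopy {d : V →ₗ[ℂ] V} {d' : V' →ₗ[ℂ] V'} {f g : V →ₗ[ℂ] V'}
    (hf : HCompat d d' f) (hg : HCompat d d' g)
    (h : ∀ x, d x = 0 → ∃ z, d' z = f x - g x) (c : Homology d) :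
    Homology.map f hf c = Homology.map g hg c := by
  obtain ⟨x, hx, rfl⟩ := c.exists_rep
  simp only [map_mk]
  exact Homology.mk_eq_mk.2 (h x hx)

theorem Homology.map_bijective_of_equiv {d : V →ₗ[ℂ] V} {d' : V' →ₗ[ℂ] V'} (f : V ≃ₗ[ℂ] V')
    (h : ∀ x, f (d x) = d' (f x)) (hf : HCompat d d' f.toLinearMap) :
    Function.Bijective (Homology.map f.toLinearMap hf) := by
  have hg : HCompat d' d f.symm.toLinearMap := .of_comm fun x => by
    apply f.injective; simp [h]
  refine Function.bijective_iff_has_inverse.2 ⟨Homology.map f.symm.toLinearMap hg, ?_, ?_⟩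
  · intro c
    obtain ⟨x, hx, rfl⟩ := c.exists_rep
    simp
  · intro c
    obtain ⟨x, hx, rfl⟩ := c.exists_rep
    simp

/-! ### Gradings by an operator with eigenvalues `2 ^ k` -/

/-- `θ` acts on `V` as the degree operator of an `ℕ`-grading: `V` is spanned by eigenvectors of
eigenvalues `2 ^ k`. -/
def IsGr (θ : V →ₗ[ℂ] V) : Prop :=
  Submodule.span ℂ {x | ∃ k : ℕ, θ x = (2 : ℂ) ^ k • x} = ⊤

theorem IsGr.induction {θ : V →ₗ[ℂ] V} (h : IsGr θ) {motive : V → Prop}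
    (mem : ∀ (k : ℕ) x, θ x = (2 : ℂ) ^ k • x → motive x) (zero : motive 0)
    (add : ∀ x y, motive x → motive y → motive (x + y)) (x : V) : motive x := by
  have hx : x ∈ Submodule.span ℂ {x | ∃ k : ℕ, θ x = (2 : ℂ) ^ k • x} := by
    rw [h]; trivial
  induction hx using Submodule.closure_induction with
  | zero => exact zero
  | add x y _ _ hx hy => exact add x y hx hy
  | smul_mem r x hx =>
    obtain ⟨k, hk⟩ := hx
    exact mem k _ (by rw [map_smul, hk, smul_comm])

theorem IsGr.of_span {θ : V →ₗ[ℂ] V} (S : Set V) (hS : Submodule.span ℂ S = ⊤)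
    (h : ∀ x ∈ S, ∃ k : ℕ, θ x = (2 : ℂ) ^ k • x) : IsGr θ := by
  rw [IsGr, eq_top_iff, ← hS]
  exact Submodule.span_mono h

/-- Every vector is annihilated by a product of factors `X - 2 ^ k`, none of which vanishes at
`1/2`. So `1/2`, the eigenvalue that degree `-1` would have, does not occur. -/
theorem IsGr.eq_zero_of_half {θ : V →ₗ[ℂ] V} (h : IsGr θ) (x : V)
    (hx : θ x = (2 : ℂ)⁻¹ • x) : x = 0 := by
  have key : ∀ y : V, ∃ p : Polynomial ℂ, p.eval (2 : ℂ)⁻¹ ≠ 0 ∧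
      Polynomial.aeval (R := ℂ) (A := Module.End ℂ V) θ p y = 0 := by
    intro y
    induction y using h.induction with
    | mem k y hy =>
      refine ⟨Polynomial.X - Polynomial.C (2 ^ k), ?_, ?_⟩
      · simp only [Polynomial.eval_sub, Polynomial.eval_X, Polynomial.eval_C]
        intro h0
        have h1 : (2 : ℂ)⁻¹ = 2 ^ k := sub_eq_zero.1 h0
        have h2 : (1 : ℂ) = 2 ^ (k + 1) := by rw [pow_succ, ← h1]; norm_num
        have h3 : (1 : ℕ) = 2 ^ (k + 1) := by exact_mod_cast h2
        have := Nat.one_lt_two_pow (n := k + 1) (by omega)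
        omega
      · rw [map_sub, Polynomial.aeval_X, Polynomial.aeval_C, LinearMap.sub_apply, hy,
          Module.algebraMap_end_apply, sub_self]
    | zero => exact ⟨1, by simp, by simp⟩
    | add y z hy hz =>
      obtain ⟨p, hp, hp'⟩ := hy
      obtain ⟨q, hq, hq'⟩ := hz
      refine ⟨p * q, by simp [hp, hq], ?_⟩
      rw [map_add]
      nth_rewrite 1 [mul_comm p q]
      simp [hp', hq']
  obtain ⟨p, hp, hp'⟩ := key x
  have h1 : ∀ p : Polynomial ℂ,
      Polynomial.aeval (R := ℂ) (A := Module.End ℂ V) θ p x = p.eval (2 : ℂ)⁻¹ • x := by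
    intro p
    induction p using Polynomial.induction_on' with
    | add p q hp hq => simp [hp, hq, add_smul]
    | monomial n a =>
      have : ∀ n : ℕ, ((θ : Module.End ℂ V) ^ n) x = ((2 : ℂ)⁻¹) ^ n • x := by
        intro n
        induction n with
        | zero => simp
        | succ n ih => rw [pow_succ, Module.End.mul_apply, hx, map_smul, ih, smul_smul, pow_succ,
            mul_comm]
      simp [Polynomial.aeval_monomial, this, smul_smul, Module.algebraMap_end_apply, mul_comm]
  rw [h1] at hp'
  exact (smul_eq_zero.1 hp').resolve_left hp

/-- An operator lowering degrees is locally nilpotent. -/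
theorem IsGr.locally_nilpotent {θ : V →ₗ[ℂ] V} (h : IsGr θ) {N : V →ₗ[ℂ] V}
    (hN : ∀ x, N (θ x) = (2 : ℂ) • θ (N x)) (x : V) : ∃ m, ((N : Module.End ℂ V) ^ m) x = 0 := by
  -- Integer exponents allow the passage from degree `0` to degree `-1`.
  have hN' : ∀ (k : ℤ) x, θ x = (2 : ℂ) ^ k • x → θ (N x) = (2 : ℂ) ^ (k - 1) • N x := by
    intro k x hx
    have h1 := hN x
    rw [hx, map_smul] at h1
    rw [zpow_sub_one₀ two_ne_zero, mul_comm, mul_smul, h1, smul_smul]; simp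
  have hpow : ∀ (m : ℕ) (k : ℤ) x, θ x = (2 : ℂ) ^ k • x →
      θ (((N : Module.End ℂ V) ^ m) x) = (2 : ℂ) ^ (k - m) • ((N : Module.End ℂ V) ^ m) x := by
    intro m
    induction m with
    | zero => intro k x hx; simpa using hx
    | succ m ih =>
      intro k x hx
      rw [pow_succ, Module.End.mul_apply]
      have := ih (k - 1) _ (hN' k x hx)
      rw [this]; congr 2; push_cast; ring
  induction x using h.induction with
  | mem k x hx =>
    -- After `k + 1` applications of `N` the eigenvalue `2 ^ k` has become `1/2`, which has no
    -- eigenvectors.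
    refine ⟨k + 1, h.eq_zero_of_half _ ?_⟩
    have := hpow (k + 1) k x (by simpa using hx)
    rw [this]; congr 1
    rw [show ((k : ℤ) - ((k + 1 : ℕ) : ℤ)) = -1 by push_cast; ring, zpow_neg_one]
  | zero => exact ⟨0, by simp⟩
  | add x y hx hy =>
    obtain ⟨m, hm⟩ := hx
    obtain ⟨n, hn⟩ := hy
    refine ⟨n + m, ?_⟩
    have h1 : ((N : Module.End ℂ V) ^ (n + m)) x = 0 := by
      rw [pow_add, Module.End.mul_apply, hm, map_zero]
    have h2 : ((N : Module.End ℂ V) ^ (n + m)) y = 0 := by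
      rw [add_comm, pow_add, Module.End.mul_apply, hn, map_zero]
    rw [map_add, h1, h2, add_zero]

/-! ### Comparison via unipotent homotopies -/

/-- If `d h + h d = 1 + N` with `N` locally nilpotent on a subcomplex, cycles of the subcomplex
are boundaries. -/
theorem exists_primitive_of_unipotent {d h N : V →ₗ[ℂ] V} (hd : ∀ x, d (d x) = 0)
    (K : Submodule ℂ V) (hdK : ∀ x ∈ K, d x ∈ K) (hNK : ∀ x ∈ K, N x ∈ K) (hhK : ∀ x ∈ K, h x ∈ K)
    (hh : ∀ x ∈ K, d (h x) + h (d x) = x + N x)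
    (hnil : ∀ x, ∃ m, ((N : Module.End ℂ V) ^ m) x = 0) (x : V) (hx : x ∈ K) (hdx : d x = 0) :
    ∃ y ∈ K, d y = x := by
  -- On `K` the operator `N` equals `d h + h d - 1`, which commutes with `d` because `d` squares to
  -- zero.
  have hcomm : ∀ x ∈ K, N (d x) = d (N x) := by
    intro x hx
    have h1 := hh (d x) (hdK x hx)
    have h2 := congrArg d (hh x hx)
    simp only [map_add, hd, map_zero, zero_add, add_zero] at h1 h2
    rw [h1] at h2
    exact add_left_cancel h2
  -- downward induction on the nilpotency index of `x`
  obtain ⟨m, hm⟩ := hnil x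
  induction m generalizing x with
  | zero => exact ⟨0, K.zero_mem, by simpa using hm.symm⟩
  | succ m ih =>
    obtain ⟨y, hyK, hy⟩ := ih (N x) (hNK x hx) (by rw [← hcomm x hx, hdx, map_zero])
      (by rw [← Module.End.mul_apply, ← pow_succ]; exact hm)
    -- For a cycle, `d (h x) = x + N x`, and `N x = d y` by induction since its nilpotency index is
    -- smaller.
    refine ⟨h x - y, K.sub_mem (hhK x hx) hyK, ?_⟩
    have h1 := hh x hx
    rw [hdx, map_zero, add_zero] at h1
    rw [map_sub, h1, hy]; abel

/-- Comparison lemma: a chain map `p` onto the image of an idempotent `π`, whose kernel is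
contractible up to a locally nilpotent error, is injective on homology with image that of `π`. -/
theorem homology_map_of_unipotent {d h N : V →ₗ[ℂ] V} {d' π : V' →ₗ[ℂ] V'} {p : V →ₗ[ℂ] V'}
    (hd : ∀ x, d (d x) = 0) (hp : HCompat d d' p) (hπ : HCompat d' d' π)
    (hpd : ∀ x, p (d x) = d' (p x)) (hπd : ∀ x, π (d' x) = d' (π x))
    (hπp : ∀ x, π (p x) = p x) (hsurj : ∀ x, ∃ y, p y = π x)
    (hph : ∀ x, p (h x) = 0) (hpN : ∀ x, p x = 0 → p (N x) = 0)
    (hh : ∀ x, p x = 0 → d (h x) + h (d x) = x + N x)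
    (hnil : ∀ x, ∃ m, ((N : Module.End ℂ V) ^ m) x = 0) :
    Function.Injective (Homology.map p hp) ∧
      (∀ c, Homology.map π hπ (Homology.map p hp c) = Homology.map p hp c) ∧
      ∀ c, ∃ c', Homology.map p hp c' = Homology.map π hπ c := by
  have key : ∀ x, p x = 0 → d x = 0 → ∃ y, p y = 0 ∧ d y = x := fun x hx hdx =>
    exists_primitive_of_unipotent hd (LinearMap.ker p)
      (fun x hx => by rw [LinearMap.mem_ker] at *; rw [hpd, hx, map_zero])
      (fun x hx => hpN x hx) (fun x _ => hph x) (fun x hx => hh x hx) hnil x hx hdx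
  refine ⟨?_, ?_, ?_⟩
  · rw [injective_iff_map_eq_zero]
    intro c hc
    obtain ⟨x, hx, rfl⟩ := c.exists_rep
    rw [Homology.map_mk, Homology.mk_eq_zero] at hc
    obtain ⟨z, hz⟩ := hc
    -- The chain `z` bounding `p x` may be replaced by `π z`, which lifts to `y`. Then `x - d y` is
    -- a cycle in the kernel of `p`, hence a boundary.
    obtain ⟨y, hy⟩ := hsurj z
    obtain ⟨w, -, hw⟩ := key (x - d y) (by rw [map_sub, hpd, hy, ← hπd, hz, hπp, sub_self])
      (by rw [map_sub, hx, hd, sub_zero])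
    rw [Homology.mk_eq_zero]
    exact ⟨w + y, by rw [map_add, hw]; abel⟩
  · intro c
    obtain ⟨x, hx, rfl⟩ := c.exists_rep
    simp only [Homology.map_mk, hπp]
  · intro c
    obtain ⟨x, hx, rfl⟩ := c.exists_rep
    -- A lift `y` of `π x` need not be a cycle. But `d y` is a cycle in the kernel of `p`, so it is
    -- `d k` with `p k = 0`, and `y - k` is a cycle with the same image.
    obtain ⟨y, hy⟩ := hsurj x
    obtain ⟨k, hk, hk'⟩ := key (d y) (by rw [hpd, hy, ← hπd, hx, map_zero]) (hd y)
    refine ⟨Homology.mk d (y - k) (by rw [map_sub, hk', sub_self]), ?_⟩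
    simp only [Homology.map_mk, map_sub, hy, hk, sub_zero]

/-- The case `π = 1` of `homology_map_of_unipotent`. -/
theorem homology_map_bijective_of_unipotent {d h N : V →ₗ[ℂ] V} {d' : V' →ₗ[ℂ] V'}
    {p : V →ₗ[ℂ] V'} (hd : ∀ x, d (d x) = 0) (hp : HCompat d d' p)
    (hpd : ∀ x, p (d x) = d' (p x)) (hsurj : Function.Surjective p)
    (hph : ∀ x, p (h x) = 0) (hpN : ∀ x, p x = 0 → p (N x) = 0)
    (hh : ∀ x, p x = 0 → d (h x) + h (d x) = x + N x)
    (hnil : ∀ x, ∃ m, ((N : Module.End ℂ V) ^ m) x = 0) :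
    Function.Bijective (Homology.map p hp) := by
  obtain ⟨h1, -, h3⟩ := homology_map_of_unipotent hd hp (.id d') hpd (fun _ => rfl)
    (fun _ => rfl) hsurj hph hpN hh hnil
  refine ⟨h1, fun c => ?_⟩
  obtain ⟨c', hc'⟩ := h3 c
  exact ⟨c', by rw [hc', Homology.map_id]⟩

/-! ### Splittings over a field -/

/-- A differential has a generalized inverse, odd with respect to any involution anticommuting
with the differential. -/
theorem exists_odd_pseudoinverse (d ε : V →ₗ[ℂ] V) (hε : ∀ x, ε (ε x) = x)
    (hεd : ∀ x, ε (d x) = -d (ε x)) :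
    ∃ g : V →ₗ[ℂ] V, (∀ x, ε (g x) = -g (ε x)) ∧ ∀ x, d (g (d x)) = d x := by
  obtain ⟨g₀, hg₀⟩ := d.rangeRestrict.exists_rightInverse_of_surjective d.range_rangeRestrict
  obtain ⟨g₁, hg₁⟩ := LinearMap.exists_extend g₀
  have h1 : ∀ x, d (g₁ (d x)) = d x := by
    intro x
    have h2 : g₁ (d x) = g₀ ⟨d x, x, rfl⟩ := (LinearMap.congr_fun hg₁ ⟨d x, x, rfl⟩)
    have h3 := congrArg Subtype.val (LinearMap.congr_fun hg₀ ⟨d x, x, rfl⟩)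
    rw [h2]; exact h3
  -- This is the odd part of `g₁`. Since `d` anticommutes with `ε`, the operator `-ε g₁ ε` is again
  -- a generalized inverse of `d`, hence so is the mean of the two.
  refine ⟨(2 : ℂ)⁻¹ • (g₁ - ε ∘ₗ g₁ ∘ₗ ε), fun x => ?_, fun x => ?_⟩
  · simp [hε, ← smul_neg]
  · have h2 : d (ε (g₁ (ε (d x)))) = - d x := by
      have : ∀ y, d (ε y) = - ε (d y) := fun y => by rw [hεd, neg_neg]
      rw [this, hεd x, map_neg, map_neg, h1, map_neg, neg_neg, this, map_neg, hε]
    simp only [LinearMap.smul_apply, LinearMap.sub_apply, LinearMap.comp_apply, map_smul, map_sub,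
      h1, h2, sub_neg_eq_add, ← two_smul ℂ (d x), smul_smul]
    norm_num

/-- Every differential vector space with a parity involution deformation retracts onto its
homology. -/
theorem exists_retraction (d ε : V →ₗ[ℂ] V) (hd : ∀ x, d (d x) = 0) (hε : ∀ x, ε (ε x) = x)
    (hεd : ∀ x, ε (d x) = -d (ε x)) :
    ∃ (q : V →ₗ[ℂ] Homology d) (s : Homology d →ₗ[ℂ] V) (h : V →ₗ[ℂ] V),
      (∀ c, d (s c) = 0) ∧ (∀ c hc, Homology.mk d (s c) hc = c) ∧ (∀ x, q (d x) = 0) ∧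
      (∀ x hx, q x = Homology.mk d x hx) ∧
      (∀ x, d (h x) + h (d x) = x - s (q x)) ∧ (∀ x, ε (h x) = -h (ε x)) ∧
      ∀ x, s (q (ε x)) = ε (s (q x)) := by
  obtain ⟨g, hgε, hg⟩ := exists_odd_pseudoinverse d ε hε hεd
  -- The operator `e = 1 - d g - g d` takes values in cycles and kills boundaries. Hence it descends
  -- to homology: `s` is `e` on representatives and `q` is the class of `e`.
  let e : V →ₗ[ℂ] V := LinearMap.id - d ∘ₗ g - g ∘ₗ d
  have he : ∀ x, e x = x - d (g x) - g (d x) := fun x => rfl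
  have hde : ∀ x, d (e x) = 0 := fun x => by rw [he]; simp [hd, hg]
  have hed : ∀ x, e (d x) = 0 := fun x => by rw [he]; simp [hd, hg]
  have heε : ∀ x, e (ε x) = ε (e x) := fun x => by
    have h2 : ∀ y, d (ε y) = - ε (d y) := fun y => by rw [hεd, neg_neg]
    have h3 : ∀ y, g (ε y) = - ε (g y) := fun y => by rw [hgε, neg_neg]
    simp [he, h2, h3]
  let q : V →ₗ[ℂ] Homology d :=
    (Submodule.mkQ _).comp (e.codRestrict (LinearMap.ker d) hde)
  have hq : ∀ x, q x = Homology.mk d (e x) (hde x) := fun x => rfl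
  let s : Homology d →ₗ[ℂ] V := Submodule.liftQ _ (e.comp (LinearMap.ker d).subtype) (by
    rintro ⟨x, hx⟩ ⟨y, hy⟩
    change e x = 0
    rw [← show d y = x from hy, hed])
  have hs : ∀ x hx, s (Homology.mk d x hx) = e x := fun x hx => rfl
  have hmk : ∀ x (hx : d x = 0), Homology.mk d (e x) (hde x) = Homology.mk d x hx := by
    intro x hx
    rw [Homology.mk_eq_mk]
    exact ⟨-g x, by rw [he, hx]; simp⟩
  -- As `g` need not square to zero, `s q = e ∘ e` differs from `e` by `d g g d`. The correction `-g
  -- g d` of the homotopy accounts for this term.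
  refine ⟨q, s, g - g ∘ₗ g ∘ₗ d, ?_, ?_, ?_, ?_, ?_, ?_, ?_⟩
  · intro c
    obtain ⟨x, hx, rfl⟩ := c.exists_rep
    rw [hs, hde]
  · intro c hc
    obtain ⟨x, hx, rfl⟩ := c.exists_rep
    exact hmk x hx
  · intro x
    rw [hq, Homology.mk_eq_zero]
    exact ⟨0, by rw [hed, map_zero]⟩
  · intro x hx
    rw [hq, hmk]
  · intro x
    rw [hq, hs]
    have h1 : e (e x) = x - d (g x) - g (d x) + d (g (g (d x))) := by
      rw [he (e x), hde, he]; simp [hg]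
    simp [h1, hd]; abel
  · intro x
    have h2 : ∀ y, d (ε y) = - ε (d y) := fun y => by rw [hεd, neg_neg]
    have h3 : ∀ y, g (ε y) = - ε (g y) := fun y => by rw [hgε, neg_neg]
    simp [h2, h3]; abel
  · intro x
    rw [hq, hq, hs, hs, heε, heε]

end Homology
end HochschildWreath

end

noncomputable section

namespace HochschildWreath

set_option linter.unusedSectionVars false

/-! ### Tensor products of differential vector spaces and the Künneth theorem -/

section Kunneth

variable {ι : Type} [Fintype ι] [LinearOrder ι] {V V' : ι → Type u}
  [∀ i, AddCommGroup (V i)] [∀ i, Module ℂ (V i)] [∀ i, AddCommGroup (V' i)] [∀ i, Module ℂ (V' i)]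

theorem tprod_eq_neg {x y : ∀ i, V i} (a : ι) (ha : x a = -y a) (h : ∀ j, j ≠ a → x j = y j) :
    PiTensorProduct.tprod ℂ x = -PiTensorProduct.tprod ℂ y := by
  have : x = Function.update y a ((-1 : ℂ) • y a) := by
    funext j
    by_cases hj : j = a
    · subst hj; simp [ha]
    · rw [Function.update_of_ne hj, h j hj]
  rw [this, MultilinearMap.map_update_smul, Function.update_eq_self, neg_one_smul]

theorem tprod_eq_zero {x : ∀ i, V i} (a : ι) (ha : x a = 0) : PiTensorProduct.tprod ℂ x = 0 :=
  (PiTensorProduct.tprod ℂ).map_coord_zero a ha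

/-- The operator acting by `f i` on the `i`-th factor, with the sign obtained by moving an odd
operator past the factors on its left; `ε j` are the parity involutions. -/
def koszulAt (ε f : ∀ i, V i →ₗ[ℂ] V i) (i : ι) : (⨂[ℂ] i, V i) →ₗ[ℂ] ⨂[ℂ] i, V i :=
  PiTensorProduct.map fun j => if j < i then ε j else if j = i then f j else LinearMap.id

/-- The differential of a tensor product of differential vector spaces. -/
def koszulD (ε d : ∀ i, V i →ₗ[ℂ] V i) : (⨂[ℂ] i, V i) →ₗ[ℂ] ⨂[ℂ] i, V i :=
  ∑ i, koszulAt ε d i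

theorem koszulAt_tprod (ε f : ∀ i, V i →ₗ[ℂ] V i) (i : ι) (x : ∀ i, V i) :
    koszulAt ε f i (PiTensorProduct.tprod ℂ x) =
      PiTensorProduct.tprod ℂ fun j => if j < i then ε j (x j) else if j = i then f j (x j) else x j := by
  rw [koszulAt, PiTensorProduct.map_tprod]
  congr 1; funext j
  split_ifs <;> rfl

theorem koszulD_tprod (ε d : ∀ i, V i →ₗ[ℂ] V i) (x : ∀ i, V i) :
    koszulD ε d (PiTensorProduct.tprod ℂ x) = ∑ i, PiTensorProduct.tprod ℂ fun j =>
      if j < i then ε j (x j) else if j = i then d j (x j) else x j := by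
  simp [koszulD, koszulAt_tprod]

/-- The operator acting by `f` on the `i`-th factor. -/
def mapAt (f : ∀ i, V i →ₗ[ℂ] V i) (s : Finset ι) : (⨂[ℂ] i, V i) →ₗ[ℂ] ⨂[ℂ] i, V i :=
  PiTensorProduct.map fun j => if j ∈ s then f j else LinearMap.id

theorem mapAt_tprod (f : ∀ i, V i →ₗ[ℂ] V i) (s : Finset ι) (x : ∀ i, V i) :
    mapAt f s (PiTensorProduct.tprod ℂ x) = PiTensorProduct.tprod ℂ fun j => if j ∈ s then f j (x j) else x j := by
  rw [mapAt, PiTensorProduct.map_tprod]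
  congr 1; funext j
  split_ifs <;> rfl

theorem mapAt_insert (f : ∀ i, V i →ₗ[ℂ] V i) (s : Finset ι) (a : ι) (ha : a ∉ s)
    (x : ⨂[ℂ] i, V i) : mapAt f (insert a s) x = mapAt f {a} (mapAt f s x) := by
  suffices h : mapAt f (insert a s) = mapAt f {a} ∘ₗ mapAt f s from LinearMap.congr_fun h x
  ext x
  simp only [LinearMap.compMultilinearMap_apply, LinearMap.comp_apply, mapAt_tprod]
  congr 1; funext j
  by_cases hj : j = a
  · subst hj; simp [ha]
  · simp [hj]

section

variable {ε d h : ∀ i, V i →ₗ[ℂ] V i}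

/-- The two orders agree except at the smaller of the two positions, where the odd operator meets
the involution `ε` contributed by the other one. This gives the single sign. -/
theorem koszulAt_anticomm (f g : ∀ i, V i →ₗ[ℂ] V i)
    (hf : ∀ i x, ε i (f i x) = -f i (ε i x)) (hg : ∀ i x, ε i (g i x) = -g i (ε i x)) (i j : ι)
    (hij : i ≠ j) (x : ⨂[ℂ] i, V i) :
    koszulAt ε f i (koszulAt ε g j x) = -koszulAt ε g j (koszulAt ε f i x) := by
  suffices h : koszulAt ε f i ∘ₗ koszulAt ε g j = -(koszulAt ε g j ∘ₗ koszulAt ε f i) from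
    LinearMap.congr_fun h x
  ext x
  simp only [LinearMap.compMultilinearMap_apply, LinearMap.comp_apply, koszulAt_tprod,
    LinearMap.neg_apply]
  rcases lt_or_gt_of_ne hij with hlt | hlt
  · refine tprod_eq_neg i ?_ ?_
    · simp [hlt, hf]
    · intro k hk
      rcases lt_trichotomy k j with h1 | h1 | h1
      · by_cases h2 : k < i <;> simp [hk, h1, h2]
      · subst h1; simp [hk, hlt.not_gt]
      · simp [hk, h1.not_gt, h1.ne']
  · refine tprod_eq_neg j ?_ ?_
    · simp [hlt, hg]
    · intro k hk
      rcases lt_trichotomy k i with h1 | h1 | h1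
      · by_cases h2 : k < j <;> simp [hk, h1, h2]
      · subst h1; simp [hk, hlt.not_gt]
      · simp [hk, h1.not_gt, h1.ne']

theorem koszulAt_comp_same (hε : ∀ i x, ε i (ε i x) = x) (f g : ∀ i, V i →ₗ[ℂ] V i) (i : ι)
    (x : ⨂[ℂ] i, V i) :
    koszulAt ε f i (koszulAt ε g i x) = mapAt (fun j => f j ∘ₗ g j) {i} x := by
  suffices h : koszulAt ε f i ∘ₗ koszulAt ε g i = mapAt (fun j => f j ∘ₗ g j) {i} from
    LinearMap.congr_fun h x
  ext x
  simp only [LinearMap.compMultilinearMap_apply, LinearMap.comp_apply, koszulAt_tprod, mapAt_tprod,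
    Finset.mem_singleton]
  congr 1; funext j
  rcases lt_trichotomy j i with h1 | h1 | h1
  · simp [h1, hε, h1.ne]
  · simp [h1]
  · simp [h1.not_gt, h1.ne']

theorem koszulD_comp (hε : ∀ i x, ε i (ε i x) = x) (hεd : ∀ i x, ε i (d i x) = -d i (ε i x))
    (hd : ∀ i x, d i (d i x) = 0) (x : ⨂[ℂ] i, V i) : koszulD ε d (koszulD ε d x) = 0 := by
  have hsame : ∀ i, koszulAt ε d i (koszulAt ε d i x) = 0 := fun i => by
    rw [koszulAt_comp_same hε]
    suffices h : mapAt (fun j => d j ∘ₗ d j) {i} = 0 from LinearMap.congr_fun h x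
    ext y
    simp only [LinearMap.compMultilinearMap_apply, mapAt_tprod]
    exact tprod_eq_zero i (by simp [hd])
  have h1 : koszulD ε d (koszulD ε d x) = ∑ i, ∑ j, koszulAt ε d i (koszulAt ε d j x) := by
    simp only [koszulD, map_sum, LinearMap.sum_apply]
    exact Finset.sum_comm
  -- The diagonal terms vanish and the others anticommute, so the double sum is its own negative.
  have h2 : ∑ i, ∑ j, koszulAt ε d i (koszulAt ε d j x) =
      -∑ i, ∑ j, koszulAt ε d i (koszulAt ε d j x) := by
    conv_lhs => rw [Finset.sum_comm]
    simp only [← Finset.sum_neg_distrib]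
    refine Finset.sum_congr rfl fun i _ => Finset.sum_congr rfl fun j _ => ?_
    by_cases hij : i = j
    · subst hij; rw [hsame, neg_zero]
    · exact koszulAt_anticomm d d hεd hεd j i (Ne.symm hij) x
  rw [h1]
  have h3 := add_eq_zero_iff_eq_neg.2 h2
  rw [← two_smul ℂ] at h3
  exact (smul_eq_zero.1 h3).resolve_left two_ne_zero

/-- Homotopies on the factors induce homotopies on the tensor product. -/
theorem koszulD_homotopy (hε : ∀ i x, ε i (ε i x) = x) (hεd : ∀ i x, ε i (d i x) = -d i (ε i x))
    (hεh : ∀ i x, ε i (h i x) = -h i (ε i x)) (i : ι) (x : ⨂[ℂ] i, V i) :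
    koszulD ε d (koszulAt ε h i x) + koszulAt ε h i (koszulD ε d x) =
      mapAt (fun j => d j ∘ₗ h j + h j ∘ₗ d j) {i} x := by
  have h1 : koszulD ε d (koszulAt ε h i x) + koszulAt ε h i (koszulD ε d x) =
      ∑ j, (koszulAt ε d j (koszulAt ε h i x) + koszulAt ε h i (koszulAt ε d j x)) := by
    simp [koszulD, map_sum, Finset.sum_add_distrib]
  rw [h1, Finset.sum_eq_single i]
  · rw [koszulAt_comp_same hε, koszulAt_comp_same hε, ← LinearMap.add_apply]
    congr 1
    ext y
    simp only [LinearMap.compMultilinearMap_apply, LinearMap.add_apply, mapAt_tprod]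
    have e : ∀ (f : ∀ i, V i →ₗ[ℂ] V i), (fun j => if j ∈ ({i} : Finset ι) then f j (y j) else y j)
        = Function.update y i (f i (y i)) := fun f => by
      funext j
      by_cases hj : j = i
      · subst hj; simp
      · simp [hj]
    have e3 := e (fun j => d j ∘ₗ h j + h j ∘ₗ d j)
    simp only [LinearMap.add_apply] at e3
    rw [e (fun j => d j ∘ₗ h j), e (fun j => h j ∘ₗ d j), e3, ← MultilinearMap.map_update_add]
  · intro j _ hj
    rw [koszulAt_anticomm d h hεd hεh j i hj, neg_add_cancel]
  · simp

theorem koszulD_tprod_cycle {z : ∀ i, V i}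
    (hz : ∀ i, d i (z i) = 0) : koszulD ε d (PiTensorProduct.tprod ℂ z) = 0 := by
  rw [koszulD_tprod]
  exact Finset.sum_eq_zero fun i _ => tprod_eq_zero i (by simp [hz])

theorem koszulD_tprod_homologous {z w : ∀ i, V i} (hε : ∀ i x, ε i (ε i x) = x)
    (hεd : ∀ i x, ε i (d i x) = -d i (ε i x)) (hz : ∀ i, d i (z i) = 0) (hw : ∀ i, d i (w i) = 0)
    (hzw : ∀ i, ∃ y, d i y = z i - w i) : ∃ y, koszulD ε d y = PiTensorProduct.tprod ℂ z - PiTensorProduct.tprod ℂ w := by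
  have hdε : ∀ i x, d i (ε i x) = -ε i (d i x) := fun i x => by rw [hεd, neg_neg]
  have step : ∀ (x : ∀ i, V i) (a : ι) (y : V a), (∀ i, d i (x i) = 0) →
      ∃ t, koszulD ε d t = PiTensorProduct.tprod ℂ (Function.update x a (d a y)) := by
    intro x a y hx
    -- The factors before `a` are twisted by `ε` in advance, so that the sign carried by the summand
    -- at `a` undoes the twist. Every other summand of the differential contains `d` of a cycle.
    refine ⟨PiTensorProduct.tprod ℂ (Function.update (fun j => if j < a then ε j (x j) else x j) a y), ?_⟩
    rw [koszulD_tprod, Finset.sum_eq_single a]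
    · congr 1; funext j
      by_cases hj : j = a
      · subst hj; simp
      · by_cases hlt : j < a <;> simp [hj, hlt, hε]
    · intro i _ hi
      refine tprod_eq_zero i ?_
      by_cases hlt : i < a <;> simp [hi, hlt, hdε, hx]
    · simp
  -- The factors of `w` are exchanged for those of `z` one at a time, each exchange costing a
  -- boundary.
  have key : ∀ s : Finset ι, ∃ y, koszulD ε d y =
      PiTensorProduct.tprod ℂ (fun j => if j ∈ s then z j else w j) - PiTensorProduct.tprod ℂ w := by
    intro s
    induction s using Finset.induction_on with
    | empty => exact ⟨0, by simp⟩
    | insert a s ha ih =>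
      obtain ⟨y, hy⟩ := ih
      obtain ⟨v, hv⟩ := hzw a
      obtain ⟨t, ht⟩ := step (fun j => if j ∈ s then z j else w j) a v
        (fun i => by split_ifs <;> simp [hz, hw])
      refine ⟨t + y, ?_⟩
      rw [map_add, hy, ht, hv, MultilinearMap.map_update_sub]
      have e1 : Function.update (fun j => if j ∈ s then z j else w j) a (z a) =
          fun j => if j ∈ insert a s then z j else w j := by
        funext j
        by_cases hj : j = a
        · subst hj; simp
        · simp [hj]
      have e2 : Function.update (fun j => if j ∈ s then z j else w j) a (w a) =
          fun j => if j ∈ s then z j else w j := by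
        rw [Function.update_eq_self_iff]; simp [ha]
      rw [e1, e2]; abel
  simpa using key Finset.univ

end

variable (ε d : ∀ i, V i →ₗ[ℂ] V i) (ε' d' : ∀ i, V' i →ₗ[ℂ] V' i)

/-- Parity involutions anticommuting with square zero differentials. -/
structure SuperDiff {V : Type u} [AddCommGroup V] [Module ℂ V] (ε d : V →ₗ[ℂ] V) : Prop where
  sq : ∀ x, d (d x) = 0
  inv : ∀ x, ε (ε x) = x
  anti : ∀ x, ε (d x) = -d (ε x)

variable {ε d ε' d'}

/-- Over a field each factor retracts onto its homology by some `s` and `q` with an odd homotopy.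
The tensor product of the `q` kills boundaries and is a left inverse of the tensor product of the
`s`, which gives injectivity. Replacing one factor at a time by its image under `s q`, with
`koszulD_homotopy`, changes a cycle by a boundary, which gives surjectivity. The retractions involve
choices; the formula on classes of cycles pins the map down and makes it natural. -/
theorem exists_kunneth (H : ∀ i, SuperDiff (ε i) (d i)) :
    ∃ K : (⨂[ℂ] i, Homology (d i)) →ₗ[ℂ] Homology (koszulD ε d),
      Function.Bijective K ∧ ∀ z (hz : ∀ i, d i (z i) = 0),
        K (PiTensorProduct.tprod ℂ fun i => Homology.mk (d i) (z i) (hz i)) =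
          Homology.mk _ (PiTensorProduct.tprod ℂ z) (koszulD_tprod_cycle hz) := by
  have hε i := (H i).inv
  have hεd i := (H i).anti
  have hd i := (H i).sq
  choose q s h hds hs hqd hq hh hεh hqs using fun i => exists_retraction (d i) (ε i) (hd i) (hε i) (hεd i)
  have hDs : ∀ y, koszulD ε d (PiTensorProduct.map s y) = 0 := by
    intro y
    suffices h : koszulD ε d ∘ₗ PiTensorProduct.map s = 0 from LinearMap.congr_fun h y
    ext x
    simp only [LinearMap.compMultilinearMap_apply, LinearMap.comp_apply, PiTensorProduct.map_tprod]
    exact koszulD_tprod_cycle fun i => hds i _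
  have hqD : ∀ y, PiTensorProduct.map q (koszulD ε d y) = 0 := by
    intro y
    suffices h : PiTensorProduct.map q ∘ₗ koszulD ε d = 0 from LinearMap.congr_fun h y
    ext x
    simp only [LinearMap.compMultilinearMap_apply, LinearMap.comp_apply, koszulD_tprod, map_sum,
      PiTensorProduct.map_tprod]
    exact Finset.sum_eq_zero fun i _ => tprod_eq_zero i (by simp [hqd])
  have hqsid : ∀ y, PiTensorProduct.map q (PiTensorProduct.map s y) = y := by
    intro y
    rw [← LinearMap.comp_apply, ← PiTensorProduct.map_comp]
    have : (fun i => q i ∘ₗ s i) = fun i => LinearMap.id := by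
      funext i; refine LinearMap.ext fun c => ?_
      rw [LinearMap.comp_apply, hq i _ (hds i c), hs i]; rfl
    rw [this, PiTensorProduct.map_id]; rfl
  let K : (⨂[ℂ] i, Homology (d i)) →ₗ[ℂ] Homology (koszulD ε d) :=
    (Submodule.mkQ _).comp ((PiTensorProduct.map s).codRestrict (LinearMap.ker (koszulD ε d)) hDs)
  have hK : ∀ y, K y = Homology.mk _ (PiTensorProduct.map s y) (hDs y) := fun y => rfl
  refine ⟨K, ⟨?_, ?_⟩, ?_⟩
  · rw [injective_iff_map_eq_zero]
    intro y hy
    rw [hK, Homology.mk_eq_zero] at hy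
    obtain ⟨w, hw⟩ := hy
    rw [← hqsid y, ← hw, hqD]
  · intro c
    obtain ⟨x, hx, rfl⟩ := c.exists_rep
    refine ⟨PiTensorProduct.map q x, ?_⟩
    rw [hK, Homology.mk_eq_mk]
    have key : ∀ t : Finset ι, ∃ y, koszulD ε d y = mapAt (fun i => s i ∘ₗ q i) t x - x := by
      intro t
      induction t using Finset.induction_on with
      | empty =>
        refine ⟨0, ?_⟩
        have : mapAt (fun i => s i ∘ₗ q i) ∅ = LinearMap.id := by
          unfold mapAt; simp only [Finset.notMem_empty, if_false, PiTensorProduct.map_id]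
        rw [this]; simp
      | insert a t ha ih =>
        obtain ⟨y, hy⟩ := ih
        rw [mapAt_insert _ _ _ ha]
        set x' := mapAt (fun i => s i ∘ₗ q i) t x
        have hx' : koszulD ε d x' = 0 := by
          rw [show x' = koszulD ε d y + x by rw [hy]; abel, map_add, koszulD_comp hε hεd hd, hx,
            add_zero]
        have h1 := koszulD_homotopy (h := h) hε hεd hεh a x'
        rw [hx', map_zero, add_zero] at h1
        have h2 : mapAt (fun j => d j ∘ₗ h j + h j ∘ₗ d j) {a} x' =
            x' - mapAt (fun i => s i ∘ₗ q i) {a} x' := by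
          suffices h3 : mapAt (fun j => d j ∘ₗ h j + h j ∘ₗ d j) {a} =
              LinearMap.id - mapAt (fun i => s i ∘ₗ q i) {a} from LinearMap.congr_fun h3 x'
          ext y
          simp only [LinearMap.compMultilinearMap_apply, LinearMap.sub_apply, mapAt_tprod,
            LinearMap.id_apply]
          have e : ∀ (f : ∀ i, V i →ₗ[ℂ] V i),
              (fun j => if j ∈ ({a} : Finset ι) then f j (y j) else y j)
              = Function.update y a (f a (y a)) := fun f => by
            funext j
            by_cases hj : j = a
            · subst hj; simp
            · simp [hj]
          rw [e (fun j => s j ∘ₗ q j), e (fun j => d j ∘ₗ h j + h j ∘ₗ d j)]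
          have h4 : PiTensorProduct.tprod ℂ y =
              PiTensorProduct.tprod ℂ (Function.update y a (y a)) := by
            rw [Function.update_eq_self]
          rw [h4, ← MultilinearMap.map_update_sub, LinearMap.add_apply, LinearMap.comp_apply,
            LinearMap.comp_apply, hh]
          rfl
        refine ⟨y - koszulAt ε h a x', ?_⟩
        rw [map_sub, h1, h2, hy]; abel
    obtain ⟨y, hy⟩ := key Finset.univ
    refine ⟨y, ?_⟩
    rw [hy]
    congr 1
    rw [← LinearMap.comp_apply, ← PiTensorProduct.map_comp]
    simp [mapAt]
  · intro z hz
    rw [hK, Homology.mk_eq_mk, PiTensorProduct.map_tprod]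
    refine koszulD_tprod_homologous hε hεd (fun i => hds i _) hz fun i => ?_
    have := hs i (Homology.mk (d i) (z i) (hz i)) (hds i _)
    exact Homology.mk_eq_mk.1 this

/-- The Künneth isomorphism. -/
def kunneth (H : ∀ i, SuperDiff (ε i) (d i)) :
    (⨂[ℂ] i, Homology (d i)) →ₗ[ℂ] Homology (koszulD ε d) :=
  (exists_kunneth H).choose

theorem kunneth_bijective (H : ∀ i, SuperDiff (ε i) (d i)) : Function.Bijective (kunneth H) :=
  (exists_kunneth H).choose_spec.1

theorem kunneth_tprod (H : ∀ i, SuperDiff (ε i) (d i)) (z : ∀ i, V i) (hz : ∀ i, d i (z i) = 0) :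
    kunneth H (PiTensorProduct.tprod ℂ fun i => Homology.mk (d i) (z i) (hz i)) =
      Homology.mk _ (PiTensorProduct.tprod ℂ z) (koszulD_tprod_cycle hz) :=
  (exists_kunneth H).choose_spec.2 z hz

theorem homology_tensor_ext {X : Type u} [AddCommGroup X] [Module ℂ X]
    {φ ψ : (⨂[ℂ] i, Homology (d i)) →ₗ[ℂ] X}
    (h : ∀ (z : ∀ i, V i) (hz : ∀ i, d i (z i) = 0), φ (PiTensorProduct.tprod ℂ fun i => Homology.mk (d i) (z i) (hz i)) =
      ψ (PiTensorProduct.tprod ℂ fun i => Homology.mk (d i) (z i) (hz i))) : φ = ψ := by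
  ext c
  choose z hz hc using fun i => (c i).exists_rep
  obtain rfl : c = fun i => Homology.mk (d i) (z i) (hz i) := funext hc
  exact h z hz

theorem koszulD_map (f : ∀ i, V i →ₗ[ℂ] V' i) (hf : ∀ i x, f i (d i x) = d' i (f i x))
    (hfε : ∀ i x, f i (ε i x) = ε' i (f i x)) (x : ⨂[ℂ] i, V i) :
    PiTensorProduct.map f (koszulD ε d x) = koszulD ε' d' (PiTensorProduct.map f x) := by
  suffices h : PiTensorProduct.map f ∘ₗ koszulD ε d = koszulD ε' d' ∘ₗ PiTensorProduct.map f from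
    LinearMap.congr_fun h x
  ext x
  simp only [LinearMap.compMultilinearMap_apply, LinearMap.comp_apply, koszulD_tprod, map_sum,
    PiTensorProduct.map_tprod]
  refine Finset.sum_congr rfl fun i _ => ?_
  congr 1; funext j
  split_ifs <;> simp [hf, hfε]

/-- Naturality of the Künneth isomorphism. -/
theorem kunneth_map (H : ∀ i, SuperDiff (ε i) (d i)) (H' : ∀ i, SuperDiff (ε' i) (d' i))
    (f : ∀ i, V i →ₗ[ℂ] V' i) (hf : ∀ i, HCompat (d i) (d' i) (f i))
    (hF : HCompat (koszulD ε d) (koszulD ε' d') (PiTensorProduct.map f))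
    (x : ⨂[ℂ] i, Homology (d i)) :
    kunneth H' (PiTensorProduct.map (fun i => Homology.map (f i) (hf i)) x) =
      Homology.map (PiTensorProduct.map f) hF (kunneth H x) := by
  suffices h : kunneth H' ∘ₗ PiTensorProduct.map (fun i => Homology.map (f i) (hf i)) =
      Homology.map (PiTensorProduct.map f) hF ∘ₗ kunneth H from LinearMap.congr_fun h x
  refine homology_tensor_ext fun z hz => ?_
  simp only [LinearMap.comp_apply, PiTensorProduct.map_tprod, Homology.map_mk, kunneth_tprod]

end Kunneth
end HochschildWreath

end

/-! ### Hochschild complexes as total spaces, with coefficients in differential bimodules -/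

noncomputable section

namespace HochschildWreath

set_option linter.unusedSectionVars false

/-! ### The total differential of a graded complex -/

section Shift

variable {V V' : ℕ → Type u} [∀ k, AddCommGroup (V k)] [∀ k, Module ℂ (V k)]
  [∀ k, AddCommGroup (V' k)] [∀ k, Module ℂ (V' k)]

theorem directSum_ext {W : Type u} [AddCommGroup W] [Module ℂ W] {f g : (⨁ k, V k) →ₗ[ℂ] W}
    (h : ∀ k x, f (DirectSum.lof ℂ ℕ V k x) = g (DirectSum.lof ℂ ℕ V k x)) (x : ⨁ k, V k) :
    f x = g x :=
  LinearMap.congr_fun (DirectSum.linearMap_ext ℂ fun k => LinearMap.ext (h k)) x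

/-- The differential of the total space `⨁ V_k` of a complex. -/
def shiftD (d : ∀ k, V (k + 1) →ₗ[ℂ] V k) : (⨁ k, V k) →ₗ[ℂ] ⨁ k, V k :=
  DirectSum.toModule ℂ ℕ _ fun k =>
    match k with
    | 0 => 0
    | k + 1 => DirectSum.lof ℂ ℕ V k ∘ₗ d k

@[simp]
theorem shiftD_lof_zero (d : ∀ k, V (k + 1) →ₗ[ℂ] V k) (x : V 0) :
    shiftD d (DirectSum.lof ℂ ℕ V 0 x) = 0 := by
  simp [shiftD]

@[simp]
theorem shiftD_lof_succ (d : ∀ k, V (k + 1) →ₗ[ℂ] V k) (k : ℕ) (x : V (k + 1)) :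
    shiftD d (DirectSum.lof ℂ ℕ V (k + 1) x) = DirectSum.lof ℂ ℕ V k (d k x) := by
  simp [shiftD]

theorem shiftD_apply (d : ∀ k, V (k + 1) →ₗ[ℂ] V k) (x : ⨁ k, V k) (j : ℕ) :
    shiftD d x j = d j (x (j + 1)) := by
  classical
  refine directSum_ext (f := DirectSum.component ℂ ℕ V j ∘ₗ shiftD d)
    (g := d j ∘ₗ DirectSum.component ℂ ℕ V (j + 1)) (fun k x => ?_) x
  match k with
  | 0 => simp [DirectSum.component.of]
  | k + 1 =>
    simp only [LinearMap.comp_apply, shiftD_lof_succ, DirectSum.component.of]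
    by_cases h : k = j
    · subst h; simp
    · simp [h]

theorem shiftD_comp (d : ∀ k, V (k + 1) →ₗ[ℂ] V k) (hd : ∀ k x, d k (d (k + 1) x) = 0)
    (x : ⨁ k, V k) : shiftD d (shiftD d x) = 0 := by
  refine directSum_ext (f := shiftD d ∘ₗ shiftD d) (g := 0) (fun k x => ?_) x
  match k with
  | 0 => simp
  | 1 => simp
  | k + 2 => simp [hd]

/-- The operator acting by `z ^ k` in degree `k`. -/
def degOp (V : ℕ → Type u) [∀ k, AddCommGroup (V k)] [∀ k, Module ℂ (V k)] (z : ℂ) :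
    (⨁ k, V k) →ₗ[ℂ] ⨁ k, V k :=
  DirectSum.lmap fun k => z ^ k • LinearMap.id

@[simp]
theorem degOp_lof (z : ℂ) (k : ℕ) (x : V k) :
    degOp V z (DirectSum.lof ℂ ℕ V k x) = z ^ k • DirectSum.lof ℂ ℕ V k x := by
  simp [degOp, DirectSum.lmap_lof]

theorem shiftD_degOp (d : ∀ k, V (k + 1) →ₗ[ℂ] V k) (z : ℂ) (x : ⨁ k, V k) :
    shiftD d (degOp V z x) = z • degOp V z (shiftD d x) := by
  refine directSum_ext (f := shiftD d ∘ₗ degOp V z) (g := z • degOp V z ∘ₗ shiftD d)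
    (fun k x => ?_) x
  match k with
  | 0 => simp
  | k + 1 => simp [smul_smul, pow_succ, mul_comm]

theorem degOp_comp (z w : ℂ) (x : ⨁ k, V k) :
    degOp V z (degOp V w x) = degOp V (z * w) x := by
  refine directSum_ext (f := degOp V z ∘ₗ degOp V w) (g := degOp V (z * w)) (fun k x => ?_) x
  simp [smul_smul, mul_pow, mul_comm]

theorem degOp_one (x : ⨁ k, V k) : degOp V 1 x = x :=
  directSum_ext (f := degOp V 1) (g := LinearMap.id) (fun k x => by simp) x

theorem isGr_degOp : IsGr (degOp V 2) := by
  refine IsGr.of_span {x | ∃ k y, x = DirectSum.lof ℂ ℕ V k y} ?_ ?_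
  · rw [eq_top_iff]
    intro x _
    induction x using DirectSum.induction_on with
    | zero => exact Submodule.zero_mem _
    | of k y => exact Submodule.subset_span ⟨k, y, rfl⟩
    | add x y hx hy => exact Submodule.add_mem _ (hx trivial) (hy trivial)
  · rintro _ ⟨k, y, rfl⟩
    exact ⟨k, degOp_lof _ _ _⟩

theorem superDiff_shiftD (d : ∀ k, V (k + 1) →ₗ[ℂ] V k) (hd : ∀ k x, d k (d (k + 1) x) = 0) :
    SuperDiff (degOp V (-1)) (shiftD d) where
  sq := shiftD_comp d hd
  inv x := by rw [degOp_comp]; norm_num; exact degOp_one x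
  anti x := by rw [shiftD_degOp, neg_one_smul, neg_neg]

/-- The degree `k` component of the eigenvectors of the degree operator. -/
theorem degOp_eigen (k : ℕ) (x : ⨁ k, V k) (hx : degOp V 2 x = (2 : ℂ) ^ k • x) :
    DirectSum.lof ℂ ℕ V k (x k) = x := by
  classical
  have h1 : ∀ (y : ⨁ k, V k) j, degOp V 2 y j = (2 : ℂ) ^ j • y j := by
    intro y j
    simp [degOp, DirectSum.lmap_apply]
  refine DFinsupp.ext fun j => ?_
  by_cases hj : j = k
  · subst hj
    exact DirectSum.of_eq_same (β := V) j _
  · have h2 := h1 x j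
    rw [hx, DirectSum.smul_apply, ← sub_eq_zero, ← sub_smul] at h2
    have h3 : x j = 0 := (smul_eq_zero.1 h2).resolve_left (by
      intro h
      rw [sub_eq_zero] at h
      have h' : (2 : ℕ) ^ k = 2 ^ j := by exact_mod_cast h
      exact hj (Nat.pow_right_injective le_rfl h').symm)
    have h4 : DirectSum.lof ℂ ℕ V k (x k) j = 0 := DirectSum.of_eq_of_ne (β := V) k j _ hj
    exact h4.trans h3.symm

theorem shiftD_lmap {d : ∀ k, V (k + 1) →ₗ[ℂ] V k} {d' : ∀ k, V' (k + 1) →ₗ[ℂ] V' k}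
    (f : ∀ k, V k →ₗ[ℂ] V' k) (hf : ∀ k x, f k (d k x) = d' k (f (k + 1) x)) (x : ⨁ k, V k) :
    DirectSum.lmap f (shiftD d x) = shiftD d' (DirectSum.lmap f x) := by
  refine directSum_ext (f := DirectSum.lmap f ∘ₗ shiftD d) (g := shiftD d' ∘ₗ DirectSum.lmap f)
    (fun k x => ?_) x
  match k with
  | 0 => simp [DirectSum.lmap_lof]
  | k + 1 => simp [DirectSum.lmap_lof, hf]

theorem degOp_lmap (f : ∀ k, V k →ₗ[ℂ] V' k) (z : ℂ) (x : ⨁ k, V k) :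
    DirectSum.lmap f (degOp V z x) = degOp V' z (DirectSum.lmap f x) := by
  refine directSum_ext (f := DirectSum.lmap f ∘ₗ degOp V z) (g := degOp V' z ∘ₗ DirectSum.lmap f)
    (fun k x => ?_) x
  simp [DirectSum.lmap_lof]

end Shift


/-! ### Hochschild homology as the homology of the total space -/

section HochschildTotal

open CategoryTheory

variable (A : Type u) [Ring A] [Algebra ℂ A]

/-- The total space of the Hochschild complex. -/
abbrev HTot : Type u := ⨁ k, TPow A (k + 1)

/-- The differential of the total space of the Hochschild complex. -/
abbrev hTotD : HTot A →ₗ[ℂ] HTot A := shiftD (V := fun k => TPow A (k + 1)) (hochschildD A)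

variable {A}

theorem hCycles_iff (k : ℕ) (x : TPow A (k + 1)) :
    ((hochschildComplex A).sc k).g.hom x = 0 ↔
      hTotD A (DirectSum.lof ℂ ℕ (fun k => TPow A (k + 1)) k x) = 0 := by
  change ((hochschildComplex A).d k ((ComplexShape.down ℕ).next k)).hom x = 0 ↔ _
  match k with
  | 0 =>
    rw [(hochschildComplex A).shape 0 _ (by simp)]
    simp only [shiftD_lof_zero, iff_true]
    rfl
  | k + 1 =>
    -- The successor index given by the complex shape equals `k` only propositionally, so it is
    -- generalized before being substituted.
    have key : ∀ j, j = k → (((hochschildComplex A).d (k + 1) j).hom x = 0 ↔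
        hochschildD A k x = 0) := by
      rintro j rfl
      dsimp only [hochschildComplex]
      rw [ChainComplex.of_d]; rfl
    rw [key _ (ChainComplex.next_nat_succ k), shiftD_lof_succ]
    exact ((DirectSum.of_injective (β := fun k => TPow A (k + 1)) k).eq_iff' (map_zero _)).symm

theorem hBoundaries_iff (k : ℕ) (x : TPow A (k + 1)) :
    (∃ z, ((hochschildComplex A).sc k).f.hom z = x) ↔ ∃ z, hochschildD A k z = x := by
  change (∃ z, ((hochschildComplex A).d ((ComplexShape.down ℕ).prev k) k).hom z = x) ↔ _
  have key : ∀ j, j = k + 1 → ((∃ z, ((hochschildComplex A).d j k).hom z = x) ↔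
      ∃ z, hochschildD A k z = x) := by
    rintro j rfl
    dsimp only [hochschildComplex]
    rw [ChainComplex.of_d]; rfl
  exact key _ (ChainComplex.prev ℕ k)

variable (A) in
/-- The space of Hochschild cycles in degree `k`. -/
def hCycles (k : ℕ) : Submodule ℂ (TPow A (k + 1)) :=
  LinearMap.ker (hTotD A ∘ₗ DirectSum.lof ℂ ℕ (fun k => TPow A (k + 1)) k)

theorem hCycles_spec {k : ℕ} (x : hCycles A k) :
    hTotD A (DirectSum.lof ℂ ℕ (fun k => TPow A (k + 1)) k x.1) = 0 := x.2

variable (A) in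
/-- The cycles of the Hochschild complex as a short complex of modules. -/
def hCyclesTo (k : ℕ) :
    hCycles A k →ₗ[ℂ] ((hochschildComplex A).sc k).moduleCatLeftHomologyData.K where
  toFun x := (⟨x.1, (hCycles_iff k x.1).2 x.2⟩ : LinearMap.ker ((hochschildComplex A).sc k).g.hom)
  map_add' _ _ := rfl
  map_smul' _ _ := rfl

/-- The Hochschild homology class of a cycle. -/
def HH.mk (k : ℕ) : hCycles A k →ₗ[ℂ] HH A k :=
  (((hochschildComplex A).sc k).moduleCatCyclesIso.inv ≫
    ((hochschildComplex A).sc k).homologyπ).hom ∘ₗ hCyclesTo A k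

theorem HH.mk_surjective (k : ℕ) : Function.Surjective (HH.mk (A := A) k) := by
  rw [HH.mk, ShortComplex.moduleCatCyclesIso_inv_π]
  have h1 : Function.Surjective (((hochschildComplex A).sc k).moduleCatLeftHomologyData.π ≫
      ((hochschildComplex A).sc k).moduleCatHomologyIso.inv).hom :=
    (ModuleCat.epi_iff_surjective _).1 inferInstance
  refine h1.comp fun x => ?_
  exact ⟨⟨x.1, (hCycles_iff k x.1).1 x.2⟩, rfl⟩

theorem HH.mk_eq_zero (k : ℕ) (x : hCycles A k) :
    HH.mk k x = 0 ↔ ∃ z, hochschildD A k z = x.1 := by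
  refine Iff.trans ?_ (hBoundaries_iff k x.1)
  rw [HH.mk, ShortComplex.moduleCatCyclesIso_inv_π]
  have h1 : Function.Injective ((hochschildComplex A).sc k).moduleCatHomologyIso.inv.hom :=
    (ModuleCat.mono_iff_injective _).1 inferInstance
  change ((hochschildComplex A).sc k).moduleCatHomologyIso.inv.hom
    (Submodule.Quotient.mk (hCyclesTo A k x)) = 0 ↔ _
  refine (h1.eq_iff' (map_zero _)).trans ((Submodule.Quotient.mk_eq_zero _).trans ?_)
  constructor
  · rintro ⟨z, hz⟩; exact ⟨z, congrArg Subtype.val hz⟩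
  · rintro ⟨z, hz⟩; exact ⟨z, Subtype.ext hz⟩

/-- The inclusion of the degree `k` part in the homology of the total space. -/
def HH.incl (k : ℕ) : HH A k →ₗ[ℂ] Homology (hTotD A) :=
  ((LinearMap.ker (HH.mk (A := A) k)).liftQ
    ((Submodule.mkQ _).comp (((DirectSum.lof ℂ ℕ (fun k => TPow A (k + 1)) k).comp
      (Submodule.subtype _)).codRestrict (LinearMap.ker (hTotD A))
        hCycles_spec)) (by
    intro x hx
    obtain ⟨z, hz⟩ := (HH.mk_eq_zero k x).1 hx
    refine (Homology.mk_eq_zero (hx := hCycles_spec x)).2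
      ⟨DirectSum.lof ℂ ℕ (fun k => TPow A (k + 1)) (k + 1) z, ?_⟩
    rw [shiftD_lof_succ, hz])).comp
  ((HH.mk (A := A) k).quotKerEquivOfSurjective (HH.mk_surjective k)).symm.toLinearMap

theorem HH.incl_mk (k : ℕ) (x : hCycles A k) :
    HH.incl k (HH.mk k x) =
      Homology.mk (hTotD A) (DirectSum.lof ℂ ℕ (fun k => TPow A (k + 1)) k x.1)
        (hCycles_spec x) := by
  have h : ((HH.mk (A := A) k).quotKerEquivOfSurjective (HH.mk_surjective k)).symm (HH.mk k x) =
      Submodule.Quotient.mk x := by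
    rw [LinearEquiv.symm_apply_eq]; rfl
  rw [HH.incl, LinearMap.comp_apply, LinearEquiv.coe_coe, h]
  rfl

/-- The map induced by an algebra homomorphism on total spaces. -/
def hTotMap {B : Type u} [Ring B] [Algebra ℂ B] (f : A →ₐ[ℂ] B) : HTot A →ₗ[ℂ] HTot B :=
  DirectSum.lmap fun k => tpowMap f (k + 1)

theorem hTotMap_d {B : Type u} [Ring B] [Algebra ℂ B] (f : A →ₐ[ℂ] B) (x : HTot A) :
    hTotMap f (hTotD A x) = hTotD B (hTotMap f x) :=
  shiftD_lmap _ (fun k x => (LinearMap.congr_fun (hochschildD_map f k) x).symm) x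

theorem tpowMap_mem_hCycles {B : Type u} [Ring B] [Algebra ℂ B] (f : A →ₐ[ℂ] B) (k : ℕ)
    (x : hCycles A k) : tpowMap f (k + 1) x.1 ∈ hCycles B k := by
  have h1 : DirectSum.lof ℂ ℕ (fun k => TPow B (k + 1)) k (tpowMap f (k + 1) x.1) =
      hTotMap f (DirectSum.lof ℂ ℕ (fun k => TPow A (k + 1)) k x.1) := by
    rw [hTotMap, DirectSum.lmap_lof]
  refine LinearMap.mem_ker.2 ?_
  rw [LinearMap.comp_apply, h1, ← hTotMap_d, hCycles_spec, map_zero]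

theorem HHMap_mk {B : Type u} [Ring B] [Algebra ℂ B] (f : A →ₐ[ℂ] B) (k : ℕ) (x : hCycles A k) :
    HHMap f k (HH.mk k x) = HH.mk k ⟨tpowMap f (k + 1) x.1, tpowMap_mem_hCycles f k x⟩ := by
  have h0 : ∀ y, HHMap f k ((((hochschildComplex A).sc k).homologyπ).hom y) =
      (((hochschildComplex B).sc k).homologyπ).hom
        ((HomologicalComplex.cyclesMap (hochschildComplexMap f) k).hom y) := fun y =>
    LinearMap.congr_fun (congrArg ModuleCat.Hom.hom
      (HomologicalComplex.homologyπ_naturality (hochschildComplexMap f) k)) y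
  have h1 : ∀ {A : Type u} [Ring A] [Algebra ℂ A] (x : hCycles A k), HH.mk k x =
    ((hochschildComplex A).sc k).homologyπ.hom
      (((hochschildComplex A).sc k).moduleCatCyclesIso.inv.hom (hCyclesTo A k x)) := fun x => rfl
  have hi : ∀ {A : Type u} [Ring A] [Algebra ℂ A] (x : hCycles A k),
    ((hochschildComplex A).sc k).iCycles.hom
      (((hochschildComplex A).sc k).moduleCatCyclesIso.inv.hom (hCyclesTo A k x)) = x.1 := fun x =>
    LinearMap.congr_fun (congrArg ModuleCat.Hom.hom
      (ShortComplex.moduleCatCyclesIso_inv_iCycles _)) (hCyclesTo _ k x)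
  rw [h1, h1, h0]
  congr 1
  -- The two cycles are compared inside the chain space, where the induced map is known explicitly.
  have hinj : Function.Injective ((hochschildComplex B).sc k).iCycles.hom :=
    (ModuleCat.mono_iff_injective _).1 inferInstance
  apply hinj
  rw [hi]
  have h2 : ∀ y, ((hochschildComplex B).sc k).iCycles.hom
      ((HomologicalComplex.cyclesMap (hochschildComplexMap f) k).hom y) =
      tpowMap f (k + 1) (((hochschildComplex A).sc k).iCycles.hom y) := fun y =>
    LinearMap.congr_fun (congrArg ModuleCat.Hom.hom
      (HomologicalComplex.cyclesMap_i (hochschildComplexMap f) k)) y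
  exact (h2 _).trans (congrArg _ (hi x))

variable (A) in
/-- The homology of the total space is the direct sum of the Hochschild homology spaces. -/
def HH.total : (⨁ k, HH A k) →ₗ[ℂ] Homology (hTotD A) := DirectSum.toModule ℂ ℕ _ fun k => HH.incl k

theorem HH.total_lof (k : ℕ) (c : HH A k) :
    HH.total A (DirectSum.lof ℂ ℕ (fun k => HH A k) k c) = HH.incl k c := by
  simp [HH.total]

theorem HH.sum_incl (s : Finset ℕ) (x : ∀ k, hCycles A k) :
    ∃ h, ∑ k ∈ s, HH.incl k (HH.mk k (x k)) = Homology.mk (hTotD A)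
      (∑ k ∈ s, DirectSum.lof ℂ ℕ (fun k => TPow A (k + 1)) k (x k).1) h := by
  classical
  induction s using Finset.induction_on with
  | empty => exact ⟨by simp, by simp only [Finset.sum_empty]; rfl⟩
  | insert a s ha ih =>
    obtain ⟨h, ih⟩ := ih
    simp only [Finset.sum_insert ha]
    rw [ih, HH.incl_mk]
    exact ⟨by rw [map_add, hCycles_spec, h, add_zero], rfl⟩

/-- The differential is homogeneous, so an element of the total space is a cycle, or a boundary,
exactly when each of its components is one. -/
theorem HH.total_bijective : Function.Bijective (HH.total A) := by
  classical
  constructor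
  · rw [injective_iff_map_eq_zero]
    intro c hc
    choose x hx using fun k => HH.mk_surjective k (c k)
    have h1 : HH.total A c = ∑ k ∈ DFinsupp.support c, HH.incl k (HH.mk k (x k)) := by
      conv_lhs => rw [← DirectSum.sum_support_of c]
      rw [map_sum]
      refine Finset.sum_congr rfl fun k _ => ?_
      rw [hx]
      exact HH.total_lof k (c k)
    obtain ⟨h, h2⟩ := HH.sum_incl (DFinsupp.support c) x
    rw [h1, h2, Homology.mk_eq_zero] at hc
    obtain ⟨z, hz⟩ := hc
    refine DFinsupp.ext fun j => ?_
    by_contra hj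
    have h3 := DFunLike.congr_fun hz j
    rw [shiftD_apply, DirectSum.sum_apply, Finset.sum_eq_single j] at h3
    · refine hj ((hx j).symm.trans ((HH.mk_eq_zero j (x j)).2 ⟨_, h3.trans ?_⟩))
      exact DirectSum.of_eq_same (β := fun k => TPow A (k + 1)) j _
    · intro k _ hk
      exact DirectSum.of_eq_of_ne (β := fun k => TPow A (k + 1)) k j _ hk.symm
    · intro h
      exact absurd (DFinsupp.mem_support_iff.2 hj) h
  · intro c
    obtain ⟨x, hx, rfl⟩ := c.exists_rep
    have hx' : ∀ k, x k ∈ hCycles A k := by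
      intro k
      refine LinearMap.mem_ker.2 ?_
      match k with
      | 0 => simp
      | k + 1 =>
        have h1 := DFunLike.congr_fun hx k
        rw [shiftD_apply] at h1
        rw [LinearMap.comp_apply, shiftD_lof_succ, h1]
        exact map_zero _
    let y : ∀ k, hCycles A k := fun k => ⟨x k, hx' k⟩
    obtain ⟨h, h2⟩ := HH.sum_incl (DFinsupp.support x) y
    refine ⟨∑ k ∈ DFinsupp.support x, DirectSum.lof ℂ ℕ (fun k => HH A k) k (HH.mk k (y k)), ?_⟩
    rw [map_sum]
    simp only [HH.total_lof]
    rw [h2]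
    congr 1
    exact DirectSum.sum_support_of x

theorem HH.total_map {B : Type u} [Ring B] [Algebra ℂ B] (f : A →ₐ[ℂ] B) (c : ⨁ k, HH A k) :
    HH.total B (DirectSum.lmap (HHMap f) c) =
      Homology.map (hTotMap f) (.of_comm (hTotMap_d f)) (HH.total A c) := by
  refine directSum_ext (f := HH.total B ∘ₗ DirectSum.lmap (HHMap f))
    (g := Homology.map (hTotMap f) (.of_comm (hTotMap_d f)) ∘ₗ HH.total A) (fun k c => ?_) c
  obtain ⟨x, rfl⟩ := HH.mk_surjective k c
  simp only [LinearMap.comp_apply, DirectSum.lmap_lof, HH.total_lof, HHMap_mk, HH.incl_mk,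
    Homology.map_mk]
  congr 1
  rw [hTotMap, DirectSum.lmap_lof]

end HochschildTotal
end HochschildWreath

end

noncomputable section

namespace HochschildWreath

set_option linter.unusedSectionVars false

/-! ### Concatenation of tensors -/

section Cons

variable (V : Type u) [AddCommGroup V] [Module ℂ V]

/-- Prepending a factor to a tensor. -/
def consT (k : ℕ) : V →ₗ[ℂ] (⨂[ℂ] _ : Fin k, V) →ₗ[ℂ] ⨂[ℂ] _ : Fin (k + 1), V :=
  PiTensorProduct.lift.toLinearMap ∘ₗ
    MultilinearMap.curryLeft (PiTensorProduct.tprod ℂ (s := fun _ : Fin (k + 1) => V))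

@[simp]
theorem consT_tprod (k : ℕ) (v : V) (a : Fin k → V) :
    consT V k v (PiTensorProduct.tprod ℂ a) =
      PiTensorProduct.tprod ℂ (Fin.cons v a : Fin (k + 1) → V) := by
  simp [consT]

/-- Splitting off the first factor of a tensor. -/
def unconsT (k : ℕ) : (⨂[ℂ] _ : Fin (k + 1), V) →ₗ[ℂ] V ⊗[ℂ] (⨂[ℂ] _ : Fin k, V) :=
  PiTensorProduct.lift (LinearMap.uncurryLeft
    { toFun := fun v => (TensorProduct.mk ℂ V (⨂[ℂ] _ : Fin k, V) v).compMultilinearMap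
        (PiTensorProduct.tprod ℂ)
      map_add' := fun v w => by ext a; simp
      map_smul' := fun c v => by ext a; simp [TensorProduct.smul_tmul'] })

@[simp]
theorem unconsT_tprod (k : ℕ) (a : Fin (k + 1) → V) :
    unconsT V k (PiTensorProduct.tprod ℂ a) = a 0 ⊗ₜ PiTensorProduct.tprod ℂ (fun j => a j.succ) := by
  simp [unconsT]; rfl

/-- `V ⊗ V^{⊗ k} ≅ V^{⊗ (k + 1)}`. -/
def consEquiv (k : ℕ) : (V ⊗[ℂ] (⨂[ℂ] _ : Fin k, V)) ≃ₗ[ℂ] ⨂[ℂ] _ : Fin (k + 1), V :=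
  LinearEquiv.ofLinearMap (TensorProduct.lift (consT V k)) (unconsT V k)
    (by
      ext a
      simp only [LinearMap.compMultilinearMap_apply, LinearMap.comp_apply, unconsT_tprod,
        TensorProduct.lift.tmul, consT_tprod, LinearMap.id_apply]
      congr 1
      exact Fin.cons_self_tail a)
    (by
      ext v a
      simp)

@[simp]
theorem consEquiv_tmul (k : ℕ) (v : V) (a : Fin k → V) :
    consEquiv V k (v ⊗ₜ PiTensorProduct.tprod ℂ a) =
      PiTensorProduct.tprod ℂ (Fin.cons v a : Fin (k + 1) → V) := by
  simp [consEquiv]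

end Cons

/-! ### Bimodules and Hochschild complexes with coefficients -/

/-- An `E`-bimodule structure on a vector space: `l x m = x m`, `r x m = m x`. -/
structure Bimod (E M : Type u) [Ring E] [Algebra ℂ E] [AddCommGroup M] [Module ℂ M] where
  l : E →ₗ[ℂ] M →ₗ[ℂ] M
  r : E →ₗ[ℂ] M →ₗ[ℂ] M
  l_one : ∀ m, l 1 m = m
  r_one : ∀ m, r 1 m = m
  l_mul : ∀ x y m, l (x * y) m = l x (l y m)
  r_mul : ∀ x y m, r (x * y) m = r y (r x m)
  comm : ∀ x y m, l x (r y m) = r y (l x m)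

section HC

variable {E M E' M' : Type u} [Ring E] [Algebra ℂ E] [AddCommGroup M] [Module ℂ M]
  [Ring E'] [Algebra ℂ E'] [AddCommGroup M'] [Module ℂ M'] (β : Bimod E M) (β' : Bimod E' M')

/-- The coefficient of the `i`-th face of `m ⊗ a`. -/
def mFace {k : ℕ} (i : Fin (k + 2)) (m : M) (a : Fin (k + 1) → E) : M :=
  if i = 0 then β.r (a 0) m else if i = Fin.last (k + 1) then β.l (a (Fin.last k)) m else m

/-- The tensor factors of the `i`-th face of `m ⊗ a`. -/
def tFace {k : ℕ} (i : Fin (k + 2)) (a : Fin (k + 1) → E) : Fin k → E := fun j =>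
  if (j : ℕ) + 1 < i then a j.castSucc
  else if (j : ℕ) + 1 = i then a j.castSucc * a j.succ
  else a j.succ

/-- The square zero extension `E ⊕ M`. -/
@[nolint unusedArguments]
def SqZero (_ : Bimod E M) : Type u := E × M

instance : AddCommGroup (SqZero β) := inferInstanceAs (AddCommGroup (E × M))
instance : Module ℂ (SqZero β) := inferInstanceAs (Module ℂ (E × M))

theorem SqZero.ext {u v : SqZero β} (h1 : u.1 = v.1) (h2 : u.2 = v.2) : u = v := Prod.ext h1 h2

instance : Ring (SqZero β) :=
  { (inferInstance : AddCommGroup (SqZero β)) with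
    mul := fun u v => (u.1 * v.1, β.l u.1 v.2 + β.r v.1 u.2)
    one := ((1 : E), (0 : M))
    mul_assoc := fun u v w => SqZero.ext β (mul_assoc u.1 v.1 w.1) (by
      change β.l (u.1 * v.1) w.2 + β.r w.1 (β.l u.1 v.2 + β.r v.1 u.2) =
        β.l u.1 (β.l v.1 w.2 + β.r w.1 v.2) + β.r (v.1 * w.1) u.2
      rw [map_add, map_add, β.l_mul, β.r_mul, β.comm, add_assoc])
    one_mul := fun u => SqZero.ext β (one_mul u.1) (by
      change β.l 1 u.2 + β.r u.1 0 = u.2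
      rw [β.l_one, map_zero, add_zero])
    mul_one := fun u => SqZero.ext β (mul_one u.1) (by
      change β.l u.1 0 + β.r 1 u.2 = u.2
      rw [β.r_one, map_zero, zero_add])
    left_distrib := fun u v w => SqZero.ext β (mul_add u.1 v.1 w.1) (by
      change β.l u.1 (v.2 + w.2) + β.r (v.1 + w.1) u.2 =
        (β.l u.1 v.2 + β.r v.1 u.2) + (β.l u.1 w.2 + β.r w.1 u.2)
      rw [map_add, map_add, LinearMap.add_apply]; abel)
    right_distrib := fun u v w => SqZero.ext β (add_mul u.1 v.1 w.1) (by
      change β.l (u.1 + v.1) w.2 + β.r w.1 (u.2 + v.2) =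
        (β.l u.1 w.2 + β.r w.1 u.2) + (β.l v.1 w.2 + β.r w.1 v.2)
      rw [map_add, map_add, LinearMap.add_apply]; abel)
    zero_mul := fun u => SqZero.ext β (zero_mul u.1) (by
      change β.l 0 u.2 + β.r u.1 0 = 0
      rw [map_zero, map_zero, LinearMap.zero_apply, add_zero])
    mul_zero := fun u => SqZero.ext β (mul_zero u.1) (by
      change β.l u.1 0 + β.r 0 u.2 = 0
      rw [map_zero, map_zero, LinearMap.zero_apply, add_zero]) }

theorem SqZero.mul_def (u v : SqZero β) :
    u * v = ((u.1 * v.1, β.l u.1 v.2 + β.r v.1 u.2) : E × M) := rfl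

instance : Algebra ℂ (SqZero β) :=
  Algebra.ofModule
    (fun c u v => SqZero.ext β (smul_mul_assoc c u.1 v.1) (by
      change β.l (c • u.1) v.2 + β.r v.1 (c • u.2) = c • (β.l u.1 v.2 + β.r v.1 u.2)
      rw [map_smul, map_smul, LinearMap.smul_apply, smul_add]))
    (fun c u v => SqZero.ext β (mul_smul_comm c u.1 v.1) (by
      change β.l u.1 (c • v.2) + β.r (c • v.1) u.2 = c • (β.l u.1 v.2 + β.r v.1 u.2)
      rw [map_smul, map_smul, LinearMap.smul_apply, smul_add]))

/-- The inclusion of the algebra in its square zero extension. -/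
def SqZero.inl : E →ₗ[ℂ] SqZero β := LinearMap.inl ℂ E M
/-- The inclusion of the bimodule in the square zero extension. -/
def SqZero.inr : M →ₗ[ℂ] SqZero β := LinearMap.inr ℂ E M
/-- The projection of the square zero extension to the algebra. -/
def SqZero.fst : SqZero β →ₗ[ℂ] E := LinearMap.fst ℂ E M
/-- The projection of the square zero extension to the bimodule. -/
def SqZero.snd : SqZero β →ₗ[ℂ] M := LinearMap.snd ℂ E M

@[simp] theorem SqZero.fst_inl (x : E) : SqZero.fst β (SqZero.inl β x) = x := rfl
@[simp] theorem SqZero.snd_inr (m : M) : SqZero.snd β (SqZero.inr β m) = m := rfl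
theorem SqZero.inl_mul_inl (x y : E) :
    SqZero.inl β x * SqZero.inl β y = SqZero.inl β (x * y) :=
  SqZero.ext β rfl (by change β.l x 0 + β.r y 0 = 0; simp)
theorem SqZero.inl_mul_inr (x : E) (m : M) :
    SqZero.inl β x * SqZero.inr β m = SqZero.inr β (β.l x m) :=
  SqZero.ext β (mul_zero x) (by change β.l x m + β.r 0 0 = β.l x m; simp)
theorem SqZero.inr_mul_inl (x : E) (m : M) :
    SqZero.inr β m * SqZero.inl β x = SqZero.inr β (β.r x m) :=
  SqZero.ext β (zero_mul x) (by change β.l 0 0 + β.r x m = β.r x m; simp)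

/-- The terms `M ⊗ E^{⊗ k}` of the Hochschild complex with coefficients in `M`. -/
abbrev HCk (E M : Type u) [Ring E] [Algebra ℂ E] [AddCommGroup M] [Module ℂ M] (k : ℕ) : Type u :=
  M ⊗[ℂ] TPow E k

/-- The embedding of the complex with coefficients in the complex of the square zero extension. -/
def hcEmb (k : ℕ) : HCk E M k →ₗ[ℂ] TPow (SqZero β) (k + 1) :=
  (consEquiv (SqZero β) k).toLinearMap ∘ₗ
    TensorProduct.map (SqZero.inr β) (PiTensorProduct.map fun _ => SqZero.inl β)

/-- The left inverse of `hcEmb`. -/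
def hcProj (k : ℕ) : TPow (SqZero β) (k + 1) →ₗ[ℂ] HCk E M k :=
  TensorProduct.map (SqZero.snd β) (PiTensorProduct.map fun _ => SqZero.fst β) ∘ₗ
    (consEquiv (SqZero β) k).symm.toLinearMap

theorem hcEmb_tmul (k : ℕ) (m : M) (a : Fin k → E) :
    hcEmb β k (m ⊗ₜ PiTensorProduct.tprod ℂ a) = PiTensorProduct.tprod ℂ
      (Fin.cons (SqZero.inr β m) fun j => SqZero.inl β (a j) : Fin (k + 1) → SqZero β) := by
  simp [hcEmb]

theorem hcProj_hcEmb (k : ℕ) (x : HCk E M k) : hcProj β k (hcEmb β k x) = x := by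
  suffices h : hcProj β k ∘ₗ hcEmb β k = LinearMap.id from LinearMap.congr_fun h x
  ext m a
  simp [hcProj, hcEmb, -consEquiv_tmul]

/-- In `E ⊕ M` a product of elements of `E` with a single element of `M` lies in `M` and is given by
the bimodule actions. The complex with coefficients thus sits inside the Hochschild complex of an
algebra, and its differential squares to zero because the latter's does. -/
theorem faceTuple_cons_sqZero {k : ℕ} (i : Fin (k + 2)) (m : M) (a : Fin (k + 1) → E) :
    faceTuple i (Fin.cons (SqZero.inr β m) fun j => SqZero.inl β (a j) : Fin (k + 2) → SqZero β) =
      (Fin.cons (SqZero.inr β (mFace β i m a)) fun j => SqZero.inl β (tFace i a j) :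
        Fin (k + 1) → SqZero β) := by
  funext j
  refine Fin.cases ?_ (fun j => ?_) j
  · simp only [faceTuple, Fin.cons_zero, Fin.val_zero, mFace, Fin.ext_iff, Fin.val_last]
    rcases Nat.lt_trichotomy (i : ℕ) 0 with h | h | h
    · omega
    · simp [h, ← SqZero.inr_mul_inl]
    · by_cases h' : (i : ℕ) = k + 1
      · simp [h', ← SqZero.inl_mul_inr, ← Fin.succ_last]
      · simp [h', h, h.ne']
  · simp only [faceTuple, Fin.cons_succ, tFace, Fin.val_succ, ← Fin.succ_castSucc]
    split_ifs <;> simp_all [SqZero.inl_mul_inl]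

/-- The `i`-th face of the Hochschild complex with coefficients. -/
def hcFace (k : ℕ) (i : Fin (k + 2)) : HCk E M (k + 1) →ₗ[ℂ] HCk E M k :=
  hcProj β k ∘ₗ face (SqZero β) k i ∘ₗ hcEmb β (k + 1)

theorem hcFace_tmul (k : ℕ) (i : Fin (k + 2)) (m : M) (a : Fin (k + 1) → E) :
    hcFace β k i (m ⊗ₜ PiTensorProduct.tprod ℂ a) =
      mFace β i m a ⊗ₜ PiTensorProduct.tprod ℂ (tFace i a) := by
  rw [hcFace, LinearMap.comp_apply, LinearMap.comp_apply, hcEmb_tmul, face_tprod,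
    faceTuple_cons_sqZero, ← hcEmb_tmul, hcProj_hcEmb]

/-- The differential of the Hochschild complex with coefficients. -/
def hcD (k : ℕ) : HCk E M (k + 1) →ₗ[ℂ] HCk E M k :=
  ∑ i : Fin (k + 2), (-1 : ℂ) ^ (i : ℕ) • hcFace β k i

theorem hcEmb_hcD (k : ℕ) (x : HCk E M (k + 1)) :
    hcEmb β k (hcD β k x) = hochschildD (SqZero β) k (hcEmb β (k + 1) x) := by
  suffices h : hcEmb β k ∘ₗ hcD β k = hochschildD (SqZero β) k ∘ₗ hcEmb β (k + 1) from
    LinearMap.congr_fun h x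
  ext m a
  simp [hcD, hochschildD, hcFace_tmul, hcEmb_tmul, faceTuple_cons_sqZero]

theorem hcD_comp (k : ℕ) (x : HCk E M (k + 2)) : hcD β k (hcD β (k + 1) x) = 0 := by
  have h := LinearMap.congr_fun (hochschildD_comp (SqZero β) k) (hcEmb β (k + 2) x)
  rw [LinearMap.comp_apply, LinearMap.zero_apply] at h
  rw [← hcProj_hcEmb β k (hcD β k _), hcEmb_hcD, hcEmb_hcD, h, map_zero]

/-- Maps of Hochschild complexes with coefficients. -/
def hcMap (f : E →ₐ[ℂ] E') (φ : M →ₗ[ℂ] M') (k : ℕ) : HCk E M k →ₗ[ℂ] HCk E' M' k :=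
  TensorProduct.map φ (tpowMap f k)

@[simp]
theorem hcMap_tmul (f : E →ₐ[ℂ] E') (φ : M →ₗ[ℂ] M') (k : ℕ) (m : M) (a : Fin k → E) :
    hcMap f φ k (m ⊗ₜ PiTensorProduct.tprod ℂ a) = φ m ⊗ₜ PiTensorProduct.tprod ℂ fun i => f (a i) := by
  simp [hcMap]

theorem tFace_map (f : E →ₐ[ℂ] E') {k : ℕ} (i : Fin (k + 2)) (a : Fin (k + 1) → E) :
    tFace i (fun j => f (a j)) = fun j => f (tFace i a j) := by
  funext j
  unfold tFace
  split_ifs <;> simp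

variable {β β'}

/-- Compatibility of a linear map of bimodules with an algebra homomorphism. -/
structure BimodHom (β : Bimod E M) (β' : Bimod E' M') (f : E →ₐ[ℂ] E') (φ : M →ₗ[ℂ] M') : Prop where
  left : ∀ x m, φ (β.l x m) = β'.l (f x) (φ m)
  right : ∀ x m, φ (β.r x m) = β'.r (f x) (φ m)

theorem hcFace_map {f : E →ₐ[ℂ] E'} {φ : M →ₗ[ℂ] M'} (h : BimodHom β β' f φ) (k : ℕ)
    (i : Fin (k + 2)) (x : HCk E M (k + 1)) :
    hcMap f φ k (hcFace β k i x) = hcFace β' k i (hcMap f φ (k + 1) x) := by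
  suffices h : hcMap f φ k ∘ₗ hcFace β k i = hcFace β' k i ∘ₗ hcMap f φ (k + 1) from
    LinearMap.congr_fun h x
  ext m a
  simp only [LinearMap.compMultilinearMap_apply, TensorProduct.AlgebraTensorModule.curry_apply,
    TensorProduct.curry_apply, LinearMap.coe_restrictScalars, LinearMap.comp_apply, hcFace_tmul,
    hcMap_tmul, tFace_map]
  congr 1
  unfold mFace
  split_ifs <;> simp [h.left, h.right]

theorem hcD_map {f : E →ₐ[ℂ] E'} {φ : M →ₗ[ℂ] M'} (h : BimodHom β β' f φ) (k : ℕ)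
    (x : HCk E M (k + 1)) : hcMap f φ k (hcD β k x) = hcD β' k (hcMap f φ (k + 1) x) := by
  simp [hcD, map_sum, hcFace_map h]

variable (E) in
/-- The regular bimodule. -/
def Bimod.regular : Bimod E E where
  l := LinearMap.mul ℂ E
  r := (LinearMap.mul ℂ E).flip
  l_one := one_mul
  r_one := mul_one
  l_mul := mul_assoc
  r_mul x y m := (mul_assoc m x y).symm
  comm x y m := (mul_assoc x m y).symm

theorem faceTuple_cons_regular {k : ℕ} (i : Fin (k + 2)) (m : E) (a : Fin (k + 1) → E) :
    faceTuple i (Fin.cons m a : Fin (k + 2) → E) =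
      (Fin.cons (mFace (Bimod.regular E) i m a) (tFace i a) : Fin (k + 1) → E) := by
  funext j
  refine Fin.cases ?_ (fun j => ?_) j
  · simp only [faceTuple, Fin.cons_zero, Fin.val_zero, mFace, Fin.ext_iff, Fin.val_last]
    rcases Nat.lt_trichotomy (i : ℕ) 0 with h | h | h
    · omega
    · simp [h, Bimod.regular]
    · by_cases h' : (i : ℕ) = k + 1
      · simp [h', Bimod.regular, ← Fin.succ_last]
      · simp [h', h, h.ne']
  · simp only [faceTuple, Fin.cons_succ, tFace, Fin.val_succ, ← Fin.succ_castSucc]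
    split_ifs <;> simp_all

theorem consEquiv_hcD (k : ℕ) (x : HCk E E (k + 1)) :
    consEquiv E k (hcD (Bimod.regular E) k x) = hochschildD E k (consEquiv E (k + 1) x) := by
  suffices h : (consEquiv E k).toLinearMap ∘ₗ hcD (Bimod.regular E) k =
    hochschildD E k ∘ₗ (consEquiv E (k + 1)).toLinearMap from LinearMap.congr_fun h x
  ext m a
  simp [hcD, hochschildD, hcFace_tmul, faceTuple_cons_regular]

theorem tpowMap_consEquiv (f : E →ₐ[ℂ] E') (k : ℕ) (x : HCk E E k) :
    tpowMap f (k + 1) (consEquiv E k x) = consEquiv E' k (hcMap f f.toLinearMap k x) := by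
  suffices h : tpowMap f (k + 1) ∘ₗ (consEquiv E k).toLinearMap =
    (consEquiv E' k).toLinearMap ∘ₗ hcMap f f.toLinearMap k from LinearMap.congr_fun h x
  ext m a
  simp only [LinearMap.compMultilinearMap_apply, TensorProduct.AlgebraTensorModule.curry_apply,
    TensorProduct.curry_apply, LinearMap.coe_restrictScalars, LinearMap.comp_apply,
    LinearEquiv.coe_coe, consEquiv_tmul, hcMap_tmul, tpowMap_tprod]
  congr 1
  funext j
  refine Fin.cases ?_ (fun j => ?_) j <;> simp

end HC
end HochschildWreath

end

noncomputable section

namespace HochschildWreath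

set_option linter.unusedSectionVars false

/-! ### Total complexes with coefficients in a differential bimodule -/

section Total

variable {E Q E' Q' Q'' : Type u} [Ring E] [Algebra ℂ E] [AddCommGroup Q] [Module ℂ Q]
  [Ring E'] [Algebra ℂ E'] [AddCommGroup Q'] [Module ℂ Q'] [AddCommGroup Q''] [Module ℂ Q'']

/-- The total space of the Hochschild complex with coefficients. -/
abbrev HC (E Q : Type u) [Ring E] [Algebra ℂ E] [AddCommGroup Q] [Module ℂ Q] : Type u :=
  ⨁ k, HCk E Q k

/-- The Hochschild differential on the total space. -/
abbrev hcTotD (β : Bimod E Q) : HC E Q →ₗ[ℂ] HC E Q := shiftD (V := HCk E Q) (hcD β)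

/-- The map of total spaces induced by maps of algebras and coefficients. -/
def hcHat (f : E →ₐ[ℂ] E') (φ : Q →ₗ[ℂ] Q') : HC E Q →ₗ[ℂ] HC E' Q' :=
  DirectSum.lmap fun k => hcMap f φ k

@[simp]
theorem hcHat_lof (f : E →ₐ[ℂ] E') (φ : Q →ₗ[ℂ] Q') (k : ℕ) (x : HCk E Q k) :
    hcHat f φ (DirectSum.lof ℂ ℕ (HCk E Q) k x) = DirectSum.lof ℂ ℕ (HCk E' Q') k (hcMap f φ k x) := by
  rw [hcHat, DirectSum.lmap_lof]

/-- Extensionality on pure tensors. -/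
theorem hc_ext {W : Type u} [AddCommGroup W] [Module ℂ W] {f g : HC E Q →ₗ[ℂ] W}
    (h : ∀ k m (a : Fin k → E),
      f (DirectSum.lof ℂ ℕ (HCk E Q) k (m ⊗ₜ PiTensorProduct.tprod ℂ a)) =
        g (DirectSum.lof ℂ ℕ (HCk E Q) k (m ⊗ₜ PiTensorProduct.tprod ℂ a))) (x : HC E Q) :
    f x = g x := by
  refine LinearMap.congr_fun (DirectSum.linearMap_ext ℂ fun k => ?_) x
  ext m a
  exact h k m a

theorem hcHat_comp (φ : Q →ₗ[ℂ] Q') (ψ : Q' →ₗ[ℂ] Q'') (x : HC E Q) :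
    hcHat (AlgHom.id ℂ E) ψ (hcHat (AlgHom.id ℂ E) φ x) = hcHat (AlgHom.id ℂ E) (ψ ∘ₗ φ) x :=
  hc_ext (f := hcHat (AlgHom.id ℂ E) ψ ∘ₗ hcHat (AlgHom.id ℂ E) φ) (fun k m a => by simp) x

theorem hcHat_id (x : HC E Q) : hcHat (AlgHom.id ℂ E) (LinearMap.id : Q →ₗ[ℂ] Q) x = x :=
  hc_ext (f := hcHat (AlgHom.id ℂ E) LinearMap.id) (g := LinearMap.id) (fun k m a => by simp) x

theorem hcHat_add (φ ψ : Q →ₗ[ℂ] Q') (x : HC E Q) :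
    hcHat (AlgHom.id ℂ E) (φ + ψ) x = hcHat (AlgHom.id ℂ E) φ x + hcHat (AlgHom.id ℂ E) ψ x :=
  hc_ext (f := hcHat (AlgHom.id ℂ E) (φ + ψ))
    (g := hcHat (AlgHom.id ℂ E) φ + hcHat (AlgHom.id ℂ E) ψ)
    (fun k m a => by simp [TensorProduct.add_tmul]) x

theorem hcHat_sub (φ ψ : Q →ₗ[ℂ] Q') (x : HC E Q) :
    hcHat (AlgHom.id ℂ E) (φ - ψ) x = hcHat (AlgHom.id ℂ E) φ x - hcHat (AlgHom.id ℂ E) ψ x :=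
  hc_ext (f := hcHat (AlgHom.id ℂ E) (φ - ψ))
    (g := hcHat (AlgHom.id ℂ E) φ - hcHat (AlgHom.id ℂ E) ψ)
    (fun k m a => by simp [TensorProduct.sub_tmul]) x

theorem hcHat_smul (c : ℂ) (φ : Q →ₗ[ℂ] Q') (x : HC E Q) :
    hcHat (AlgHom.id ℂ E) (c • φ) x = c • hcHat (AlgHom.id ℂ E) φ x :=
  hc_ext (f := hcHat (AlgHom.id ℂ E) (c • φ)) (g := c • hcHat (AlgHom.id ℂ E) φ)
    (fun k m a => by simp [← TensorProduct.smul_tmul']) x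

theorem hcHat_zero (x : HC E Q) : hcHat (AlgHom.id ℂ E) (0 : Q →ₗ[ℂ] Q') x = 0 :=
  hc_ext (f := hcHat (AlgHom.id ℂ E) (0 : Q →ₗ[ℂ] Q')) (g := 0) (fun k m a => by simp) x

theorem hcHat_degOp (f : E →ₐ[ℂ] E') (φ : Q →ₗ[ℂ] Q') (z : ℂ) (x : HC E Q) :
    hcHat f φ (degOp (HCk E Q) z x) = degOp (HCk E' Q') z (hcHat f φ x) :=
  degOp_lmap _ z x

theorem hcHat_hcTotD {β : Bimod E Q} {β' : Bimod E' Q'} {f : E →ₐ[ℂ] E'} {φ : Q →ₗ[ℂ] Q'}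
    (h : BimodHom β β' f φ) (x : HC E Q) : hcHat f φ (hcTotD β x) = hcTotD β' (hcHat f φ x) :=
  shiftD_lmap _ (hcD_map h) x

theorem hcTotD_sq (β : Bimod E Q) (x : HC E Q) : hcTotD β (hcTotD β x) = 0 :=
  shiftD_comp _ (hcD_comp β) x

/-- The differential of the total complex with coefficients in a differential bimodule. -/
def totD (β : Bimod E Q) (dQ : Q →ₗ[ℂ] Q) : HC E Q →ₗ[ℂ] HC E Q :=
  hcTotD β + degOp (HCk E Q) (-1) ∘ₗ hcHat (AlgHom.id ℂ E) dQ

theorem totD_apply (β : Bimod E Q) (dQ : Q →ₗ[ℂ] Q) (x : HC E Q) :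
    totD β dQ x = hcTotD β x + degOp (HCk E Q) (-1) (hcHat (AlgHom.id ℂ E) dQ x) := rfl

theorem degOp_neg_one_sq {V : ℕ → Type u} [∀ k, AddCommGroup (V k)] [∀ k, Module ℂ (V k)]
    (x : ⨁ k, V k) : degOp V (-1) (degOp V (-1) x) = x := by
  rw [degOp_comp]; norm_num; exact degOp_one x

/-- The mixed terms cancel: `dQ` is a bimodule map, so it commutes with the Hochschild differential,
while the sign `(-1) ^ k` anticommutes with it. -/
theorem totD_sq {β : Bimod E Q} {dQ : Q →ₗ[ℂ] Q} (hβ : BimodHom β β (AlgHom.id ℂ E) dQ)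
    (hd : ∀ q, dQ (dQ q) = 0) (x : HC E Q) : totD β dQ (totD β dQ x) = 0 := by
  have h0 : dQ ∘ₗ dQ = 0 := LinearMap.ext hd
  simp only [totD_apply, map_add, hcTotD_sq, hcHat_degOp, degOp_neg_one_sq, hcHat_comp, h0,
    hcHat_zero, shiftD_degOp, hcHat_hcTotD hβ]
  simp

/-- Change of algebras and coefficients for total complexes. -/
theorem hcHat_totD {β : Bimod E Q} {β' : Bimod E' Q'} {f : E →ₐ[ℂ] E'} {φ : Q →ₗ[ℂ] Q'}
    (h : BimodHom β β' f φ) {dQ : Q →ₗ[ℂ] Q} {dQ' : Q' →ₗ[ℂ] Q'}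
    (hd : ∀ q, φ (dQ q) = dQ' (φ q)) (x : HC E Q) :
    hcHat f φ (totD β dQ x) = totD β' dQ' (hcHat f φ x) := by
  have h1 : hcHat f φ (hcHat (AlgHom.id ℂ E) dQ x) = hcHat (AlgHom.id ℂ E') dQ' (hcHat f φ x) :=
    hc_ext (f := hcHat f φ ∘ₗ hcHat (AlgHom.id ℂ E) dQ)
      (g := hcHat (AlgHom.id ℂ E') dQ' ∘ₗ hcHat f φ) (fun k m a => by simp [hd]) x
  rw [totD_apply, totD_apply, map_add, hcHat_hcTotD h, hcHat_degOp, h1]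

theorem totD_zero (β : Bimod E Q) : totD β 0 = hcTotD β := by
  refine LinearMap.ext fun x => ?_
  rw [totD_apply, hcHat_zero, map_zero, add_zero]

/-- Resolving the coefficients: a bimodule map `aug` that is a homotopy equivalence of vector
spaces onto a bimodule with zero differential induces an isomorphism on Hochschild homology. -/
theorem hcHat_aug_bijective {β : Bimod E Q} {β' : Bimod E Q'} {dQ : Q →ₗ[ℂ] Q}
    (hβ : BimodHom β β (AlgHom.id ℂ E) dQ) (hd : ∀ q, dQ (dQ q) = 0) {aug : Q →ₗ[ℂ] Q'}
    (haug : BimodHom β β' (AlgHom.id ℂ E) aug) (haugd : ∀ q, aug (dQ q) = 0) (σ : Q' →ₗ[ℂ] Q)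
    (h : Q →ₗ[ℂ] Q) (hσ : ∀ x, aug (σ x) = x) (hh : ∀ q, dQ (h q) + h (dQ q) = q - σ (aug q))
    (haugh : ∀ q, aug (h q) = 0) (hc : HCompat (totD β dQ) (hcTotD β') (hcHat (AlgHom.id ℂ E) aug)) :
    Function.Bijective (Homology.map (hcHat (AlgHom.id ℂ E) aug) hc) := by
  have h0 : aug ∘ₗ dQ = 0 := LinearMap.ext haugd
  have h1 : aug ∘ₗ h = 0 := LinearMap.ext haugh
  have h2 : aug ∘ₗ σ = LinearMap.id := LinearMap.ext hσ
  have h3 : ∀ x : HC E Q, hcHat (AlgHom.id ℂ E) dQ (hcHat (AlgHom.id ℂ E) h x) +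
      hcHat (AlgHom.id ℂ E) h (hcHat (AlgHom.id ℂ E) dQ x) =
      x - hcHat (AlgHom.id ℂ E) σ (hcHat (AlgHom.id ℂ E) aug x) := by
    intro x
    have : dQ ∘ₗ h + h ∘ₗ dQ = LinearMap.id - σ ∘ₗ aug :=
      LinearMap.ext fun q => by
        simp only [LinearMap.add_apply, LinearMap.comp_apply, hh]; simp
    rw [hcHat_comp, hcHat_comp, hcHat_comp, ← hcHat_add, this, hcHat_sub, hcHat_id]
  -- With the same sign `(-1) ^ k` as in `totD`, the coefficient part of the differential and `s`
  -- have anticommutator `1 - σ aug`, which is `1` on the kernel of `aug`. The Hochschild part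
  -- produces the error `N`.
  obtain ⟨s, hs⟩ : ∃ s : HC E Q →ₗ[ℂ] HC E Q,
      ∀ x, s x = degOp (HCk E Q) (-1) (hcHat (AlgHom.id ℂ E) h x) :=
    ⟨degOp (HCk E Q) (-1) ∘ₗ hcHat (AlgHom.id ℂ E) h, fun x => rfl⟩
  have hps : ∀ x, hcHat (AlgHom.id ℂ E) aug (s x) = 0 := fun x => by
    rw [hs, hcHat_degOp, hcHat_comp, h1, hcHat_zero, map_zero]
  refine homology_map_bijective_of_unipotent (h := s)
    (N := hcTotD β ∘ₗ s + s ∘ₗ hcTotD β) (totD_sq hβ hd) hc ?_ ?_ hps ?_ ?_ ?_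
  · intro x
    rw [totD_apply, map_add, hcHat_hcTotD haug, hcHat_degOp, hcHat_comp, h0, hcHat_zero, map_zero,
      add_zero]
  · intro x
    exact ⟨hcHat (AlgHom.id ℂ E) σ x, by rw [hcHat_comp, h2, hcHat_id]⟩
  · intro x _
    rw [LinearMap.add_apply, LinearMap.comp_apply, LinearMap.comp_apply, map_add,
      hcHat_hcTotD haug, hps, hps, map_zero, add_zero]
  · intro x hx
    have h4 := h3 x
    rw [hx, map_zero, sub_zero] at h4
    have h5 : degOp (HCk E Q) (-1) (hcHat (AlgHom.id ℂ E) dQ (s x)) +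
        s (degOp (HCk E Q) (-1) (hcHat (AlgHom.id ℂ E) dQ x)) = x := by
      rw [hs, hs, hcHat_degOp, hcHat_degOp, degOp_neg_one_sq, degOp_neg_one_sq]
      exact h4
    simp only [LinearMap.add_apply, LinearMap.comp_apply, totD_apply, map_add]
    rw [add_add_add_comm, h5, add_comm]
  -- As `s` acts only on coefficients, the error lowers the Hochschild degree by one.
  · refine isGr_degOp.locally_nilpotent fun x => ?_
    have h5 : ∀ y, s (degOp (HCk E Q) 2 y) = degOp (HCk E Q) 2 (s y) := fun y => by
      rw [hs, hs, hcHat_degOp, degOp_comp, degOp_comp, mul_comm]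
    simp only [LinearMap.add_apply, LinearMap.comp_apply, h5, shiftD_degOp, map_smul, map_add,
      smul_add]

/-! ### Coefficients in relatively projective bimodules -/

/-- The bimodule `Q ⊗ E` with `x (q ⊗ e) y = x q ⊗ e y`. -/
def Bimod.extend (β : Bimod E Q) : Bimod E (Q ⊗[ℂ] E) where
  l := LinearMap.rTensorHom E ∘ₗ β.l
  r := LinearMap.lTensorHom Q ∘ₗ (LinearMap.mul ℂ E).flip
  l_one m := by
    induction m using TensorProduct.induction_on with
    | zero => simp
    | tmul q e => simp [β.l_one]
    | add a b ha hb => rw [map_add, ha, hb]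
  r_one m := by
    induction m using TensorProduct.induction_on with
    | zero => simp
    | tmul q e => simp
    | add a b ha hb => rw [map_add, ha, hb]
  l_mul x y m := by
    induction m using TensorProduct.induction_on with
    | zero => simp
    | tmul q e => simp [β.l_mul]
    | add a b ha hb => simp only [map_add, ha, hb]
  r_mul x y m := by
    induction m using TensorProduct.induction_on with
    | zero => simp
    | tmul q e => simp [mul_assoc]
    | add a b ha hb => simp only [map_add, ha, hb]
  comm x y m := by
    induction m using TensorProduct.induction_on with
    | zero => simp
    | tmul q e => simp
    | add a b ha hb => simp only [map_add, ha, hb]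

@[simp]
theorem Bimod.extend_l (β : Bimod E Q) (x : E) (q : Q) (e : E) :
    β.extend.l x (q ⊗ₜ e) = β.l x q ⊗ₜ e := rfl

@[simp]
theorem Bimod.extend_r (β : Bimod E Q) (x : E) (q : Q) (e : E) :
    β.extend.r x (q ⊗ₜ e) = q ⊗ₜ (e * x) := rfl

/-- The map `(q ⊗ e) ⊗ a ↦ q ⊗ (e, a)`. -/
def hcShift (E Q : Type u) [Ring E] [Algebra ℂ E] [AddCommGroup Q] [Module ℂ Q] (k : ℕ) :
    HCk E (Q ⊗[ℂ] E) k →ₗ[ℂ] HCk E Q (k + 1) :=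
  LinearMap.lTensor Q (consEquiv E k).toLinearMap ∘ₗ
    (TensorProduct.assoc ℂ Q E (TPow E k)).toLinearMap

@[simp]
theorem hcShift_tmul (k : ℕ) (q : Q) (e : E) (a : Fin k → E) :
    hcShift E Q k ((q ⊗ₜ e) ⊗ₜ PiTensorProduct.tprod ℂ a) =
      q ⊗ₜ PiTensorProduct.tprod ℂ (Fin.cons e a : Fin (k + 1) → E) := by
  simp [hcShift]

theorem hcFace_zero_hcShift (β : Bimod E Q) (k : ℕ) (x : HCk E (Q ⊗[ℂ] E) k) :
    hcFace β k 0 (hcShift E Q k x) =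
      TensorProduct.map (TensorProduct.lift β.r.flip) LinearMap.id x := by
  suffices h : hcFace β k 0 ∘ₗ hcShift E Q k =
      TensorProduct.map (TensorProduct.lift β.r.flip) LinearMap.id from LinearMap.congr_fun h x
  ext q e a
  simp only [LinearMap.compMultilinearMap_apply, TensorProduct.AlgebraTensorModule.curry_apply,
    TensorProduct.curry_apply, LinearMap.coe_restrictScalars, LinearMap.comp_apply, hcShift_tmul,
    hcFace_tmul, TensorProduct.map_tmul, TensorProduct.lift.tmul, LinearMap.id_apply]
  congr 1

/-- The shift acts as an extra degeneracy: face `0` multiplies the shifted element back into the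
coefficients, and face `i + 1` is face `i` for the extended bimodule. In the alternating sum this
yields a contracting homotopy as soon as multiplication `Q ⊗ E → Q` has a bimodule splitting. -/
theorem hcFace_succ_hcShift (β : Bimod E Q) (k : ℕ) (i : Fin (k + 2))
    (x : HCk E (Q ⊗[ℂ] E) (k + 1)) :
    hcFace β (k + 1) i.succ (hcShift E Q (k + 1) x) =
      hcShift E Q k (hcFace β.extend k i x) := by
  suffices h : hcFace β (k + 1) i.succ ∘ₗ hcShift E Q (k + 1) =
      hcShift E Q k ∘ₗ hcFace β.extend k i from LinearMap.congr_fun h x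
  ext q e a
  simp only [LinearMap.compMultilinearMap_apply, TensorProduct.AlgebraTensorModule.curry_apply,
    TensorProduct.curry_apply, LinearMap.coe_restrictScalars, LinearMap.comp_apply, hcShift_tmul,
    hcFace_tmul]
  by_cases h0 : i = 0
  · subst h0
    simp only [mFace, if_true, Bimod.extend_r, hcShift_tmul]
    rw [if_neg (Fin.succ_ne_zero _), if_neg (by simp [Fin.ext_iff])]
    congr 2
    funext j
    refine Fin.cases ?_ (fun j => ?_) j
    · simp [tFace]
    · simp [tFace]
  · have h1 : tFace i.succ (Fin.cons e a : Fin (k + 2) → E) =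
        (Fin.cons e (tFace i a) : Fin (k + 1) → E) := by
      have : 0 < (i : ℕ) := Nat.pos_of_ne_zero fun h => h0 (Fin.ext h)
      funext j
      refine Fin.cases ?_ (fun j => ?_) j
      · simp [tFace, this]
      · simp [tFace]
    rw [h1]
    unfold mFace
    rw [if_neg (Fin.succ_ne_zero _), if_neg h0]
    by_cases h2 : i = Fin.last (k + 1)
    · rw [if_pos h2, if_pos (by rw [h2]; rfl), Bimod.extend_l, hcShift_tmul]
      simp [← Fin.succ_last]
    · rw [if_neg h2, if_neg (by rw [← Fin.succ_last, Fin.succ_inj]; exact h2), hcShift_tmul]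

/-- `M ⊗ E^{⊗ 0} ≅ M`. -/
def hcZero (E Q : Type u) [Ring E] [Algebra ℂ E] [AddCommGroup Q] [Module ℂ Q] :
    HCk E Q 0 ≃ₗ[ℂ] Q :=
  (TensorProduct.congr (LinearEquiv.refl ℂ Q) (PiTensorProduct.isEmptyEquiv (Fin 0))) ≪≫ₗ
    TensorProduct.rid ℂ Q

@[simp]
theorem hcZero_tmul (q : Q) (a : Fin 0 → E) :
    hcZero E Q (q ⊗ₜ PiTensorProduct.tprod ℂ a) = q := by
  simp [hcZero]

/-- The contraction `q ↦ ∑ e' q'` where `t q = ∑ q' ⊗ e'`. -/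
def swapMul (β : Bimod E Q) (t : Q →ₗ[ℂ] Q ⊗[ℂ] E) : Q →ₗ[ℂ] Q :=
  TensorProduct.lift β.l.flip ∘ₗ t

theorem hcFace_one_hcShift (β : Bimod E Q) (x : HCk E (Q ⊗[ℂ] E) 0) :
    hcZero E Q (hcFace β 0 1 (hcShift E Q 0 x)) =
      TensorProduct.lift β.l.flip (hcZero E (Q ⊗[ℂ] E) x) := by
  suffices h : (hcZero E Q).toLinearMap ∘ₗ hcFace β 0 1 ∘ₗ hcShift E Q 0 =
      TensorProduct.lift β.l.flip ∘ₗ (hcZero E (Q ⊗[ℂ] E)).toLinearMap from LinearMap.congr_fun h x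
  ext q e a
  simp [hcFace_tmul, mFace]

theorem hcZero_hcMap (f : E →ₐ[ℂ] E') (φ : Q →ₗ[ℂ] Q') (x : HCk E Q 0) :
    hcZero E' Q' (hcMap f φ 0 x) = φ (hcZero E Q x) := by
  suffices h : (hcZero E' Q').toLinearMap ∘ₗ hcMap f φ 0 =
      φ ∘ₗ (hcZero E Q).toLinearMap from LinearMap.congr_fun h x
  ext q a
  simp

/-- The map on the total complex that is `φ` on the coefficients in degree `0` and vanishes in
positive degrees. -/
def hcBottom (E : Type u) [Ring E] [Algebra ℂ E] (φ : Q →ₗ[ℂ] Q') : HC E Q →ₗ[ℂ] Q' :=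
  DirectSum.toModule ℂ ℕ _ fun k =>
    match k with
    | 0 => φ ∘ₗ (hcZero E Q).toLinearMap
    | _ + 1 => 0

@[simp]
theorem hcBottom_lof_zero (φ : Q →ₗ[ℂ] Q') (x : HCk E Q 0) :
    hcBottom E φ (DirectSum.lof ℂ ℕ (HCk E Q) 0 x) = φ (hcZero E Q x) := by
  simp [hcBottom]

@[simp]
theorem hcBottom_lof_succ (φ : Q →ₗ[ℂ] Q') (k : ℕ) (x : HCk E Q (k + 1)) :
    hcBottom E φ (DirectSum.lof ℂ ℕ (HCk E Q) (k + 1) x) = 0 := by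
  simp [hcBottom]

theorem hcBottom_hcHat (f : E →ₐ[ℂ] E') (φ : Q →ₗ[ℂ] Q') (ψ : Q' →ₗ[ℂ] Q'') (x : HC E Q) :
    hcBottom E' ψ (hcHat f φ x) = hcBottom E (ψ ∘ₗ φ) x := by
  refine directSum_ext (f := hcBottom E' ψ ∘ₗ hcHat f φ) (g := hcBottom E (ψ ∘ₗ φ))
    (fun k x => ?_) x
  match k with
  | 0 => simp [hcZero_hcMap]
  | k + 1 => simp

theorem hcBottom_degOp (φ : Q →ₗ[ℂ] Q') (z : ℂ) (x : HC E Q) :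
    hcBottom E φ (degOp (HCk E Q) z x) = hcBottom E φ x := by
  refine directSum_ext (f := hcBottom E φ ∘ₗ degOp (HCk E Q) z) (g := hcBottom E φ)
    (fun k x => ?_) x
  match k with
  | 0 => simp
  | k + 1 => simp

/-- Only the differential from degree `1` to degree `0` matters. It sends `q ⊗ x` to `q x - x q`. -/
theorem hcBottom_hcTotD {β : Bimod E Q} {φ : Q →ₗ[ℂ] Q'}
    (h : ∀ x q, φ (β.l x q) = φ (β.r x q)) (x : HC E Q) : hcBottom E φ (hcTotD β x) = 0 := by
  refine hc_ext (f := hcBottom E φ ∘ₗ hcTotD β) (g := 0) (fun k m a => ?_) x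
  match k with
  | 0 => simp
  | 1 => simp [hcD, Fin.sum_univ_two, hcFace_tmul, mFace, h]
  | k + 2 => simp

theorem hcBottom_totD {β : Bimod E Q} {φ : Q →ₗ[ℂ] Q'} {dQ : Q →ₗ[ℂ] Q} {d' : Q' →ₗ[ℂ] Q'}
    (h : ∀ x q, φ (β.l x q) = φ (β.r x q)) (hd : ∀ q, φ (dQ q) = d' (φ q)) (x : HC E Q) :
    hcBottom E φ (totD β dQ x) = d' (hcBottom E φ x) := by
  rw [totD_apply, map_add, hcBottom_hcTotD h, zero_add, hcBottom_degOp, hcBottom_hcHat]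
  refine directSum_ext (f := hcBottom E (φ ∘ₗ dQ)) (g := d' ∘ₗ hcBottom E φ) (fun k x => ?_) x
  match k with
  | 0 => simp [hd]
  | k + 1 => simp

theorem isGr_hcHat {θ : Q →ₗ[ℂ] Q} (h : IsGr θ) : IsGr (hcHat (AlgHom.id ℂ E) θ) := by
  refine IsGr.of_span {x | ∃ k m a i, θ m = (2 : ℂ) ^ i • m ∧
    x = DirectSum.lof ℂ ℕ (HCk E Q) k (m ⊗ₜ a)} ?_ ?_
  · rw [eq_top_iff]
    intro x _
    induction x using DirectSum.induction_on with
    | zero => exact Submodule.zero_mem _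
    | add x y hx hy => exact Submodule.add_mem _ (hx trivial) (hy trivial)
    | of k y =>
      clear * - h
      change DirectSum.lof ℂ ℕ (HCk E Q) k y ∈ _
      induction y using TensorProduct.induction_on with
      | zero => rw [map_zero]; exact Submodule.zero_mem _
      | add x y hx hy => rw [map_add]; exact Submodule.add_mem _ hx hy
      | tmul m a =>
        induction m using h.induction with
        | mem i m hm => exact Submodule.subset_span ⟨k, m, a, i, hm, rfl⟩
        | zero => rw [TensorProduct.zero_tmul, map_zero]; exact Submodule.zero_mem _
        | add x y hx hy =>
          rw [TensorProduct.add_tmul, map_add]; exact Submodule.add_mem _ hx hy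
  · rintro _ ⟨k, m, a, i, hm, rfl⟩
    refine ⟨i, ?_⟩
    have : tpowMap (AlgHom.id ℂ E) k = LinearMap.id := by ext a; simp
    rw [hcHat_lof, hcMap, TensorProduct.map_tmul, hm, this, LinearMap.id_apply,
      ← TensorProduct.smul_tmul', map_smul]

/-- The contracting homotopy given by a splitting of the right multiplication `Q ⊗ E → Q`. -/
def hcHomotopy (t : Q →ₗ[ℂ] Q ⊗[ℂ] E) : HC E Q →ₗ[ℂ] HC E Q :=
  DirectSum.toModule ℂ ℕ _ fun k => DirectSum.lof ℂ ℕ (HCk E Q) (k + 1) ∘ₗ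
    hcShift E Q k ∘ₗ hcMap (AlgHom.id ℂ E) t k

@[simp]
theorem hcHomotopy_lof (t : Q →ₗ[ℂ] Q ⊗[ℂ] E) (k : ℕ) (x : HCk E Q k) :
    hcHomotopy t (DirectSum.lof ℂ ℕ (HCk E Q) k x) = DirectSum.lof ℂ ℕ (HCk E Q) (k + 1)
      (hcShift E Q k (hcMap (AlgHom.id ℂ E) t k x)) := by
  simp [hcHomotopy]

/-- Face `0` of the shift of `t q` gives `q` back, and the remaining faces cancel against those of
the second summand. In degree `0` there is no second summand. The last face then survives; it
multiplies the split-off element back from the other side, which is `swapMul`. -/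
theorem hcHomotopy_spec {β : Bimod E Q} {t : Q →ₗ[ℂ] Q ⊗[ℂ] E}
    (ht : BimodHom β β.extend (AlgHom.id ℂ E) t)
    (hmul : ∀ q, TensorProduct.lift β.r.flip (t q) = q) (x : HC E Q) :
    hcTotD β (hcHomotopy t x) + hcHomotopy t (hcTotD β x) = x -
      DirectSum.lof ℂ ℕ (HCk E Q) 0 ((hcZero E Q).symm (hcBottom E (swapMul β t) x)) := by
  have hmul' : TensorProduct.lift β.r.flip ∘ₗ t = LinearMap.id := LinearMap.ext hmul
  have h0 : ∀ k (x : HCk E Q k), hcFace β k 0 (hcShift E Q k (hcMap (AlgHom.id ℂ E) t k x)) = x := by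
    intro k x
    have : tpowMap (AlgHom.id ℂ E) k = LinearMap.id := by ext a; simp
    rw [hcFace_zero_hcShift, hcMap, ← LinearMap.comp_apply, ← TensorProduct.map_comp, hmul', this]
    simp
  refine directSum_ext (f := hcTotD β ∘ₗ hcHomotopy t + hcHomotopy t ∘ₗ hcTotD β)
    (g := LinearMap.id - DirectSum.lof ℂ ℕ (HCk E Q) 0 ∘ₗ (hcZero E Q).symm.toLinearMap ∘ₗ
      hcBottom E (swapMul β t)) (fun k x => ?_) x
  match k with
  | 0 =>
    simp only [LinearMap.add_apply, LinearMap.comp_apply, hcHomotopy_lof, shiftD_lof_zero,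
      shiftD_lof_succ, map_zero, add_zero, LinearMap.sub_apply, LinearMap.id_apply,
      hcBottom_lof_zero, LinearEquiv.coe_coe]
    rw [← map_sub]
    congr 1
    rw [hcD, Fin.sum_univ_two]
    simp only [LinearMap.add_apply, LinearMap.smul_apply, h0]
    have h1 : hcFace β 0 1 (hcShift E Q 0 (hcMap (AlgHom.id ℂ E) t 0 x)) =
        (hcZero E Q).symm (swapMul β t (hcZero E Q x)) := by
      rw [LinearEquiv.eq_symm_apply, hcFace_one_hcShift, hcZero_hcMap]; rfl
    rw [h1]
    simp [sub_eq_add_neg]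
  | k + 1 =>
    simp only [LinearMap.add_apply, LinearMap.comp_apply, hcHomotopy_lof,
      shiftD_lof_succ, LinearMap.sub_apply, LinearMap.id_apply,
      hcBottom_lof_succ, map_zero, sub_zero]
    rw [← map_add]
    congr 1
    rw [hcD, Fin.sum_univ_succ]
    simp only [LinearMap.add_apply, LinearMap.sum_apply, LinearMap.smul_apply, h0,
      hcFace_succ_hcShift, ← hcFace_map ht, hcD, map_sum, map_smul]
    simp [pow_succ]

/-- Hochschild homology with coefficients in a relatively projective differential bimodule: it is
computed by the image of a map `p` killing commutators. -/
theorem hcBottom_homology {β : Bimod E Q} {dQ θ : Q →ₗ[ℂ] Q}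
    (hβ : BimodHom β β (AlgHom.id ℂ E) dQ) (hd : ∀ q, dQ (dQ q) = 0) (hθ : IsGr θ)
    (hdθ : ∀ q, dQ (θ q) = (2 : ℂ) • θ (dQ q)) {t : Q →ₗ[ℂ] Q ⊗[ℂ] E}
    (ht : BimodHom β β.extend (AlgHom.id ℂ E) t)
    (hmul : ∀ q, TensorProduct.lift β.r.flip (t q) = q)
    (htθ : ∀ q, t (θ q) = LinearMap.rTensor E θ (t q))
    {d' π : Q' →ₗ[ℂ] Q'} {p : Q →ₗ[ℂ] Q'} (hp : ∀ q, p (dQ q) = d' (p q))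
    (hlr : ∀ x q, p (β.l x q) = p (β.r x q)) (hker : ∀ q, p q = 0 → swapMul β t q = 0)
    (hπp : ∀ q, π (p q) = p q) (hsurj : ∀ y, ∃ q, p q = π y) (hπd : ∀ y, π (d' y) = d' (π y))
    (hc : HCompat (totD β dQ) d' (hcBottom E p)) (hπ : HCompat d' d' π) :
    Function.Injective (Homology.map (hcBottom E p) hc) ∧
      (∀ c, Homology.map π hπ (Homology.map (hcBottom E p) hc c) =
        Homology.map (hcBottom E p) hc c) ∧
      ∀ c, ∃ c', Homology.map (hcBottom E p) hc c' = Homology.map π hπ c := by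
  obtain ⟨δ, hδ⟩ : ∃ δ : HC E Q →ₗ[ℂ] HC E Q,
      ∀ x, δ x = degOp (HCk E Q) (-1) (hcHat (AlgHom.id ℂ E) dQ x) :=
    ⟨degOp (HCk E Q) (-1) ∘ₗ hcHat (AlgHom.id ℂ E) dQ, fun _ => rfl⟩
  have hps : ∀ x, hcBottom E p (hcHomotopy t x) = 0 := fun x =>
    directSum_ext (f := hcBottom E p ∘ₗ hcHomotopy t) (g := 0) (fun k x => by simp) x
  have hpδs : ∀ x, hcBottom E p (δ (hcHomotopy t x)) = 0 := fun x => by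
    rw [hδ]
    exact directSum_ext (f := hcBottom E p ∘ₗ degOp (HCk E Q) (-1) ∘ₗ hcHat (AlgHom.id ℂ E) dQ ∘ₗ
      hcHomotopy t) (g := 0) (fun k x => by simp) x
  have hpx : ∀ x, p (hcBottom E LinearMap.id x) = hcBottom E p x := fun x => by
    refine directSum_ext (f := p ∘ₗ hcBottom E LinearMap.id) (g := hcBottom E p) (fun k x => ?_) x
    match k with
    | 0 => simp
    | k + 1 => simp
  have hsx : ∀ x, swapMul β t (hcBottom E LinearMap.id x) = hcBottom E (swapMul β t) x :=
      fun x => by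
    refine directSum_ext (f := swapMul β t ∘ₗ hcBottom E LinearMap.id)
      (g := hcBottom E (swapMul β t)) (fun k x => ?_) x
    match k with
    | 0 => simp
    | k + 1 => simp
  -- On the kernel of `p` the term `swapMul` vanishes by `hker`, so the Hochschild part of the
  -- differential contributes exactly `1`. The error comes from `dQ` alone and lowers the degree of
  -- the coefficients, since `t` commutes with `θ`.
  refine homology_map_of_unipotent (h := hcHomotopy t) (N := δ ∘ₗ hcHomotopy t + hcHomotopy t ∘ₗ δ)
    (totD_sq hβ hd) hc hπ (hcBottom_totD hlr hp) hπd ?_ ?_ hps ?_ ?_ ?_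
  · intro x
    rw [← hpx, hπp]
  · intro y
    obtain ⟨q, hq⟩ := hsurj y
    exact ⟨DirectSum.lof ℂ ℕ (HCk E Q) 0 ((hcZero E Q).symm q), by simp [hq]⟩
  · intro x _
    rw [LinearMap.add_apply, LinearMap.comp_apply, LinearMap.comp_apply, map_add, hpδs, hps,
      add_zero]
  · intro x hx
    have h1 : hcBottom E (swapMul β t) x = 0 := by
      rw [← hsx]
      exact hker _ (by rw [hpx, hx])
    have h2 := hcHomotopy_spec ht hmul x
    rw [h1, map_zero, map_zero, sub_zero] at h2
    have h3 : ∀ y, totD β dQ y = hcTotD β y + δ y := fun y => by rw [totD_apply, hδ]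
    rw [h3, h3, map_add, add_add_add_comm, h2, LinearMap.add_apply, LinearMap.comp_apply,
      LinearMap.comp_apply]
  · refine (isGr_hcHat (E := E) hθ).locally_nilpotent fun x => ?_
    have h1 : dQ ∘ₗ θ = (2 : ℂ) • (θ ∘ₗ dQ) := LinearMap.ext hdθ
    have h4 : ∀ y, δ (hcHat (AlgHom.id ℂ E) θ y) = (2 : ℂ) • hcHat (AlgHom.id ℂ E) θ (δ y) :=
        fun y => by
      rw [hδ, hδ, hcHat_comp, h1, hcHat_smul, map_smul, hcHat_degOp, hcHat_comp]
    have h5 : ∀ y, hcHomotopy t (hcHat (AlgHom.id ℂ E) θ y) =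
        hcHat (AlgHom.id ℂ E) θ (hcHomotopy t y) := by
      intro y
      refine hc_ext (f := hcHomotopy t ∘ₗ hcHat (AlgHom.id ℂ E) θ)
        (g := hcHat (AlgHom.id ℂ E) θ ∘ₗ hcHomotopy t) (fun k m a => ?_) y
      have h6 : ∀ τ : Q ⊗[ℂ] E, hcShift E Q k (LinearMap.rTensor E θ τ ⊗ₜ PiTensorProduct.tprod ℂ a) =
          hcMap (AlgHom.id ℂ E) θ (k + 1) (hcShift E Q k (τ ⊗ₜ PiTensorProduct.tprod ℂ a)) := by
        intro τ
        induction τ using TensorProduct.induction_on with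
        | zero => simp
        | tmul q e => simp
        | add a b ha hb => simp only [map_add, TensorProduct.add_tmul, ha, hb]
      simp [htθ, h6]
    simp only [LinearMap.add_apply, LinearMap.comp_apply, h4, h5, map_smul, map_add]
    exact (smul_add (2 : ℂ) _ _).symm

end Total
end HochschildWreath

end

/-! ### Koszul signs and tensor powers of the bar resolution -/

noncomputable section

namespace HochschildWreath

set_option linter.unusedSectionVars false

/-! ### Extensionality for tensor products -/

section TensorTools

theorem tensor_ext {ι : Type} [Finite ι] {V : ι → Type u} [∀ i, AddCommGroup (V i)]
    [∀ i, Module ℂ (V i)] {W : Type u} [AddCommGroup W] [Module ℂ W] (S : ∀ i, Set (V i))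
    (hS : ∀ i, Submodule.span ℂ (S i) = ⊤) {φ ψ : (⨂[ℂ] i, V i) →ₗ[ℂ] W}
    (h : ∀ x : ∀ i, V i, (∀ i, x i ∈ S i) →
      φ (PiTensorProduct.tprod ℂ x) = ψ (PiTensorProduct.tprod ℂ x)) (z : ⨂[ℂ] i, V i) :
    φ z = ψ z := by
  refine LinearMap.congr_fun (PiTensorProduct.ext_of_span_eq_top
    (g := fun i (s : S i) => s.1) (fun i => ?_) fun j => h _ fun i => (j i).2) z
  rw [Subtype.range_coe, hS]

theorem pi_tensor_ext {ι : Type} {V : ι → Type u} [∀ i, AddCommGroup (V i)]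
    [∀ i, Module ℂ (V i)] {W : Type u} [AddCommGroup W] [Module ℂ W]
    {φ ψ : (⨂[ℂ] i, V i) →ₗ[ℂ] W}
    (h : ∀ x : ∀ i, V i, φ (PiTensorProduct.tprod ℂ x) = ψ (PiTensorProduct.tprod ℂ x))
    (z : ⨂[ℂ] i, V i) : φ z = ψ z :=
  LinearMap.congr_fun (PiTensorProduct.ext (MultilinearMap.ext h)) z

theorem span_parity {V : Type u} [AddCommGroup V] [Module ℂ V] (ε : V →ₗ[ℂ] V)
    (hε : ∀ x, ε (ε x) = x) :
    Submodule.span ℂ {x | ∃ p : ℕ, ε x = (-1 : ℂ) ^ p • x} = ⊤ := by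
  rw [eq_top_iff]
  intro x _
  have h1 : (2 : ℂ)⁻¹ • (x + ε x) + (2 : ℂ)⁻¹ • (x - ε x) = x := by
    rw [← smul_add, add_add_sub_cancel, ← two_smul ℂ x, smul_smul]; norm_num
  rw [← h1]
  refine Submodule.add_mem _ (Submodule.smul_mem _ _ (Submodule.subset_span ⟨0, ?_⟩))
    (Submodule.smul_mem _ _ (Submodule.subset_span ⟨1, ?_⟩))
  · simp [hε, add_comm]
  · simp [hε]

/-- Extensionality on tensors with homogeneous factors. -/
theorem super_ext {ι : Type} [Finite ι] {V : ι → Type u} [∀ i, AddCommGroup (V i)]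
    [∀ i, Module ℂ (V i)] {W : Type u} [AddCommGroup W] [Module ℂ W] (ε : ∀ i, V i →ₗ[ℂ] V i)
    (hε : ∀ i x, ε i (ε i x) = x) {φ ψ : (⨂[ℂ] i, V i) →ₗ[ℂ] W}
    (h : ∀ (x : ∀ i, V i) (p : ι → ℕ), (∀ i, ε i (x i) = (-1 : ℂ) ^ p i • x i) →
      φ (PiTensorProduct.tprod ℂ x) = ψ (PiTensorProduct.tprod ℂ x)) (z : ⨂[ℂ] i, V i) :
    φ z = ψ z :=
  tensor_ext _ (fun i => span_parity (ε i) (hε i)) (fun x hx => by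
    choose p hp using hx
    exact h x p hp) z

theorem bijective_of_basis {M N : Type u} [AddCommGroup M] [Module ℂ M] [AddCommGroup N]
    [Module ℂ N] {I J : Type*} (b : Module.Basis I ℂ M) (c : Module.Basis J ℂ N) (e : I ≃ J)
    (f : M →ₗ[ℂ] N) (h : ∀ i, f (b i) = c (e i)) : Function.Bijective f := by
  have : f = (b.equiv c e).toLinearMap := b.ext fun i => by simp [h]
  rw [this]
  exact (b.equiv c e).bijective

/-- The distributivity map `(⨂ Mᵢ) ⊗ (⨂ Nᵢ) → ⨂ (Mᵢ ⊗ Nᵢ)`. -/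
def zipT {ι : Type} (M N : ι → Type u) [∀ i, AddCommGroup (M i)] [∀ i, Module ℂ (M i)]
    [∀ i, AddCommGroup (N i)] [∀ i, Module ℂ (N i)] :
    ((⨂[ℂ] i, M i) ⊗[ℂ] (⨂[ℂ] i, N i)) →ₗ[ℂ] ⨂[ℂ] i, (M i ⊗[ℂ] N i) :=
  TensorProduct.lift (PiTensorProduct.map₂ fun i => TensorProduct.mk ℂ (M i) (N i))

theorem zipT_bijective {ι : Type} [Finite ι] (M N : ι → Type u) [∀ i, AddCommGroup (M i)]
    [∀ i, Module ℂ (M i)] [∀ i, AddCommGroup (N i)] [∀ i, Module ℂ (N i)] :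
    Function.Bijective (zipT M N) := by
  let b i := Module.Basis.ofVectorSpace ℂ (M i)
  let c i := Module.Basis.ofVectorSpace ℂ (N i)
  refine bijective_of_basis ((Basis.piTensorProduct b).tensorProduct (Basis.piTensorProduct c))
    (Basis.piTensorProduct fun i => (b i).tensorProduct (c i))
    (Equiv.arrowProdEquivProdArrow _ _ _).symm _ fun ⟨p, q⟩ => ?_
  simp [zipT, PiTensorProduct.map₂_tprod_tprod, Module.Basis.tensorProduct_apply]

/-- The distributivity isomorphism `⨂ (Mᵢ ⊗ Nᵢ) ≅ (⨂ Mᵢ) ⊗ (⨂ Nᵢ)`. -/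
def unzipT {ι : Type} [Finite ι] (M N : ι → Type u) [∀ i, AddCommGroup (M i)]
    [∀ i, Module ℂ (M i)] [∀ i, AddCommGroup (N i)] [∀ i, Module ℂ (N i)] :
    (⨂[ℂ] i, (M i ⊗[ℂ] N i)) ≃ₗ[ℂ] (⨂[ℂ] i, M i) ⊗[ℂ] (⨂[ℂ] i, N i) :=
  (LinearEquiv.ofBijective (zipT M N) (zipT_bijective M N)).symm

@[simp]
theorem unzipT_tprod {ι : Type} [Finite ι] (M N : ι → Type u) [∀ i, AddCommGroup (M i)]
    [∀ i, Module ℂ (M i)] [∀ i, AddCommGroup (N i)] [∀ i, Module ℂ (N i)] (x : ∀ i, M i)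
    (y : ∀ i, N i) : unzipT M N (PiTensorProduct.tprod ℂ fun i => x i ⊗ₜ y i) =
      PiTensorProduct.tprod ℂ x ⊗ₜ PiTensorProduct.tprod ℂ y := by
  rw [unzipT, LinearEquiv.symm_apply_eq]
  simp [zipT, PiTensorProduct.map₂_tprod_tprod]

end TensorTools

/-! ### Nested tensor products -/

section Nest

variable {I : Type} {F : I → Type} (V : Type u) [AddCommGroup V] [Module ℂ V]

variable {V} in
open scoped Classical in
theorem nest_update [inst : DecidableEq (Σₗ c, F c)] (x : (Σₗ c, F c) → V) (i : Σₗ c, F c) (v : V) :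
    (fun c => PiTensorProduct.tprod ℂ fun j : F c => Function.update x i v (toLex ⟨c, j⟩)) =
      Function.update (fun c => PiTensorProduct.tprod ℂ fun j : F c => x (toLex ⟨c, j⟩))
        (ofLex i).1 (PiTensorProduct.tprod ℂ (Function.update
          (fun j => x (toLex ⟨(ofLex i).1, j⟩)) (ofLex i).2 v)) := by
  obtain ⟨⟨c₀, j₀⟩, rfl⟩ := toLex.surjective i
  funext c
  by_cases hc : c = c₀
  · subst hc
    rw [ofLex_toLex, Function.update_self]
    congr 1; funext j
    by_cases hj : j = j₀
    · subst hj; simp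
    · rw [Function.update_of_ne hj, Function.update_of_ne (by simpa using hj)]
  · rw [ofLex_toLex, Function.update_of_ne hc]
    congr 1; funext j
    rw [Function.update_of_ne]
    intro h
    exact hc (congrArg (fun s => (ofLex s).1) h)

variable (F) in
/-- The map `⨂_{(c, j)} V → ⨂_c ⨂_j V`. -/
def nestT : (⨂[ℂ] _ : (Σₗ c, F c), V) →ₗ[ℂ] ⨂[ℂ] c, ⨂[ℂ] _ : F c, V :=
  PiTensorProduct.lift
    { toFun := fun x => PiTensorProduct.tprod ℂ fun c =>
        PiTensorProduct.tprod ℂ fun j => x (toLex ⟨c, j⟩)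
      map_update_add' := by
        intro inst x i v w
        simp only [nest_update, MultilinearMap.map_update_add]
      map_update_smul' := by
        intro inst x i r v
        simp only [nest_update, MultilinearMap.map_update_smul] }

@[simp]
theorem nestT_tprod (x : (Σₗ c, F c) → V) :
    nestT F V (PiTensorProduct.tprod ℂ x) = PiTensorProduct.tprod ℂ fun c =>
        PiTensorProduct.tprod ℂ fun j => x (toLex ⟨c, j⟩) := by
  simp [nestT]

theorem nestT_bijective [Finite I] [∀ c, Finite (F c)] : Function.Bijective (nestT F V) := by
  let b := Module.Basis.ofVectorSpace ℂ V
  have : Finite (Σₗ c, F c) := inferInstanceAs (Finite (Σ c, F c))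
  refine bijective_of_basis (Basis.piTensorProduct fun _ : (Σₗ c, F c) => b)
    (Basis.piTensorProduct fun c => Basis.piTensorProduct fun _ : F c => b)
    (Equiv.piCurry (fun (c : I) (_ : F c) => (Module.Basis.ofVectorSpaceIndex ℂ V : Type u))) _
    fun i => ?_
  simp
  rfl

variable {V} [Fintype I] [LinearOrder I] [∀ c, Fintype (F c)] [∀ c, LinearOrder (F c)]

theorem superDiff_koszulD {ι : Type} [Fintype ι] [LinearOrder ι] {V : ι → Type u}
    [∀ i, AddCommGroup (V i)] [∀ i, Module ℂ (V i)] {ε d : ∀ i, V i →ₗ[ℂ] V i}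
    (H : ∀ i, SuperDiff (ε i) (d i)) : SuperDiff (PiTensorProduct.map ε) (koszulD ε d) where
  sq := koszulD_comp (fun i => (H i).inv) (fun i => (H i).anti) fun i => (H i).sq
  inv x := by
    rw [← LinearMap.comp_apply, ← PiTensorProduct.map_comp]
    have : (fun i => ε i ∘ₗ ε i) = fun i => LinearMap.id := by
      funext i; exact LinearMap.ext (H i).inv
    rw [this, PiTensorProduct.map_id]; rfl
  anti x := by
    refine pi_tensor_ext (φ := PiTensorProduct.map ε ∘ₗ koszulD ε d)
      (ψ := -(koszulD ε d ∘ₗ PiTensorProduct.map ε)) (fun x => ?_) x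
    simp only [LinearMap.comp_apply, LinearMap.neg_apply, koszulD_tprod, map_sum,
      PiTensorProduct.map_tprod, ← Finset.sum_neg_distrib]
    refine Finset.sum_congr rfl fun i _ => tprod_eq_neg i ?_ fun j hj => ?_
    · simp [(H i).anti]
    · split_ifs <;> simp

theorem lex_lt_of_fst {c c' : I} (h : c' < c) (j : F c') (i : F c) :
    (toLex ⟨c', j⟩ : Σₗ c, F c) < toLex ⟨c, i⟩ := Sigma.Lex.lt_def.2 (Or.inl h)

theorem lex_lt_iff_snd {c : I} (j i : F c) :
    (toLex ⟨c, j⟩ : Σₗ c, F c) < toLex ⟨c, i⟩ ↔ j < i := by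
  rw [Sigma.Lex.lt_def]
  constructor
  · rintro (h | ⟨_, h⟩)
    · exact absurd h (lt_irrefl c)
    · exact h
  · exact fun h => Or.inr ⟨rfl, h⟩

theorem lex_eq_iff_snd {c : I} (j i : F c) :
    (toLex ⟨c, j⟩ : Σₗ c, F c) = toLex ⟨c, i⟩ ↔ j = i := by simp

theorem sum_lex {M : Type*} [AddCommMonoid M] (f : (Σₗ c, F c) → M) :
    ∑ s, f s = ∑ c, ∑ i : F c, f (toLex ⟨c, i⟩) := by
  rw [← Fintype.sum_sigma (fun s : Σ c, F c => f (toLex s))]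
  exact (Fintype.sum_equiv toLex _ _ fun s => rfl).symm

theorem prod_lex {M : Type*} [CommMonoid M] (f : (Σₗ c, F c) → M) :
    ∏ s, f s = ∏ c, ∏ i : F c, f (toLex ⟨c, i⟩) := by
  rw [← Fintype.prod_sigma (fun s : Σ c, F c => f (toLex s))]
  exact (Fintype.prod_equiv toLex _ _ fun s => rfl).symm

/-- In the lexicographic order the positions before `(c, i)` are those in earlier fibres and the
earlier ones in the fibre of `c`. The sign of the flat tensor product is therefore the product of
the outer and the inner Koszul sign. -/
theorem nestT_koszulD {ε d : V →ₗ[ℂ] V} (x : ⨂[ℂ] _ : (Σₗ c, F c), V) :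
    nestT F V (koszulD (fun _ => ε) (fun _ => d) x) =
      koszulD (fun _ => PiTensorProduct.map fun _ => ε)
        (fun c => koszulD (fun _ : F c => ε) (fun _ => d)) (nestT F V x) := by
  refine pi_tensor_ext (φ := nestT F V ∘ₗ koszulD (fun _ => ε) (fun _ => d))
    (ψ := koszulD (fun _ => PiTensorProduct.map fun _ => ε)
        (fun c => koszulD (fun _ : F c => ε) (fun _ => d)) ∘ₗ nestT F V) (fun x => ?_) x
  simp only [LinearMap.comp_apply, koszulD_tprod, map_sum, nestT_tprod]
  have h1 : ∀ c, (PiTensorProduct.tprod ℂ fun c' => if c' < c then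
        PiTensorProduct.map (fun _ => ε) (PiTensorProduct.tprod ℂ fun j => x (toLex ⟨c', j⟩))
      else if c' = c then ∑ i : F c', PiTensorProduct.tprod ℂ (fun j => if j < i then
          ε (x (toLex ⟨c', j⟩)) else if j = i then d (x (toLex ⟨c', j⟩)) else x (toLex ⟨c', j⟩))
      else PiTensorProduct.tprod ℂ fun j : F c' => x (toLex ⟨c', j⟩)) =
      ∑ i : F c, PiTensorProduct.tprod ℂ fun c' => PiTensorProduct.tprod ℂ fun j : F c' =>
        if (toLex ⟨c', j⟩ : Σₗ c, F c) < toLex ⟨c, i⟩ then ε (x (toLex ⟨c', j⟩))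
        else if (toLex ⟨c', j⟩ : Σₗ c, F c) = toLex ⟨c, i⟩ then d (x (toLex ⟨c', j⟩))
        else x (toLex ⟨c', j⟩) := by
    intro c
    trans PiTensorProduct.tprod ℂ (Function.update (fun c' => if c' < c then
          PiTensorProduct.map (fun _ => ε) (PiTensorProduct.tprod ℂ fun j => x (toLex ⟨c', j⟩))
          else PiTensorProduct.tprod ℂ fun j : F c' => x (toLex ⟨c', j⟩)) c
          (∑ i : F c, PiTensorProduct.tprod ℂ (fun j => if j < i then
          ε (x (toLex ⟨c, j⟩)) else if j = i then d (x (toLex ⟨c, j⟩)) else x (toLex ⟨c, j⟩))))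
    · congr 1; funext c'
      by_cases h : c' = c
      · subst h; simp
      · simp [h]
    rw [MultilinearMap.map_update_sum]
    refine Finset.sum_congr rfl fun i _ => ?_
    congr 1; funext c'
    rcases lt_trichotomy c' c with h | h | h
    · rw [Function.update_of_ne h.ne, if_pos h, PiTensorProduct.map_tprod]
      congr 1; funext j
      rw [if_pos (lex_lt_of_fst h _ _)]
    · subst h
      rw [Function.update_self]
      simp only [lex_lt_iff_snd, lex_eq_iff_snd]
    · rw [Function.update_of_ne h.ne', if_neg h.not_gt]
      congr 1; funext j
      have h4 := lex_lt_of_fst (F := F) h i j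
      rw [if_neg h4.not_gt, if_neg h4.ne']
  rw [sum_lex]
  exact Finset.sum_congr rfl fun c _ => (h1 c).symm

end Nest

/-! ### Koszul signs and permutations of tensor factors -/

section KoszulT

variable {ι ι' ι'' : Type} [Fintype ι] [LinearOrder ι] [Fintype ι'] [LinearOrder ι'] [Fintype ι'']
  [LinearOrder ι'']

/-- The Koszul sign of a bijection of linearly ordered sets, for factors of parity `p i`. -/
def ksign (e : ι ≃ ι') (p : ι → ℕ) : ℂ :=
  ∏ i, ∏ j, if i < j ∧ e j < e i then (-1) ^ (p i * p j) else 1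

/-- Folding ordered pairs into pairs with `i < j` lets signs that refer to different orderings be
compared pair by pair. -/
theorem prod_pairs_eq (G : ι → ι → ℂ) (hG : ∀ i, G i i = 1) :
    ∏ i, ∏ j, G i j = ∏ i, ∏ j, if i < j then G i j * G j i else 1 := by
  have h1 : ∀ i j, (if i < j then G i j * G j i else 1) =
      (if i < j then G i j else 1) * (if i < j then G j i else 1) := by
    intro i j; split_ifs <;> simp
  simp only [h1, Finset.prod_mul_distrib]
  rw [Finset.prod_comm (f := fun i j => if i < j then G j i else 1)]
  simp only [← Finset.prod_mul_distrib]
  refine Finset.prod_congr rfl fun i _ => Finset.prod_congr rfl fun j _ => ?_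
  rcases lt_trichotomy i j with h | h | h
  · simp [h, h.not_gt]
  · subst h; simp [hG]
  · simp [h, h.not_gt]

theorem ksign_refl (p : ι → ℕ) : ksign (Equiv.refl ι) p = 1 := by
  refine Finset.prod_eq_one fun i _ => Finset.prod_eq_one fun j _ => if_neg ?_
  rintro ⟨h1, h2⟩
  exact lt_asymm h1 h2

theorem neg_one_pow_mul_self (a : ℕ) : ((-1 : ℂ)) ^ a * (-1) ^ a = 1 := by
  rw [← pow_add, ← two_mul, pow_mul]; simp

/-- The composite exchanges a pair exactly when one, but not both, of the bijections does. If both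
do, the sign occurs twice and squares to one. -/
theorem ksign_trans (e : ι ≃ ι') (e' : ι' ≃ ι'') (p : ι → ℕ) :
    ksign (e.trans e') p = ksign e p * ksign e' (fun i => p (e.symm i)) := by
  have h1 : ksign e' (fun i => p (e.symm i)) =
      ∏ i, ∏ j, if e i < e j ∧ e' (e j) < e' (e i) then (-1 : ℂ) ^ (p i * p j) else 1 := by
    unfold ksign
    rw [← e.prod_comp]
    refine Finset.prod_congr rfl fun i _ => ?_
    rw [← e.prod_comp]
    simp
  rw [h1, prod_pairs_eq _ (fun i => by simp)]
  unfold ksign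
  simp only [← Finset.prod_mul_distrib]
  refine Finset.prod_congr rfl fun i _ => Finset.prod_congr rfl fun j _ => ?_
  have hc : ((-1 : ℂ)) ^ (p j * p i) = (-1) ^ (p i * p j) := by rw [mul_comm]
  have hs := neg_one_pow_mul_self (p i * p j)
  simp only [Equiv.trans_apply, hc]
  by_cases hij : i < j
  · have hne : e i ≠ e j := fun h => hij.ne (e.injective h)
    have hne' : e' (e i) ≠ e' (e j) := fun h => hne (e'.injective h)
    rcases lt_or_gt_of_ne hne with h2 | h2 <;> rcases lt_or_gt_of_ne hne' with h3 | h3 <;>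
      simp [hij, h2, h3, h2.not_gt, h3.not_gt, hs]
  · simp [hij]

/-- The Koszul sign as a function of one of the parities. -/
theorem ksign_update (e : ι ≃ ι') (p : ι → ℕ) (i : ι) :
    ksign e (Function.update p i (p i + 1)) * ∏ j, (if j < i then (-1 : ℂ) ^ p j else 1) =
      ksign e p * ∏ j, if e j < e i then (-1 : ℂ) ^ p j else 1 := by
  -- Raising the parity at `i` by one contributes `(-1) ^ p j` for every `j` that crosses `i`. The
  -- two products list the crossings from the right and from the left.
  have h1 : ksign e (Function.update p i (p i + 1)) = ksign e p *
      ((∏ b, if i < b ∧ e b < e i then (-1 : ℂ) ^ p b else 1) *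
        ∏ a, if a < i ∧ e i < e a then (-1 : ℂ) ^ p a else 1) := by
    have h2 : (∏ b, if i < b ∧ e b < e i then (-1 : ℂ) ^ p b else 1) =
        ∏ a, ∏ b, if a = i ∧ a < b ∧ e b < e a then (-1 : ℂ) ^ p b else 1 := by
      refine Eq.symm ((Finset.prod_eq_single i ?_ ?_).trans ?_)
      · intro a _ ha; simp [ha]
      · simp
      · simp
    have h3 : (∏ a, if a < i ∧ e i < e a then (-1 : ℂ) ^ p a else 1) =
        ∏ a, ∏ b, if b = i ∧ a < b ∧ e b < e a then (-1 : ℂ) ^ p a else 1 := by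
      refine Finset.prod_congr rfl fun a _ => ?_
      refine Eq.symm ((Finset.prod_eq_single i ?_ ?_).trans ?_)
      · intro b _ hb; simp [hb]
      · simp
      · simp
    rw [h2, h3]
    unfold ksign
    simp only [← Finset.prod_mul_distrib]
    refine Finset.prod_congr rfl fun a _ => Finset.prod_congr rfl fun b _ => ?_
    by_cases hab : a < b ∧ e b < e a
    · by_cases ha : a = i
      · subst ha
        have hb : b ≠ a := hab.1.ne'
        simp [hab, hb, add_mul, pow_add]
      · by_cases hb : b = i
        · subst hb
          simp [hab, ha, mul_add, pow_add]
        · simp [hab, ha, hb]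
    · simp [hab]
  rw [h1, mul_assoc]
  congr 1
  simp only [← Finset.prod_mul_distrib]
  refine Finset.prod_congr rfl fun j _ => ?_
  have hs := neg_one_pow_mul_self (p j)
  rcases lt_trichotomy i j with h | h | h
  · simp [h, h.not_gt]
  · subst h; simp
  · have hne : e i ≠ e j := fun h' => h.ne' (e.injective h')
    rcases lt_or_gt_of_ne hne with h2 | h2 <;> simp [h, h.not_gt, h2, h2.not_gt, hs]

variable {V V' : Type u} [AddCommGroup V] [Module ℂ V] [AddCommGroup V'] [Module ℂ V']

/-- The projection to the part of parity `b`. -/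
def parProj (ε : V →ₗ[ℂ] V) (b : Fin 2) : V →ₗ[ℂ] V :=
  (2 : ℂ)⁻¹ • (LinearMap.id + (-1 : ℂ) ^ (b : ℕ) • ε)

theorem parProj_apply (ε : V →ₗ[ℂ] V) (b : Fin 2) (p : ℕ) (x : V) (hx : ε x = (-1 : ℂ) ^ p • x) :
    parProj ε b x = if (b : ℕ) = p % 2 then x else 0 := by
  have h1 : parProj ε b x = (2 : ℂ)⁻¹ • (x + (-1 : ℂ) ^ ((b : ℕ) + p % 2) • x) := by
    simp only [parProj, LinearMap.smul_apply, LinearMap.add_apply, LinearMap.id_apply, hx,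
      smul_smul]
    rw [neg_one_pow_eq_pow_mod_two p, ← pow_add]
  rw [h1]
  have hp := Nat.mod_two_eq_zero_or_one p
  rcases hp with hp | hp <;> fin_cases b <;> simp [hp, ← two_smul ℂ x, smul_smul]

/-- Permuting the tensor factors along `e` with Koszul signs. -/
def koszulT (ε : V →ₗ[ℂ] V) (e : ι ≃ ι') : (⨂[ℂ] _ : ι, V) →ₗ[ℂ] ⨂[ℂ] _ : ι', V :=
  ∑ p : ι → Fin 2, ksign e (fun i => (p i : ℕ)) •
    ((PiTensorProduct.reindex ℂ (fun _ => V) e).toLinearMap ∘ₗ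
      PiTensorProduct.map fun i => parProj ε (p i))

/-- Among the parity vectors in the defining sum only the reduction of `p` modulo `2` survives.
Arbitrary natural numbers are allowed for `p`, so that degrees can serve as parities. -/
theorem koszulT_tprod (ε : V →ₗ[ℂ] V) (e : ι ≃ ι') (x : ι → V) (p : ι → ℕ)
    (hx : ∀ i, ε (x i) = (-1 : ℂ) ^ p i • x i) :
    koszulT ε e (PiTensorProduct.tprod ℂ x) =
      ksign e p • PiTensorProduct.tprod ℂ fun i => x (e.symm i) := by
  simp only [koszulT, LinearMap.sum_apply, LinearMap.smul_apply, LinearMap.comp_apply,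
    PiTensorProduct.map_tprod, LinearEquiv.coe_coe]
  rw [Finset.sum_eq_single fun i => ⟨p i % 2, Nat.mod_lt _ two_pos⟩]
  · have h1 : (fun i => parProj ε ⟨p i % 2, Nat.mod_lt _ two_pos⟩ (x i)) = x := by
      funext i
      rw [parProj_apply ε _ (p i) (x i) (hx i), if_pos rfl]
    rw [h1, PiTensorProduct.reindex_tprod]
    congr 1
    unfold ksign
    refine Finset.prod_congr rfl fun i _ => Finset.prod_congr rfl fun j _ => ?_
    congr 1
    dsimp only
    rw [pow_mul, pow_mul, ← neg_one_pow_eq_pow_mod_two, ← pow_mul, mul_comm, pow_mul,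
      ← neg_one_pow_eq_pow_mod_two, ← pow_mul, mul_comm, pow_mul]
  · intro q _ hq
    obtain ⟨i, hi⟩ := Function.ne_iff.1 hq
    rw [tprod_eq_zero i, map_zero, smul_zero]
    rw [parProj_apply ε _ (p i) (x i) (hx i), if_neg fun h => hi (Fin.ext h)]
  · simp

variable {ε d : V →ₗ[ℂ] V}

theorem koszulT_comp (hε : ∀ x, ε (ε x) = x) (e : ι ≃ ι') (e' : ι' ≃ ι'')
    (z : ⨂[ℂ] _ : ι, V) : koszulT ε e' (koszulT ε e z) = koszulT ε (e.trans e') z := by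
  refine super_ext (fun _ => ε) (fun _ => hε) (φ := koszulT ε e' ∘ₗ koszulT ε e)
    (ψ := koszulT ε (e.trans e')) (fun x p hx => ?_) z
  rw [LinearMap.comp_apply, koszulT_tprod ε e x p hx, map_smul,
    koszulT_tprod ε e' (fun i => x (e.symm i)) _ (fun i => hx (e.symm i)), koszulT_tprod ε _ x p hx,
    smul_smul, ksign_trans]
  rfl

theorem koszulT_refl (hε : ∀ x, ε (ε x) = x) (z : ⨂[ℂ] _ : ι, V) :
    koszulT ε (Equiv.refl ι) z = z := by
  refine super_ext (fun _ => ε) (fun _ => hε) (φ := koszulT ε (Equiv.refl ι))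
    (ψ := LinearMap.id) (fun x p hx => ?_) z
  rw [koszulT_tprod ε _ x p hx, ksign_refl, one_smul]
  rfl

theorem koszulT_map {ε' : V' →ₗ[ℂ] V'} (hε : ∀ x, ε (ε x) = x) (f : V →ₗ[ℂ] V')
    (hf : ∀ x, f (ε x) = ε' (f x)) (e : ι ≃ ι') (z : ⨂[ℂ] _ : ι, V) :
    koszulT ε' e (PiTensorProduct.map (fun _ => f) z) =
      PiTensorProduct.map (fun _ => f) (koszulT ε e z) := by
  refine super_ext (fun _ => ε) (fun _ => hε) (φ := koszulT ε' e ∘ₗ PiTensorProduct.map fun _ => f)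
    (ψ := (PiTensorProduct.map fun _ => f) ∘ₗ koszulT ε e) (fun x p hx => ?_) z
  rw [LinearMap.comp_apply, LinearMap.comp_apply, koszulT_tprod ε e x p hx, map_smul,
    PiTensorProduct.map_tprod, PiTensorProduct.map_tprod,
    koszulT_tprod ε' e _ p (fun i => by rw [← hf, hx, map_smul])]

theorem tprod_smul_prod {κ : Type} [Fintype κ] {V : κ → Type u} [∀ i, AddCommGroup (V i)]
    [∀ i, Module ℂ (V i)] (c : κ → ℂ) (x : ∀ i, V i) :
    PiTensorProduct.tprod ℂ (fun i => c i • x i) = (∏ i, c i) • PiTensorProduct.tprod ℂ x :=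
  (PiTensorProduct.tprod ℂ).map_smul_univ c x

theorem koszulAt_homogeneous (f : V →ₗ[ℂ] V) (x : ι → V) (p : ι → ℕ)
    (hx : ∀ i, ε (x i) = (-1 : ℂ) ^ p i • x i) (i : ι) :
    koszulAt (fun _ => ε) (fun _ => f) i (PiTensorProduct.tprod ℂ x) =
      (∏ j, if j < i then (-1 : ℂ) ^ p j else 1) •
        PiTensorProduct.tprod ℂ (Function.update x i (f (x i))) := by
  rw [koszulAt_tprod, ← tprod_smul_prod]
  congr 1; funext j
  rcases lt_trichotomy j i with h | h | h
  · simp [h, h.ne, hx]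
  · subst h; simp
  · simp [h.not_gt, h.ne']

/-- Applying `d` at position `i` raises the parity there. By `ksign_update`, the change of the
permutation sign matches the change of the sign for moving `d` past the factors on its left. -/
theorem koszulT_koszulD (hε : ∀ x, ε (ε x) = x) (hεd : ∀ x, ε (d x) = -d (ε x)) (e : ι ≃ ι')
    (z : ⨂[ℂ] _ : ι, V) :
    koszulT ε e (koszulD (fun _ => ε) (fun _ => d) z) =
      koszulD (fun _ => ε) (fun _ => d) (koszulT ε e z) := by
  refine super_ext (fun _ => ε) (fun _ => hε)
    (φ := koszulT ε e ∘ₗ koszulD (fun _ => ε) (fun _ => d))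
    (ψ := koszulD (fun _ => ε) (fun _ => d) ∘ₗ koszulT ε e) (fun x p hx => ?_) z
  rw [LinearMap.comp_apply, LinearMap.comp_apply, koszulT_tprod ε e x p hx, map_smul, koszulD,
    koszulD, LinearMap.sum_apply, LinearMap.sum_apply, map_sum, Finset.smul_sum, ← e.sum_comp]
  refine Finset.sum_congr rfl fun i _ => ?_
  rw [koszulAt_homogeneous d x p hx,
    koszulAt_homogeneous d (fun i => x (e.symm i)) (fun i => p (e.symm i)) (fun i => hx _), map_smul,
    koszulT_tprod ε e _ (Function.update p i (p i + 1)), smul_smul, smul_smul,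
    mul_comm, ksign_update]
  · congr 1
    · congr 1
      rw [← e.prod_comp]
      simp
    · congr 1; funext j
      by_cases hj : j = e i
      · subst hj; simp
      · have : e.symm j ≠ i := fun h => hj (by rw [← h]; simp)
        simp [hj, this]
  · intro j
    by_cases hj : j = i
    · subst hj; simp [hεd, hx, pow_succ]
    · simp [hj, hx]

end KoszulT
end HochschildWreath

end

noncomputable section

namespace HochschildWreath

set_option linter.unusedSectionVars false

/-! ### The cyclic and the bar complex of an algebra -/

section Sites

variable (A : Type u) [Ring A] [Algebra ℂ A]

/-- The bimodule `A ⊗ A` with the inner structure `a (x ⊗ y) b = x b ⊗ a y`. -/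
def Bimod.inner : Bimod A (A ⊗[ℂ] A) where
  l := LinearMap.lTensorHom A ∘ₗ LinearMap.mul ℂ A
  r := LinearMap.rTensorHom A ∘ₗ (LinearMap.mul ℂ A).flip
  l_one m := by
    induction m using TensorProduct.induction_on with
    | zero => simp
    | tmul q e => simp
    | add a b ha hb => rw [map_add, ha, hb]
  r_one m := by
    induction m using TensorProduct.induction_on with
    | zero => simp
    | tmul q e => simp
    | add a b ha hb => rw [map_add, ha, hb]
  l_mul x y m := by
    induction m using TensorProduct.induction_on with
    | zero => simp
    | tmul q e => simp [mul_assoc]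
    | add a b ha hb => simp only [map_add, ha, hb]
  r_mul x y m := by
    induction m using TensorProduct.induction_on with
    | zero => simp
    | tmul q e => simp [mul_assoc]
    | add a b ha hb => simp only [map_add, ha, hb]
  comm x y m := by
    induction m using TensorProduct.induction_on with
    | zero => simp
    | tmul q e => simp
    | add a b ha hb => simp only [map_add, ha, hb]

@[simp] theorem Bimod.inner_l (a x y : A) : (Bimod.inner A).l a (x ⊗ₜ y) = x ⊗ₜ (a * y) := rfl
@[simp] theorem Bimod.inner_r (a x y : A) : (Bimod.inner A).r a (x ⊗ₜ y) = (x * a) ⊗ₜ y := rfl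
@[simp] theorem Bimod.regular_l (a x : A) : (Bimod.regular A).l a x = a * x := rfl
@[simp] theorem Bimod.regular_r (a x : A) : (Bimod.regular A).r a x = x * a := rfl

/-- The bar resolution `⨁ A ⊗ A^{⊗ k} ⊗ A`. -/
def Res : Type u := HC A (A ⊗[ℂ] A)

instance : AddCommGroup (Res A) := inferInstanceAs (AddCommGroup (HC A (A ⊗[ℂ] A)))
instance : Module ℂ (Res A) := inferInstanceAs (Module ℂ (HC A (A ⊗[ℂ] A)))

/-- The Hochschild complex `⨁ A ⊗ A^{⊗ k}`. -/
def Cyc : Type u := HC A A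

instance : AddCommGroup (Cyc A) := inferInstanceAs (AddCommGroup (HC A A))
instance : Module ℂ (Cyc A) := inferInstanceAs (Module ℂ (HC A A))

variable {A}

/-- The element `x ⊗ a₁ ⊗ ⋯ ⊗ a_k ⊗ y` of the bar resolution. -/
def Res.gen (k : ℕ) (x y : A) (a : Fin k → A) : Res A :=
  DirectSum.lof ℂ ℕ (HCk A (A ⊗[ℂ] A)) k ((x ⊗ₜ y) ⊗ₜ PiTensorProduct.tprod ℂ a)

/-- The element `x ⊗ a₁ ⊗ ⋯ ⊗ a_k` of the Hochschild complex. -/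
def Cyc.gen (k : ℕ) (x : A) (a : Fin k → A) : Cyc A :=
  DirectSum.lof ℂ ℕ (HCk A A) k (x ⊗ₜ PiTensorProduct.tprod ℂ a)

theorem Res.ext {W : Type u} [AddCommGroup W] [Module ℂ W] {f g : Res A →ₗ[ℂ] W}
    (h : ∀ k x y a, f (Res.gen k x y a) = g (Res.gen k x y a)) (z : Res A) : f z = g z := by
  refine hc_ext (E := A) (Q := A ⊗[ℂ] A) (f := f) (g := g) (fun k m a => ?_) z
  induction m using TensorProduct.induction_on with
  | zero => rw [TensorProduct.zero_tmul, map_zero]; exact (map_zero f).trans (map_zero g).symm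
  | tmul x y => exact h k x y a
  | add m n hm hn =>
    rw [TensorProduct.add_tmul, map_add]
    exact (map_add f _ _).trans ((congrArg₂ (· + ·) hm hn).trans (map_add g _ _).symm)

theorem Cyc.ext {W : Type u} [AddCommGroup W] [Module ℂ W] {f g : Cyc A →ₗ[ℂ] W}
    (h : ∀ k x a, f (Cyc.gen k x a) = g (Cyc.gen k x a)) (z : Cyc A) : f z = g z :=
  hc_ext (E := A) (Q := A) (f := f) (g := g) h z

/-- The linear dependence of `hcHat` on the map of coefficients. -/
def hcHatL (E Q Q' : Type u) [Ring E] [Algebra ℂ E] [AddCommGroup Q] [Module ℂ Q]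
    [AddCommGroup Q'] [Module ℂ Q'] : (Q →ₗ[ℂ] Q') →ₗ[ℂ] HC E Q →ₗ[ℂ] HC E Q' where
  toFun := hcHat (AlgHom.id ℂ E)
  map_add' φ ψ := LinearMap.ext (hcHat_add φ ψ)
  map_smul' c φ := LinearMap.ext (hcHat_smul c φ)

namespace Res

/-- The differential of the bar resolution. -/
def d : Res A →ₗ[ℂ] Res A := hcTotD (Bimod.inner A)
/-- The operator `z ^ k` in degree `k`. -/
def deg (z : ℂ) : Res A →ₗ[ℂ] Res A := degOp (HCk A (A ⊗[ℂ] A)) z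
/-- The left action. -/
def l : A →ₗ[ℂ] Res A →ₗ[ℂ] Res A :=
  hcHatL A (A ⊗[ℂ] A) (A ⊗[ℂ] A) ∘ₗ LinearMap.rTensorHom A ∘ₗ LinearMap.mul ℂ A
/-- The right action. -/
def r : A →ₗ[ℂ] Res A →ₗ[ℂ] Res A :=
  hcHatL A (A ⊗[ℂ] A) (A ⊗[ℂ] A) ∘ₗ LinearMap.lTensorHom A ∘ₗ (LinearMap.mul ℂ A).flip
/-- The augmentation. -/
def aug : Res A →ₗ[ℂ] A := hcBottom A (LinearMap.mul' ℂ A)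

@[simp] theorem deg_gen (z : ℂ) (k x y) (a : Fin k → A) :
    deg z (gen k x y a) = z ^ k • gen k x y a := degOp_lof _ _ _
@[simp] theorem l_gen (b : A) (k x y) (a : Fin k → A) :
    l b (gen k x y a) = gen k (b * x) y a :=
  (hcHat_lof (AlgHom.id ℂ A) (LinearMap.rTensor A (LinearMap.mul ℂ A b)) k _).trans (by
    simp [gen])
@[simp] theorem r_gen (b : A) (k x y) (a : Fin k → A) :
    r b (gen k x y a) = gen k x (y * b) a :=
  (hcHat_lof (AlgHom.id ℂ A) (LinearMap.lTensor A ((LinearMap.mul ℂ A).flip b)) k _).trans (by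
    simp [gen])
@[simp] theorem aug_gen_zero (x y : A) (a) : aug (gen 0 x y a) = x * y :=
  (hcBottom_lof_zero _ _).trans (by simp)
@[simp] theorem aug_gen_succ (k) (x y : A) (a) : aug (gen (k + 1) x y a) = 0 :=
  hcBottom_lof_succ _ _ _

theorem d_deg (z : ℂ) (x : Res A) : d (deg z x) = z • deg z (d x) := shiftD_degOp _ z x
theorem superDiff : SuperDiff (deg (A := A) (-1)) d := superDiff_shiftD _ (hcD_comp _)
theorem isGr : IsGr (deg (A := A) 2) := isGr_degOp

theorem d_l (b : A) (x : Res A) : d (l b x) = l b (d x) := by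
  refine (hcHat_hcTotD (β := Bimod.inner A) (β' := Bimod.inner A) (f := AlgHom.id ℂ A)
    (φ := LinearMap.rTensor A (LinearMap.mul ℂ A b)) ⟨fun y m => ?_, fun y m => ?_⟩ x).symm
  · induction m using TensorProduct.induction_on with
    | zero => simp
    | tmul q e => simp
    | add m n hm hn => simp only [map_add, hm, hn]
  · induction m using TensorProduct.induction_on with
    | zero => simp
    | tmul q e => simp [mul_assoc]
    | add m n hm hn => simp only [map_add, hm, hn]

theorem d_r (b : A) (x : Res A) : d (r b x) = r b (d x) := by
  refine (hcHat_hcTotD (β := Bimod.inner A) (β' := Bimod.inner A) (f := AlgHom.id ℂ A)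
    (φ := LinearMap.lTensor A ((LinearMap.mul ℂ A).flip b)) ⟨fun y m => ?_, fun y m => ?_⟩ x).symm
  · induction m using TensorProduct.induction_on with
    | zero => simp
    | tmul q e => simp [mul_assoc]
    | add m n hm hn => simp only [map_add, hm, hn]
  · induction m using TensorProduct.induction_on with
    | zero => simp
    | tmul q e => simp
    | add m n hm hn => simp only [map_add, hm, hn]

theorem deg_l (z : ℂ) (b : A) (x : Res A) : deg z (l b x) = l b (deg z x) :=
  Res.ext (f := deg z ∘ₗ l b) (g := l b ∘ₗ deg z) (fun k x y a => by simp) x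
theorem deg_r (z : ℂ) (b : A) (x : Res A) : deg z (r b x) = r b (deg z x) :=
  Res.ext (f := deg z ∘ₗ r b) (g := r b ∘ₗ deg z) (fun k x y a => by simp) x
theorem deg_comm (z w : ℂ) (x : Res A) : deg z (deg w x) = deg w (deg z x) :=
  Res.ext (f := deg z ∘ₗ deg w) (g := deg w ∘ₗ deg z)
    (fun k x y a => by simp [smul_smul, mul_comm]) x
theorem l_mul (b c : A) (x : Res A) : l (b * c) x = l b (l c x) :=
  Res.ext (f := l (b * c)) (g := l b ∘ₗ l c) (fun k x y a => by simp [mul_assoc]) x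
theorem r_mul (b c : A) (x : Res A) : r (b * c) x = r c (r b x) :=
  Res.ext (f := r (b * c)) (g := r c ∘ₗ r b) (fun k x y a => by simp [mul_assoc]) x
theorem l_one (x : Res A) : l 1 x = x :=
  Res.ext (f := l 1) (g := LinearMap.id) (fun k x y a => by simp) x
theorem r_one (x : Res A) : r 1 x = x :=
  Res.ext (f := r 1) (g := LinearMap.id) (fun k x y a => by simp) x
theorem l_r (b c : A) (x : Res A) : l b (r c x) = r c (l b x) :=
  Res.ext (f := l b ∘ₗ r c) (g := r c ∘ₗ l b) (fun k x y a => by simp) x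

theorem aug_deg (z : ℂ) (x : Res A) : aug (deg z x) = aug x :=
  Res.ext (f := aug ∘ₗ deg z) (g := aug) (fun k x y a => by cases k <;> simp) x
theorem aug_l (b : A) (x : Res A) : aug (l b x) = b * aug x :=
  Res.ext (f := aug ∘ₗ l b) (g := LinearMap.mul ℂ A b ∘ₗ aug)
    (fun k x y a => by cases k <;> simp [mul_assoc]) x
theorem aug_r (b : A) (x : Res A) : aug (r b x) = aug x * b :=
  Res.ext (f := aug ∘ₗ r b) (g := (LinearMap.mul ℂ A).flip b ∘ₗ aug)
    (fun k x y a => by cases k <;> simp [mul_assoc]) x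

theorem aug_d (x : Res A) : aug (d x) = 0 := by
  refine hcBottom_hcTotD (β := Bimod.inner A) (φ := LinearMap.mul' ℂ A) (fun a m => ?_) x
  induction m using TensorProduct.induction_on with
  | zero => simp
  | tmul q e => simp [mul_assoc]
  | add m n hm hn => simp only [map_add, hm, hn]

theorem hCompat_aug : HCompat (d (A := A)) (0 : A →ₗ[ℂ] A) aug :=
  .of_comm fun x => by rw [aug_d, LinearMap.zero_apply]

/-- The bar resolution is a resolution. -/
theorem aug_bijective : Function.Bijective
    (Homology.map (d := d (A := A)) (d' := (0 : A →ₗ[ℂ] A)) aug hCompat_aug) := by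
  -- For the inner bimodule structure `x` is the part on which right multiplication acts, so it can
  -- be split off. The contraction `swapMul` of this splitting is `1 ⊗ x y`, which vanishes wherever
  -- `x y` does.
  let t : (A ⊗[ℂ] A) →ₗ[ℂ] (A ⊗[ℂ] A) ⊗[ℂ] A :=
    TensorProduct.lift ((TensorProduct.mk ℂ (A ⊗[ℂ] A) A).flip.compl₂ (TensorProduct.mk ℂ A A 1))
  have ht : ∀ x y, t (x ⊗ₜ y) = (1 ⊗ₜ y) ⊗ₜ x := fun x y => rfl
  have hc : HCompat (totD (Bimod.inner A) 0) (0 : A →ₗ[ℂ] A)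
      (hcBottom A (LinearMap.mul' ℂ A)) := by
    rw [totD_zero]; exact hCompat_aug
  -- The coefficients carry no differential and sit in degree `0`, so the degree operator is the
  -- identity.
  have h := hcBottom_homology (β := Bimod.inner A) (dQ := 0) (θ := LinearMap.id) (t := t)
    (d' := 0) (π := LinearMap.id) (p := LinearMap.mul' ℂ A) ⟨by simp, by simp⟩ (by simp)
    (IsGr.of_span Set.univ (by simp) fun x _ => ⟨0, by simp⟩) (by simp)
    ⟨fun x m => ?_, fun x m => ?_⟩ (fun m => ?_) (by simp) (by simp) (fun x m => ?_) (fun m hm => ?_)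
    (fun _ => rfl) (fun y => ⟨y ⊗ₜ 1, by simp⟩) (by simp) hc (.id _)
  · have fin : ∀ (D : HC A (A ⊗[ℂ] A) →ₗ[ℂ] HC A (A ⊗[ℂ] A)), D = hcTotD (Bimod.inner A) →
        ∀ hc' : HCompat D (0 : A →ₗ[ℂ] A) (hcBottom A (LinearMap.mul' ℂ A)),
        Function.Bijective (Homology.map _ hc') → Function.Bijective
          (Homology.map (d := d (A := A)) (d' := (0 : A →ₗ[ℂ] A)) aug hCompat_aug) := by
      rintro D rfl hc' h
      exact h
    refine fin _ (totD_zero _) hc ⟨h.1, fun c => ?_⟩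
    obtain ⟨c', h'⟩ := h.2.2 c
    exact ⟨c', h'.trans (Homology.map_id _ c)⟩
  · induction m using TensorProduct.induction_on with
    | zero => simp
    | tmul q e => simp [ht]
    | add m n hm hn => simp only [map_add, hm, hn]
  · induction m using TensorProduct.induction_on with
    | zero => simp
    | tmul q e => simp [ht]
    | add m n hm hn => simp only [map_add, hm, hn]
  · induction m using TensorProduct.induction_on with
    | zero => simp
    | tmul q e => simp [ht]
    | add m n hm hn => simp only [map_add, hm, hn]
  · induction m using TensorProduct.induction_on with
    | zero => simp
    | tmul q e => simp [mul_assoc]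
    | add m n hm hn => simp only [map_add, hm, hn]
  · have h1 : ∀ m, swapMul (Bimod.inner A) t m = 1 ⊗ₜ LinearMap.mul' ℂ A m := fun m => by
      induction m using TensorProduct.induction_on with
      | zero => simp
      | tmul q e => simp [swapMul, ht]
      | add m n hm hn => simp only [map_add, hm, hn, TensorProduct.tmul_add]
    rw [h1, hm, TensorProduct.tmul_zero]

end Res

namespace Cyc

/-- The differential of the Hochschild complex. -/
def d : Cyc A →ₗ[ℂ] Cyc A := hcTotD (Bimod.regular A)
/-- The operator `z ^ k` in degree `k`. -/
def deg (z : ℂ) : Cyc A →ₗ[ℂ] Cyc A := degOp (HCk A A) z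
/-- Left multiplication on the coefficients (not a chain map). -/
def l : A →ₗ[ℂ] Cyc A →ₗ[ℂ] Cyc A := hcHatL A A A ∘ₗ LinearMap.mul ℂ A
/-- The inclusion `x ⊗ a ↦ x ⊗ a ⊗ 1` in the bar resolution. -/
def op : Cyc A →ₗ[ℂ] Res A := hcHat (AlgHom.id ℂ A) ((TensorProduct.mk ℂ A A).flip 1)

@[simp] theorem deg_gen (z : ℂ) (k x) (a : Fin k → A) :
    deg z (gen k x a) = z ^ k • gen k x a := degOp_lof _ _ _
@[simp] theorem l_gen (b : A) (k x) (a : Fin k → A) : l b (gen k x a) = gen k (b * x) a :=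
  (hcHat_lof (AlgHom.id ℂ A) (LinearMap.mul ℂ A b) k _).trans (by simp [gen])
@[simp] theorem op_gen (k x) (a : Fin k → A) : op (gen k x a) = Res.gen k x 1 a :=
  (hcHat_lof (AlgHom.id ℂ A) ((TensorProduct.mk ℂ A A).flip 1) k _).trans (by simp [Res.gen])

theorem d_deg (z : ℂ) (x : Cyc A) : d (deg z x) = z • deg z (d x) := shiftD_degOp _ z x
theorem superDiff : SuperDiff (deg (A := A) (-1)) d := superDiff_shiftD _ (hcD_comp _)
theorem isGr : IsGr (deg (A := A) 2) := isGr_degOp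

theorem deg_l (z : ℂ) (b : A) (x : Cyc A) : deg z (l b x) = l b (deg z x) :=
  Cyc.ext (f := deg z ∘ₗ l b) (g := l b ∘ₗ deg z) (fun k x a => by simp) x
theorem l_mul (b c : A) (x : Cyc A) : l (b * c) x = l b (l c x) :=
  Cyc.ext (f := l (b * c)) (g := l b ∘ₗ l c) (fun k x a => by simp [mul_assoc]) x
theorem l_one (x : Cyc A) : l 1 x = x :=
  Cyc.ext (f := l 1) (g := LinearMap.id) (fun k x a => by simp) x
theorem op_deg (z : ℂ) (x : Cyc A) : op (deg z x) = Res.deg z (op x) :=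
  Cyc.ext (f := op ∘ₗ deg z) (g := Res.deg z ∘ₗ op) (fun k x a => by simp) x
theorem op_l (b : A) (x : Cyc A) : op (l b x) = Res.l b (op x) :=
  Cyc.ext (f := op ∘ₗ l b) (g := Res.l b ∘ₗ op) (fun k x a => by simp) x

end Cyc

/-- The decomposition `x ⊗ a ⊗ y ↦ (x ⊗ a) ⊗ y` of the bar resolution. -/
def Res.split : Res A →ₗ[ℂ] Cyc A ⊗[ℂ] A :=
  DirectSum.toModule ℂ ℕ (Cyc A ⊗[ℂ] A) fun k =>
    LinearMap.rTensor A (DirectSum.lof ℂ ℕ (HCk A A) k : HCk A A k →ₗ[ℂ] Cyc A) ∘ₗ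
      (TensorProduct.rightComm ℂ A A (TPow A k)).toLinearMap

@[simp]
theorem Res.split_gen (k x y) (a : Fin k → A) :
    Res.split (Res.gen k x y a) = Cyc.gen k x a ⊗ₜ y :=
  (DirectSum.toModule_lof ℂ k _).trans (by simp; rfl)

/-- The element `z y` of the bar resolution for `z = x ⊗ a` in the Hochschild complex. -/
def Res.join : Cyc A →ₗ[ℂ] A →ₗ[ℂ] Res A := Res.r.flip ∘ₗ Cyc.op

theorem Res.join_apply (z : Cyc A) (y : A) : Res.join z y = Res.r y (Cyc.op z) := rfl

theorem Res.split_join (z : Cyc A) (y : A) : Res.split (Res.join z y) = z ⊗ₜ y :=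
  Cyc.ext (f := Res.split ∘ₗ Res.join.flip y) (g := (TensorProduct.mk ℂ _ _).flip y)
    (fun k x a => by simp [Res.join_apply]) z

theorem Res.deg_join (w : ℂ) (z : Cyc A) (y : A) :
    Res.deg w (Res.join z y) = Res.join (Cyc.deg w z) y := by
  rw [Res.join_apply, Res.deg_r, ← Cyc.op_deg]; rfl

/-- Tensors with homogeneous factors `zᵢ yᵢ` span the tensor powers of the bar resolution. -/
theorem Res.tensor_ext {ι : Type} [Finite ι] {W : Type u} [AddCommGroup W] [Module ℂ W]
    {φ ψ : (⨂[ℂ] _ : ι, Res A) →ₗ[ℂ] W}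
    (h : ∀ (z : ι → Cyc A) (y : ι → A) (p : ι → ℕ),
      (∀ i, Cyc.deg (-1) (z i) = (-1 : ℂ) ^ p i • z i) →
      φ (PiTensorProduct.tprod ℂ fun i => Res.join (z i) (y i)) =
        ψ (PiTensorProduct.tprod ℂ fun i => Res.join (z i) (y i))) (x : ⨂[ℂ] _ : ι, Res A) :
    φ x = ψ x := by
  refine HochschildWreath.tensor_ext (fun _ => {x | ∃ (z : Cyc A) (y : A) (p : ℕ),
    Cyc.deg (-1) z = (-1 : ℂ) ^ p • z ∧ x = Res.join z y}) (fun _ => ?_) (fun x hx => ?_) x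
  · rw [eq_top_iff]
    intro x _
    set S := Submodule.span ℂ {x | ∃ (z : Cyc A) (y : A) (p : ℕ),
      Cyc.deg (-1) z = (-1 : ℂ) ^ p • z ∧ x = Res.join z y}
    rw [← Submodule.Quotient.mk_eq_zero S]
    refine Res.ext (f := S.mkQ) (g := 0) (fun k x y a => ?_) x
    rw [Submodule.mkQ_apply, LinearMap.zero_apply, Submodule.Quotient.mk_eq_zero]
    exact Submodule.subset_span ⟨Cyc.gen k x a, y, k, by simp, by simp [Res.join_apply]⟩
  · choose z y p hp hx using hx
    obtain rfl : x = fun i => Res.join (z i) (y i) := funext hx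
    exact h z y p hp

end Sites

section SiteMaps

variable {A B : Type u} [Ring A] [Algebra ℂ A] [Ring B] [Algebra ℂ B] (f : A →ₐ[ℂ] B)

/-- The map of bar resolutions induced by an algebra homomorphism. -/
def Res.map : Res A →ₗ[ℂ] Res B := hcHat f (TensorProduct.map f.toLinearMap f.toLinearMap)
/-- The map of Hochschild complexes induced by an algebra homomorphism. -/
def Cyc.map : Cyc A →ₗ[ℂ] Cyc B := hcHat f f.toLinearMap

@[simp] theorem Res.map_gen (k x y) (a : Fin k → A) :
    Res.map f (Res.gen k x y a) = Res.gen k (f x) (f y) fun i => f (a i) :=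
  (hcHat_lof f _ k _).trans (by simp [Res.gen])
@[simp] theorem Cyc.map_gen (k x) (a : Fin k → A) :
    Cyc.map f (Cyc.gen k x a) = Cyc.gen k (f x) fun i => f (a i) :=
  (hcHat_lof f _ k _).trans (by simp [Cyc.gen])

theorem Res.map_d (x : Res A) : Res.map f (Res.d x) = Res.d (Res.map f x) := by
  refine hcHat_hcTotD (β := Bimod.inner A) (β' := Bimod.inner B) (f := f)
    (φ := TensorProduct.map f.toLinearMap f.toLinearMap) ⟨fun y m => ?_, fun y m => ?_⟩ x
  · induction m using TensorProduct.induction_on with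
    | zero => simp
    | tmul q e => simp
    | add m n hm hn => simp only [map_add, hm, hn]
  · induction m using TensorProduct.induction_on with
    | zero => simp
    | tmul q e => simp
    | add m n hm hn => simp only [map_add, hm, hn]

theorem Cyc.map_d (x : Cyc A) : Cyc.map f (Cyc.d x) = Cyc.d (Cyc.map f x) :=
  hcHat_hcTotD (β := Bimod.regular A) (β' := Bimod.regular B) (f := f)
    (φ := f.toLinearMap) ⟨fun y m => by simp, fun y m => by simp⟩ x

theorem Res.map_deg (z : ℂ) (x : Res A) : Res.map f (Res.deg z x) = Res.deg z (Res.map f x) :=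
  hcHat_degOp f _ z x
theorem Cyc.map_deg (z : ℂ) (x : Cyc A) : Cyc.map f (Cyc.deg z x) = Cyc.deg z (Cyc.map f x) :=
  hcHat_degOp f _ z x
theorem Res.map_join (z : Cyc A) (y : A) :
    Res.map f (Res.join z y) = Res.join (Cyc.map f z) (f y) :=
  Cyc.ext (f := Res.map f ∘ₗ Res.join.flip y) (g := Res.join.flip (f y) ∘ₗ Cyc.map f)
    (fun k x a => by simp [Res.join_apply]) z
theorem Res.aug_map (x : Res A) : Res.aug (Res.map f x) = f (Res.aug x) :=
  Res.ext (f := Res.aug ∘ₗ Res.map f) (g := f.toLinearMap ∘ₗ Res.aug)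
    (fun k x y a => by cases k <;> simp) x
theorem Res.map_l (b : A) (x : Res A) : Res.map f (Res.l b x) = Res.l (f b) (Res.map f x) :=
  Res.ext (f := Res.map f ∘ₗ Res.l b) (g := Res.l (f b) ∘ₗ Res.map f)
    (fun k x y a => by simp) x
theorem Res.map_r (b : A) (x : Res A) : Res.map f (Res.r b x) = Res.r (f b) (Res.map f x) :=
  Res.ext (f := Res.map f ∘ₗ Res.r b) (g := Res.r (f b) ∘ₗ Res.map f)
    (fun k x y a => by simp) x
theorem Cyc.map_l (b : A) (x : Cyc A) : Cyc.map f (Cyc.l b x) = Cyc.l (f b) (Cyc.map f x) :=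
  Cyc.ext (f := Cyc.map f ∘ₗ Cyc.l b) (g := Cyc.l (f b) ∘ₗ Cyc.map f) (fun k x a => by simp) x

end SiteMaps
end HochschildWreath

end

noncomputable section

namespace HochschildWreath

set_option linter.unusedSectionVars false

/-! ### Tensor powers of the bar resolution and of the Hochschild complex -/

section SiteTensors

theorem map₂_tprod_left {ι : Type} {M N N' : ι → Type u} [∀ i, AddCommGroup (M i)]
    [∀ i, Module ℂ (M i)] [∀ i, AddCommGroup (N i)] [∀ i, Module ℂ (N i)]
    [∀ i, AddCommGroup (N' i)] [∀ i, Module ℂ (N' i)] (f : ∀ i, M i →ₗ[ℂ] N i →ₗ[ℂ] N' i)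
    (b : ∀ i, M i) :
    PiTensorProduct.map₂ f (PiTensorProduct.tprod ℂ b) = PiTensorProduct.map fun i => f i (b i) := by
  ext x
  simp [PiTensorProduct.map₂_tprod_tprod]

/-- Permuting tensor factors without signs. -/
def permT {ι ι' : Type} {V : Type u} [AddCommGroup V] [Module ℂ V] (e : ι ≃ ι') :
    (⨂[ℂ] _ : ι, V) →ₗ[ℂ] ⨂[ℂ] _ : ι', V :=
  (PiTensorProduct.reindex ℂ (fun _ => V) e).toLinearMap

@[simp]
theorem permT_tprod {ι ι' : Type} {V : Type u} [AddCommGroup V] [Module ℂ V] (e : ι ≃ ι')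
    (x : ι → V) : permT e (PiTensorProduct.tprod ℂ x) =
      PiTensorProduct.tprod ℂ fun i => x (e.symm i) :=
  PiTensorProduct.reindex_tprod _ _

theorem permT_trans {ι ι' ι'' : Type} {V : Type u} [AddCommGroup V] [Module ℂ V] (e : ι ≃ ι')
    (e' : ι' ≃ ι'') (x : ⨂[ℂ] _ : ι, V) : permT e' (permT e x) = permT (e.trans e') x :=
  pi_tensor_ext (φ := permT e' ∘ₗ permT e) (ψ := permT (e.trans e')) (fun x => by simp) x

theorem ksign_zero {ι ι' : Type} [Fintype ι] [LinearOrder ι] [Fintype ι'] [LinearOrder ι']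
    (e : ι ≃ ι') : ksign e (fun _ => 0) = 1 := by
  simp [ksign]

theorem koszulT_id {ι ι' : Type} [Fintype ι] [LinearOrder ι] [Fintype ι'] [LinearOrder ι']
    {V : Type u} [AddCommGroup V] [Module ℂ V] (e : ι ≃ ι') (x : ⨂[ℂ] _ : ι, V) :
    koszulT LinearMap.id e x = permT e x :=
  pi_tensor_ext (φ := koszulT LinearMap.id e) (ψ := permT e) (fun x => by
    rw [koszulT_tprod LinearMap.id e x (fun _ => 0) (fun i => by simp), ksign_zero, one_smul,
      permT_tprod]) x

theorem koszulD_degree {ι : Type} [Fintype ι] [LinearOrder ι] {V : ι → Type u}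
    [∀ i, AddCommGroup (V i)] [∀ i, Module ℂ (V i)] {ε d θ : ∀ i, V i →ₗ[ℂ] V i} (w : ℂ)
    (hε : ∀ i x, ε i (θ i x) = θ i (ε i x)) (hd : ∀ i x, d i (θ i x) = w • θ i (d i x))
    (x : ⨂[ℂ] i, V i) :
    koszulD ε d (PiTensorProduct.map θ x) = w • PiTensorProduct.map θ (koszulD ε d x) := by
  refine pi_tensor_ext (φ := koszulD ε d ∘ₗ PiTensorProduct.map θ)
    (ψ := w • (PiTensorProduct.map θ ∘ₗ koszulD ε d)) (fun x => ?_) x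
  simp only [LinearMap.comp_apply, LinearMap.smul_apply, PiTensorProduct.map_tprod, koszulD_tprod,
    map_sum, Finset.smul_sum]
  refine Finset.sum_congr rfl fun i _ => ?_
  have h1 : (fun j => if j < i then ε j (θ j (x j)) else if j = i then d j (θ j (x j))
      else θ j (x j)) = fun j => (if j = i then w else 1) •
        θ j (if j < i then ε j (x j) else if j = i then d j (x j) else x j) := by
    funext j
    split_ifs with h1 h2
    · exact absurd h2 h1.ne
    · rw [hε, one_smul]
    · rw [hd]
    · rw [one_smul]
  rw [h1, (PiTensorProduct.tprod ℂ).map_smul_univ, Finset.prod_ite_eq' Finset.univ i,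
    if_pos (Finset.mem_univ _)]

/-- The homology of a tensor product of quasi-isomorphisms. -/
theorem koszulD_map_bijective {ι : Type} [Fintype ι] [LinearOrder ι] {V V' : ι → Type u}
    [∀ i, AddCommGroup (V i)] [∀ i, Module ℂ (V i)] [∀ i, AddCommGroup (V' i)]
    [∀ i, Module ℂ (V' i)] {ε d : ∀ i, V i →ₗ[ℂ] V i} {ε' d' : ∀ i, V' i →ₗ[ℂ] V' i}
    (H : ∀ i, SuperDiff (ε i) (d i)) (H' : ∀ i, SuperDiff (ε' i) (d' i))
    (f : ∀ i, V i →ₗ[ℂ] V' i) (hf : ∀ i, HCompat (d i) (d' i) (f i))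
    (hb : ∀ i, Function.Bijective (Homology.map (f i) (hf i)))
    (hF : HCompat (koszulD ε d) (koszulD ε' d') (PiTensorProduct.map f)) :
    Function.Bijective (Homology.map (PiTensorProduct.map f) hF) := by
  have h1 : Function.Bijective (PiTensorProduct.map fun i => Homology.map (f i) (hf i)) :=
    (PiTensorProduct.congr fun i => LinearEquiv.ofBijective _ (hb i)).bijective
  have h2 := (kunneth_bijective H').comp h1
  have h3 : kunneth H' ∘ PiTensorProduct.map (fun i => Homology.map (f i) (hf i)) =
      Homology.map (PiTensorProduct.map f) hF ∘ kunneth H := funext (kunneth_map H H' f hf hF)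
  rw [h3] at h2
  exact (Function.Bijective.of_comp_iff _ (kunneth_bijective H)).1 h2

variable (A : Type u) [Ring A] [Algebra ℂ A] {ι ι' : Type} [Fintype ι] [LinearOrder ι]
  [Fintype ι'] [LinearOrder ι']

/-- Tensor powers of the bar resolution. -/
abbrev ResT (ι : Type) : Type u := ⨂[ℂ] _ : ι, Res A
/-- Tensor powers of the Hochschild complex. -/
abbrev CycT (ι : Type) : Type u := ⨂[ℂ] _ : ι, Cyc A
/-- Tensor powers of the algebra. -/
abbrev AlgT (ι : Type) : Type u := ⨂[ℂ] _ : ι, A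

variable {A}

/-- The differential of the tensor power of the bar resolution. -/
def resD : ResT A ι →ₗ[ℂ] ResT A ι := koszulD (fun _ => Res.deg (-1)) fun _ => Res.d
/-- The operator `z ^ k` in total degree `k`. -/
def resDeg (z : ℂ) : ResT A ι →ₗ[ℂ] ResT A ι := PiTensorProduct.map fun _ => Res.deg z
/-- The operator `z ^ k` in total degree `k`. -/
def cycDeg (z : ℂ) : CycT A ι →ₗ[ℂ] CycT A ι := PiTensorProduct.map fun _ => Cyc.deg z
/-- The left action of `A^{⊗ ι}`. -/
def actL : AlgT A ι →ₗ[ℂ] ResT A ι →ₗ[ℂ] ResT A ι := PiTensorProduct.map₂ fun _ => Res.l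
/-- The right action of `A^{⊗ ι}`. -/
def actR : AlgT A ι →ₗ[ℂ] ResT A ι →ₗ[ℂ] ResT A ι := PiTensorProduct.map₂ fun _ => Res.r
/-- Left multiplication on the coefficients. -/
def cycL : AlgT A ι →ₗ[ℂ] CycT A ι →ₗ[ℂ] CycT A ι := PiTensorProduct.map₂ fun _ => Cyc.l
/-- The augmentation. -/
def resAug : ResT A ι →ₗ[ℂ] AlgT A ι := PiTensorProduct.map fun _ => Res.aug
/-- The inclusion of the Hochschild complexes in the bar resolutions. -/
def opT : CycT A ι →ₗ[ℂ] ResT A ι := PiTensorProduct.map fun _ => Cyc.op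
/-- The Koszul action on tensor powers of the bar resolution. -/
def resT (e : ι ≃ ι') : ResT A ι →ₗ[ℂ] ResT A ι' := koszulT (Res.deg (-1)) e
/-- The Koszul action on tensor powers of the Hochschild complex. -/
def cycT (e : ι ≃ ι') : CycT A ι →ₗ[ℂ] CycT A ι' := koszulT (Cyc.deg (-1)) e
/-- The decomposition `z b ↦ z ⊗ b`. -/
def splitT : ResT A ι →ₗ[ℂ] CycT A ι ⊗[ℂ] AlgT A ι :=
  (unzipT (fun _ : ι => Cyc A) (fun _ : ι => A)).toLinearMap ∘ₗ
    PiTensorProduct.map fun _ => Res.split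

theorem actL_tprod (b : ι → A) :
    actL (PiTensorProduct.tprod ℂ b) = PiTensorProduct.map fun i => Res.l (b i) :=
  map₂_tprod_left _ b
theorem actR_tprod (b : ι → A) :
    actR (PiTensorProduct.tprod ℂ b) = PiTensorProduct.map fun i => Res.r (b i) :=
  map₂_tprod_left _ b
theorem cycL_tprod (b : ι → A) :
    cycL (PiTensorProduct.tprod ℂ b) = PiTensorProduct.map fun i => Cyc.l (b i) :=
  map₂_tprod_left _ b

@[simp]
theorem actL_tprod_tprod (b : ι → A) (x : ι → Res A) :
    actL (PiTensorProduct.tprod ℂ b) (PiTensorProduct.tprod ℂ x) =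
      PiTensorProduct.tprod ℂ fun i => Res.l (b i) (x i) := by
  rw [actL_tprod, PiTensorProduct.map_tprod]
@[simp]
theorem actR_tprod_tprod (b : ι → A) (x : ι → Res A) :
    actR (PiTensorProduct.tprod ℂ b) (PiTensorProduct.tprod ℂ x) =
      PiTensorProduct.tprod ℂ fun i => Res.r (b i) (x i) := by
  rw [actR_tprod, PiTensorProduct.map_tprod]
@[simp]
theorem cycL_tprod_tprod (b : ι → A) (x : ι → Cyc A) :
    cycL (PiTensorProduct.tprod ℂ b) (PiTensorProduct.tprod ℂ x) =
      PiTensorProduct.tprod ℂ fun i => Cyc.l (b i) (x i) := by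
  rw [cycL_tprod, PiTensorProduct.map_tprod]
@[simp]
theorem opT_tprod (x : ι → Cyc A) :
    opT (PiTensorProduct.tprod ℂ x) = PiTensorProduct.tprod ℂ fun i => Cyc.op (x i) :=
  PiTensorProduct.map_tprod _ _
@[simp]
theorem resAug_tprod (x : ι → Res A) :
    resAug (PiTensorProduct.tprod ℂ x) = PiTensorProduct.tprod ℂ fun i => Res.aug (x i) :=
  PiTensorProduct.map_tprod _ _
@[simp]
theorem resDeg_tprod (z : ℂ) (x : ι → Res A) :
    resDeg z (PiTensorProduct.tprod ℂ x) = PiTensorProduct.tprod ℂ fun i => Res.deg z (x i) :=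
  PiTensorProduct.map_tprod _ _
@[simp]
theorem cycDeg_tprod (z : ℂ) (x : ι → Cyc A) :
    cycDeg z (PiTensorProduct.tprod ℂ x) = PiTensorProduct.tprod ℂ fun i => Cyc.deg z (x i) :=
  PiTensorProduct.map_tprod _ _
@[simp]
theorem splitT_tprod (z : ι → Cyc A) (y : ι → A) :
    splitT (PiTensorProduct.tprod ℂ fun i => Res.join (z i) (y i)) =
      PiTensorProduct.tprod ℂ z ⊗ₜ PiTensorProduct.tprod ℂ y := by
  simp [splitT, Res.split_join]

theorem tprod_join (z : ι → Cyc A) (y : ι → A) :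
    PiTensorProduct.tprod ℂ (fun i => Res.join (z i) (y i)) =
      actR (PiTensorProduct.tprod ℂ y) (opT (PiTensorProduct.tprod ℂ z)) := by
  simp [Res.join_apply]

theorem splitT_actR_opT (z : CycT A ι) (b : AlgT A ι) : splitT (actR b (opT z)) = z ⊗ₜ b := by
  refine pi_tensor_ext (φ := splitT ∘ₗ actR b ∘ₗ opT) (ψ := (TensorProduct.mk ℂ _ _).flip b)
    (fun z => ?_) z
  refine pi_tensor_ext (φ := splitT ∘ₗ actR.flip (opT (PiTensorProduct.tprod ℂ z)))
    (ψ := TensorProduct.mk ℂ _ _ (PiTensorProduct.tprod ℂ z)) (fun b => ?_) b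
  simp only [LinearMap.comp_apply, LinearMap.flip_apply, ← tprod_join, splitT_tprod,
    TensorProduct.mk_apply]

/-- Every element of the tensor power of the bar resolution is a sum of elements `z b`. -/
theorem resT_induction {motive : ResT A ι → Prop} (zero : motive 0)
    (add : ∀ x y, motive x → motive y → motive (x + y))
    (mem : ∀ z b, motive (actR b (opT z))) (x : ResT A ι) : motive x := by
  have h : TensorProduct.lift (actR.flip ∘ₗ opT) (splitT x) = x :=
    Res.tensor_ext (φ := TensorProduct.lift (actR.flip ∘ₗ opT) ∘ₗ splitT) (ψ := LinearMap.id)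
      (fun z y p _ => by
        rw [LinearMap.comp_apply, splitT_tprod, TensorProduct.lift.tmul, LinearMap.comp_apply,
          LinearMap.flip_apply, ← tprod_join]; rfl) x
  rw [← h]
  induction splitT x using TensorProduct.induction_on with
  | zero => rw [map_zero]; exact zero
  | tmul z b => exact mem z b
  | add x y hx hy => rw [map_add]; exact add _ _ hx hy

theorem algT_ext {W : Type u} [AddCommGroup W] [Module ℂ W] {φ ψ : AlgT A ι →ₗ[ℂ] W}
    (h : ∀ b : ι → A, φ (PiTensorProduct.tprod ℂ b) = ψ (PiTensorProduct.tprod ℂ b))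
    (b : AlgT A ι) : φ b = ψ b := pi_tensor_ext h b

theorem resD_actL (b : AlgT A ι) (x : ResT A ι) : resD (actL b x) = actL b (resD x) := by
  refine algT_ext (φ := resD ∘ₗ actL.flip x) (ψ := actL.flip (resD x)) (fun b => ?_) b
  simp only [LinearMap.comp_apply, LinearMap.flip_apply, actL_tprod]
  exact (koszulD_map (fun i => Res.l (b i)) (fun i x => (Res.d_l _ x).symm)
    (fun i x => (Res.deg_l _ _ x).symm) x).symm
theorem resD_actR (b : AlgT A ι) (x : ResT A ι) : resD (actR b x) = actR b (resD x) := by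
  refine algT_ext (φ := resD ∘ₗ actR.flip x) (ψ := actR.flip (resD x)) (fun b => ?_) b
  simp only [LinearMap.comp_apply, LinearMap.flip_apply, actR_tprod]
  exact (koszulD_map (fun i => Res.r (b i)) (fun i x => (Res.d_r _ x).symm)
    (fun i x => (Res.deg_r _ _ x).symm) x).symm
theorem resDeg_actL (w : ℂ) (b : AlgT A ι) (x : ResT A ι) :
    resDeg w (actL b x) = actL b (resDeg w x) := by
  refine algT_ext (φ := resDeg w ∘ₗ actL.flip x) (ψ := actL.flip (resDeg w x)) (fun b => ?_) b
  refine pi_tensor_ext (φ := resDeg w ∘ₗ actL (PiTensorProduct.tprod ℂ b))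
    (ψ := actL (PiTensorProduct.tprod ℂ b) ∘ₗ resDeg w) (fun x => ?_) x
  simp [Res.deg_l]
theorem resDeg_actR (w : ℂ) (b : AlgT A ι) (x : ResT A ι) :
    resDeg w (actR b x) = actR b (resDeg w x) := by
  refine algT_ext (φ := resDeg w ∘ₗ actR.flip x) (ψ := actR.flip (resDeg w x)) (fun b => ?_) b
  refine pi_tensor_ext (φ := resDeg w ∘ₗ actR (PiTensorProduct.tprod ℂ b))
    (ψ := actR (PiTensorProduct.tprod ℂ b) ∘ₗ resDeg w) (fun x => ?_) x
  simp [Res.deg_r]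

theorem superDiff_resD : SuperDiff (resDeg (-1)) (resD (A := A) (ι := ι)) :=
  superDiff_koszulD fun _ => Res.superDiff

theorem resD_resDeg (w : ℂ) (x : ResT A ι) : resD (resDeg w x) = w • resDeg w (resD x) :=
  koszulD_degree w (fun _ => Res.deg_comm _ _) (fun _ => Res.d_deg w) x

theorem isGr_map {V : ι → Type u} [∀ i, AddCommGroup (V i)] [∀ i, Module ℂ (V i)]
    {θ : ∀ i, V i →ₗ[ℂ] V i} (h : ∀ i, IsGr (θ i)) : IsGr (PiTensorProduct.map θ) := by
  refine IsGr.of_span {x | ∃ y : ∀ i, V i, (∀ i, ∃ k : ℕ, θ i (y i) = (2 : ℂ) ^ k • y i) ∧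
    x = PiTensorProduct.tprod ℂ y} ?_ ?_
  · rw [eq_top_iff]
    intro x _
    set S := Submodule.span ℂ {x | ∃ y : ∀ i, V i,
      (∀ i, ∃ k : ℕ, θ i (y i) = (2 : ℂ) ^ k • y i) ∧ x = PiTensorProduct.tprod ℂ y}
    rw [← Submodule.Quotient.mk_eq_zero S]
    refine HochschildWreath.tensor_ext (φ := S.mkQ) (ψ := 0) _ h (fun y hy => ?_) x
    rw [Submodule.mkQ_apply, LinearMap.zero_apply, Submodule.Quotient.mk_eq_zero]
    exact Submodule.subset_span ⟨y, hy, rfl⟩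
  · rintro _ ⟨y, hy, rfl⟩
    choose k hk using hy
    refine ⟨∑ i, k i, ?_⟩
    rw [PiTensorProduct.map_tprod]
    simp only [hk]
    rw [tprod_smul_prod, Finset.prod_pow_eq_pow_sum]

theorem isGr_resDeg : IsGr (resDeg (A := A) (ι := ι) 2) := isGr_map fun _ => Res.isGr

theorem actL_actL (b c x) : actL b (actL c x) = actL (A := A) (ι := ι) (b * c) x := by
  refine algT_ext (φ := actL.flip (actL c x)) (ψ := actL.flip x ∘ₗ LinearMap.mulRight ℂ c)
    (fun b => ?_) b
  refine algT_ext (φ := actL (PiTensorProduct.tprod ℂ b) ∘ₗ actL.flip x)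
    (ψ := actL.flip x ∘ₗ LinearMap.mulLeft ℂ (PiTensorProduct.tprod ℂ b)) (fun c => ?_) c
  refine pi_tensor_ext (φ := actL (PiTensorProduct.tprod ℂ b) ∘ₗ actL (PiTensorProduct.tprod ℂ c))
    (ψ := actL (PiTensorProduct.tprod ℂ b * PiTensorProduct.tprod ℂ c)) (fun x => ?_) x
  simp [PiTensorProduct.tprod_mul_tprod, Res.l_mul]
theorem actR_actR (b c x) : actR b (actR c x) = actR (A := A) (ι := ι) (c * b) x := by
  refine algT_ext (φ := actR.flip (actR c x)) (ψ := actR.flip x ∘ₗ LinearMap.mulLeft ℂ c)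
    (fun b => ?_) b
  refine algT_ext (φ := actR (PiTensorProduct.tprod ℂ b) ∘ₗ actR.flip x)
    (ψ := actR.flip x ∘ₗ LinearMap.mulRight ℂ (PiTensorProduct.tprod ℂ b)) (fun c => ?_) c
  refine pi_tensor_ext (φ := actR (PiTensorProduct.tprod ℂ b) ∘ₗ actR (PiTensorProduct.tprod ℂ c))
    (ψ := actR (PiTensorProduct.tprod ℂ c * PiTensorProduct.tprod ℂ b)) (fun x => ?_) x
  simp [PiTensorProduct.tprod_mul_tprod, Res.r_mul]
theorem actL_actR (b c x) : actL b (actR c x) = actR c (actL (A := A) (ι := ι) b x) := by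
  refine algT_ext (φ := actL.flip (actR c x)) (ψ := actR c ∘ₗ actL.flip x) (fun b => ?_) b
  refine algT_ext (φ := actL (PiTensorProduct.tprod ℂ b) ∘ₗ actR.flip x)
    (ψ := actR.flip (actL (PiTensorProduct.tprod ℂ b) x)) (fun c => ?_) c
  refine pi_tensor_ext (φ := actL (PiTensorProduct.tprod ℂ b) ∘ₗ actR (PiTensorProduct.tprod ℂ c))
    (ψ := actR (PiTensorProduct.tprod ℂ c) ∘ₗ actL (PiTensorProduct.tprod ℂ b)) (fun x => ?_) x
  simp [Res.l_r]
theorem actL_one (x) : actL (A := A) (ι := ι) 1 x = x := by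
  rw [PiTensorProduct.one_def, actL_tprod]
  refine pi_tensor_ext (ψ := LinearMap.id) (fun x => ?_) x
  simp [Res.l_one]
theorem actR_one (x) : actR (A := A) (ι := ι) 1 x = x := by
  rw [PiTensorProduct.one_def, actR_tprod]
  refine pi_tensor_ext (ψ := LinearMap.id) (fun x => ?_) x
  simp [Res.r_one]

theorem resAug_actL (b x) : resAug (actL (A := A) (ι := ι) b x) = b * resAug x := by
  refine algT_ext (φ := resAug ∘ₗ actL.flip x) (ψ := LinearMap.mulRight ℂ (resAug x))
    (fun b => ?_) b
  refine pi_tensor_ext (φ := resAug ∘ₗ actL (PiTensorProduct.tprod ℂ b))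
    (ψ := LinearMap.mulLeft ℂ (PiTensorProduct.tprod ℂ b) ∘ₗ resAug) (fun x => ?_) x
  simp [PiTensorProduct.tprod_mul_tprod, Res.aug_l]
  rfl
theorem resAug_actR (b x) : resAug (actR (A := A) (ι := ι) b x) = resAug x * b := by
  refine algT_ext (φ := resAug ∘ₗ actR.flip x) (ψ := LinearMap.mulLeft ℂ (resAug x))
    (fun b => ?_) b
  refine pi_tensor_ext (φ := resAug ∘ₗ actR (PiTensorProduct.tprod ℂ b))
    (ψ := LinearMap.mulRight ℂ (PiTensorProduct.tprod ℂ b) ∘ₗ resAug) (fun x => ?_) x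
  simp [PiTensorProduct.tprod_mul_tprod, Res.aug_r]
  rfl
theorem resAug_resDeg (w : ℂ) (x : ResT A ι) : resAug (resDeg w x) = resAug x :=
  pi_tensor_ext (φ := resAug ∘ₗ resDeg w) (ψ := resAug) (fun x => by simp [Res.aug_deg]) x

theorem resAug_resD (x : ResT A ι) : resAug (resD x) = 0 := by
  refine pi_tensor_ext (φ := resAug ∘ₗ resD) (ψ := 0) (fun x => ?_) x
  rw [LinearMap.comp_apply, resD, koszulD_tprod, map_sum]
  refine Finset.sum_eq_zero fun i _ => ?_
  rw [resAug_tprod]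
  exact tprod_eq_zero i (by simp [Res.aug_d])

theorem hCompat_resAug : HCompat resD (0 : AlgT A ι →ₗ[ℂ] AlgT A ι) resAug :=
  .of_comm fun x => by rw [resAug_resD, LinearMap.zero_apply]

/-- This is Künneth applied to the augmentations of the factors, with `A` carrying the zero
differential and the trivial parity. -/
theorem resAug_bijective : Function.Bijective (Homology.map (d := resD (A := A) (ι := ι))
    (d' := (0 : AlgT A ι →ₗ[ℂ] AlgT A ι)) resAug hCompat_resAug) := by
  have h0 : koszulD (fun _ : ι => (LinearMap.id : A →ₗ[ℂ] A)) (fun _ => 0) = 0 := by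
    ext x
    simp only [LinearMap.compMultilinearMap_apply, koszulD_tprod, LinearMap.zero_apply]
    exact Finset.sum_eq_zero fun i _ => tprod_eq_zero i (by simp)
  have h1 := koszulD_map_bijective (V' := fun _ : ι => A) (ε' := fun _ => LinearMap.id)
    (d' := fun _ => 0) (fun _ : ι => Res.superDiff (A := A))
    (fun _ => ⟨by simp, by simp, by simp⟩) (fun _ => Res.aug) (fun _ => Res.hCompat_aug)
    (fun _ => Res.aug_bijective) (by rw [h0]; exact hCompat_resAug)
  have fin : ∀ (D : AlgT A ι →ₗ[ℂ] AlgT A ι), D = 0 → ∀ hc' : HCompat resD D resAug,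
        Function.Bijective (Homology.map _ hc') → Function.Bijective
          (Homology.map (d := resD (A := A) (ι := ι))
    (d' := (0 : AlgT A ι →ₗ[ℂ] AlgT A ι)) resAug hCompat_resAug) := by
    rintro D rfl hc' h
    exact h
  exact fin _ h0 _ h1

/-- Linear contractions of the augmented tensor power of the bar resolution. -/
theorem exists_resAug_contraction : ∃ (σ : AlgT A ι →ₗ[ℂ] ResT A ι) (h : ResT A ι →ₗ[ℂ] ResT A ι),
    (∀ b, resAug (σ b) = b) ∧ (∀ x, resD (h x) + h (resD x) = x - σ (resAug x)) ∧
      ∀ x, resAug (h x) = 0 := by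
  have S := superDiff_resD (A := A) (ι := ι)
  obtain ⟨q, s, h, hds, hs, hqd, hq, hh, -, -⟩ := exists_retraction _ _ S.sq S.inv S.anti
  -- The map `s` picks cycles representing homology, and the augmentation identifies homology with
  -- the tensor power of `A`.
  have hb : Function.Bijective (resAug ∘ₗ s) := by
    have h1 : ∀ c, Homology.map (d := resD (A := A) (ι := ι))
        (d' := (0 : AlgT A ι →ₗ[ℂ] AlgT A ι)) resAug hCompat_resAug c =
        Homology.mk 0 (resAug (s c)) rfl := by
      intro c
      rw [← Homology.map_mk resAug hCompat_resAug (s c) (hds c), hs]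
    constructor
    · intro c c' hc
      apply resAug_bijective.1
      rw [h1, h1, Homology.mk_eq_mk]
      exact ⟨0, by rw [← LinearMap.comp_apply, ← LinearMap.comp_apply, hc]; simp⟩
    · intro b
      obtain ⟨c, hc⟩ := resAug_bijective.2 (Homology.mk 0 b rfl)
      rw [h1, Homology.mk_eq_mk] at hc
      obtain ⟨z, hz⟩ := hc
      exact ⟨c, (sub_eq_zero.1 hz.symm)⟩
  let e := LinearEquiv.ofBijective _ hb
  have he : ∀ c, e c = resAug (s c) := fun c => rfl
  have hes : ∀ b, resAug (s (e.symm b)) = b := fun b => by rw [← he, e.apply_symm_apply]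
  let σ : AlgT A ι →ₗ[ℂ] ResT A ι := s ∘ₗ e.symm.toLinearMap
  have hσ : ∀ b, σ b = s (e.symm b) := fun b => rfl
  -- Subtracting `σ resAug h` moves the homotopy into the kernel of the augmentation. As the values
  -- of `σ` are cycles, the anticommutator changes only by `σ resAug h resD`, which turns the
  -- projection `s q` into `σ resAug`.
  refine ⟨σ, h - σ ∘ₗ resAug ∘ₗ h, ?_, ?_, ?_⟩
  · intro b; rw [hσ, hes]
  · intro x
    have h1 := congrArg resAug (hh x)
    simp only [map_add, map_sub, resAug_resD, zero_add] at h1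
    have h2 : σ (resAug (h (resD x))) = σ (resAug x) - s (q x) := by
      rw [h1, map_sub, hσ (resAug (s _)), ← he, e.symm_apply_apply]
    simp only [LinearMap.sub_apply, LinearMap.comp_apply, map_sub, h2]
    rw [hσ (resAug (h x)), hds, sub_zero, ← add_sub_assoc, hh]
    abel
  · intro x
    simp only [LinearMap.sub_apply, LinearMap.comp_apply, map_sub, hσ, hes, sub_self]

end SiteTensors
end HochschildWreath

end

/-! ### Gluing bar resolutions along a permutation, and contracting a cycle to one site -/

noncomputable section

namespace HochschildWreath

set_option linter.unusedSectionVars false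

/-! ### Closing up tensor powers of the bar resolution along a permutation -/

section Close

variable {A : Type u} [Ring A] [Algebra ℂ A] {ι ι' ι'' : Type} [Fintype ι] [LinearOrder ι]
  [Fintype ι'] [LinearOrder ι'] [Fintype ι''] [LinearOrder ι'']

/-- The right ends of the factors `x i` are multiplied on the left ends of the factors
`x (c i)`. -/
def close (c : Equiv.Perm ι) : ResT A ι →ₗ[ℂ] CycT A ι :=
  TensorProduct.lift (cycL.flip.compl₂ (permT c)) ∘ₗ splitT

/-- The differential on the tensor power of the Hochschild complex obtained by closing up the bar
resolutions along a permutation. -/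
def closeD (c : Equiv.Perm ι) : CycT A ι →ₗ[ℂ] CycT A ι := close c ∘ₗ resD ∘ₗ opT

theorem close_actR_opT (c : Equiv.Perm ι) (b : AlgT A ι) (z : CycT A ι) :
    close c (actR b (opT z)) = cycL (permT c b) z := by
  rw [close, LinearMap.comp_apply, splitT_actR_opT]; rfl

theorem close_opT (c : Equiv.Perm ι) (z : CycT A ι) : close c (opT z) = z := by
  rw [← actR_one (opT z), close_actR_opT, PiTensorProduct.one_def, permT_tprod]
  refine pi_tensor_ext (φ := cycL (PiTensorProduct.tprod ℂ fun _ => 1)) (ψ := LinearMap.id)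
    (fun z => ?_) z
  rw [cycL_tprod_tprod]
  simp [Cyc.l_one]

theorem close_tprod (c : Equiv.Perm ι) (z : ι → Cyc A) (y : ι → A) :
    close c (PiTensorProduct.tprod ℂ fun i => Res.join (z i) (y i)) =
      PiTensorProduct.tprod ℂ fun i => Cyc.l (y (c.symm i)) (z i) := by
  rw [tprod_join, close_actR_opT, permT_tprod, cycL_tprod_tprod]

theorem permT_mul (e : ι ≃ ι') (b b' : AlgT A ι) : permT e (b * b') = permT e b * permT e b' := by
  refine algT_ext (φ := permT e ∘ₗ LinearMap.mulRight ℂ b')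
    (ψ := LinearMap.mulRight ℂ (permT e b') ∘ₗ permT e) (fun b => ?_) b
  refine algT_ext (φ := permT e ∘ₗ LinearMap.mulLeft ℂ (PiTensorProduct.tprod ℂ b))
    (ψ := LinearMap.mulLeft ℂ (permT e (PiTensorProduct.tprod ℂ b)) ∘ₗ permT e) (fun b' => ?_) b'
  simp only [LinearMap.comp_apply, LinearMap.mulLeft_apply, PiTensorProduct.tprod_mul_tprod,
    permT_tprod]
  rfl

theorem cycL_cycL (b b' : AlgT A ι) (z : CycT A ι) : cycL b (cycL b' z) = cycL (b * b') z := by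
  refine algT_ext (φ := cycL.flip (cycL b' z)) (ψ := cycL.flip z ∘ₗ LinearMap.mulRight ℂ b')
    (fun b => ?_) b
  refine algT_ext (φ := cycL (PiTensorProduct.tprod ℂ b) ∘ₗ cycL.flip z)
    (ψ := cycL.flip z ∘ₗ LinearMap.mulLeft ℂ (PiTensorProduct.tprod ℂ b)) (fun b' => ?_) b'
  refine pi_tensor_ext (φ := cycL (PiTensorProduct.tprod ℂ b) ∘ₗ cycL (PiTensorProduct.tprod ℂ b'))
    (ψ := cycL (PiTensorProduct.tprod ℂ b * PiTensorProduct.tprod ℂ b')) (fun x => ?_) z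
  simp [PiTensorProduct.tprod_mul_tprod, Cyc.l_mul]

theorem opT_cycL (b : AlgT A ι) (z : CycT A ι) : opT (cycL b z) = actL b (opT z) := by
  refine algT_ext (φ := opT ∘ₗ cycL.flip z) (ψ := actL.flip (opT z)) (fun b => ?_) b
  refine pi_tensor_ext (φ := opT ∘ₗ cycL (PiTensorProduct.tprod ℂ b))
    (ψ := actL (PiTensorProduct.tprod ℂ b) ∘ₗ opT) (fun x => ?_) z
  simp [Cyc.op_l]

theorem cycDeg_cycL (w : ℂ) (b : AlgT A ι) (z : CycT A ι) :
    cycDeg w (cycL b z) = cycL b (cycDeg w z) := by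
  refine algT_ext (φ := cycDeg w ∘ₗ cycL.flip z) (ψ := cycL.flip (cycDeg w z)) (fun b => ?_) b
  refine pi_tensor_ext (φ := cycDeg w ∘ₗ cycL (PiTensorProduct.tprod ℂ b))
    (ψ := cycL (PiTensorProduct.tprod ℂ b) ∘ₗ cycDeg w) (fun x => ?_) z
  simp [Cyc.deg_l]

theorem opT_cycDeg (w : ℂ) (z : CycT A ι) : opT (cycDeg w z) = resDeg w (opT z) :=
  pi_tensor_ext (φ := opT ∘ₗ cycDeg w) (ψ := resDeg w ∘ₗ opT) (fun x => by simp [Cyc.op_deg]) z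

/-- What is multiplied on the right end at `i` reappears on the left end at `c i`. In other words,
`close c` kills the commutators twisted by `c`. -/
theorem close_actR (c : Equiv.Perm ι) (b : AlgT A ι) (p : ResT A ι) :
    close c (actR b p) = close c (actL (permT c b) p) := by
  induction p using resT_induction with
  | zero => simp only [map_zero]
  | add x y hx hy => simp only [map_add, hx, hy]
  | mem z b' =>
    rw [actR_actR, close_actR_opT, actL_actR, ← opT_cycL, close_actR_opT, cycL_cycL, permT_mul]

/-- For `p = z b` the differential commutes with the action of `b`. By `close_actR` this `b` moves
to the left, where it is absorbed into `z`. So the differential descends along the closing map. -/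
theorem close_resD (c : Equiv.Perm ι) (p : ResT A ι) :
    close c (resD p) = closeD c (close c p) := by
  induction p using resT_induction with
  | zero => simp only [map_zero]
  | add x y hx hy => simp only [map_add, hx, hy]
  | mem z b =>
    rw [resD_actR, close_actR, ← resD_actL, ← opT_cycL, close_actR_opT]; rfl

theorem close_resDeg (c : Equiv.Perm ι) (w : ℂ) (p : ResT A ι) :
    close c (resDeg w p) = cycDeg w (close c p) := by
  induction p using resT_induction with
  | zero => simp only [map_zero]
  | add x y hx hy => simp only [map_add, hx, hy]
  | mem z b =>
    rw [resDeg_actR, ← opT_cycDeg, close_actR_opT, close_actR_opT, cycDeg_cycL]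

theorem closeD_apply (c : Equiv.Perm ι) (z : CycT A ι) : closeD c z = close c (resD (opT z)) := rfl

theorem closeD_closeD (c : Equiv.Perm ι) (z : CycT A ι) : closeD c (closeD c z) = 0 := by
  rw [closeD_apply c z, ← close_resD, superDiff_resD.sq, map_zero]

theorem closeD_cycDeg (c : Equiv.Perm ι) (w : ℂ) (z : CycT A ι) :
    closeD c (cycDeg w z) = w • cycDeg w (closeD c z) := by
  rw [closeD_apply, opT_cycDeg, resD_resDeg, map_smul, close_resDeg]; rfl

theorem cycDeg_inv (z : CycT A ι) : cycDeg (-1) (cycDeg (-1) z) = z :=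
  pi_tensor_ext (φ := cycDeg (-1) ∘ₗ cycDeg (-1)) (ψ := LinearMap.id)
    (fun z => by simp [Cyc.superDiff.inv]) z

theorem superDiff_closeD (c : Equiv.Perm ι) : SuperDiff (cycDeg (-1)) (closeD (A := A) c) where
  sq := closeD_closeD c
  inv := cycDeg_inv
  anti z := by rw [closeD_cycDeg, neg_smul, one_smul, neg_neg]

/-! ### Permutations -/

theorem resT_resT (e : ι ≃ ι') (e' : ι' ≃ ι'') (x : ResT A ι) :
    resT e' (resT e x) = resT (e.trans e') x := koszulT_comp Res.superDiff.inv e e' x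
theorem cycT_cycT (e : ι ≃ ι') (e' : ι' ≃ ι'') (x : CycT A ι) :
    cycT e' (cycT e x) = cycT (e.trans e') x := koszulT_comp Cyc.superDiff.inv e e' x
theorem resT_refl (x : ResT A ι) : resT (Equiv.refl ι) x = x := koszulT_refl Res.superDiff.inv x
theorem cycT_refl (x : CycT A ι) : cycT (Equiv.refl ι) x = x := koszulT_refl Cyc.superDiff.inv x

theorem resT_resD (e : ι ≃ ι') (x : ResT A ι) : resT e (resD x) = resD (resT e x) :=
  koszulT_koszulD Res.superDiff.inv Res.superDiff.anti e x

theorem resT_resDeg (e : ι ≃ ι') (w : ℂ) (x : ResT A ι) :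
    resT e (resDeg w x) = resDeg w (resT e x) :=
  koszulT_map Res.superDiff.inv _ (fun x => Res.deg_comm _ _ x) e x

theorem Cyc.deg_comm (z w : ℂ) (x : Cyc A) : Cyc.deg z (Cyc.deg w x) = Cyc.deg w (Cyc.deg z x) :=
  Cyc.ext (f := Cyc.deg z ∘ₗ Cyc.deg w) (g := Cyc.deg w ∘ₗ Cyc.deg z)
    (fun k x a => by simp [smul_smul, mul_comm]) x

theorem cycT_cycDeg (e : ι ≃ ι') (w : ℂ) (x : CycT A ι) :
    cycT e (cycDeg w x) = cycDeg w (cycT e x) :=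
  koszulT_map Cyc.superDiff.inv _ (fun x => Cyc.deg_comm _ _ x) e x

theorem resT_opT (e : ι ≃ ι') (x : CycT A ι) : resT e (opT x) = opT (cycT e x) :=
  koszulT_map Cyc.superDiff.inv _ (fun x => Cyc.op_deg _ x) e x

theorem resAug_resT (e : ι ≃ ι') (x : ResT A ι) : resAug (resT e x) = permT e (resAug x) := by
  rw [← koszulT_id]
  exact (koszulT_map Res.superDiff.inv _ (fun x => Res.aug_deg _ x) e x).symm

theorem resT_actL (e : ι ≃ ι') (b : AlgT A ι) (x : ResT A ι) :
    resT e (actL b x) = actL (permT e b) (resT e x) := by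
  refine algT_ext (φ := resT e ∘ₗ actL.flip x) (ψ := actL.flip (resT e x) ∘ₗ permT e)
    (fun b => ?_) b
  refine super_ext (fun _ => Res.deg (-1)) (fun _ => Res.superDiff.inv)
    (φ := resT e ∘ₗ actL (PiTensorProduct.tprod ℂ b))
    (ψ := actL (permT e (PiTensorProduct.tprod ℂ b)) ∘ₗ resT e) (fun x p hp => ?_) x
  rw [LinearMap.comp_apply, LinearMap.comp_apply, actL_tprod_tprod, resT, koszulT_tprod _ _ x p hp,
    koszulT_tprod _ _ _ p fun i => by rw [Res.deg_l, hp, map_smul], map_smul, permT_tprod,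
    actL_tprod_tprod]

theorem resT_actR (e : ι ≃ ι') (b : AlgT A ι) (x : ResT A ι) :
    resT e (actR b x) = actR (permT e b) (resT e x) := by
  refine algT_ext (φ := resT e ∘ₗ actR.flip x) (ψ := actR.flip (resT e x) ∘ₗ permT e)
    (fun b => ?_) b
  refine super_ext (fun _ => Res.deg (-1)) (fun _ => Res.superDiff.inv)
    (φ := resT e ∘ₗ actR (PiTensorProduct.tprod ℂ b))
    (ψ := actR (permT e (PiTensorProduct.tprod ℂ b)) ∘ₗ resT e) (fun x p hp => ?_) x
  rw [LinearMap.comp_apply, LinearMap.comp_apply, actR_tprod_tprod, resT, koszulT_tprod _ _ x p hp,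
    koszulT_tprod _ _ _ p fun i => by rw [Res.deg_r, hp, map_smul], map_smul, permT_tprod,
    actR_tprod_tprod]

/-- Relabelling the sites by `e` carries the gluing pattern `c` to `c'`. Gluing multiplies ends by
elements of `A`, which are even, so the Koszul signs before and after gluing agree. -/
theorem close_resT (e : ι ≃ ι') {c : Equiv.Perm ι} {c' : Equiv.Perm ι'}
    (h : ∀ i, c' (e i) = e (c i)) (p : ResT A ι) : close c' (resT e p) = cycT e (close c p) := by
  have h' : ∀ i, e.symm (c'.symm i) = c.symm (e.symm i) := fun i => by
    rw [Equiv.symm_apply_eq, Equiv.symm_apply_eq, h]; simp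
  refine Res.tensor_ext (φ := close c' ∘ₗ resT e) (ψ := cycT e ∘ₗ close c) (fun z y p hp => ?_) p
  rw [LinearMap.comp_apply, LinearMap.comp_apply, close_tprod, resT, cycT,
    koszulT_tprod _ _ _ p fun i => by rw [Res.deg_join, hp, map_smul, LinearMap.smul_apply],
    koszulT_tprod _ _ _ p fun i => by rw [Cyc.deg_l, hp, map_smul], map_smul, close_tprod]
  simp only [h']

theorem closeD_cycT (e : ι ≃ ι') {c : Equiv.Perm ι} {c' : Equiv.Perm ι'}
    (h : ∀ i, c' (e i) = e (c i)) (z : CycT A ι) : closeD c' (cycT e z) = cycT e (closeD c z) := by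
  rw [closeD_apply, ← resT_opT, ← resT_resD, close_resT e h]; rfl

/-- The decomposition `z b ↦ z 1 ⊗ b`. -/
def splitR : ResT A ι →ₗ[ℂ] ResT A ι ⊗[ℂ] AlgT A ι := LinearMap.rTensor _ opT ∘ₗ splitT

theorem splitR_actR_opT (b : AlgT A ι) (z : CycT A ι) :
    splitR (actR b (opT z)) = opT z ⊗ₜ b := by
  rw [splitR, LinearMap.comp_apply, splitT_actR_opT, LinearMap.rTensor_tmul]

/-! ### Functoriality -/

variable {B : Type u} [Ring B] [Algebra ℂ B] (f : A →ₐ[ℂ] B)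

/-- The map of tensor powers of bar resolutions induced by an algebra homomorphism. -/
def resMap : ResT A ι →ₗ[ℂ] ResT B ι := PiTensorProduct.map fun _ => Res.map f
/-- The map of tensor powers of Hochschild complexes induced by an algebra homomorphism. -/
def cycMap : CycT A ι →ₗ[ℂ] CycT B ι := PiTensorProduct.map fun _ => Cyc.map f
/-- The map of tensor powers induced by an algebra homomorphism. -/
def algMap : AlgT A ι →ₗ[ℂ] AlgT B ι := PiTensorProduct.map fun _ => f.toLinearMap

@[simp]
theorem resMap_tprod (x : ι → Res A) :
    resMap f (PiTensorProduct.tprod ℂ x) = PiTensorProduct.tprod ℂ fun i => Res.map f (x i) :=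
  PiTensorProduct.map_tprod _ _
@[simp]
theorem cycMap_tprod (x : ι → Cyc A) :
    cycMap f (PiTensorProduct.tprod ℂ x) = PiTensorProduct.tprod ℂ fun i => Cyc.map f (x i) :=
  PiTensorProduct.map_tprod _ _
@[simp]
theorem algMap_tprod (x : ι → A) :
    algMap f (PiTensorProduct.tprod ℂ x) = PiTensorProduct.tprod ℂ fun i => f (x i) :=
  PiTensorProduct.map_tprod _ _

theorem resMap_resD (x : ResT A ι) : resMap f (resD x) = resD (resMap f x) :=
  koszulD_map _ (fun _ => Res.map_d f) (fun _ => Res.map_deg f _) x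
theorem resMap_resT (e : ι ≃ ι') (x : ResT A ι) : resMap f (resT e x) = resT e (resMap f x) :=
  (koszulT_map Res.superDiff.inv _ (Res.map_deg f _) e x).symm
theorem resMap_opT (x : CycT A ι) : resMap f (opT x) = opT (cycMap f x) :=
  pi_tensor_ext (φ := resMap f ∘ₗ opT) (ψ := opT ∘ₗ cycMap f) (fun x => by
    simp only [LinearMap.comp_apply, opT_tprod, resMap_tprod, cycMap_tprod]
    congr 1; funext i
    exact Cyc.ext (f := Res.map f ∘ₗ Cyc.op) (g := Cyc.op ∘ₗ Cyc.map f)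
      (fun k x a => by simp) (x i)) x
theorem resAug_resMap (x : ResT A ι) : resAug (resMap f x) = algMap f (resAug x) :=
  pi_tensor_ext (φ := resAug ∘ₗ resMap f) (ψ := algMap f ∘ₗ resAug) (fun x => by
    simp [Res.aug_map]) x
theorem close_resMap (c : Equiv.Perm ι) (x : ResT A ι) :
    close c (resMap f x) = cycMap f (close c x) := by
  refine Res.tensor_ext (φ := close c ∘ₗ resMap f) (ψ := cycMap f ∘ₗ close c)
    (fun z y p hp => ?_) x
  simp only [LinearMap.comp_apply, close_tprod, resMap_tprod, cycMap_tprod, Res.map_join,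
    Cyc.map_l]
theorem cycMap_closeD (c : Equiv.Perm ι) (x : CycT A ι) :
    cycMap f (closeD c x) = closeD c (cycMap f x) := by
  rw [closeD_apply, closeD_apply, ← close_resMap, resMap_resD, resMap_opT]
theorem resMap_actL (b : AlgT A ι) (x : ResT A ι) :
    resMap f (actL b x) = actL (algMap f b) (resMap f x) := by
  refine algT_ext (φ := resMap f ∘ₗ actL.flip x) (ψ := actL.flip (resMap f x) ∘ₗ algMap f)
    (fun b => ?_) b
  refine pi_tensor_ext (φ := resMap f ∘ₗ actL (PiTensorProduct.tprod ℂ b))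
    (ψ := actL (algMap f (PiTensorProduct.tprod ℂ b)) ∘ₗ resMap f) (fun x => ?_) x
  simp [Res.map_l]
theorem resMap_actR (b : AlgT A ι) (x : ResT A ι) :
    resMap f (actR b x) = actR (algMap f b) (resMap f x) := by
  refine algT_ext (φ := resMap f ∘ₗ actR.flip x) (ψ := actR.flip (resMap f x) ∘ₗ algMap f)
    (fun b => ?_) b
  refine pi_tensor_ext (φ := resMap f ∘ₗ actR (PiTensorProduct.tprod ℂ b))
    (ψ := actR (algMap f (PiTensorProduct.tprod ℂ b)) ∘ₗ resMap f) (fun x => ?_) x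
  simp [Res.map_r]

end Close
end HochschildWreath

end

noncomputable section

namespace HochschildWreath

set_option linter.unusedSectionVars false

/-! ### Contraction and concatenation on the bar resolution -/

section Concat

variable {A : Type u} [Ring A] [Algebra ℂ A]

variable (A) in
/-- The map `x ⊗ y ↦ (1 ⊗ y) ⊗ x`. -/
def shiftLeft : (A ⊗[ℂ] A) →ₗ[ℂ] (A ⊗[ℂ] A) ⊗[ℂ] A :=
  TensorProduct.lift ((TensorProduct.mk ℂ (A ⊗[ℂ] A) A).flip.compl₂ (TensorProduct.mk ℂ A A 1))

@[simp]
theorem shiftLeft_tmul (x y : A) : shiftLeft A (x ⊗ₜ y) = (1 ⊗ₜ y) ⊗ₜ x := rfl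

/-- The right linear contraction `x ⊗ a ⊗ y ↦ 1 ⊗ x ⊗ a ⊗ y` of the bar resolution. -/
def Res.s : Res A →ₗ[ℂ] Res A := hcHomotopy (shiftLeft A)

/-- The section `y ↦ 1 ⊗ y` of the augmentation. -/
def Res.unit : A →ₗ[ℂ] Res A :=
  DirectSum.lof ℂ ℕ (HCk A (A ⊗[ℂ] A)) 0 ∘ₗ (hcZero A (A ⊗[ℂ] A)).symm.toLinearMap ∘ₗ
    TensorProduct.mk ℂ A A 1

theorem Res.unit_apply (y : A) : Res.unit y = Res.gen 0 1 y Fin.elim0 := by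
  refine congrArg (DirectSum.lof ℂ ℕ (HCk A (A ⊗[ℂ] A)) 0) ?_
  rw [LinearMap.comp_apply, LinearEquiv.coe_coe, LinearEquiv.symm_apply_eq, hcZero_tmul]
  rfl

theorem hcBottom_comp {E Q Q' Q'' : Type u} [Ring E] [Algebra ℂ E] [AddCommGroup Q] [Module ℂ Q]
    [AddCommGroup Q'] [Module ℂ Q'] [AddCommGroup Q''] [Module ℂ Q''] (φ : Q →ₗ[ℂ] Q')
    (ψ : Q' →ₗ[ℂ] Q'') (x : HC E Q) : hcBottom E (ψ ∘ₗ φ) x = ψ (hcBottom E φ x) := by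
  refine directSum_ext (f := hcBottom E (ψ ∘ₗ φ)) (g := ψ ∘ₗ hcBottom E φ) (fun k x => ?_) x
  cases k <;> simp

@[simp]
theorem Res.s_gen (k x y) (a : Fin k → A) :
    Res.s (Res.gen k x y a) = Res.gen (k + 1) 1 y (Fin.cons x a : Fin (k + 1) → A) := by
  refine (hcHomotopy_lof (shiftLeft A) k _).trans ?_
  simp [Res.gen]

/-- This is `hcHomotopy_spec` for the splitting `shiftLeft`, whose `swapMul` is multiplication
followed by `y ↦ 1 ⊗ y`. -/
theorem Res.d_s (x : Res A) : Res.d (Res.s x) = x - Res.s (Res.d x) - Res.unit (Res.aug x) := by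
  have h := hcHomotopy_spec (β := Bimod.inner A) (t := shiftLeft A) ⟨fun x m => ?_, fun x m => ?_⟩
    (fun m => ?_) x
  · have h2 : DirectSum.lof ℂ ℕ (HCk A (A ⊗[ℂ] A)) 0 ((hcZero A (A ⊗[ℂ] A)).symm
        (hcBottom A (swapMul (Bimod.inner A) (shiftLeft A)) x)) = Res.unit (Res.aug x) := by
      have h1 : swapMul (Bimod.inner A) (shiftLeft A) =
          TensorProduct.mk ℂ A A 1 ∘ₗ LinearMap.mul' ℂ A :=
        TensorProduct.ext' fun x y => by simp [swapMul]
      rw [h1]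
      exact congrArg (fun m => DirectSum.lof ℂ ℕ (HCk A (A ⊗[ℂ] A)) 0
        ((hcZero A (A ⊗[ℂ] A)).symm m)) (hcBottom_comp (LinearMap.mul' ℂ A) _ x)
    rw [h2] at h
    rw [sub_right_comm, eq_sub_iff_add_eq]
    exact h
  · induction m using TensorProduct.induction_on with
    | zero => simp
    | tmul q e => simp
    | add m n hm hn => simp only [map_add, hm, hn]
  · induction m using TensorProduct.induction_on with
    | zero => simp
    | tmul q e => simp
    | add m n hm hn => simp only [map_add, hm, hn]
  · induction m using TensorProduct.induction_on with
    | zero => simp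
    | tmul q e => simp
    | add m n hm hn => simp only [map_add, hm, hn]

theorem Res.s_r (b : A) (x : Res A) : Res.s (Res.r b x) = Res.r b (Res.s x) :=
  Res.ext (f := Res.s ∘ₗ Res.r b) (g := Res.r b ∘ₗ Res.s) (fun k x y a => by simp) x

theorem Res.s_deg (w : ℂ) (x : Res A) : Res.deg w (Res.s x) = w • Res.s (Res.deg w x) :=
  Res.ext (f := Res.deg w ∘ₗ Res.s) (g := w • (Res.s ∘ₗ Res.deg w))
    (fun k x y a => by simp [smul_smul, pow_succ']) x

theorem Res.aug_s (x : Res A) : Res.aug (Res.s x) = 0 :=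
  Res.ext (f := Res.aug ∘ₗ Res.s) (g := 0) (fun k x y a => by simp) x

theorem Res.aug_unit (y : A) : Res.aug (Res.unit y) = y := by simp [Res.unit_apply]

theorem Res.d_gen_zero (x y) (a : Fin 0 → A) : Res.d (Res.gen 0 x y a) = 0 :=
  shiftD_lof_zero _ _

/-- Every generator arises from some `Res.unit y` by alternately applying `s` and left
multiplications. Concatenation is defined by this recursion, and its properties are proved by it. -/
theorem Res.gen_succ (k x y) (a : Fin (k + 1) → A) :
    Res.gen (k + 1) x y a = Res.l x (Res.s (Res.gen k (a 0) y (Fin.tail a))) := by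
  rw [Res.s_gen, Res.l_gen, mul_one, Fin.cons_self_tail]

theorem Res.gen_zero (x y) (a : Fin 0 → A) : Res.gen 0 x y a = Res.l x (Res.unit y) := by
  rw [Res.unit_apply, Res.l_gen, mul_one, Subsingleton.elim a]

/-- The isomorphism `x ⊗ a₀ ⊗ a ⊗ y ↦ x ⊗ (a₀ ⊗ a ⊗ y)`. -/
def hcUncons (k : ℕ) : HCk A (A ⊗[ℂ] A) (k + 1) →ₗ[ℂ] A ⊗[ℂ] HCk A (A ⊗[ℂ] A) k :=
  LinearMap.lTensor A (TensorProduct.assoc ℂ A A (TPow A k)).symm.toLinearMap ∘ₗ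
    (TensorProduct.assoc ℂ A A _).toLinearMap ∘ₗ
    (TensorProduct.tensorTensorTensorComm ℂ A A A (TPow A k)).toLinearMap ∘ₗ
    LinearMap.lTensor (A ⊗[ℂ] A) (unconsT A k)

@[simp]
theorem hcUncons_tmul (k : ℕ) (x y : A) (a : Fin (k + 1) → A) :
    hcUncons k ((x ⊗ₜ y) ⊗ₜ PiTensorProduct.tprod ℂ a) =
      x ⊗ₜ ((a 0 ⊗ₜ y) ⊗ₜ PiTensorProduct.tprod ℂ (Fin.tail a)) := by
  simp [hcUncons]; rfl

/-- The operators `x s`. -/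
def Res.ls : A →ₗ[ℂ] Res A →ₗ[ℂ] Res A :=
  (LinearMap.llcomp ℂ (Res A) (Res A) (Res A)).flip Res.s ∘ₗ Res.l

/-- The homogeneous parts of the concatenation map. -/
def concAux : ∀ k, HCk A (A ⊗[ℂ] A) k →ₗ[ℂ] Res A →ₗ[ℂ] Res A
  | 0 => TensorProduct.lift ((LinearMap.llcomp ℂ (Res A) (Res A) (Res A)).compl₁₂ Res.ls Res.l) ∘ₗ
      (hcZero A (A ⊗[ℂ] A)).toLinearMap
  | k + 1 => TensorProduct.lift
      ((LinearMap.llcomp ℂ (Res A) (Res A) (Res A)).compl₁₂ Res.ls (concAux k)) ∘ₗ hcUncons k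

/-- Concatenation `(x ⊗ a ⊗ x') ⊗ (y' ⊗ b ⊗ y) ↦ x ⊗ a ⊗ x' y' ⊗ b ⊗ y`. -/
def conc : Res A →ₗ[ℂ] Res A →ₗ[ℂ] Res A := DirectSum.toModule ℂ ℕ _ concAux

theorem conc_gen_zero (x y) (a : Fin 0 → A) (w : Res A) :
    conc (Res.gen 0 x y a) w = Res.l x (Res.s (Res.l y w)) := by
  refine (LinearMap.congr_fun (DirectSum.toModule_lof ℂ (φ := concAux) 0 _) w).trans ?_
  rw [concAux, LinearMap.comp_apply, LinearEquiv.coe_coe, hcZero_tmul]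
  rfl

theorem conc_gen_succ (k x y) (a : Fin (k + 1) → A) (w : Res A) :
    conc (Res.gen (k + 1) x y a) w =
      Res.l x (Res.s (conc (Res.gen k (a 0) y (Fin.tail a)) w)) := by
  refine (LinearMap.congr_fun (DirectSum.toModule_lof ℂ (φ := concAux) (k + 1) _) w).trans ?_
  have h := LinearMap.congr_fun (DirectSum.toModule_lof ℂ (φ := concAux) k
    ((a 0 ⊗ₜ y) ⊗ₜ PiTensorProduct.tprod ℂ (Fin.tail a))) w
  rw [concAux, LinearMap.comp_apply, hcUncons_tmul]
  refine Eq.trans ?_ (congrArg (fun t => Res.l x (Res.s t)) h.symm)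
  rfl

theorem conc_l (b : A) (z w : Res A) : conc (Res.l b z) w = Res.l b (conc z w) :=
  Res.ext (f := conc.flip w ∘ₗ Res.l b) (g := Res.l b ∘ₗ conc.flip w) (fun k x y a => by
    cases k with
    | zero => simp [conc_gen_zero, Res.l_mul]
    | succ k => simp [conc_gen_succ, Res.l_mul]) z

theorem conc_s (z w : Res A) : conc (Res.s z) w = Res.s (conc z w) :=
  Res.ext (f := conc.flip w ∘ₗ Res.s) (g := Res.s ∘ₗ conc.flip w) (fun k x y a => by
    simp [conc_gen_succ, Res.l_one]) z

theorem conc_unit (b : A) (w : Res A) : conc (Res.unit b) w = Res.s (Res.l b w) := by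
  rw [Res.unit_apply, conc_gen_zero, Res.l_one]

/-- An induction principle for the bar resolution. -/
theorem Res.gen_induction {W : Type u} [AddCommGroup W] [Module ℂ W] {f g : Res A →ₗ[ℂ] W}
    (h0 : ∀ x y, f (Res.l x (Res.unit y)) = g (Res.l x (Res.unit y)))
    (hs : ∀ x z, f z = g z → f (Res.l x (Res.s z)) = g (Res.l x (Res.s z))) (z : Res A) :
    f z = g z := by
  refine Res.ext (fun k => ?_) z
  induction k with
  | zero => intro x y a; rw [Res.gen_zero]; exact h0 x y
  | succ k ih => intro x y a; rw [Res.gen_succ]; exact hs x _ (ih _ _ _)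

theorem conc_r (b : A) (z w : Res A) : conc z (Res.r b w) = Res.r b (conc z w) := by
  refine Res.gen_induction (f := conc.flip (Res.r b w)) (g := Res.r b ∘ₗ conc.flip w)
    (fun x y => ?_) (fun x z hz => ?_) z
  · simp only [LinearMap.comp_apply, LinearMap.flip_apply, conc_l, conc_unit, Res.l_r, Res.s_r]
  · simp only [LinearMap.comp_apply, LinearMap.flip_apply, conc_l, conc_s] at hz ⊢
    rw [hz, Res.s_r, Res.l_r]

theorem Res.r_unit (b y : A) : Res.r b (Res.unit y) = Res.unit (y * b) := by
  simp [Res.unit_apply]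

/-- Concatenation is balanced over `A` at the junction. -/
theorem conc_r_left (b : A) (z w : Res A) : conc (Res.r b z) w = conc z (Res.l b w) := by
  refine Res.gen_induction (f := conc.flip w ∘ₗ Res.r b) (g := conc.flip (Res.l b w))
    (fun x y => ?_) (fun x z hz => ?_) z
  · simp only [LinearMap.comp_apply, LinearMap.flip_apply, conc_l, conc_unit, ← Res.l_r,
      Res.r_unit, Res.l_mul]
  · simp only [LinearMap.comp_apply, LinearMap.flip_apply, ← Res.l_r, ← Res.s_r, conc_l,
      conc_s] at hz ⊢
    rw [hz]

theorem aug_conc (z w : Res A) : Res.aug (conc z w) = 0 := by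
  refine Res.gen_induction (f := Res.aug ∘ₗ conc.flip w) (g := 0)
    (fun x y => ?_) (fun x z hz => ?_) z
  · simp only [LinearMap.comp_apply, LinearMap.flip_apply, conc_l, conc_unit, Res.aug_l, Res.aug_s,
      mul_zero, LinearMap.zero_apply]
  · simp only [LinearMap.comp_apply, LinearMap.flip_apply, conc_l, conc_s, Res.aug_l, Res.aug_s,
      mul_zero, LinearMap.zero_apply]

theorem Res.d_unit (y : A) : Res.d (Res.unit y) = 0 := by
  rw [Res.unit_apply, Res.d_gen_zero]
theorem Res.deg_unit (w : ℂ) (y : A) : Res.deg w (Res.unit y) = Res.unit y := by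
  simp [Res.unit_apply]

/-- Concatenation raises the degree by one. Up to signs it is a homotopy between `z ⊗ w ↦ aug(z) w`
and `z ⊗ w ↦ z aug(w)`. The recursion uses `Res.d_s` at each step, together with the vanishing of
the augmentation on concatenations. -/
theorem conc_d (z w : Res A) : Res.d (conc z w) =
    conc (Res.d z) w - conc (Res.deg (-1) z) (Res.d w) + Res.l (Res.aug z) w -
      Res.r (Res.aug w) (Res.deg (-1) z) := by
  refine Res.gen_induction (f := Res.d ∘ₗ conc.flip w)
    (g := conc.flip w ∘ₗ Res.d - conc.flip (Res.d w) ∘ₗ Res.deg (-1) + Res.l.flip w ∘ₗ Res.aug -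
      Res.r (Res.aug w) ∘ₗ Res.deg (-1)) (fun x y => ?_) (fun x z hz => ?_) z
  · simp only [LinearMap.comp_apply, LinearMap.flip_apply, LinearMap.add_apply,
      LinearMap.sub_apply, conc_l, conc_unit, Res.d_l, Res.d_s, Res.d_unit, Res.deg_l,
      Res.deg_unit, Res.aug_l, Res.aug_unit, map_zero, ← Res.l_r, Res.r_unit,
      map_sub, Res.l_mul]
    abel
  · simp only [LinearMap.comp_apply, LinearMap.flip_apply, LinearMap.add_apply,
      LinearMap.sub_apply] at hz ⊢
    have e1 : Res.deg (-1) (Res.s z) = -Res.s (Res.deg (-1) z) := by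
      rw [Res.s_deg]; exact (neg_smul _ _).trans (congrArg _ (one_smul _ _))
    simp only [conc_l, conc_s, Res.d_l, Res.d_s, hz, aug_conc, map_zero, sub_zero, Res.deg_l, e1,
      map_sub, map_add, map_neg, LinearMap.sub_apply, LinearMap.neg_apply, conc_unit, ← Res.l_r,
      ← Res.s_r, Res.aug_l, Res.aug_s, mul_zero, LinearMap.zero_apply]
    abel

/-! ### Closing up a single bar resolution -/

/-- The map `x ⊗ a ⊗ y ↦ y x ⊗ a` closing up the bar resolution. -/
def Res.close : Res A →ₗ[ℂ] Cyc A := hcHat (AlgHom.id ℂ A) (TensorProduct.lift (LinearMap.mul ℂ A).flip)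

@[simp]
theorem Res.close_gen (k x y) (a : Fin k → A) :
    Res.close (Res.gen k x y a) = Cyc.gen k (y * x) a :=
  (hcHat_lof (AlgHom.id ℂ A) _ k _).trans (by simp [Cyc.gen])

theorem Res.close_d (x : Res A) : Res.close (Res.d x) = Cyc.d (Res.close x) := by
  refine hcHat_hcTotD (β := Bimod.inner A) (β' := Bimod.regular A) (f := AlgHom.id ℂ A)
    (φ := TensorProduct.lift (LinearMap.mul ℂ A).flip) ⟨fun y m => ?_, fun y m => ?_⟩ x
  · induction m using TensorProduct.induction_on with
    | zero => simp
    | tmul q e => simp [mul_assoc]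
    | add m n hm hn => simp only [map_add, hm, hn]
  · induction m using TensorProduct.induction_on with
    | zero => simp
    | tmul q e => simp [mul_assoc]
    | add m n hm hn => simp only [map_add, hm, hn]

theorem Res.close_join (z : Cyc A) (y : A) : Res.close (Res.join z y) = Cyc.l y z :=
  Cyc.ext (f := Res.close ∘ₗ Res.join.flip y) (g := Cyc.l y)
    (fun k x a => by simp [Res.join_apply]) z

theorem Res.close_op (z : Cyc A) : Res.close (Cyc.op z) = z := by
  have := Res.close_join z 1
  rwa [Res.join_apply, Res.r_one, Cyc.l_one] at this

theorem Res.close_r (b : A) (x : Res A) : Res.close (Res.r b x) = Res.close (Res.l b x) :=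
  Res.ext (f := Res.close ∘ₗ Res.r b) (g := Res.close ∘ₗ Res.l b)
    (fun k x y a => by simp [mul_assoc]) x

/-- The augmentation `A ⊗ A^{⊗ 0} ≅ A` of the Hochschild complex. -/
def Cyc.aug : Cyc A →ₗ[ℂ] A := Res.aug ∘ₗ Cyc.op

theorem Cyc.aug_l (b : A) (x : Cyc A) : Cyc.aug (Cyc.l b x) = b * Cyc.aug x := by
  simp only [Cyc.aug, LinearMap.comp_apply, Cyc.op_l, Res.aug_l]

theorem Cyc.aug_deg (w : ℂ) (x : Cyc A) : Cyc.aug (Cyc.deg w x) = Cyc.aug x := by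
  simp only [Cyc.aug, LinearMap.comp_apply, Cyc.op_deg, Res.aug_deg]

theorem Res.aug_join (z : Cyc A) (y : A) : Res.aug (Res.join z y) = Cyc.aug z * y := by
  rw [Res.join_apply, Res.aug_r]; rfl

theorem Res.l_join (b : A) (z : Cyc A) (y : A) :
    Res.l b (Res.join z y) = Res.join (Cyc.l b z) y := by
  rw [Res.join_apply, Res.join_apply, Res.l_r, Cyc.op_l]

theorem Res.join_one (z : Cyc A) : Res.join z 1 = Cyc.op z := by rw [Res.join_apply, Res.r_one]

theorem Cyc.aug_map {B : Type u} [Ring B] [Algebra ℂ B] (f : A →ₐ[ℂ] B) (x : Cyc A) :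
    Cyc.aug (Cyc.map f x) = f (Cyc.aug x) :=
  Cyc.ext (f := Cyc.aug ∘ₗ Cyc.map f) (g := f.toLinearMap ∘ₗ Cyc.aug)
    (fun k x a => by cases k <;> simp [Cyc.aug]) x

end Concat
end HochschildWreath

end

noncomputable section

namespace HochschildWreath

set_option linter.unusedSectionVars false

/-! ### Removing a site from a cycle -/

section Merge

variable {V : Type u} [AddCommGroup V] [Module ℂ V]

/-- Replacing the first two factors `x₀ ⊗ x₁` by `φ x₀ x₁`. -/
def mergeT (φ : V →ₗ[ℂ] V →ₗ[ℂ] V) (l : ℕ) :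
    (⨂[ℂ] _ : Fin (l + 2), V) →ₗ[ℂ] ⨂[ℂ] _ : Fin (l + 1), V :=
  TensorProduct.lift ((consEquiv V l).conj.toLinearMap ∘ₗ
    LinearMap.rTensorHom (⨂[ℂ] _ : Fin l, V) ∘ₗ φ) ∘ₗ unconsT V (l + 1)

theorem consEquiv_symm_tprod (k : ℕ) (a : Fin (k + 1) → V) :
    (consEquiv V k).symm (PiTensorProduct.tprod ℂ a) =
      a 0 ⊗ₜ PiTensorProduct.tprod ℂ (Fin.tail a) := by
  rw [LinearEquiv.symm_apply_eq, consEquiv_tmul, Fin.cons_self_tail]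

theorem mergeT_tprod (φ : V →ₗ[ℂ] V →ₗ[ℂ] V) (l : ℕ) (x : Fin (l + 2) → V) :
    mergeT φ l (PiTensorProduct.tprod ℂ x) = PiTensorProduct.tprod ℂ
      (Fin.cons (φ (x 0) (x 1)) (fun j => x j.succ.succ) : Fin (l + 1) → V) := by
  rw [mergeT, LinearMap.comp_apply, unconsT_tprod, TensorProduct.lift.tmul]
  simp only [LinearMap.comp_apply, LinearEquiv.coe_coe, LinearEquiv.conj_apply,
    consEquiv_symm_tprod, LinearMap.coe_rTensorHom, LinearMap.rTensor_tmul, consEquiv_tmul]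
  rfl

/-- The map `φ` treats the first factor as an element of degree zero, killing its boundaries and
ignoring its parity. So the first summand of the differential vanishes and the others lose no sign.
-/
theorem mergeT_koszulD {φ : V →ₗ[ℂ] V →ₗ[ℂ] V} {ε d : V →ₗ[ℂ] V} (h1 : ∀ x y, φ (d x) y = 0)
    (h2 : ∀ x y, φ (ε x) y = φ x y) (h3 : ∀ x y, φ x (d y) = d (φ x y))
    (h4 : ∀ x y, φ x (ε y) = ε (φ x y)) (l : ℕ) (x : ⨂[ℂ] _ : Fin (l + 2), V) :
    mergeT φ l (koszulD (fun _ => ε) (fun _ => d) x) =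
      koszulD (fun _ => ε) (fun _ => d) (mergeT φ l x) := by
  refine pi_tensor_ext (φ := mergeT φ l ∘ₗ koszulD (fun _ => ε) (fun _ => d))
    (ψ := koszulD (fun _ => ε) (fun _ => d) ∘ₗ mergeT φ l) (fun x => ?_) x
  rw [LinearMap.comp_apply, LinearMap.comp_apply, koszulD_tprod, mergeT_tprod, koszulD_tprod,
    map_sum, Fin.sum_univ_succ]
  simp only [mergeT_tprod]
  rw [tprod_eq_zero 0 (by simp [h1]), zero_add]
  refine Finset.sum_congr rfl fun i _ => ?_
  congr 1; funext j
  refine Fin.cases ?_ (fun j => ?_) j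
  · rw [Fin.cons_zero, Fin.cons_zero, if_pos (Fin.succ_pos i), h2]
    simp only [← Fin.succ_zero_eq_one, Fin.succ_lt_succ_iff, Fin.succ_inj]
    split_ifs <;> simp [h3, h4]
  · simp only [Fin.cons_succ, Fin.succ_lt_succ_iff, Fin.succ_inj]

end Merge

section Cycle

variable {A : Type u} [Ring A] [Algebra ℂ A]

/-- Removing the first site of a cycle of bar resolutions. -/
def resDrop (l : ℕ) : ResT A (Fin (l + 2)) →ₗ[ℂ] ResT A (Fin (l + 1)) := mergeT (Res.l ∘ₗ Res.aug) l
/-- Removing the first site of a cycle of Hochschild complexes. -/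
def cycDrop (l : ℕ) : CycT A (Fin (l + 2)) →ₗ[ℂ] CycT A (Fin (l + 1)) := mergeT (Cyc.l ∘ₗ Cyc.aug) l

theorem resDrop_tprod (l : ℕ) (x : Fin (l + 2) → Res A) :
    resDrop l (PiTensorProduct.tprod ℂ x) = PiTensorProduct.tprod ℂ
      (Fin.cons (Res.l (Res.aug (x 0)) (x 1)) (fun j => x j.succ.succ) : Fin (l + 1) → Res A) :=
  mergeT_tprod _ l x
theorem cycDrop_tprod (l : ℕ) (x : Fin (l + 2) → Cyc A) :
    cycDrop l (PiTensorProduct.tprod ℂ x) = PiTensorProduct.tprod ℂ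
      (Fin.cons (Cyc.l (Cyc.aug (x 0)) (x 1)) (fun j => x j.succ.succ) : Fin (l + 1) → Cyc A) :=
  mergeT_tprod _ l x

theorem resDrop_resD (l : ℕ) (x : ResT A (Fin (l + 2))) :
    resDrop l (resD x) = resD (resDrop l x) :=
  mergeT_koszulD (fun x y => by simp [Res.aug_d]) (fun x y => by simp [Res.aug_deg])
    (fun x y => by simp [Res.d_l]) (fun x y => by simp [Res.deg_l]) l x

theorem resDrop_opT (l : ℕ) (z : CycT A (Fin (l + 2))) : resDrop l (opT z) = opT (cycDrop l z) := by
  refine pi_tensor_ext (φ := resDrop l ∘ₗ opT) (ψ := opT ∘ₗ cycDrop l) (fun x => ?_) z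
  simp only [LinearMap.comp_apply, opT_tprod, resDrop_tprod, cycDrop_tprod]
  congr 1; funext j
  refine Fin.cases ?_ (fun j => ?_) j
  · simp only [Fin.cons_zero, Cyc.op_l]; rfl
  · simp only [Fin.cons_succ]

theorem finRotate_symm_zero (l : ℕ) : (finRotate (l + 1)).symm 0 = Fin.last l := by
  rw [Equiv.symm_apply_eq, finRotate_last]

theorem finRotate_symm_succ (l : ℕ) (j : Fin l) : (finRotate (l + 1)).symm j.succ = j.castSucc := by
  rw [Equiv.symm_apply_eq, finRotate_apply, Fin.coeSucc_eq_succ]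

/-- Either way the last right end, then `aug(z₀)`, then `y₀` end up multiplied in this order on the
left of `z₁`. -/
theorem cycDrop_close (l : ℕ) (p : ResT A (Fin (l + 2))) :
    cycDrop l (close (finRotate (l + 2)) p) = close (finRotate (l + 1)) (resDrop l p) := by
  refine Res.tensor_ext (φ := cycDrop l ∘ₗ close (finRotate (l + 2)))
    (ψ := close (finRotate (l + 1)) ∘ₗ resDrop l) (fun z y p hp => ?_) p
  have h1 : (Fin.cons (Res.l (Res.aug (Res.join (z 0) (y 0))) (Res.join (z 1) (y 1)))
      (fun j => Res.join (z j.succ.succ) (y j.succ.succ)) : Fin (l + 1) → Res A) =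
      fun j => Res.join ((Fin.cons (Cyc.l (Cyc.aug (z 0) * y 0) (z 1)) (fun j => z j.succ.succ) :
        Fin (l + 1) → Cyc A) j) (y j.succ) := by
    funext j
    refine Fin.cases ?_ (fun j => ?_) j
    · simp only [Fin.cons_zero, Res.aug_join, Res.l_join]; rfl
    · simp only [Fin.cons_succ]
  rw [LinearMap.comp_apply, LinearMap.comp_apply, close_tprod, cycDrop_tprod, resDrop_tprod, h1,
    close_tprod]
  congr 1; funext j
  refine Fin.cases ?_ (fun j => ?_) j
  · simp only [Fin.cons_zero, finRotate_symm_zero, ← Fin.succ_zero_eq_one (n := l),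
      finRotate_symm_succ, Cyc.aug_l, Cyc.l_mul, Fin.castSucc_zero, Fin.succ_last]
  · simp only [Fin.cons_succ, finRotate_symm_succ, Fin.succ_castSucc]

theorem cycDrop_closeD (l : ℕ) (z : CycT A (Fin (l + 2))) :
    cycDrop l (closeD (finRotate (l + 2)) z) = closeD (finRotate (l + 1)) (cycDrop l z) := by
  rw [closeD_apply, cycDrop_close, resDrop_resD, resDrop_opT]; rfl

theorem hCompat_cycDrop (l : ℕ) : HCompat (closeD (finRotate (l + 2)))
    (closeD (finRotate (l + 1))) (cycDrop (A := A) l) := .of_comm (cycDrop_closeD l)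

/-- The contraction of the first site. -/
def contr (l : ℕ) : ResT A (Fin (l + 2)) →ₗ[ℂ] ResT A (Fin (l + 2)) :=
  koszulAt (fun _ => Res.deg (-1)) (fun _ => Res.s) 0

theorem contr_tprod (l : ℕ) (x : Fin (l + 2) → Res A) :
    contr l (PiTensorProduct.tprod ℂ x) =
      PiTensorProduct.tprod ℂ fun j => if j = 0 then Res.s (x j) else x j := by
  rw [contr, koszulAt_tprod]
  simp

theorem resDrop_contr (l : ℕ) (p : ResT A (Fin (l + 2))) : resDrop l (contr l p) = 0 := by
  refine pi_tensor_ext (φ := resDrop l ∘ₗ contr l) (ψ := 0) (fun x => ?_) p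
  rw [LinearMap.comp_apply, contr_tprod, resDrop_tprod]
  exact tprod_eq_zero 0 (by simp [Res.aug_s])

theorem contr_actR (l : ℕ) (b : AlgT A (Fin (l + 2))) (p : ResT A (Fin (l + 2))) :
    contr l (actR b p) = actR b (contr l p) := by
  refine algT_ext (φ := contr l ∘ₗ actR.flip p) (ψ := actR.flip (contr l p)) (fun b => ?_) b
  refine pi_tensor_ext (φ := contr l ∘ₗ actR (PiTensorProduct.tprod ℂ b))
    (ψ := actR (PiTensorProduct.tprod ℂ b) ∘ₗ contr l) (fun x => ?_) p
  simp only [LinearMap.comp_apply, contr_tprod, actR_tprod_tprod]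
  congr 1; funext j
  split_ifs <;> simp [Res.s_r]

theorem contr_actL (l : ℕ) (b : Fin (l + 2) → A) (hb : b 0 = 1) (p : ResT A (Fin (l + 2))) :
    contr l (actL (PiTensorProduct.tprod ℂ b) p) = actL (PiTensorProduct.tprod ℂ b) (contr l p) := by
  refine pi_tensor_ext (φ := contr l ∘ₗ actL (PiTensorProduct.tprod ℂ b))
    (ψ := actL (PiTensorProduct.tprod ℂ b) ∘ₗ contr l) (fun x => ?_) p
  simp only [LinearMap.comp_apply, contr_tprod, actL_tprod_tprod]
  congr 1; funext j
  split_ifs with h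
  · rw [h, hb, Res.l_one, Res.l_one]
  · rfl

/-- The contraction of the first site, on the closed up complex. -/
def cycContr (l : ℕ) : CycT A (Fin (l + 2)) →ₗ[ℂ] CycT A (Fin (l + 2)) :=
  close (finRotate (l + 2)) ∘ₗ contr l ∘ₗ opT

/-- The failure of the contraction to commute with closing up. -/
def cycDefect (l : ℕ) : ResT A (Fin (l + 2)) →ₗ[ℂ] CycT A (Fin (l + 2)) :=
  cycContr l ∘ₗ close (finRotate (l + 2)) - close (finRotate (l + 2)) ∘ₗ contr l

/-- The contraction `s` commutes with right multiplications but not with left ones. The only element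
that closing up puts on the left of site `0` is the right end of the last site, so the defect
vanishes when that end is trivial. -/
theorem cycDefect_join (l : ℕ) (z : Fin (l + 2) → Cyc A) (y : Fin (l + 2) → A)
    (hy : y (Fin.last (l + 1)) = 1) :
    cycDefect l (PiTensorProduct.tprod ℂ fun i => Res.join (z i) (y i)) = 0 := by
  rw [tprod_join, cycDefect, LinearMap.sub_apply, LinearMap.comp_apply, LinearMap.comp_apply,
    close_actR_opT, cycContr, LinearMap.comp_apply, LinearMap.comp_apply, opT_cycL, permT_tprod,
    contr_actL _ _ (by rw [finRotate_symm_zero, hy]), ← permT_tprod, ← close_actR, contr_actR,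
    sub_self]

theorem cycDefect_update (l : ℕ) (z : Fin (l + 2) → Cyc A) (i : Fin (l + 2))
    (hi : i ≠ Fin.last (l + 1)) (w : Res A) : cycDefect l (PiTensorProduct.tprod ℂ
      (Function.update (fun i => Cyc.op (z i)) i w)) = 0 := by
  refine Res.ext (f := cycDefect l ∘ₗ
    (PiTensorProduct.tprod ℂ).toLinearMap (fun i => Cyc.op (z i)) i) (g := 0) (fun k x y a => ?_) w
  rw [LinearMap.comp_apply, MultilinearMap.toLinearMap_apply, LinearMap.zero_apply,
    ← cycDefect_join l (Function.update z i (Cyc.gen k x a)) (Function.update 1 i y)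
      (by rw [Function.update_of_ne hi.symm]; rfl)]
  congr 2; funext j
  by_cases hj : j = i
  · subst hj; simp [Res.join_apply]
  · simp [hj, Res.join_one]

/-- The operator measuring the degree of the last site. -/
def lastDeg (l : ℕ) (i : Fin (l + 2)) : ℂ := if i = Fin.last (l + 1) then 2 else 1

/-- Gluing multiplies ends by elements of degree zero, so the degree of every single site is
preserved. -/
theorem close_sitewise {ι : Type} [Fintype ι] [LinearOrder ι] (c : Equiv.Perm ι) (w : ι → ℂ)
    (p : ResT A ι) : close c (PiTensorProduct.map (fun i => Res.deg (w i)) p) =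
      PiTensorProduct.map (fun i => Cyc.deg (w i)) (close c p) := by
  refine Res.tensor_ext (φ := close c ∘ₗ PiTensorProduct.map (fun i => Res.deg (w i)))
    (ψ := PiTensorProduct.map (fun i => Cyc.deg (w i)) ∘ₗ close c) (fun z y p hp => ?_) p
  simp only [LinearMap.comp_apply, PiTensorProduct.map_tprod, Res.deg_join, close_tprod, Cyc.deg_l]

theorem opT_sitewise {ι : Type} [Fintype ι] [LinearOrder ι] (w : ι → ℂ) (z : CycT A ι) :
    opT (PiTensorProduct.map (fun i => Cyc.deg (w i)) z) =
      PiTensorProduct.map (fun i => Res.deg (w i)) (opT z) := by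
  refine pi_tensor_ext (φ := opT ∘ₗ PiTensorProduct.map (fun i => Cyc.deg (w i)))
    (ψ := PiTensorProduct.map (fun i => Res.deg (w i)) ∘ₗ opT) (fun z => ?_) z
  simp [PiTensorProduct.map_tprod, Cyc.op_deg]

theorem Res.deg_one (x : Res A) : Res.deg 1 x = x :=
  Res.ext (f := Res.deg 1) (g := LinearMap.id) (fun k x y a => by simp) x
theorem Cyc.deg_one (x : Cyc A) : Cyc.deg 1 x = x :=
  Cyc.ext (f := Cyc.deg 1) (g := LinearMap.id) (fun k x a => by simp) x

theorem isGr_lastDeg (l : ℕ) :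
    IsGr (PiTensorProduct.map fun i => Cyc.deg (A := A) (lastDeg l i)) := by
  refine isGr_map fun i => ?_
  unfold lastDeg
  split_ifs
  · exact Cyc.isGr
  · exact IsGr.of_span Set.univ (by simp) fun x _ => ⟨0, by simp [Cyc.deg_one]⟩

theorem contr_lastDeg (l : ℕ) (p : ResT A (Fin (l + 2))) :
    contr l (PiTensorProduct.map (fun i => Res.deg (lastDeg l i)) p) =
      PiTensorProduct.map (fun i => Res.deg (lastDeg l i)) (contr l p) := by
  refine pi_tensor_ext (φ := contr l ∘ₗ PiTensorProduct.map (fun i => Res.deg (lastDeg l i)))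
    (ψ := PiTensorProduct.map (fun i => Res.deg (lastDeg l i)) ∘ₗ contr l) (fun x => ?_) p
  simp only [LinearMap.comp_apply, PiTensorProduct.map_tprod, contr_tprod]
  congr 1; funext j
  split_ifs with h
  · have h0 : lastDeg l j = 1 := by rw [h]; exact if_neg (Fin.last_pos.ne)
    simp [h0, Res.deg_one]
  · rfl

theorem cycDefect_lastDeg (l : ℕ) (p : ResT A (Fin (l + 2))) :
    cycDefect l (PiTensorProduct.map (fun i => Res.deg (lastDeg l i)) p) =
      PiTensorProduct.map (fun i => Cyc.deg (lastDeg l i)) (cycDefect l p) := by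
  simp only [cycDefect, cycContr, LinearMap.sub_apply, LinearMap.comp_apply, close_sitewise,
    opT_sitewise, contr_lastDeg, map_sub]

/-- The last summand of the differential. -/
def lastD (l : ℕ) : ResT A (Fin (l + 2)) →ₗ[ℂ] ResT A (Fin (l + 2)) :=
  koszulAt (fun _ => Res.deg (-1)) (fun _ => Res.d) (Fin.last (l + 1))

theorem lastD_lastDeg (l : ℕ) (p : ResT A (Fin (l + 2))) :
    lastD l (PiTensorProduct.map (fun i => Res.deg (lastDeg l i)) p) =
      (2 : ℂ) • PiTensorProduct.map (fun i => Res.deg (lastDeg l i)) (lastD l p) := by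
  refine pi_tensor_ext (φ := lastD l ∘ₗ PiTensorProduct.map (fun i => Res.deg (lastDeg l i)))
    (ψ := (2 : ℂ) • (PiTensorProduct.map (fun i => Res.deg (lastDeg l i)) ∘ₗ lastD l))
    (fun x => ?_) p
  have h1 : ∀ y : Fin (l + 2) → Res A, lastD l (PiTensorProduct.tprod ℂ y) =
      PiTensorProduct.tprod ℂ (fun j => if j = Fin.last (l + 1) then Res.d (y j)
        else Res.deg (-1) (y j)) := by
    intro y
    rw [lastD, koszulAt_tprod]
    congr 1; funext j
    rcases eq_or_ne j (Fin.last (l + 1)) with h | h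
    · simp [h]
    · simp [h, Fin.lt_last_iff_ne_last.2 h]
  rw [LinearMap.comp_apply, LinearMap.smul_apply, LinearMap.comp_apply, PiTensorProduct.map_tprod,
    h1, h1, PiTensorProduct.map_tprod]
  have h2 : (fun j => if j = Fin.last (l + 1) then Res.d (Res.deg (lastDeg l j) (x j))
      else Res.deg (-1) (Res.deg (lastDeg l j) (x j))) = fun j =>
      (if j = Fin.last (l + 1) then (2 : ℂ) else 1) • Res.deg (lastDeg l j)
        (if j = Fin.last (l + 1) then Res.d (x j) else Res.deg (-1) (x j)) := by
    funext j
    split_ifs with h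
    · simp [lastDeg, h, Res.d_deg]
    · simp [lastDeg, h, Res.deg_one]
  rw [h2, tprod_smul_prod, Finset.prod_ite_eq' Finset.univ, if_pos (Finset.mem_univ _)]

/-- Inserting a trivial first site. -/
def cycInsert (l : ℕ) : CycT A (Fin (l + 1)) →ₗ[ℂ] CycT A (Fin (l + 2)) :=
  consT (Cyc A) (l + 1) (Cyc.gen 0 1 Fin.elim0)

theorem cycInsert_tprod (l : ℕ) (x : Fin (l + 1) → Cyc A) :
    cycInsert l (PiTensorProduct.tprod ℂ x) = PiTensorProduct.tprod ℂ
      (Fin.cons (Cyc.gen 0 1 Fin.elim0) x : Fin (l + 2) → Cyc A) := consT_tprod _ _ _ _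

theorem cycDrop_cycInsert (l : ℕ) (x : CycT A (Fin (l + 1))) : cycDrop l (cycInsert l x) = x := by
  refine pi_tensor_ext (φ := cycDrop l ∘ₗ cycInsert l) (ψ := LinearMap.id) (fun x => ?_) x
  rw [LinearMap.comp_apply, cycInsert_tprod, cycDrop_tprod, LinearMap.id_apply]
  congr 1; funext j
  refine Fin.cases ?_ (fun j => ?_) j
  · rw [Fin.cons_zero, Fin.cons_zero, ← Fin.succ_zero_eq_one, Fin.cons_succ]
    simp [Cyc.aug, Cyc.l_one]
  · simp

theorem Res.join_cyc_unit (b : A) : Res.join (Cyc.gen 0 1 Fin.elim0) b = Res.unit b := by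
  rw [Res.join_apply, Cyc.op_gen, Res.r_gen, one_mul, Res.unit_apply]

/-- At site `0` the anticommutator of `d` and `s` is `1 - unit ∘ aug`. Closing up after site `0` has
been replaced by `unit (aug z₀)` moves `aug z₀` to site `1` and leaves a trivial site behind. -/
theorem resD_contr (l : ℕ) (z : CycT A (Fin (l + 2))) :
    close (finRotate (l + 2)) (resD (contr l (opT z)) + contr l (resD (opT z))) =
      z - cycInsert l (cycDrop l z) := by
  have h0 : ∀ x : ResT A (Fin (l + 2)), resD (contr l x) + contr l (resD x) =
      mapAt (fun _ => Res.d ∘ₗ Res.s + Res.s ∘ₗ Res.d) {0} x := fun x =>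
    koszulD_homotopy (fun _ => Res.superDiff.inv) (fun _ => Res.superDiff.anti)
      (fun _ x => by rw [Res.s_deg, neg_smul, one_smul]) 0 x
  rw [h0]
  refine pi_tensor_ext (φ := close (finRotate (l + 2)) ∘ₗ
    mapAt (fun _ => Res.d ∘ₗ Res.s + Res.s ∘ₗ Res.d) {0} ∘ₗ opT)
    (ψ := LinearMap.id - cycInsert l ∘ₗ cycDrop l) (fun z => ?_) z
  simp only [LinearMap.comp_apply, LinearMap.sub_apply, LinearMap.id_apply]
  rw [opT_tprod, mapAt_tprod]
  have h1 : (fun j => if j ∈ ({0} : Finset (Fin (l + 2))) then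
      (Res.d ∘ₗ Res.s + Res.s ∘ₗ Res.d : Res A →ₗ[ℂ] Res A) (Cyc.op (z j)) else Cyc.op (z j)) =
      Function.update (fun j => Cyc.op (z j)) 0 (Cyc.op (z 0) - Res.unit (Cyc.aug (z 0))) := by
    funext j
    by_cases hj : j = 0
    · subst hj
      simp only [Finset.mem_singleton, if_true, LinearMap.add_apply, LinearMap.comp_apply, Res.d_s,
        Function.update_self]
      rw [sub_right_comm, sub_add_cancel]; rfl
    · simp [hj]
  rw [h1, MultilinearMap.map_update_sub, map_sub, Function.update_eq_self, ← opT_tprod, close_opT]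
  congr 1
  have h2 : Function.update (fun j => Cyc.op (z j)) 0 (Res.unit (Cyc.aug (z 0))) = fun j =>
      Res.join (Function.update z 0 (Cyc.gen 0 1 Fin.elim0) j)
        (Function.update (1 : Fin (l + 2) → A) 0 (Cyc.aug (z 0)) j) := by
    funext j
    by_cases hj : j = 0
    · subst hj; simp [Res.join_cyc_unit]
    · simp [hj, Res.join_one]
  rw [h2, close_tprod, cycDrop_tprod, cycInsert_tprod]
  congr 1; funext j
  refine Fin.cases ?_ (fun j => Fin.cases ?_ (fun j => ?_) j) j
  · rw [finRotate_symm_zero, Function.update_of_ne (Fin.last_pos.ne'), Fin.cons_zero]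
    simp
  · rw [finRotate_symm_succ]
    simp
  · rw [finRotate_symm_succ, Function.update_of_ne (by simp [Fin.ext_iff])]
    simp [Cyc.l_one]

/-- The bar resolution at the first site is contracted by `s`. This contraction does not descend to
the closed-up complex. The failure is caused only by the part of the differential at the last site,
and that part lowers the degree of the last site, while closing up and `contr`, which acts at site
`0`, preserve it. So the error is locally nilpotent. -/
theorem cycDrop_bijective (l : ℕ) :
    Function.Bijective (Homology.map (cycDrop (A := A) l) (hCompat_cycDrop l)) := by
  refine homology_map_bijective_of_unipotent (h := cycContr l) (N := cycDefect l ∘ₗ lastD l ∘ₗ opT)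
    (closeD_closeD _) _ (cycDrop_closeD l) (fun x => ⟨_, cycDrop_cycInsert l x⟩) (fun x => ?_)
    (fun x _ => ?_) (fun x hx => ?_) (IsGr.locally_nilpotent (isGr_lastDeg l) fun x => ?_)
  · rw [cycContr, LinearMap.comp_apply, LinearMap.comp_apply, cycDrop_close, resDrop_contr, map_zero]
  · simp only [LinearMap.comp_apply, cycDefect, LinearMap.sub_apply, cycContr, map_sub,
      cycDrop_close, resDrop_contr, map_zero, sub_zero]
  · have h1 : ∀ x : CycT A (Fin (l + 2)), cycDefect l (resD (opT x)) = cycDefect l (lastD l (opT x)) := by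
      refine fun x => pi_tensor_ext (φ := cycDefect l ∘ₗ resD ∘ₗ opT)
        (ψ := cycDefect l ∘ₗ lastD l ∘ₗ opT) (fun x => ?_) x
      simp only [LinearMap.comp_apply, resD, koszulD, LinearMap.sum_apply, map_sum]
      refine Finset.sum_eq_single _ (fun i _ hi => ?_) (by simp)
      rw [opT_tprod, koszulAt_tprod]
      rw [← cycDefect_update l (fun j => if j < i then Cyc.deg (-1) (x j) else x j) i hi
        (Res.d (Cyc.op (x i)))]
      congr 2; funext j
      rcases lt_trichotomy j i with h | h | h
      · simp [h, h.ne, Cyc.op_deg]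
      · subst h; simp
      · simp [h.not_gt, h.ne']
    have h2 := resD_contr l x
    rw [hx, map_zero, sub_zero, map_add, close_resD] at h2
    have h3 := h1 x
    rw [cycDefect, LinearMap.sub_apply, LinearMap.comp_apply, LinearMap.comp_apply, ← cycDefect] at h3
    have h4 : cycContr l (closeD (finRotate (l + 2)) x) = cycDefect l (lastD l (opT x)) +
        close (finRotate (l + 2)) (contr l (resD (opT x))) := by rw [← h3, sub_add_cancel]; rfl
    rw [h4, add_comm (cycDefect l _), ← add_assoc]
    exact congrArg (· + cycDefect l (lastD l (opT x))) h2
  · simp only [LinearMap.comp_apply, opT_sitewise, lastD_lastDeg, map_smul, cycDefect_lastDeg]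

end Cycle
end HochschildWreath

end

noncomputable section

namespace HochschildWreath

set_option linter.unusedSectionVars false

/-! ### Contracting a cycle to a single site -/

section Contract

variable {A : Type u} [Ring A] [Algebra ℂ A]

/-- Contracting a cycle of Hochschild complexes to the last site. -/
def cycContract : ∀ l, CycT A (Fin (l + 1)) →ₗ[ℂ] Cyc A
  | 0 => (PiTensorProduct.subsingletonEquiv (0 : Fin 1)).toLinearMap
  | l + 1 => cycContract l ∘ₗ cycDrop l

theorem cycContract_zero (x : Fin 1 → Cyc A) : cycContract 0 (PiTensorProduct.tprod ℂ x) = x 0 := by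
  rw [cycContract, LinearEquiv.coe_coe, PiTensorProduct.subsingletonEquiv_apply_tprod]

theorem cycContract_tprod (l : ℕ) (x : Fin (l + 1) → Cyc A) :
    cycContract l (PiTensorProduct.tprod ℂ x) =
      Cyc.l (List.ofFn fun i : Fin l => Cyc.aug (x i.castSucc)).prod (x (Fin.last l)) := by
  induction l with
  | zero => simp [cycContract_zero, Cyc.l_one]
  | succ l ih =>
    rw [cycContract, LinearMap.comp_apply, cycDrop_tprod, ih]
    cases l with
    | zero => simp [Cyc.l_one]
    | succ l =>
      rw [List.ofFn_succ, List.ofFn_succ, List.ofFn_succ]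
      simp [← Fin.succ_last, Cyc.aug_l, mul_assoc]

theorem cycContract_zero_closeD (z : CycT A (Fin 1)) :
    cycContract 0 (closeD (finRotate 1) z) = Cyc.d (cycContract 0 z) := by
  have h1 : ∀ p, cycContract 0 (close (finRotate 1) p) =
      Res.close (((PiTensorProduct.subsingletonEquiv (0 : Fin 1)).toLinearMap :
        ResT A (Fin 1) →ₗ[ℂ] Res A) p) := by
    refine Res.tensor_ext (φ := cycContract 0 ∘ₗ close (finRotate 1))
      (ψ := Res.close ∘ₗ (PiTensorProduct.subsingletonEquiv (0 : Fin 1)).toLinearMap)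
      (fun z y p hp => ?_)
    rw [LinearMap.comp_apply, LinearMap.comp_apply, LinearEquiv.coe_coe, close_tprod,
      cycContract_zero, PiTensorProduct.subsingletonEquiv_apply_tprod, Res.close_join]
    rfl
  refine pi_tensor_ext (φ := cycContract 0 ∘ₗ closeD (finRotate 1)) (ψ := Cyc.d ∘ₗ cycContract 0)
    (fun z => ?_) z
  rw [LinearMap.comp_apply, LinearMap.comp_apply, closeD_apply, h1, cycContract_zero, opT_tprod, resD,
    koszulD_tprod, Fin.sum_univ_one, LinearEquiv.coe_coe,
    PiTensorProduct.subsingletonEquiv_apply_tprod, if_neg (lt_irrefl _),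
    if_pos rfl, Res.close_d, Res.close_op]

theorem cycContract_closeD (l : ℕ) (z : CycT A (Fin (l + 1))) :
    cycContract l (closeD (finRotate (l + 1)) z) = Cyc.d (cycContract l z) := by
  induction l with
  | zero => exact cycContract_zero_closeD z
  | succ l ih =>
    rw [cycContract, LinearMap.comp_apply, cycDrop_closeD, ih]; rfl

theorem hCompat_cycContract (l : ℕ) :
    HCompat (closeD (finRotate (l + 1))) (Cyc.d (A := A)) (cycContract l) :=
  .of_comm (cycContract_closeD l)

theorem cycContract_bijective (l : ℕ) :
    Function.Bijective (Homology.map (cycContract (A := A) l) (hCompat_cycContract l)) := by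
  induction l with
  | zero =>
    let e : CycT A (Fin 1) ≃ₗ[ℂ] Cyc A := PiTensorProduct.subsingletonEquiv (0 : Fin 1)
    have h := Homology.map_bijective_of_equiv e (d := closeD (finRotate 1)) (d' := Cyc.d)
      (fun x => cycContract_zero_closeD x) (hCompat_cycContract 0)
    exact h
  | succ l ih =>
    have h := ih.comp (cycDrop_bijective l)
    have h2 : ⇑(Homology.map (cycContract (A := A) (l + 1)) (hCompat_cycContract (l + 1))) =
        Homology.map _ (hCompat_cycContract l) ∘ Homology.map _ (hCompat_cycDrop l) :=
      funext fun c => (Homology.map_comp _ _ _ _ c).symm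
    rw [h2]
    exact h

theorem cycContract_deg (l : ℕ) (w : ℂ) (x : CycT A (Fin (l + 1))) :
    cycContract l (cycDeg w x) = Cyc.deg w (cycContract l x) := by
  refine pi_tensor_ext (φ := cycContract l ∘ₗ cycDeg w) (ψ := Cyc.deg w ∘ₗ cycContract l)
    (fun x => ?_) x
  simp only [LinearMap.comp_apply, cycDeg_tprod, cycContract_tprod, Cyc.aug_deg, Cyc.deg_l]

theorem cycContract_map {B : Type u} [Ring B] [Algebra ℂ B] (f : A →ₐ[ℂ] B) (l : ℕ)
    (x : CycT A (Fin (l + 1))) : cycContract l (cycMap f x) = Cyc.map f (cycContract l x) := by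
  refine pi_tensor_ext (φ := cycContract l ∘ₗ cycMap f) (ψ := Cyc.map f ∘ₗ cycContract l)
    (fun x => ?_) x
  simp only [LinearMap.comp_apply, cycMap_tprod, cycContract_tprod, Cyc.aug_map, Cyc.map_l,
    map_list_prod, List.map_ofFn]
  rfl

/-! ### Rotations act trivially -/

/-- The augmentation is invariant under the parity operator, so on an odd element it equals its own
negative. For this reason augmented sites never contribute Koszul signs. -/
theorem Cyc.aug_eq_zero_of_odd {x : Cyc A} {p : ℕ} (hx : Cyc.deg (-1) x = (-1 : ℂ) ^ p • x)
    (hp : Odd p) : Cyc.aug x = 0 := by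
  have h := congrArg Cyc.aug hx
  rw [Cyc.aug_deg, hp.neg_one_pow, map_smul, neg_one_smul] at h
  have h2 : (2 : ℂ) • Cyc.aug x = 0 := by
    rw [two_smul]
    nth_rewrite 1 [h]
    exact neg_add_cancel _
  exact (smul_eq_zero.1 h2).resolve_left two_ne_zero

/-- Contracting a cycle to the site before the last one. -/
def cycContract' (l : ℕ) : CycT A (Fin (l + 2)) →ₗ[ℂ] Cyc A :=
  cycContract (l + 1) ∘ₗ cycT (finRotate (l + 2))

/-- The rotation moves only the last factor past the others and preserves their order. If that
factor is even there is no sign; if it is odd, its augmentation is zero and the sign is irrelevant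
to `cycContract'`. -/
theorem ksign_finRotate (l : ℕ) (p : Fin (l + 2) → ℕ) (hp : Even (p (Fin.last (l + 1)))) :
    ksign (finRotate (l + 2)) p = 1 := by
  refine Finset.prod_eq_one fun i _ => Finset.prod_eq_one fun j _ => ?_
  split_ifs with h
  · rcases eq_or_ne j (Fin.last _) with hj | hj
    · subst hj
      exact (Even.mul_left hp _).neg_one_pow
    · exfalso
      have hi : i ≠ Fin.last _ := (h.1.trans (Fin.lt_last_iff_ne_last.2 hj)).ne
      obtain ⟨i, rfl⟩ := Fin.exists_castSucc_eq.2 hi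
      obtain ⟨j, rfl⟩ := Fin.exists_castSucc_eq.2 hj
      rw [← finRotate_symm_succ, ← finRotate_symm_succ, Equiv.apply_symm_apply,
        Equiv.apply_symm_apply] at h
      simp only [finRotate_symm_succ, Fin.castSucc_lt_castSucc_iff, Fin.succ_lt_succ_iff] at h
      exact lt_asymm h.1 h.2
  · rfl

theorem cycContract'_tprod (l : ℕ) (x : Fin (l + 2) → Cyc A) (p : Fin (l + 2) → ℕ)
    (hx : ∀ i, Cyc.deg (-1) (x i) = (-1 : ℂ) ^ p i • x i) :
    cycContract' l (PiTensorProduct.tprod ℂ x) =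
      Cyc.l (Cyc.aug (x (Fin.last (l + 1))) *
        (List.ofFn fun i : Fin l => Cyc.aug (x i.castSucc.castSucc)).prod) (x (Fin.last l).castSucc) := by
  rw [cycContract', LinearMap.comp_apply, cycT, koszulT_tprod _ _ _ p hx, map_smul, cycContract_tprod,
    List.ofFn_succ, List.prod_cons]
  simp only [← Fin.succ_castSucc, ← Fin.succ_last, finRotate_symm_succ, Fin.castSucc_zero,
    finRotate_symm_zero]
  rcases Nat.even_or_odd (p (Fin.last (l + 1))) with h | h
  · rw [ksign_finRotate l p h, one_smul, Fin.succ_last]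
  · have h0 := Cyc.aug_eq_zero_of_odd (hx _) h
    rw [Fin.succ_last, h0, zero_mul, map_zero, LinearMap.zero_apply, smul_zero]

/-- With three or more sites the first is neither the last nor the one before it, so it only
contributes its augmentation. This reduces rotations to cycles with two sites. -/
theorem cycContract'_cycDrop (l : ℕ) (x : CycT A (Fin (l + 3))) :
    cycContract' (l + 1) x = cycContract' l (cycDrop (l + 1) x) := by
  refine super_ext (fun _ => Cyc.deg (-1)) (fun _ => Cyc.superDiff.inv) (φ := cycContract' (l + 1))
    (ψ := cycContract' l ∘ₗ cycDrop (l + 1)) (fun x p hx => ?_) x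
  rw [LinearMap.comp_apply, cycDrop_tprod, cycContract'_tprod _ _ p hx]
  by_cases h0 : Even (p 0)
  · rw [cycContract'_tprod l _ (fun j => p j.succ)]
    · rw [← Fin.succ_last (l + 1), ← Fin.succ_last l, Fin.cons_succ]
      cases l with
      | zero => simp [Cyc.l_mul]
      | succ l =>
        rw [List.ofFn_succ, List.ofFn_succ, List.ofFn_succ]
        simp [← Fin.succ_last, Cyc.aug_l, mul_assoc]
    · intro j
      refine Fin.cases ?_ (fun j => ?_) j
      · rw [Fin.cons_zero, Cyc.deg_l, hx, map_smul]; rfl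
      · rw [Fin.cons_succ, hx]
  · have h0 := Cyc.aug_eq_zero_of_odd (hx 0) (Nat.not_even_iff_odd.1 h0)
    rw [tprod_eq_zero 0 (by simp [h0]), map_zero, List.ofFn_succ]
    simp [h0]

/-- Concatenation of the two sites of a cycle of length two. -/
def concT : ResT A (Fin 2) →ₗ[ℂ] Res A :=
  TensorProduct.lift (conc ∘ₗ Res.deg (-1)) ∘ₗ
    LinearMap.lTensor _ (PiTensorProduct.subsingletonEquiv (0 : Fin 1)).toLinearMap ∘ₗ
    unconsT (Res A) 1

theorem concT_tprod (x : Fin 2 → Res A) :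
    concT (PiTensorProduct.tprod ℂ x) = conc (Res.deg (-1) (x 0)) (x 1) := by
  rw [concT, LinearMap.comp_apply, LinearMap.comp_apply, unconsT_tprod, LinearMap.lTensor_tmul,
    LinearEquiv.coe_coe, PiTensorProduct.subsingletonEquiv_apply_tprod]
  rfl

/-- The parity twist in `concT` matches the signs of `conc_d` with those of the differential on two
sites, so that only the two augmentation terms remain. -/
theorem concT_resD (x : Fin 2 → Res A) :
    Res.d (concT (PiTensorProduct.tprod ℂ x)) + concT (resD (PiTensorProduct.tprod ℂ x)) =
      Res.l (Res.aug (x 0)) (x 1) - Res.r (Res.aug (x 1)) (x 0) := by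
  rw [concT_tprod, conc_d, resD, koszulD_tprod, Fin.sum_univ_two, map_add, concT_tprod, concT_tprod,
    Res.superDiff.inv, Res.aug_deg]
  simp only [Res.superDiff.inv, Res.superDiff.anti, map_neg, LinearMap.neg_apply, Fin.isValue,
    lt_self_iff_false, if_false, if_true, zero_lt_one, one_ne_zero, zero_ne_one, not_lt_zero]
  abel

/-- A cycle with two sites has two junctions. Concatenation is balanced at one of them and
`Res.close` is cyclic at the other, so gluing in advance changes nothing. -/
theorem concT_close (p : ResT A (Fin 2)) :
    Res.close (concT (opT (close (finRotate 2) p))) = Res.close (concT p) := by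
  refine Res.tensor_ext (φ := Res.close ∘ₗ concT ∘ₗ opT ∘ₗ close (finRotate 2))
    (ψ := Res.close ∘ₗ concT) (fun z y p hp => ?_) p
  have h1 : (finRotate 2).symm 0 = 1 := rfl
  have h2 : (finRotate 2).symm 1 = 0 := rfl
  simp only [LinearMap.comp_apply, close_tprod, opT_tprod, concT_tprod, h1, h2]
  simp only [Cyc.op_l, Res.join_apply, Res.deg_l, Res.deg_r, conc_l, conc_r, conc_r_left,
    Res.close_r]

theorem cycContract_two_homotopy (z : CycT A (Fin 2)) :
    Cyc.d (Res.close (concT (opT z))) + Res.close (concT (opT (closeD (finRotate 2) z))) =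
      cycContract 1 z - cycContract' 0 z := by
  rw [closeD_apply, concT_close, ← Res.close_d, ← map_add]
  refine super_ext (fun _ => Cyc.deg (-1)) (fun _ => Cyc.superDiff.inv)
    (φ := Res.close ∘ₗ (Res.d ∘ₗ concT + concT ∘ₗ resD) ∘ₗ opT)
    (ψ := cycContract 1 - cycContract' 0) (fun x p hx => ?_) z
  simp only [LinearMap.comp_apply, LinearMap.add_apply, LinearMap.sub_apply, opT_tprod, concT_resD]
  rw [cycContract_tprod, cycContract'_tprod _ _ p hx, map_sub, Res.close_r, ← Cyc.op_l, ← Cyc.op_l,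
    Res.close_op, Res.close_op]
  simp [Cyc.aug]

theorem hCompat_cycT_finRotate (l : ℕ) : HCompat (closeD (A := A) (finRotate (l + 1)))
    (closeD (finRotate (l + 1))) (cycT (finRotate (l + 1))) :=
  .of_comm fun z => (closeD_cycT _ (fun _ => rfl) z).symm

/-- Rotations of a cycle act trivially on homology. -/
theorem cycContract_rotate (l : ℕ) (c : Homology (closeD (A := A) (finRotate (l + 1)))) :
    Homology.map (cycContract l) (hCompat_cycContract l)
      (Homology.map (cycT (finRotate (l + 1))) (hCompat_cycT_finRotate l) c) =
      Homology.map (cycContract l) (hCompat_cycContract l) c := by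
  have h0 : ∀ l, HCompat (closeD (finRotate (l + 2))) (Cyc.d (A := A)) (cycContract' l) := fun l =>
    (hCompat_cycContract (l + 1)).comp (hCompat_cycT_finRotate (l + 1))
  cases l with
  | zero =>
    congr 1
    rw [← Homology.map_id (.id _) c]
    obtain ⟨x, hx, rfl⟩ := c.exists_rep
    have h1 : cycT (finRotate 1) x = x := by
      rw [finRotate_one]; exact cycT_refl x
    simp only [Homology.map_mk, h1, LinearMap.id_apply]
  | succ l =>
    rw [Homology.map_comp _ _ (hCompat_cycContract (l + 1)) (hCompat_cycT_finRotate (l + 1))]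
    change Homology.map (cycContract' l) (h0 l) c = _
    induction l with
    | zero =>
      symm
      -- For two sites, the closed-up concatenation is a homotopy between the contractions to either
      -- site.
      exact Homology.map_eq_of_homotopy _ _ (fun z hz => ⟨Res.close (concT (opT z)), by
        rw [← cycContract_two_homotopy, hz, map_zero, map_zero, map_zero, add_zero]⟩) c
    | succ l ih =>
      have h1 : Homology.map (cycContract' (l + 1)) (h0 (l + 1)) c =
          Homology.map (cycContract' l) (h0 l) (Homology.map _ (hCompat_cycDrop (l + 1)) c) := by
        rw [Homology.map_comp]
        exact Homology.map_congr (LinearMap.ext (cycContract'_cycDrop l)) _ _ c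
      rw [h1, ih, Homology.map_comp]
      rfl

end Contract
end HochschildWreath

end

/-! ### The resolution of the crossed product and its commutator quotient -/

noncomputable section

namespace HochschildWreath

set_option linter.unusedSectionVars false

/-! ### A resolution of the crossed product -/

section Wreath

variable {A : Type u} [Ring A] [Algebra ℂ A] {n : ℕ} {W : Type u} [AddCommGroup W] [Module ℂ W]

/-- Linear maps out of the crossed product. -/
def sumE (F : Equiv.Perm (Fin n) → TPow A n →ₗ[ℂ] W) : CrossedProduct A n →ₗ[ℂ] W :=
  Finsupp.lsum ℂ F ∘ₗ (SkewMonoidAlgebra.coeffLinearEquiv (S := ℂ) (k := TPow A n)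
    (G := Equiv.Perm (Fin n))).toLinearMap

@[simp]
theorem sumE_single (F : Equiv.Perm (Fin n) → TPow A n →ₗ[ℂ] W) (g : Equiv.Perm (Fin n))
    (b : TPow A n) : sumE F (SkewMonoidAlgebra.single g b) = F g b :=
  Finsupp.sum_single_index (map_zero (F g))

theorem crossed_ext {f g : CrossedProduct A n →ₗ[ℂ] W}
    (h : ∀ s b, f (SkewMonoidAlgebra.single s b) = g (SkewMonoidAlgebra.single s b))
    (x : CrossedProduct A n) : f x = g x := by
  rw [SkewMonoidAlgebra.lhom_ext (φ := f) (ψ := g) h]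

variable (A n) in
/-- The crossed product of the tensor power of the bar resolution with the symmetric group. -/
abbrev WrQ : Type u := Equiv.Perm (Fin n) →₀ ResT A (Fin n)

theorem wrQ_ext {f g : WrQ A n →ₗ[ℂ] W}
    (h : ∀ s p, f (Finsupp.single s p) = g (Finsupp.single s p)) (x : WrQ A n) : f x = g x := by
  rw [Finsupp.lhom_ext (φ := f) (ψ := g) h]

theorem permT_smul (g : Equiv.Perm (Fin n)) (b : TPow A n) : permT g b = g • b := rfl

variable (A n) in
/-- The left action of the crossed product. -/
def wrL : CrossedProduct A n →ₗ[ℂ] WrQ A n →ₗ[ℂ] WrQ A n :=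
  sumE fun h => (Finsupp.lsum ℂ).toLinearMap ∘ₗ
    LinearMap.pi fun g => (actL.compl₂ (resT h)).compr₂ (Finsupp.lsingle (h * g))

variable (A n) in
/-- The right action of the crossed product. -/
def wrR : CrossedProduct A n →ₗ[ℂ] WrQ A n →ₗ[ℂ] WrQ A n :=
  sumE fun h => (Finsupp.lsum ℂ).toLinearMap ∘ₗ
    LinearMap.pi fun g => (actR ∘ₗ permT g).compr₂ (Finsupp.lsingle (g * h))

-- The element `Finsupp.single g p` plays the role of `p g`. Moving `h` past `p` costs the Koszul
-- action `resT h`, whereas on the right `g` moves past elements of `A^{⊗ n}`, which are even, so no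
-- signs occur there.
@[simp]
theorem wrL_single (h g : Equiv.Perm (Fin n)) (b : TPow A n) (p : ResT A (Fin n)) :
    (wrL A n) (SkewMonoidAlgebra.single h b) (Finsupp.single g p) =
      Finsupp.single (h * g) (actL b (resT h p)) := by
  rw [wrL, sumE_single]
  exact Finsupp.lsum_single ℂ _ _ _

@[simp]
theorem wrR_single (h g : Equiv.Perm (Fin n)) (b : TPow A n) (p : ResT A (Fin n)) :
    (wrR A n) (SkewMonoidAlgebra.single h b) (Finsupp.single g p) =
      Finsupp.single (g * h) (actR (g • b) p) := by
  rw [wrR, sumE_single]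
  exact Finsupp.lsum_single ℂ _ _ _

theorem resT_mul (g h : Equiv.Perm (Fin n)) (p : ResT A (Fin n)) :
    resT (g * h) p = resT g (resT h p) := (resT_resT h g p).symm

variable (A n) in
/-- The crossed product of the bar resolution as a bimodule. -/
def wrBimod : Bimod (CrossedProduct A n) (WrQ A n) where
  l := (wrL A n)
  r := (wrR A n)
  l_one q := by
    refine wrQ_ext (f := (wrL A n) 1) (g := LinearMap.id) (fun s p => ?_) q
    rw [SkewMonoidAlgebra.one_def, wrL_single, one_mul, actL_one, Equiv.Perm.one_def, resT_refl]
    rfl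
  r_one q := by
    refine wrQ_ext (f := (wrR A n) 1) (g := LinearMap.id) (fun s p => ?_) q
    rw [SkewMonoidAlgebra.one_def, wrR_single, mul_one, smul_one, actR_one]
    rfl
  l_mul x y q := by
    refine crossed_ext (f := (wrL A n).flip q ∘ₗ LinearMap.mulRight ℂ y) (g := (wrL A n).flip ((wrL A n) y q))
      (fun h b => ?_) x
    refine crossed_ext (f := (wrL A n).flip q ∘ₗ LinearMap.mulLeft ℂ (SkewMonoidAlgebra.single h b))
      (g := (wrL A n) (SkewMonoidAlgebra.single h b) ∘ₗ (wrL A n).flip q) (fun k c => ?_) y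
    refine wrQ_ext (f := (wrL A n) (SkewMonoidAlgebra.single h b * SkewMonoidAlgebra.single k c))
      (g := (wrL A n) (SkewMonoidAlgebra.single h b) ∘ₗ (wrL A n) (SkewMonoidAlgebra.single k c))
      (fun s p => ?_) q
    rw [SkewMonoidAlgebra.single_mul_single, LinearMap.comp_apply, wrL_single, wrL_single,
      wrL_single, resT_actL, actL_actL, resT_mul, mul_assoc]
    rfl
  r_mul x y q := by
    refine crossed_ext (f := (wrR A n).flip q ∘ₗ LinearMap.mulRight ℂ y) (g := (wrR A n) y ∘ₗ (wrR A n).flip q)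
      (fun h b => ?_) x
    refine crossed_ext (f := (wrR A n).flip q ∘ₗ LinearMap.mulLeft ℂ (SkewMonoidAlgebra.single h b))
      (g := (wrR A n).flip ((wrR A n) (SkewMonoidAlgebra.single h b) q)) (fun k c => ?_) y
    refine wrQ_ext (f := (wrR A n) (SkewMonoidAlgebra.single h b * SkewMonoidAlgebra.single k c))
      (g := (wrR A n) (SkewMonoidAlgebra.single k c) ∘ₗ (wrR A n) (SkewMonoidAlgebra.single h b))
      (fun s p => ?_) q
    rw [SkewMonoidAlgebra.single_mul_single, LinearMap.comp_apply, wrR_single, wrR_single,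
      wrR_single, actR_actR, mul_assoc, smul_mul', smul_smul]
  comm x y q := by
    refine crossed_ext (f := (wrL A n).flip ((wrR A n) y q)) (g := (wrR A n) y ∘ₗ (wrL A n).flip q) (fun h b => ?_) x
    refine crossed_ext (f := (wrL A n) (SkewMonoidAlgebra.single h b) ∘ₗ (wrR A n).flip q)
      (g := (wrR A n).flip ((wrL A n) (SkewMonoidAlgebra.single h b) q)) (fun k c => ?_) y
    refine wrQ_ext (f := (wrL A n) (SkewMonoidAlgebra.single h b) ∘ₗ (wrR A n) (SkewMonoidAlgebra.single k c))
      (g := (wrR A n) (SkewMonoidAlgebra.single k c) ∘ₗ (wrL A n) (SkewMonoidAlgebra.single h b))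
      (fun s p => ?_) q
    rw [LinearMap.comp_apply, LinearMap.comp_apply, wrR_single, wrL_single, wrL_single,
      wrR_single, resT_actR, actL_actR, mul_assoc, permT_smul, smul_smul]

@[simp]
theorem wrBimod_l : (wrBimod A n).l = (wrL A n) := rfl
@[simp]
theorem wrBimod_r : (wrBimod A n).r = (wrR A n) := rfl

/-- The operator acting by `T` on all coefficients. -/
def wrMap {B : Type u} [Ring B] [Algebra ℂ B] (T : ResT A (Fin n) →ₗ[ℂ] ResT B (Fin n)) :
    WrQ A n →ₗ[ℂ] WrQ B n := Finsupp.mapRange.linearMap T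

@[simp]
theorem wrMap_single {B : Type u} [Ring B] [Algebra ℂ B]
    (T : ResT A (Fin n) →ₗ[ℂ] ResT B (Fin n)) (g : Equiv.Perm (Fin n)) (p : ResT A (Fin n)) :
    wrMap T (Finsupp.single g p) = Finsupp.single g (T p) := by
  simp [wrMap]

theorem bimodHom_wrMap {B : Type u} [Ring B] [Algebra ℂ B] (f : A →ₐ[ℂ] B)
    (T : ResT A (Fin n) →ₗ[ℂ] ResT B (Fin n)) (h1 : ∀ b p, T (actL b p) = actL (algMap f b) (T p))
    (h2 : ∀ b p, T (actR b p) = actR (algMap f b) (T p)) (h3 : ∀ g : Equiv.Perm (Fin n), ∀ p,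
      T (resT g p) = resT g (T p)) :
    BimodHom (wrBimod A n) (wrBimod B n) (crossedMap n f) (wrMap T) where
  left x q := by
    refine crossed_ext (f := wrMap T ∘ₗ (wrL A n).flip q)
      (g := (wrL B n).flip (wrMap T q) ∘ₗ (crossedMap n f).toLinearMap) (fun h b => ?_) x
    refine wrQ_ext (f := wrMap T ∘ₗ (wrL A n) (SkewMonoidAlgebra.single h b))
      (g := (wrL B n) (crossedMap n f (SkewMonoidAlgebra.single h b)) ∘ₗ wrMap T) (fun s p => ?_) q
    rw [crossedMap_single, LinearMap.comp_apply, LinearMap.comp_apply, wrL_single, wrMap_single,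
      wrMap_single, wrL_single, h1, h3]
    rfl
  right x q := by
    refine crossed_ext (f := wrMap T ∘ₗ (wrR A n).flip q)
      (g := (wrR B n).flip (wrMap T q) ∘ₗ (crossedMap n f).toLinearMap) (fun h b => ?_) x
    refine wrQ_ext (f := wrMap T ∘ₗ (wrR A n) (SkewMonoidAlgebra.single h b))
      (g := (wrR B n) (crossedMap n f (SkewMonoidAlgebra.single h b)) ∘ₗ wrMap T) (fun s p => ?_) q
    rw [crossedMap_single, LinearMap.comp_apply, LinearMap.comp_apply, wrR_single, wrMap_single,
      wrMap_single, wrR_single, h2, ← tpowAlgHom_smul]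
    rfl

theorem crossedMap_id : crossedMap n (AlgHom.id ℂ A) = AlgHom.id ℂ (CrossedProduct A n) := by
  refine AlgHom.ext fun x => crossed_ext (f := (crossedMap n (AlgHom.id ℂ A)).toLinearMap)
    (g := LinearMap.id) (fun s b => ?_) x
  change crossedMap n (AlgHom.id ℂ A) _ = _
  rw [crossedMap_single]
  congr 1
  exact pi_tensor_ext (φ := (tpowAlgHom n (AlgHom.id ℂ A)).toLinearMap) (ψ := LinearMap.id)
    (fun x => tpowMap_tprod _ _ _) b

theorem algMap_id (b : TPow A n) : algMap (AlgHom.id ℂ A) b = b :=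
  pi_tensor_ext (φ := algMap (AlgHom.id ℂ A)) (ψ := LinearMap.id) (fun x => by simp) b

theorem bimodHom_wrMap_id (T : ResT A (Fin n) →ₗ[ℂ] ResT A (Fin n))
    (h1 : ∀ b p, T (actL b p) = actL b (T p)) (h2 : ∀ b p, T (actR b p) = actR b (T p))
    (h3 : ∀ g : Equiv.Perm (Fin n), ∀ p, T (resT g p) = resT g (T p)) :
    BimodHom (wrBimod A n) (wrBimod A n) (AlgHom.id ℂ _) (wrMap T) := by
  rw [← crossedMap_id]
  exact bimodHom_wrMap _ T (fun b p => by rw [algMap_id, h1]) (fun b p => by rw [algMap_id, h2]) h3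

/-- The differential on the coefficients. -/
def wrD : WrQ A n →ₗ[ℂ] WrQ A n := wrMap resD
/-- The degree operator on the coefficients. -/
def wrDeg (w : ℂ) : WrQ A n →ₗ[ℂ] WrQ A n := wrMap (resDeg w)

theorem wrD_single (g : Equiv.Perm (Fin n)) (p : ResT A (Fin n)) :
    wrD (Finsupp.single g p) = Finsupp.single g (resD p) := wrMap_single _ _ _
theorem wrDeg_single (w : ℂ) (g : Equiv.Perm (Fin n)) (p : ResT A (Fin n)) :
    wrDeg w (Finsupp.single g p) = Finsupp.single g (resDeg w p) := wrMap_single _ _ _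

theorem bimodHom_wrD : BimodHom (wrBimod A n) (wrBimod A n) (AlgHom.id ℂ _) wrD :=
  bimodHom_wrMap_id _ resD_actL resD_actR fun g p => (resT_resD g p).symm

theorem wrD_wrD (q : WrQ A n) : wrD (wrD q) = 0 :=
  wrQ_ext (f := wrD ∘ₗ wrD) (g := 0) (fun g p => by
    rw [LinearMap.comp_apply, wrD_single, wrD_single, superDiff_resD.sq, Finsupp.single_zero]; rfl) q

theorem wrD_wrDeg (w : ℂ) (q : WrQ A n) : wrD (wrDeg w q) = w • wrDeg w (wrD q) :=
  wrQ_ext (f := wrD ∘ₗ wrDeg w) (g := w • (wrDeg w ∘ₗ wrD)) (fun g p => by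
    rw [LinearMap.comp_apply, LinearMap.smul_apply, LinearMap.comp_apply, wrD_single, wrDeg_single,
      wrDeg_single, wrD_single, resD_resDeg, Finsupp.smul_single]) q

theorem isGr_wrDeg : IsGr (wrDeg (A := A) (n := n) 2) := by
  let S : Set (WrQ A n) := {x | ∃ g p, ∃ k : ℕ, resDeg (2 : ℂ) p = (2 : ℂ) ^ k • p ∧
    x = Finsupp.single g p}
  refine IsGr.of_span S ?_ ?_
  · rw [eq_top_iff]
    rintro x -
    induction x using Finsupp.induction_linear with
    | zero => exact Submodule.zero_mem _
    | add x y hx hy => exact Submodule.add_mem _ hx hy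
    | single g p =>
      refine isGr_resDeg.induction (motive := fun p => Finsupp.single g p ∈ Submodule.span ℂ S)
        (fun k p hp => Submodule.subset_span ⟨g, p, k, hp, rfl⟩) ?_ (fun x y hx hy => ?_) p
      · rw [Finsupp.single_zero]; exact Submodule.zero_mem _
      · rw [Finsupp.single_add]; exact Submodule.add_mem _ hx hy
  · rintro _ ⟨g, p, k, hp, rfl⟩
    exact ⟨k, by rw [wrDeg_single, hp, Finsupp.smul_single]⟩

variable (A n) in
/-- The augmentation. -/
def wrAug : WrQ A n →ₗ[ℂ] CrossedProduct A n :=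
  Finsupp.lsum ℂ fun g => SkewMonoidAlgebra.lsingle ℂ g ∘ₗ resAug

@[simp]
theorem wrAug_single (g : Equiv.Perm (Fin n)) (p : ResT A (Fin n)) :
    (wrAug A n) (Finsupp.single g p) = SkewMonoidAlgebra.single g (resAug p) :=
  Finsupp.lsum_single ℂ _ _ _

theorem bimodHom_wrAug :
    BimodHom (wrBimod A n) (Bimod.regular (CrossedProduct A n)) (AlgHom.id ℂ _) (wrAug A n) where
  left x q := by
    refine crossed_ext (f := (wrAug A n) ∘ₗ (wrL A n).flip q) (g := LinearMap.mulRight ℂ ((wrAug A n) q))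
      (fun h b => ?_) x
    refine wrQ_ext (f := (wrAug A n) ∘ₗ (wrL A n) (SkewMonoidAlgebra.single h b))
      (g := LinearMap.mulLeft ℂ (SkewMonoidAlgebra.single h b) ∘ₗ (wrAug A n)) (fun s p => ?_) q
    rw [LinearMap.comp_apply, LinearMap.comp_apply, wrL_single, wrAug_single, wrAug_single,
      LinearMap.mulLeft_apply, SkewMonoidAlgebra.single_mul_single, resAug_actL, resAug_resT]
    rfl
  right x q := by
    refine crossed_ext (f := (wrAug A n) ∘ₗ (wrR A n).flip q) (g := LinearMap.mulLeft ℂ ((wrAug A n) q))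
      (fun h b => ?_) x
    refine wrQ_ext (f := (wrAug A n) ∘ₗ (wrR A n) (SkewMonoidAlgebra.single h b))
      (g := LinearMap.mulRight ℂ (SkewMonoidAlgebra.single h b) ∘ₗ (wrAug A n)) (fun s p => ?_) q
    rw [LinearMap.comp_apply, LinearMap.comp_apply, wrR_single, wrAug_single, wrAug_single,
      LinearMap.mulRight_apply, SkewMonoidAlgebra.single_mul_single, resAug_actR]

theorem wrAug_wrD (q : WrQ A n) : (wrAug A n) (wrD q) = 0 :=
  wrQ_ext (f := (wrAug A n) ∘ₗ wrD) (g := 0) (fun g p => by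
    rw [LinearMap.comp_apply, wrD_single, wrAug_single, resAug_resD, SkewMonoidAlgebra.single_zero]
    rfl) q

theorem wrAug_wrDeg (w : ℂ) (q : WrQ A n) : (wrAug A n) (wrDeg w q) = (wrAug A n) q :=
  wrQ_ext (f := (wrAug A n) ∘ₗ wrDeg w) (g := (wrAug A n)) (fun g p => by
    rw [LinearMap.comp_apply, wrDeg_single, wrAug_single, resAug_resDeg, wrAug_single]) q

variable (A n) in
/-- The total differential on the Hochschild complex with coefficients in the resolution. -/
def wrTot : HC (CrossedProduct A n) (WrQ A n) →ₗ[ℂ] HC (CrossedProduct A n) (WrQ A n) :=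
  totD (wrBimod A n) wrD

theorem hCompat_wrAug : HCompat (wrTot A n) (hcTotD (Bimod.regular (CrossedProduct A n)))
    (hcHat (AlgHom.id ℂ _) (wrAug A n)) := by
  refine .of_comm fun x => ?_
  have h := hcHat_totD (dQ := wrD) (dQ' := 0) bimodHom_wrAug
    (fun q => by rw [wrAug_wrD, LinearMap.zero_apply]) x
  rw [totD_zero] at h
  exact h

/-- A contraction of the tensor power of the bar resolution is applied to the coefficient of each
permutation separately. It need not respect the bimodule structure, since `hcHat_aug_bijective` asks
only for a linear contraction. -/
theorem wrAug_bijective : Function.Bijective (Homology.map (d := wrTot A n)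
    (d' := hcTotD (Bimod.regular (CrossedProduct A n))) (hcHat (AlgHom.id ℂ _) (wrAug A n))
    hCompat_wrAug) := by
  obtain ⟨σ, h, hσ, hh, hah⟩ := exists_resAug_contraction (A := A) (ι := Fin n)
  refine hcHat_aug_bijective bimodHom_wrD wrD_wrD bimodHom_wrAug wrAug_wrD
    (sumE fun g => Finsupp.lsingle g ∘ₗ σ) (wrMap h) (fun x => ?_) (fun q => ?_) (fun q => ?_) _
  · refine crossed_ext (f := (wrAug A n) ∘ₗ sumE fun g => Finsupp.lsingle g ∘ₗ σ) (g := LinearMap.id)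
      (fun g b => ?_) x
    rw [LinearMap.comp_apply, sumE_single, LinearMap.comp_apply, Finsupp.lsingle_apply,
      wrAug_single, hσ]
    rfl
  · refine wrQ_ext (f := wrD ∘ₗ wrMap h + wrMap h ∘ₗ wrD) (g := LinearMap.id -
      (sumE fun g => Finsupp.lsingle g ∘ₗ σ) ∘ₗ (wrAug A n)) (fun g p => ?_) q
    rw [LinearMap.add_apply, LinearMap.sub_apply, LinearMap.comp_apply, LinearMap.comp_apply,
      LinearMap.comp_apply, wrMap_single, wrD_single, wrD_single, wrMap_single, wrAug_single,
      sumE_single, ← Finsupp.single_add, hh, Finsupp.single_sub]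
    rfl
  · refine wrQ_ext (f := (wrAug A n) ∘ₗ wrMap h) (g := 0) (fun g p => ?_) q
    rw [LinearMap.comp_apply, wrMap_single, wrAug_single, hah, SkewMonoidAlgebra.single_zero]
    rfl

end Wreath
end HochschildWreath

end

noncomputable section

namespace HochschildWreath

set_option linter.unusedSectionVars false

/-! ### The resolution of the crossed product is relatively projective -/

section Split

variable {A : Type u} [Ring A] [Algebra ℂ A] {n : ℕ} {W : Type u} [AddCommGroup W] [Module ℂ W]

variable (A n) in
/-- A splitting of the right multiplication that is a homomorphism of bimodules. -/
def wrSplit : WrQ A n →ₗ[ℂ] WrQ A n ⊗[ℂ] CrossedProduct A n :=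
  Finsupp.lsum ℂ fun g => (Fintype.card (Equiv.Perm (Fin n)) : ℂ)⁻¹ •
    ∑ h : Equiv.Perm (Fin n), TensorProduct.map (Finsupp.lsingle h)
      (SkewMonoidAlgebra.lsingle ℂ (h⁻¹ * g) ∘ₗ permT h⁻¹) ∘ₗ splitR

/-- For every `h` the element `z b g` is the product of `z h` with `(h⁻¹ • b) (h⁻¹ g)`. Averaging
over `h` makes the splitting linear for the left action of `S_n`; the invertibility of `n!` enters
here. -/
theorem wrSplit_single (g : Equiv.Perm (Fin n)) (b : TPow A n) (z : CycT A (Fin n)) :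
    wrSplit A n (Finsupp.single g (actR b (opT z))) =
      (Fintype.card (Equiv.Perm (Fin n)) : ℂ)⁻¹ • ∑ h : Equiv.Perm (Fin n),
        Finsupp.single h (opT z) ⊗ₜ SkewMonoidAlgebra.single (h⁻¹ * g) (h⁻¹ • b) := by
  refine (Finsupp.lsum_single ℂ _ _ _).trans ?_
  rw [LinearMap.smul_apply, LinearMap.sum_apply]
  refine congrArg _ (Finset.sum_congr rfl fun h _ => ?_)
  rw [LinearMap.comp_apply, splitR_actR_opT]
  rfl

theorem wrQ_gen_ext {f g : WrQ A n →ₗ[ℂ] W}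
    (h : ∀ s b z, f (Finsupp.single s (actR b (opT z))) = g (Finsupp.single s (actR b (opT z))))
    (x : WrQ A n) : f x = g x := by
  refine wrQ_ext (fun s p => ?_) x
  induction p using resT_induction with
  | zero => simp only [Finsupp.single_zero, map_zero]
  | add x y hx hy => simp only [Finsupp.single_add, map_add, hx, hy]
  | mem z b => exact h s b z

theorem bimodHom_wrSplit :
    BimodHom (wrBimod A n) (wrBimod A n).extend (AlgHom.id ℂ _) (wrSplit A n) where
  left x q := by
    refine crossed_ext (f := wrSplit A n ∘ₗ (wrL A n).flip q)
      (g := (wrBimod A n).extend.l.flip (wrSplit A n q)) (fun k c => ?_) x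
    refine wrQ_gen_ext (f := wrSplit A n ∘ₗ wrL A n (SkewMonoidAlgebra.single k c))
      (g := (wrBimod A n).extend.l (SkewMonoidAlgebra.single k c) ∘ₗ wrSplit A n)
      (fun g b z => ?_) q
    rw [LinearMap.comp_apply, LinearMap.comp_apply, wrL_single, resT_actR, resT_opT, actL_actR,
      ← opT_cycL, wrSplit_single, wrSplit_single, map_smul, map_sum]
    -- Left multiplication by `k` permutes the summands of the average.
    refine congrArg _ (Fintype.sum_equiv (Equiv.mulLeft k⁻¹) _ _ fun h => ?_)
    rw [Bimod.extend_l, wrBimod_l, wrL_single, Equiv.coe_mulLeft, resT_opT, ← opT_cycL]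
    simp [mul_assoc, permT_smul, smul_smul]
  right x q := by
    refine crossed_ext (f := wrSplit A n ∘ₗ (wrR A n).flip q)
      (g := (wrBimod A n).extend.r.flip (wrSplit A n q)) (fun k c => ?_) x
    refine wrQ_gen_ext (f := wrSplit A n ∘ₗ wrR A n (SkewMonoidAlgebra.single k c))
      (g := (wrBimod A n).extend.r (SkewMonoidAlgebra.single k c) ∘ₗ wrSplit A n)
      (fun g b z => ?_) q
    rw [LinearMap.comp_apply, LinearMap.comp_apply, wrR_single, actR_actR, wrSplit_single,
      wrSplit_single, map_smul, map_sum]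
    refine congrArg _ (Finset.sum_congr rfl fun h _ => ?_)
    rw [Bimod.extend_r, SkewMonoidAlgebra.single_mul_single, smul_mul', smul_smul, mul_assoc]

theorem lift_wrR_wrSplit (q : WrQ A n) :
    TensorProduct.lift (wrBimod A n).r.flip (wrSplit A n q) = q := by
  refine wrQ_gen_ext (f := TensorProduct.lift (wrBimod A n).r.flip ∘ₗ wrSplit A n)
    (g := LinearMap.id) (fun g b z => ?_) q
  rw [LinearMap.comp_apply, wrSplit_single, map_smul, map_sum]
  simp only [TensorProduct.lift.tmul, LinearMap.flip_apply, wrBimod_r, wrR_single, smul_smul,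
    mul_inv_cancel, one_smul, mul_inv_cancel_left, Finset.sum_const, Finset.card_univ]
  rw [← Nat.cast_smul_eq_nsmul ℂ, smul_smul, inv_mul_cancel₀, one_smul]
  · rfl
  · exact Nat.cast_ne_zero.2 Fintype.card_ne_zero

theorem swapMul_wrSplit (g : Equiv.Perm (Fin n)) (b : TPow A n) (z : CycT A (Fin n)) :
    swapMul (wrBimod A n) (wrSplit A n) (Finsupp.single g (actR b (opT z))) =
      (Fintype.card (Equiv.Perm (Fin n)) : ℂ)⁻¹ • ∑ h : Equiv.Perm (Fin n),
        Finsupp.single (h⁻¹ * g * h) (actL (h⁻¹ • b) (resT (h⁻¹ * g) (opT z))) := by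
  rw [swapMul, LinearMap.comp_apply, wrSplit_single, map_smul, map_sum]
  simp only [TensorProduct.lift.tmul, LinearMap.flip_apply, wrBimod_l, wrL_single]

theorem wrSplit_wrDeg (w : ℂ) (q : WrQ A n) :
    wrSplit A n (wrDeg w q) = LinearMap.rTensor _ (wrDeg w) (wrSplit A n q) := by
  refine wrQ_gen_ext (f := wrSplit A n ∘ₗ wrDeg w)
    (g := LinearMap.rTensor _ (wrDeg w) ∘ₗ wrSplit A n) (fun g b z => ?_) q
  rw [LinearMap.comp_apply, LinearMap.comp_apply, wrDeg_single, resDeg_actR, ← opT_cycDeg,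
    wrSplit_single, wrSplit_single, map_smul, map_sum]
  simp only [LinearMap.rTensor_tmul, wrDeg_single, opT_cycDeg]

end Split

/-! ### Closing up along the conjugacy classes -/

section Close

variable {A : Type u} [Ring A] [Algebra ℂ A] {n : ℕ} {Ω : Type} [Fintype Ω] [LinearOrder Ω]

/-- The bijections conjugating the permutation `c` to `g⁻¹`. -/
def conjugators (c : Equiv.Perm Ω) (g : Equiv.Perm (Fin n)) : Finset (Ω ≃ Fin n) :=
  {e | ∀ i, e (c i) = g⁻¹ (e i)}

/-- The centralizer of a permutation. -/
def centralizers (c : Equiv.Perm Ω) : Finset (Equiv.Perm Ω) := {z | ∀ i, z (c i) = c (z i)}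

theorem mem_conjugators {c : Equiv.Perm Ω} {g : Equiv.Perm (Fin n)} {e : Ω ≃ Fin n} :
    e ∈ conjugators c g ↔ ∀ i, e (c i) = g⁻¹ (e i) := by simp [conjugators]

theorem mem_centralizers {c z : Equiv.Perm Ω} :
    z ∈ centralizers c ↔ ∀ i, z (c i) = c (z i) := by simp [centralizers]

theorem card_centralizers_ne_zero (c : Equiv.Perm Ω) : ((centralizers c).card : ℂ) ≠ 0 :=
  Nat.cast_ne_zero.2 (Finset.card_ne_zero.2 ⟨1, mem_centralizers.2 fun _ => rfl⟩)

theorem trans_mem_conjugators {c z : Equiv.Perm Ω} {g : Equiv.Perm (Fin n)} {e : Ω ≃ Fin n}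
    (hz : z ∈ centralizers c) (he : e ∈ conjugators c g) : z.trans e ∈ conjugators c g := by
  rw [mem_centralizers] at hz
  rw [mem_conjugators] at he ⊢
  intro i
  simp [hz, he]

theorem symm_mem_centralizers {c z : Equiv.Perm Ω} (hz : z ∈ centralizers c) :
    z.symm ∈ centralizers c := by
  rw [mem_centralizers] at hz ⊢
  intro i
  rw [Equiv.symm_apply_eq, hz, Equiv.apply_symm_apply]

/-- The conjugators form a torsor under the centralizer. -/
theorem sum_conjugators {M : Type*} [AddCommMonoid M] {c : Equiv.Perm Ω}
    {g : Equiv.Perm (Fin n)} {e : Ω ≃ Fin n} (he : e ∈ conjugators c g) (F : (Ω ≃ Fin n) → M) :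
    ∑ e' ∈ conjugators c g, F e' = ∑ z ∈ centralizers c, F (z.trans e) := by
  refine (Finset.sum_bij' (fun z _ => z.trans e) (fun e' _ => e'.trans e.symm)
    (fun z hz => trans_mem_conjugators hz he) (fun e' he' => ?_) (fun z _ => ?_) (fun e' _ => ?_)
    fun _ _ => rfl).symm
  · rw [mem_conjugators] at he he'
    rw [mem_centralizers]
    intro i
    rw [Equiv.trans_apply, Equiv.symm_apply_eq, he', he]
    simp
  · ext i; simp
  · ext i; simp

theorem card_conjugators {c : Equiv.Perm Ω} {g : Equiv.Perm (Fin n)} {e : Ω ≃ Fin n}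
    (he : e ∈ conjugators c g) : (conjugators c g).card = (centralizers c).card := by
  rw [Finset.card_eq_sum_ones, sum_conjugators he, Finset.card_eq_sum_ones]

/-- Closing up all coefficients along bijections that conjugate to `c`. -/
def wrClose (c : Equiv.Perm Ω) : WrQ A n →ₗ[ℂ] CycT A Ω :=
  Finsupp.lsum ℂ fun g => ((centralizers c).card : ℂ)⁻¹ •
    ∑ e ∈ conjugators c g, close c ∘ₗ resT e.symm

theorem wrClose_single (c : Equiv.Perm Ω) (g : Equiv.Perm (Fin n)) (p : ResT A (Fin n)) :
    wrClose c (Finsupp.single g p) = ((centralizers c).card : ℂ)⁻¹ •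
      ∑ e ∈ conjugators c g, close c (resT e.symm p) := by
  refine (Finsupp.lsum_single ℂ _ _ _).trans ?_
  rw [LinearMap.smul_apply, LinearMap.sum_apply]
  rfl

/-- The right action sends `p g` and `b` to `p (g • b) g`. Modulo commutators, multiplying `p` by
`b'` on the right therefore amounts to multiplying it by `g⁻¹ • b'` on the left. This is the gluing
rule of `close` for `g⁻¹`, and the reason why `conjugators` refers to the inverse. The permutation
`h` itself is absorbed by reindexing the conjugators. -/
theorem wrClose_wrL (c : Equiv.Perm Ω) (x : CrossedProduct A n) (q : WrQ A n) :
    wrClose c (wrL A n x q) = wrClose c (wrR A n x q) := by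
  refine crossed_ext (f := wrClose c ∘ₗ (wrL A n).flip q) (g := wrClose c ∘ₗ (wrR A n).flip q)
    (fun h b => ?_) x
  refine wrQ_ext (f := wrClose c ∘ₗ wrL A n (SkewMonoidAlgebra.single h b))
    (g := wrClose c ∘ₗ wrR A n (SkewMonoidAlgebra.single h b)) (fun g p => ?_) q
  rw [LinearMap.comp_apply, LinearMap.comp_apply, wrL_single, wrR_single, wrClose_single,
    wrClose_single]
  refine congrArg _ (Finset.sum_bij' (fun e _ => e.trans h⁻¹) (fun e _ => e.trans h)
    (fun e he => ?_) (fun e he => ?_) (fun e _ => by ext; simp) (fun e _ => by ext; simp)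
    fun e he => ?_)
  · rw [mem_conjugators] at he ⊢
    intro i
    simp [he]
  · rw [mem_conjugators] at he ⊢
    intro i
    simp [he]
  · rw [mem_conjugators] at he
    have h1 : Equiv.trans g ((e.trans h⁻¹).symm.trans c) = e.symm := by
      refine Equiv.ext fun i => e.injective ?_
      rw [Equiv.trans_apply, Equiv.trans_apply, he, Equiv.Perm.inv_eq_iff_eq]
      simp [Equiv.Perm.inv_def]
    have h2 : Equiv.trans h e.symm = (e.trans h⁻¹).symm := rfl
    rw [resT_actL, resT_actR, close_actR, resT_resT, ← permT_smul, permT_trans, permT_trans, h1, h2]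

theorem wrClose_wrD (c : Equiv.Perm Ω) (q : WrQ A n) :
    wrClose c (wrD q) = closeD c (wrClose c q) := by
  refine wrQ_ext (f := wrClose c ∘ₗ wrD) (g := closeD c ∘ₗ wrClose c) (fun g p => ?_) q
  rw [LinearMap.comp_apply, LinearMap.comp_apply, wrD_single, wrClose_single, wrClose_single,
    map_smul, map_sum]
  simp only [resT_resD, close_resD]

theorem wrClose_wrDeg (c : Equiv.Perm Ω) (w : ℂ) (q : WrQ A n) :
    wrClose c (wrDeg w q) = cycDeg w (wrClose c q) := by
  refine wrQ_ext (f := wrClose c ∘ₗ wrDeg w) (g := cycDeg w ∘ₗ wrClose c) (fun g p => ?_) q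
  rw [LinearMap.comp_apply, LinearMap.comp_apply, wrDeg_single, wrClose_single, wrClose_single,
    map_smul, map_sum]
  simp only [resT_resDeg, close_resDeg]

theorem wrClose_wrMap {B : Type u} [Ring B] [Algebra ℂ B] (f : A →ₐ[ℂ] B) (c : Equiv.Perm Ω)
    (q : WrQ A n) : wrClose c (wrMap (resMap f) q) = cycMap f (wrClose c q) := by
  refine wrQ_ext (f := wrClose c ∘ₗ wrMap (resMap f)) (g := cycMap f ∘ₗ wrClose c)
    (fun g p => ?_) q
  rw [LinearMap.comp_apply, LinearMap.comp_apply, wrMap_single, wrClose_single, wrClose_single,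
    map_smul, map_sum]
  simp only [← resMap_resT, close_resMap]

/-- Averaging over the centralizer. -/
def cycAverage (c : Equiv.Perm Ω) : CycT A Ω →ₗ[ℂ] CycT A Ω :=
  ((centralizers c).card : ℂ)⁻¹ • ∑ z ∈ centralizers c, cycT z

theorem cycAverage_apply (c : Equiv.Perm Ω) (y : CycT A Ω) :
    cycAverage c y = ((centralizers c).card : ℂ)⁻¹ • ∑ z ∈ centralizers c, cycT z y := by
  rw [cycAverage, LinearMap.smul_apply, LinearMap.sum_apply]

theorem cycAverage_closeD (c : Equiv.Perm Ω) (y : CycT A Ω) :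
    cycAverage c (closeD c y) = closeD c (cycAverage c y) := by
  rw [cycAverage_apply, cycAverage_apply, map_smul, map_sum]
  refine congrArg _ (Finset.sum_congr rfl fun z hz => ?_)
  rw [closeD_cycT z fun i => (mem_centralizers.1 hz i).symm]

/-- An element of the centralizer permutes the conjugators and so fixes the sum over them. -/
theorem cycAverage_wrClose (c : Equiv.Perm Ω) (q : WrQ A n) :
    cycAverage c (wrClose c q) = wrClose c q := by
  have key : ∀ z ∈ centralizers c, cycT z (wrClose c q) = wrClose c q := fun z hz => by
    refine wrQ_ext (f := cycT z ∘ₗ wrClose c) (g := wrClose c) (fun g p => ?_) q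
    rw [LinearMap.comp_apply, wrClose_single, map_smul, map_sum]
    refine congrArg _ (Finset.sum_bij' (fun e _ => z.symm.trans e) (fun e _ => z.trans e)
      (fun e he => trans_mem_conjugators (symm_mem_centralizers hz) he)
      (fun e he => trans_mem_conjugators hz he) (fun e _ => by ext; simp)
      (fun e _ => by ext; simp) fun e he => ?_)
    rw [← close_resT z fun i => (mem_centralizers.1 hz i).symm, resT_resT]
    rfl
  rw [cycAverage_apply, Finset.sum_congr rfl key, Finset.sum_const, ← Nat.cast_smul_eq_nsmul ℂ,
    smul_smul, inv_mul_cancel₀ (card_centralizers_ne_zero c), one_smul]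

/-- A map from closed up tensors back to the resolution. -/
def wrOpen (n : ℕ) (c : Equiv.Perm Ω) : CycT A Ω →ₗ[ℂ] WrQ A n :=
  ∑ e : Ω ≃ Fin n, Finsupp.lsingle (e.permCongr c⁻¹) ∘ₗ resT e ∘ₗ opT

/-- For each conjugator, summing over all ways to open up again reproduces the sum over `S_n` in
`swapMul_wrSplit`. The closed-up tensors thus determine `swapMul`, which is the condition `hker` of
`hcBottom_homology`. -/
theorem wrOpen_wrClose [Nonempty (Ω ≃ Fin n)] (c : Equiv.Perm Ω) (g : Equiv.Perm (Fin n))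
    (p : ResT A (Fin n)) :
    wrOpen n c (wrClose c (Finsupp.single g p)) =
      (((centralizers c).card : ℂ)⁻¹ * (conjugators c g).card *
        Fintype.card (Equiv.Perm (Fin n))) •
          swapMul (wrBimod A n) (wrSplit A n) (Finsupp.single g p) := by
  induction p using resT_induction with
  | zero => simp only [Finsupp.single_zero, map_zero, smul_zero]
  | add x y hx hy => rw [Finsupp.single_add, map_add, map_add, hx, hy, map_add, smul_add]
  | mem z b =>
    rw [swapMul_wrSplit, smul_smul, mul_assoc, mul_inv_cancel₀, mul_one, wrClose_single, map_smul,
      map_sum, mul_smul, Nat.cast_smul_eq_nsmul ℂ, ← Finset.sum_const]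
    · refine congrArg _ (Finset.sum_congr rfl fun e he => ?_)
      rw [mem_conjugators] at he
      rw [wrOpen, LinearMap.sum_apply]
      -- With the conjugator `e` fixed, the summand of `h` in `swapMul` is obtained by opening up
      -- along `h⁻¹ g e`.
      let F : Equiv.Perm (Fin n) ≃ (Ω ≃ Fin n) :=
        ⟨fun h => e.trans (h⁻¹ * g), fun e' => g * (e.symm.trans e')⁻¹,
          fun h => by
            change g * (e.symm.trans (e.trans (h⁻¹ * g)))⁻¹ = h
            rw [← Equiv.trans_assoc, Equiv.symm_trans_self, Equiv.refl_trans, mul_inv_rev, inv_inv,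
              mul_inv_cancel_left],
          fun e' => by ext; simp [Equiv.Perm.inv_def]⟩
      refine (Fintype.sum_equiv F _ _ fun h => ?_).symm
      have hF : ∀ i, F h i = h⁻¹ (g (e i)) := fun _ => rfl
      have h1 : (F h).permCongr c⁻¹ = h⁻¹ * g * h := by
        refine Equiv.ext fun x => ?_
        obtain ⟨i, rfl⟩ := (c.trans (F h)).surjective x
        change F h (c.symm ((F h).symm (F h (c i)))) = h⁻¹ (g (h (F h (c i))))
        rw [Equiv.symm_apply_apply, Equiv.symm_apply_apply, hF, hF, he]
        simp
      have h2 : e.symm.trans (Equiv.trans c (F h)) = h⁻¹ := by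
        refine Equiv.ext fun x => ?_
        simp [F, he]
      have h3 : e.symm.trans (F h) = h⁻¹ * g := by ext; simp [F]
      rw [LinearMap.comp_apply, LinearMap.comp_apply, Finsupp.lsingle_apply, resT_actR,
        resT_opT e.symm, close_actR_opT, opT_cycL, resT_actL, ← resT_opT e.symm, resT_resT,
        permT_trans, permT_trans, h1, h2, h3, permT_smul]
    · exact Nat.cast_ne_zero.2 Fintype.card_ne_zero

/-- The conjugators of the chosen element are `e` composed with centralizer elements `z`, and
closing up along them returns `y` moved by `z⁻¹`. -/
theorem wrClose_surjective [Nonempty (Ω ≃ Fin n)] (c : Equiv.Perm Ω) (e : Ω ≃ Fin n)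
    (y : CycT A Ω) : wrClose c (Finsupp.single (e.permCongr c⁻¹) (resT e (opT y))) =
      cycAverage c y := by
  have he : e ∈ conjugators c (e.permCongr c⁻¹) := by
    rw [mem_conjugators]
    intro i
    rw [Equiv.Perm.eq_inv_iff_eq]
    simp
  rw [wrClose_single, sum_conjugators he, cycAverage_apply]
  refine congrArg _ (Finset.sum_bij' (fun z _ => z.symm) (fun z _ => z.symm)
    (fun z hz => symm_mem_centralizers hz) (fun z hz => symm_mem_centralizers hz)
    (fun z _ => by ext; simp) (fun z _ => by ext; simp) fun z hz => ?_)
  rw [resT_resT, resT_opT, close_opT]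
  congr 2
  ext i
  simp

theorem wrClose_eq_zero (c : Equiv.Perm Ω) (g : Equiv.Perm (Fin n)) (h : conjugators c g = ∅)
    (p : ResT A (Fin n)) : wrClose c (Finsupp.single g p) = 0 := by
  rw [wrClose_single, h, Finset.sum_empty, smul_zero]

end Close

end HochschildWreath

end

noncomputable section

namespace HochschildWreath

set_option linter.unusedSectionVars false

/-! ### Hochschild homology of the crossed product and conjugacy classes -/

section Classes

variable {A : Type u} [Ring A] [Algebra ℂ A] {n : ℕ}

theorem hCompat_wrClose {Ω : Type} [Fintype Ω] [LinearOrder Ω] (c : Equiv.Perm Ω) :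
    HCompat (wrTot A n) (closeD c) (hcBottom (CrossedProduct A n) (wrClose c)) :=
  .of_comm fun x => hcBottom_totD (wrClose_wrL c) (wrClose_wrD c) x

variable (A n) in
/-- The component of the Hochschild homology of the crossed product attached to a permutation. -/
def wrHom {Ω : Type} [Fintype Ω] [LinearOrder Ω] (c : Equiv.Perm Ω) :
    Homology (wrTot A n) →ₗ[ℂ] Homology (closeD (A := A) c) :=
  Homology.map _ (hCompat_wrClose c)

theorem hCompat_cycAverage {Ω : Type} [Fintype Ω] [LinearOrder Ω] (c : Equiv.Perm Ω) :
    HCompat (closeD (A := A) c) (closeD c) (cycAverage c) :=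
  .of_comm fun x => cycAverage_closeD c x

variable {Λ : Type} [Fintype Λ] {Ω : Λ → Type} [∀ l, Fintype (Ω l)] [∀ l, LinearOrder (Ω l)]

/-- A family of permutations representing all conjugacy classes of `S_n`. -/
structure Classifies (n : ℕ) (c : ∀ l, Equiv.Perm (Ω l)) : Prop where
  nonempty : ∀ l, Nonempty (Ω l ≃ Fin n)
  existsUnique : ∀ g : Equiv.Perm (Fin n), ∃! l, ∃ e : Ω l ≃ Fin n, ∀ i, e (c l i) = g (e i)

variable {c : ∀ l, Equiv.Perm (Ω l)}

theorem Classifies.exists_conjugators (hc : Classifies n c) (g : Equiv.Perm (Fin n)) :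
    ∃ l, (conjugators (c l) g).Nonempty ∧ ∀ m, m ≠ l → conjugators (c m) g = ∅ := by
  -- The inverse appears because `conjugators` conjugates to `g⁻¹`.
  obtain ⟨l, ⟨e, he⟩, hl⟩ := hc.existsUnique g⁻¹
  refine ⟨l, ⟨e, mem_conjugators.2 he⟩, fun m hm => Finset.eq_empty_of_forall_notMem fun e' he' =>
    hm (hl m ⟨e', mem_conjugators.1 he'⟩)⟩

/-- Only one representative has conjugators for a given `g`, and their number is the order of the
centralizer, so the constants of `wrOpen_wrClose` cancel down to `n!`. -/
theorem Classifies.sum_wrOpen_wrClose (hc : Classifies n c) (q : WrQ A n) :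
    ∑ l, wrOpen n (c l) (wrClose (c l) q) = (Fintype.card (Equiv.Perm (Fin n)) : ℂ) •
      swapMul (wrBimod A n) (wrSplit A n) q := by
  have := hc.nonempty
  refine (LinearMap.sum_apply _ _ _).symm.trans (wrQ_ext
    (f := ∑ l, wrOpen n (c l) ∘ₗ wrClose (c l)) (g := (Fintype.card (Equiv.Perm (Fin n)) : ℂ) •
      swapMul (wrBimod A n) (wrSplit A n)) (fun g p => ?_) q)
  obtain ⟨l, ⟨e, he⟩, hl⟩ := hc.exists_conjugators g
  rw [LinearMap.sum_apply, Finset.sum_eq_single l, LinearMap.comp_apply, wrOpen_wrClose,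
    card_conjugators he, inv_mul_cancel₀ (card_centralizers_ne_zero _), one_mul]
  · rfl
  · intro m _ hm
    rw [LinearMap.comp_apply, wrClose_eq_zero _ _ (hl m hm), map_zero]
  · exact fun h => absurd (Finset.mem_univ l) h

theorem Classifies.wrClose_surjective (hc : Classifies n c) (y : ∀ l, CycT A (Ω l)) :
    ∃ q : WrQ A n, ∀ l, wrClose (c l) q = cycAverage (c l) (y l) := by
  have e : ∀ l, Ω l ≃ Fin n := fun l => (hc.nonempty l).some
  refine ⟨∑ l, Finsupp.single ((e l).permCongr (c l)⁻¹) (resT (e l) (opT (y l))), fun l => ?_⟩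
  have := hc.nonempty
  rw [map_sum, Finset.sum_eq_single l, HochschildWreath.wrClose_surjective]
  · intro m _ hm
    refine wrClose_eq_zero _ _ (Finset.eq_empty_of_forall_notMem fun e' he' => hm ?_) _
    refine (hc.existsUnique ((e m).permCongr (c m))).unique ⟨e m, fun i => by simp⟩
      ⟨e', fun i => ?_⟩
    rw [mem_conjugators.1 he']
    congr 1
  · exact fun h => absurd (Finset.mem_univ l) h

/-- This is `hcBottom_homology` for the resolution `WrQ`, with all representatives taken together:
the maps `wrClose` jointly detect `swapMul`, and their joint image is that of the averages over the
centralizers. -/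
theorem Classifies.bottom (hc : Classifies n c) {d' π : (∀ l, CycT A (Ω l)) →ₗ[ℂ] _}
    (hd' : d' = LinearMap.pi fun l => closeD (c l) ∘ₗ LinearMap.proj l)
    (hπ' : π = LinearMap.pi fun l => cycAverage (c l) ∘ₗ LinearMap.proj l)
    {p : WrQ A n →ₗ[ℂ] ∀ l, CycT A (Ω l)} (hp : p = LinearMap.pi fun l => wrClose (c l))
    (h1 : HCompat (wrTot A n) d' (hcBottom (CrossedProduct A n) p)) (h2 : HCompat d' d' π) :
    Function.Injective (Homology.map (hcBottom (CrossedProduct A n) p) h1) ∧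
      (∀ x, Homology.map π h2 (Homology.map (hcBottom (CrossedProduct A n) p) h1 x) =
        Homology.map (hcBottom (CrossedProduct A n) p) h1 x) ∧
      ∀ x, ∃ x', Homology.map (hcBottom (CrossedProduct A n) p) h1 x' = Homology.map π h2 x := by
  subst hd' hπ' hp
  refine hcBottom_homology (t := wrSplit A n) (θ := wrDeg 2) (bimodHom_wrD (A := A) (n := n))
    wrD_wrD isGr_wrDeg (wrD_wrDeg 2) (bimodHom_wrSplit (A := A) (n := n))
    (lift_wrR_wrSplit (A := A) (n := n)) (wrSplit_wrDeg (A := A) (n := n) 2) (fun q => funext fun l => wrClose_wrD _ q)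
    (fun x q => funext fun l => wrClose_wrL _ x q) (fun q hq => ?_)
    (fun q => funext fun l => cycAverage_wrClose _ q) (fun y => ?_)
    (fun y => funext fun l => cycAverage_closeD _ _) h1 h2
  · have h := hc.sum_wrOpen_wrClose q
    rw [Finset.sum_eq_zero fun l _ => by
      rw [show wrClose (c l) q = 0 from congrFun hq l, map_zero]] at h
    exact (smul_eq_zero.1 h.symm).resolve_left (Nat.cast_ne_zero.2 Fintype.card_ne_zero)
  · obtain ⟨q, hq⟩ := hc.wrClose_surjective y
    exact ⟨q, funext hq⟩

/-- The Hochschild homology of the crossed product, computed by the quotients of the homology of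
the closed up tensors by the action of the centralizers. -/
theorem Classifies.bijective (hc : Classifies n c) {X : Λ → Type u} [∀ l, AddCommGroup (X l)]
    [∀ l, Module ℂ (X l)] (R : ∀ l, Homology (closeD (A := A) (c l)) →ₗ[ℂ] X l)
    (hR : ∀ l, Function.Surjective (R l))
    (hR1 : ∀ l y, R l (Homology.map _ (hCompat_cycAverage (c l)) y) = R l y)
    (hR2 : ∀ l y, R l y = 0 → Homology.map _ (hCompat_cycAverage (c l)) y = 0) :
    Function.Bijective (LinearMap.pi fun l => R l ∘ₗ wrHom A n (c l)) := by
  obtain ⟨p, hp⟩ : ∃ p : WrQ A n →ₗ[ℂ] ∀ l, CycT A (Ω l), p = LinearMap.pi fun l => wrClose (c l) :=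
    ⟨_, rfl⟩
  obtain ⟨d', hd'⟩ : ∃ d' : (∀ l, CycT A (Ω l)) →ₗ[ℂ] (∀ l, CycT A (Ω l)),
    d' = LinearMap.pi fun l => closeD (c l) ∘ₗ LinearMap.proj l := ⟨_, rfl⟩
  obtain ⟨π, hπ⟩ : ∃ π : (∀ l, CycT A (Ω l)) →ₗ[ℂ] (∀ l, CycT A (Ω l)),
    π = LinearMap.pi fun l => cycAverage (c l) ∘ₗ LinearMap.proj l := ⟨_, rfl⟩
  have hpx : ∀ x l, hcBottom (CrossedProduct A n) p x l =
      hcBottom (CrossedProduct A n) (wrClose (c l)) x := fun x l => by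
    exact (hcBottom_comp p (LinearMap.proj (φ := fun l => CycT A (Ω l)) l) x).symm.trans
      (by rw [hp]; rfl)
  have h1 : HCompat (wrTot A n) d' (hcBottom (CrossedProduct A n) p) := .of_comm fun x =>
    funext fun l => by
      rw [hpx, hd']
      exact ((hcBottom_totD (wrClose_wrL (c l)) (wrClose_wrD (c l)) x).trans
        (congrArg _ (hpx x l).symm))
  have h2 : HCompat d' d' π := .of_comm fun x => by
    rw [hd', hπ]; exact funext fun l => cycAverage_closeD _ _
  obtain ⟨b1, b2, b3⟩ := hc.bottom hd' hπ hp h1 h2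
  -- The homology of the product complex is the product of the homologies, compatibly with `wrHom`
  -- and with the averages. This is what `e1` to `e4` record.
  have hproj : ∀ l, HCompat d' (closeD (c l)) (LinearMap.proj l) := fun l => .of_comm fun x => by
    rw [hd']; rfl
  have e1 : ∀ l x, Homology.map _ (hproj l) (Homology.map _ h1 x) = wrHom A n (c l) x := by
    intro l x
    obtain ⟨x, hx, rfl⟩ := x.exists_rep
    rw [wrHom, Homology.map_mk, Homology.map_mk, Homology.map_mk]
    refine Homology.mk_eq_mk.2 ⟨0, ?_⟩
    rw [LinearMap.proj_apply, hpx, sub_self, map_zero]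
  have e2 : ∀ l x, Homology.map _ (hproj l) (Homology.map _ h2 x) =
      Homology.map _ (hCompat_cycAverage (c l)) (Homology.map _ (hproj l) x) := by
    intro l x
    obtain ⟨x, hx, rfl⟩ := x.exists_rep
    simp only [Homology.map_mk]
    refine Homology.mk_eq_mk.2 ⟨0, ?_⟩
    rw [hπ, map_zero]
    exact (sub_self _).symm
  have e3 : ∀ x, (∀ l, Homology.map _ (hproj l) x = 0) → x = 0 := by
    intro x h
    obtain ⟨x, hx, rfl⟩ := x.exists_rep
    simp only [Homology.map_mk, Homology.mk_eq_zero] at h ⊢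
    choose z hz using h
    exact ⟨z, by rw [hd']; exact funext hz⟩
  have e4 : ∀ y : ∀ l, Homology (closeD (A := A) (c l)), ∃ x,
      ∀ l, Homology.map _ (hproj l) x = y l := by
    intro y
    choose z hz hy using fun l => (y l).exists_rep
    refine ⟨Homology.mk d' z (by rw [hd']; exact funext hz), fun l => ?_⟩
    rw [Homology.map_mk, hy]
    rfl
  constructor
  · rw [injective_iff_map_eq_zero]
    intro x hx
    refine (injective_iff_map_eq_zero _).1 b1 x (e3 _ fun l => ?_)
    -- The image of `x` is fixed by the average, and the average kills the kernel of `R l`.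
    rw [← b2, e2]
    refine hR2 l _ ?_
    rw [e1]
    exact congrFun hx l
  · intro x
    choose y hy using fun l => hR l (x l)
    obtain ⟨z, hz⟩ := e4 y
    obtain ⟨x', hx'⟩ := b3 z
    refine ⟨x', funext fun l => ?_⟩
    change R l (wrHom A n (c l) x') = x l
    rw [← e1, hx', e2, hR1, hz, hy]

end Classes

end HochschildWreath

end

/-! ### Products of cycles: contraction, centralizers and partitions -/

noncomputable section

namespace HochschildWreath

set_option linter.unusedSectionVars false

/-! ### Fiberwise permutations of nested tensor products -/

section Fiberwise

variable {I : Type} {F : I → Type}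

/-- A permutation of a lexicographic sum preserving the fibers. -/
def lexCongr (ρ : ∀ c, Equiv.Perm (F c)) : Equiv.Perm (Σₗ c, F c) :=
  ofLex.trans ((Equiv.sigmaCongrRight ρ).trans toLex)

@[simp]
theorem lexCongr_toLex (ρ : ∀ c, Equiv.Perm (F c)) (c : I) (i : F c) :
    lexCongr ρ (toLex ⟨c, i⟩) = toLex ⟨c, ρ c i⟩ := rfl

variable [Fintype I] [LinearOrder I] [∀ c, Fintype (F c)] [∀ c, LinearOrder (F c)]

@[simp]
theorem lexCongr_symm_toLex (ρ : ∀ c, Equiv.Perm (F c)) (c : I) (i : F c) :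
    (lexCongr ρ).symm (toLex ⟨c, i⟩) = toLex ⟨c, (ρ c).symm i⟩ := rfl

/-- Positions in different fibres keep their relative order, so only pairs within one fibre
contribute. -/
theorem ksign_lexCongr (ρ : ∀ c, Equiv.Perm (F c)) (p : (Σₗ c, F c) → ℕ) :
    ksign (lexCongr ρ) p = ∏ c, ksign (ρ c) fun i => p (toLex ⟨c, i⟩) := by
  unfold ksign
  rw [prod_lex]
  refine Finset.prod_congr rfl fun c _ => Finset.prod_congr rfl fun i _ => ?_
  rw [prod_lex, Finset.prod_eq_single c]
  · simp only [lexCongr_toLex, lex_lt_iff_snd]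
  · intro c' _ hc'
    refine Finset.prod_eq_one fun j _ => if_neg ?_
    rintro ⟨h1, h2⟩
    rw [lexCongr_toLex, lexCongr_toLex] at h2
    rcases lt_or_gt_of_ne hc' with h | h
    · exact lt_asymm h1 (lex_lt_of_fst h _ _)
    · exact lt_asymm h2 (lex_lt_of_fst h _ _)
  · exact fun h => absurd (Finset.mem_univ c) h

variable {V : Type u} [AddCommGroup V] [Module ℂ V] {ε : V →ₗ[ℂ] V}

theorem nestT_koszulT (hε : ∀ x, ε (ε x) = x) (ρ : ∀ c, Equiv.Perm (F c))
    (z : ⨂[ℂ] _ : (Σₗ c, F c), V) :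
    nestT F V (koszulT ε (lexCongr ρ) z) =
      PiTensorProduct.map (fun c => koszulT ε (ρ c)) (nestT F V z) := by
  refine super_ext (fun _ => ε) (fun _ => hε) (φ := nestT F V ∘ₗ koszulT ε (lexCongr ρ))
    (ψ := PiTensorProduct.map (fun c => koszulT ε (ρ c)) ∘ₗ nestT F V) (fun x p hx => ?_) z
  rw [LinearMap.comp_apply, LinearMap.comp_apply, koszulT_tprod ε _ x p hx, map_smul, nestT_tprod,
    nestT_tprod, PiTensorProduct.map_tprod, ksign_lexCongr, ← tprod_smul_prod]
  congr 1
  funext c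
  rw [koszulT_tprod ε (ρ c) _ (fun i => p (toLex ⟨c, i⟩)) fun i => hx _]
  simp only [lexCongr_symm_toLex]

variable {V' : Type u} [AddCommGroup V'] [Module ℂ V']

theorem nestT_map (f : V →ₗ[ℂ] V') (z : ⨂[ℂ] _ : (Σₗ c, F c), V) :
    nestT F V' (PiTensorProduct.map (fun _ => f) z) =
      PiTensorProduct.map (fun _ => PiTensorProduct.map fun _ => f) (nestT F V z) := by
  refine pi_tensor_ext (φ := nestT F V' ∘ₗ PiTensorProduct.map fun _ => f)
    (ψ := PiTensorProduct.map (fun c => PiTensorProduct.map fun _ : F c => f) ∘ₗ nestT F V)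
    (fun x => ?_) z
  simp only [LinearMap.comp_apply, PiTensorProduct.map_tprod, nestT_tprod]

variable {A : Type u} [Ring A] [Algebra ℂ A]

theorem nestT_close (ρ : ∀ c, Equiv.Perm (F c)) (p : ResT A (Σₗ c, F c)) :
    nestT F (Cyc A) (close (lexCongr ρ) p) =
      PiTensorProduct.map (fun c => close (ρ c)) (nestT F (Res A) p) := by
  refine Res.tensor_ext (φ := nestT F (Cyc A) ∘ₗ close (lexCongr ρ))
    (ψ := PiTensorProduct.map (fun c => close (ρ c)) ∘ₗ nestT F (Res A)) (fun z y p hp => ?_) p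
  rw [LinearMap.comp_apply, LinearMap.comp_apply, close_tprod, nestT_tprod, nestT_tprod,
    PiTensorProduct.map_tprod]
  simp only [close_tprod, lexCongr_symm_toLex]

/-- Closing up along a fibrewise permutation is the tensor product of the closings of the fibres. In
a summand of the differential all fibres but one are simply closed again, which returns them
unchanged up to parity. -/
theorem nestT_closeD (ρ : ∀ c, Equiv.Perm (F c)) (z : CycT A (Σₗ c, F c)) :
    nestT F (Cyc A) (closeD (lexCongr ρ) z) =
      koszulD (fun _ => cycDeg (-1)) (fun c => closeD (ρ c)) (nestT F (Cyc A) z) := by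
  rw [closeD_apply, nestT_close, resD, nestT_koszulD, opT, nestT_map]
  refine pi_tensor_ext (φ := PiTensorProduct.map (fun c => close (ρ c)) ∘ₗ
    koszulD (fun _ => PiTensorProduct.map fun _ => Res.deg (-1)) (fun c =>
      koszulD (fun _ : F c => Res.deg (-1)) fun _ => Res.d) ∘ₗ
      PiTensorProduct.map fun c => PiTensorProduct.map fun _ : F c => Cyc.op)
    (ψ := koszulD (fun _ => cycDeg (-1)) (fun c => closeD (ρ c))) (fun y => ?_) (nestT F (Cyc A) z)
  simp only [LinearMap.comp_apply, PiTensorProduct.map_tprod, koszulD_tprod, map_sum]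
  refine Finset.sum_congr rfl fun c _ => ?_
  congr 1
  funext c'
  have h1 : close (ρ c') (resDeg (-1) (opT (y c'))) = cycDeg (-1) (y c') := by
    rw [← opT_cycDeg, close_opT]
  have h2 : close (ρ c') (opT (y c')) = y c' := close_opT _ _
  split_ifs
  · exact h1
  · rfl
  · exact h2

end Fiberwise

/-! ### Contracting all cycles -/

section Beads

variable {I : Type} [Fintype I] [LinearOrder I]

/-- The points of a family of cycles of lengths `s c + 1`. -/
abbrev Beads (s : I → ℕ) : Type := Σₗ c : I, Fin (s c + 1)

/-- The permutation with cycles of lengths `s c + 1`. -/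
def beadRotate (s : I → ℕ) : Equiv.Perm (Beads s) := lexCongr fun c => finRotate (s c + 1)

variable {A : Type u} [Ring A] [Algebra ℂ A] (s : I → ℕ)

variable (A) in
/-- Contracting every cycle to a single site. -/
def beadContract : CycT A (Beads s) →ₗ[ℂ] CycT A I :=
  PiTensorProduct.map (fun c => cycContract (s c)) ∘ₗ nestT _ (Cyc A)

variable (A I) in
/-- The differential of the tensor power of the Hochschild complex. -/
def cycD : CycT A I →ₗ[ℂ] CycT A I := koszulD (fun _ => Cyc.deg (-1)) fun _ => Cyc.d

theorem map_cycContract_koszulD (y) : PiTensorProduct.map (fun c => cycContract (A := A) (s c))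
    (koszulD (fun _ => cycDeg (-1)) (fun c => closeD (finRotate (s c + 1))) y) =
    cycD I A (PiTensorProduct.map (fun c => cycContract (s c)) y) :=
  (koszulD_map (fun c => cycContract (s c)) (fun c x => cycContract_closeD (s c) x)
    (fun c x => cycContract_deg (s c) (-1) x) y)

theorem beadContract_closeD (z : CycT A (Beads s)) :
    beadContract A s (closeD (beadRotate s) z) = cycD I A (beadContract A s z) := by
  rw [beadContract, LinearMap.comp_apply, beadRotate, nestT_closeD, map_cycContract_koszulD]; rfl

theorem hCompat_beadContract : HCompat (closeD (beadRotate s)) (cycD I A) (beadContract A s) :=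
  .of_comm (beadContract_closeD s)

variable (A) in
/-- Contracting every cycle to a single site, on homology. -/
def beadHom : Homology (closeD (A := A) (beadRotate s)) →ₗ[ℂ] Homology (cycD I A) :=
  Homology.map _ (hCompat_beadContract s)

theorem hCompat_nestT : HCompat (closeD (beadRotate s)) (koszulD (fun _ => cycDeg (-1))
    fun c => closeD (A := A) (finRotate (s c + 1))) (nestT _ (Cyc A)) :=
  .of_comm fun z => nestT_closeD _ z

theorem hCompat_map_cycContract : HCompat (koszulD (fun _ => cycDeg (-1))
    fun c => closeD (A := A) (finRotate (s c + 1))) (cycD I A)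
    (PiTensorProduct.map fun c => cycContract (s c)) :=
  .of_comm fun z => map_cycContract_koszulD s z

theorem beadHom_apply (x : Homology (closeD (A := A) (beadRotate s))) :
    beadHom A s x = Homology.map _ (hCompat_map_cycContract s)
      (Homology.map _ (hCompat_nestT s) x) := by
  rw [Homology.map_comp]; rfl

theorem homology_nestT_bijective :
    Function.Bijective (Homology.map _ (hCompat_nestT (A := A) s)) :=
  Homology.map_bijective_of_equiv (LinearEquiv.ofBijective _ (nestT_bijective (Cyc A)))
    (fun z => nestT_closeD _ z) (hCompat_nestT s)

/-- Künneth reduces the claim to a single cycle, where it is `cycContract_bijective`. -/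
theorem beadHom_bijective : Function.Bijective (beadHom A s) := by
  have h1 : Function.Bijective (Homology.map _ (hCompat_map_cycContract (A := A) s)) :=
    koszulD_map_bijective (fun c => superDiff_closeD _) (fun _ => Cyc.superDiff)
      (fun c => cycContract (s c)) (fun c => hCompat_cycContract (s c))
      (fun c => cycContract_bijective (s c)) (hCompat_map_cycContract s)
  have h2 := h1.comp (homology_nestT_bijective s)
  have h3 : ⇑(beadHom A s) = Homology.map _ (hCompat_map_cycContract s) ∘
    Homology.map _ (hCompat_nestT s) := funext fun x => beadHom_apply s x
  rw [h3]
  exact h2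

theorem beadContract_cycDeg (w : ℂ) (z : CycT A (Beads s)) :
    beadContract A s (cycDeg w z) = cycDeg w (beadContract A s z) := by
  rw [beadContract, LinearMap.comp_apply, cycDeg, nestT_map]
  refine pi_tensor_ext (φ := PiTensorProduct.map (fun c => cycContract (s c)) ∘ₗ
    PiTensorProduct.map fun c => PiTensorProduct.map fun _ : Fin (s c + 1) => Cyc.deg w)
    (ψ := cycDeg w ∘ₗ PiTensorProduct.map (fun c => cycContract (s c))) (fun y => ?_)
    (nestT _ (Cyc A) z)
  simp only [LinearMap.comp_apply, PiTensorProduct.map_tprod, cycDeg_tprod]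
  congr 1
  funext c
  exact cycContract_deg _ _ _

theorem beadContract_map {B : Type u} [Ring B] [Algebra ℂ B] (f : A →ₐ[ℂ] B)
    (z : CycT A (Beads s)) : beadContract B s (cycMap f z) = cycMap f (beadContract A s z) := by
  rw [beadContract, LinearMap.comp_apply, cycMap, nestT_map]
  refine pi_tensor_ext (φ := PiTensorProduct.map (fun c => cycContract (s c)) ∘ₗ
    PiTensorProduct.map fun c => PiTensorProduct.map fun _ : Fin (s c + 1) => Cyc.map f)
    (ψ := cycMap f ∘ₗ PiTensorProduct.map (fun c => cycContract (s c))) (fun y => ?_)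
    (nestT _ (Cyc A) z)
  simp only [LinearMap.comp_apply, PiTensorProduct.map_tprod, cycMap_tprod]
  congr 1
  funext c
  exact cycContract_map _ _ _

/-! ### The centralizer of a product of cycles -/

theorem hCompat_cycT {Ω : Type} [Fintype Ω] [LinearOrder Ω] {c z : Equiv.Perm Ω}
    (hz : z ∈ centralizers c) : HCompat (closeD (A := A) c) (closeD c) (cycT z) :=
  .of_comm fun x => (closeD_cycT z (fun i => (mem_centralizers.1 hz i).symm) x).symm

theorem hCompat_cycT_cycD (τ : Equiv.Perm I) : HCompat (cycD I A) (cycD I A) (cycT τ) :=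
  .of_comm fun x => koszulT_koszulD Cyc.superDiff.inv Cyc.superDiff.anti τ x

theorem pow_mem_centralizers {Ω : Type} [Fintype Ω] [LinearOrder Ω] (c : Equiv.Perm Ω) (k : ℕ) :
    c ^ k ∈ centralizers c := mem_centralizers.2 fun i =>
  congrArg (fun g : Equiv.Perm Ω => g i) (Commute.pow_self c k).eq

theorem cycContract_rotate_pow (l k : ℕ) (c : Homology (closeD (A := A) (finRotate (l + 1)))) :
    Homology.map (cycContract l) (hCompat_cycContract l)
      (Homology.map _ (hCompat_cycT (pow_mem_centralizers (finRotate (l + 1)) k)) c) =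
      Homology.map (cycContract l) (hCompat_cycContract l) c := by
  induction k with
  | zero =>
    congr 1
    obtain ⟨x, hx, rfl⟩ := c.exists_rep
    have h1 : cycT (finRotate (l + 1) ^ 0) x = x := cycT_refl x
    simp only [Homology.map_mk, h1]
  | succ k ih =>
    have h1 : Homology.map _ (hCompat_cycT (A := A) (pow_mem_centralizers (finRotate (l + 1))
        (k + 1))) c = Homology.map _ (hCompat_cycT_finRotate l)
          (Homology.map _ (hCompat_cycT (pow_mem_centralizers (finRotate (l + 1)) k)) c) := by
      rw [Homology.map_comp]
      refine Homology.map_congr (LinearMap.ext fun x => ?_) _ _ c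
      rw [LinearMap.comp_apply, cycT_cycT, pow_succ']
      rfl
    rw [h1, cycContract_rotate, ih]

theorem lexCongr_pow_mem_centralizers (k : I → ℕ) :
    lexCongr (fun c => finRotate (s c + 1) ^ k c) ∈ centralizers (beadRotate s) := by
  refine mem_centralizers.2 fun x => ?_
  obtain ⟨⟨c, i⟩, rfl⟩ := toLex.surjective x
  rw [beadRotate, lexCongr_toLex, lexCongr_toLex, lexCongr_toLex, lexCongr_toLex,
    mem_centralizers.1 (pow_mem_centralizers _ _)]

/-- Through the Künneth isomorphism, rotating all cycles becomes the tensor product of the rotations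
on the homologies of the single cycles. Each of these is invisible after contraction. -/
theorem beadHom_rotate (k : I → ℕ) (x : Homology (closeD (A := A) (beadRotate s))) :
    beadHom A s (Homology.map _ (hCompat_cycT (lexCongr_pow_mem_centralizers s k)) x) =
      beadHom A s x := by
  have h0 : ∀ c, HCompat (closeD (A := A) (finRotate (s c + 1))) (closeD (finRotate (s c + 1)))
    (cycT (finRotate (s c + 1) ^ k c)) := fun c => hCompat_cycT (pow_mem_centralizers _ _)
  have h1 : HCompat (koszulD (fun _ => cycDeg (-1)) fun c => closeD (A := A) (finRotate (s c + 1)))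
      (koszulD (fun _ => cycDeg (-1)) fun c => closeD (A := A) (finRotate (s c + 1)))
      (PiTensorProduct.map fun c => cycT (finRotate (s c + 1) ^ k c)) := .of_comm fun y =>
    (koszulD_map (fun c => cycT (finRotate (s c + 1) ^ k c))
      (fun c x => (closeD_cycT _ (fun i => (mem_centralizers.1 (pow_mem_centralizers _ _) i).symm) x).symm)
      (fun c x => cycT_cycDeg _ (-1) x) y)
  have h2 : Homology.map _ (hCompat_nestT s)
      (Homology.map _ (hCompat_cycT (lexCongr_pow_mem_centralizers s k)) x) =
      Homology.map _ h1 (Homology.map _ (hCompat_nestT s) x) :=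
    Homology.map_square _ _ _ _ (fun x => nestT_koszulT Cyc.superDiff.inv _ x) x
  rw [beadHom_apply, beadHom_apply, h2]
  generalize Homology.map _ (hCompat_nestT s) x = y
  obtain ⟨y, rfl⟩ := (kunneth_bijective fun c => superDiff_closeD (A := A) (finRotate (s c + 1))).2 y
  have h3 : ∀ y, Homology.map _ (hCompat_map_cycContract (A := A) s)
      (kunneth (fun c => superDiff_closeD _) y) = kunneth (fun _ : I => Cyc.superDiff)
        (PiTensorProduct.map (fun c => Homology.map _ (hCompat_cycContract (s c))) y) := fun y =>
    (kunneth_map (fun c => superDiff_closeD _) (fun c => Cyc.superDiff) _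
      (fun c => hCompat_cycContract (s c)) (hCompat_map_cycContract s) y).symm
  rw [← kunneth_map _ (fun c => superDiff_closeD _) _ h0, h3, h3]
  congr 1
  rw [← LinearMap.comp_apply, ← PiTensorProduct.map_comp]
  congr 2
  funext c
  exact LinearMap.ext fun x => cycContract_rotate_pow _ _ x

end Beads

end HochschildWreath

end

noncomputable section

namespace HochschildWreath

set_option linter.unusedSectionVars false

/-! ### Permuting cycles of equal lengths -/

section BeadPerm

variable {I : Type} [Fintype I] [LinearOrder I] {A : Type u} [Ring A] [Algebra ℂ A] {s : I → ℕ}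

theorem beads_ext {x y : Beads s} (h1 : (ofLex x).1 = (ofLex y).1)
    (h2 : ((ofLex x).2 : ℕ) = (ofLex y).2) : x = y := by
  obtain ⟨⟨c, i⟩, rfl⟩ := toLex.surjective x
  obtain ⟨⟨c', i'⟩, rfl⟩ := toLex.surjective y
  dsimp only [ofLex_toLex] at h1 h2
  subst h1
  rw [Fin.ext h2]

theorem lex_lt_iff_fst {F : I → Type} [∀ c, LinearOrder (F c)] {c c' : I} (h : c ≠ c') (i : F c)
    (j : F c') : (toLex ⟨c, i⟩ : Σₗ c, F c) < toLex ⟨c', j⟩ ↔ c < c' := by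
  rw [Sigma.Lex.lt_def]
  exact ⟨fun h' => h'.resolve_right fun ⟨h'', _⟩ => h h'', Or.inl⟩

/-- The permutation of the beads induced by a permutation of cycles that preserves the lengths. -/
def beadPerm (τ : Equiv.Perm I) (h : ∀ c, s (τ c) = s c) : Equiv.Perm (Beads s) where
  toFun x := toLex ⟨τ (ofLex x).1, Fin.cast (by rw [h]) (ofLex x).2⟩
  invFun x := toLex ⟨τ.symm (ofLex x).1, Fin.cast (by rw [← h (τ.symm _), Equiv.apply_symm_apply]) (ofLex x).2⟩
  left_inv x := beads_ext (by simp) rfl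
  right_inv x := beads_ext (by simp) rfl

theorem val_finRotate_pow (l k : ℕ) (i : Fin (l + 1)) :
    (((finRotate (l + 1) ^ k) i : Fin (l + 1)) : ℕ) = (i + k) % (l + 1) := by
  induction k with
  | zero => simp [Nat.mod_eq_of_lt i.2]
  | succ k ih =>
    rw [pow_succ', Equiv.Perm.mul_apply, finRotate_apply, Fin.val_add, ih]
    simp [← add_assoc]

theorem beadRotate_pow (m : ℕ) (c : I) (i : Fin (s c + 1)) :
    (beadRotate s ^ m) (toLex ⟨c, i⟩) = toLex ⟨c, (finRotate (s c + 1) ^ m) i⟩ := by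
  induction m with
  | zero => rfl
  | succ m ih => rw [pow_succ', Equiv.Perm.mul_apply, ih, pow_succ', beadRotate]; rfl

theorem beadPerm_mem_centralizers (τ : Equiv.Perm I) (h : ∀ c, s (τ c) = s c) :
    beadPerm τ h ∈ centralizers (beadRotate s) := by
  refine mem_centralizers.2 fun x => ?_
  obtain ⟨⟨c, i⟩, rfl⟩ := toLex.surjective x
  refine beads_ext rfl ?_
  change ((finRotate (s c + 1) i : Fin (s c + 1)) : ℕ) =
    (finRotate (s (τ c) + 1) (Fin.cast (by rw [h]) i) : Fin (s (τ c) + 1))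
  have h1 := val_finRotate_pow (s c) 1 i
  have h2 := val_finRotate_pow (s (τ c)) 1 (Fin.cast (by rw [h]) i)
  rw [pow_one] at h1 h2
  rw [h1, h2, Fin.val_cast, h]

theorem mem_centralizers_pow {Ω : Type} [Fintype Ω] [LinearOrder Ω] {c z : Equiv.Perm Ω}
    (hz : z ∈ centralizers c) (m : ℕ) (i : Ω) : z ((c ^ m) i) = (c ^ m) (z i) := by
  have h : Commute z c := Equiv.ext fun i => mem_centralizers.1 hz i
  exact congrArg (fun g : Equiv.Perm Ω => g i) (h.pow_right m).eq

/-- The structure of the centralizer of a product of cycles. -/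
theorem exists_beadPerm {z : Equiv.Perm (Beads s)} (hz : z ∈ centralizers (beadRotate s)) :
    ∃ (τ : Equiv.Perm I) (h : ∀ c, s (τ c) = s c) (k : I → ℕ),
      z = (lexCongr fun c => finRotate (s c + 1) ^ k c).trans (beadPerm τ h) := by
  -- The point `(c, i)` is a rotation of the base point `(c, 0)`, so `z` is determined by the images
  -- of the base points.
  have hfib : ∀ c i, z (toLex ⟨c, i⟩) = (beadRotate s ^ (i : ℕ)) (z (toLex ⟨c, 0⟩)) := fun c i => by
    rw [← mem_centralizers_pow hz, beadRotate_pow]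
    refine congrArg z (beads_ext rfl ?_)
    change (i : ℕ) = ((finRotate (s c + 1) ^ (i : ℕ)) 0 : Fin (s c + 1))
    rw [val_finRotate_pow, Fin.val_zero, zero_add, Nat.mod_eq_of_lt i.2]
  have hrot : ∀ m x, (ofLex ((beadRotate s ^ m) x)).1 = (ofLex x).1 := fun m x => by
    obtain ⟨⟨c, i⟩, rfl⟩ := toLex.surjective x
    rw [beadRotate_pow]; rfl
  have hrot2 : ∀ m x, ((ofLex ((beadRotate s ^ m) x)).2 : ℕ) =
      ((ofLex x).2 + m) % (s (ofLex x).1 + 1) := fun m x => by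
    obtain ⟨⟨c, i⟩, rfl⟩ := toLex.surjective x
    rw [beadRotate_pow]
    exact val_finRotate_pow _ _ _
  -- The image of the base point of `c` lies in the cycle `τ₀ c`, at the position called `K c`
  -- below.
  obtain ⟨τ₀, hτ₀⟩ : ∃ τ₀ : I → I, ∀ c, τ₀ c = (ofLex (z (toLex ⟨c, 0⟩))).1 := ⟨_, fun _ => rfl⟩
  have hsurj : Function.Surjective τ₀ := fun d => by
    refine ⟨(ofLex (z.symm (toLex ⟨d, 0⟩))).1, ?_⟩
    rw [hτ₀, ← hrot (ofLex (z.symm (toLex ⟨d, 0⟩))).2, ← hfib]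
    change (ofLex (z (z.symm (toLex ⟨d, 0⟩)))).1 = d
    rw [Equiv.apply_symm_apply]; rfl
  let τ : Equiv.Perm I := Equiv.ofBijective τ₀ ⟨Finite.injective_iff_surjective.2 hsurj, hsurj⟩
  have hτ : ∀ c, τ c = (ofLex (z (toLex ⟨c, 0⟩))).1 := hτ₀
  obtain ⟨K, hK⟩ : ∃ K : I → ℕ, ∀ c, K c = (ofLex (z (toLex ⟨c, 0⟩))).2 := ⟨_, fun _ => rfl⟩
  have hlt : ∀ c, K c < s (τ c) + 1 := fun c => by
    have h := (ofLex (z (toLex ⟨c, 0⟩))).2.2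
    rwa [← hK, ← hτ] at h
  have hval : ∀ m c, ((ofLex ((beadRotate s ^ m) (z (toLex ⟨c, 0⟩)))).2 : ℕ) =
      (K c + m) % (s (τ c) + 1) := fun m c => by
    have h := hrot2 m (z (toLex ⟨c, 0⟩))
    rwa [← hK, ← hτ] at h
  -- The power `s c + 1` of the rotation fixes the base point of `c`, hence also its image. So the
  -- length of the cycle `τ c` divides that of `c`.
  have hle : ∀ c, s (τ c) ≤ s c := fun c => by
    have h1 : (beadRotate s ^ (s c + 1)) (toLex ⟨c, 0⟩) = toLex ⟨c, 0⟩ := by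
      rw [beadRotate_pow]
      refine beads_ext rfl ?_
      change ((finRotate (s c + 1) ^ (s c + 1)) 0 : Fin (s c + 1)).val = 0
      rw [val_finRotate_pow]; simp
    have h2 := hval (s c + 1) c
    rw [← mem_centralizers_pow hz, h1, ← hK] at h2
    have h3 : K c + (s c + 1) ≡ K c + 0 [MOD (s (τ c) + 1)] := by
      rw [Nat.ModEq, ← h2, add_zero, Nat.mod_eq_of_lt (hlt c)]
    have h4 := (Nat.modEq_zero_iff_dvd.1 (Nat.ModEq.add_left_cancel' _ h3))
    have := Nat.le_of_dvd (Nat.succ_pos _) h4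
    omega
  -- Lengths do not increase along `τ`, but their sum is unchanged by a permutation, so each is
  -- preserved.
  have hs : ∀ c, s (τ c) = s c := fun c =>
    (Finset.sum_eq_sum_iff_of_le fun c _ => hle c).1 (Equiv.sum_comp τ s) c (Finset.mem_univ c)
  refine ⟨τ, hs, K, Equiv.ext fun x => ?_⟩
  obtain ⟨⟨c, i⟩, rfl⟩ := toLex.surjective x
  rw [hfib]
  refine beads_ext ?_ ?_
  · rw [hrot, ← hτ]; rfl
  · rw [hval, hs, add_comm]
    exact (val_finRotate_pow _ _ _).symm

theorem cycContract_cast {m m' : ℕ} (h : m = m') (x : Fin (m' + 1) → Cyc A) :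
    cycContract m (PiTensorProduct.tprod ℂ fun i => x (Fin.cast (by rw [h]) i)) =
      cycContract m' (PiTensorProduct.tprod ℂ x) := by
  subst h; rfl

/-- Even sites contribute no sign, which leaves the last sites. Those are ordered like the cycles.
-/
theorem ksign_beadPerm (τ : Equiv.Perm I) (h : ∀ c, s (τ c) = s c) (p : Beads s → ℕ)
    (hp : ∀ c (i : Fin (s c)), Even (p (toLex ⟨c, i.castSucc⟩))) :
    ksign (beadPerm τ h) p = ksign τ fun c => p (toLex ⟨c, Fin.last _⟩) := by
  have he : ∀ c (i : Fin (s c + 1)), i ≠ Fin.last _ → Even (p (toLex ⟨c, i⟩)) := fun c i hi => by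
    obtain ⟨i, rfl⟩ := Fin.exists_castSucc_eq.2 hi
    exact hp c i
  unfold ksign
  rw [prod_lex]
  refine Finset.prod_congr rfl fun c _ => ?_
  rw [Finset.prod_eq_single (Fin.last (s c))]
  · rw [prod_lex]
    refine Finset.prod_congr rfl fun c' _ => ?_
    rw [Finset.prod_eq_single (Fin.last (s c'))]
    · refine if_congr ?_ rfl rfl
      rcases eq_or_ne c c' with rfl | hne
      · simp only [lt_irrefl, false_and]
      · exact and_congr (lex_lt_iff_fst hne _ _)
          (lex_lt_iff_fst (fun h => hne (τ.injective h).symm) _ _)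
    · intro j _ hj
      rw [(Even.mul_left (he c' j hj) _).neg_one_pow, ite_self]
    · exact fun h => absurd (Finset.mem_univ _) h
  · intro i _ hi
    refine Finset.prod_eq_one fun y _ => ?_
    rw [(Even.mul_right (he c i hi) _).neg_one_pow, ite_self]
  · exact fun h => absurd (Finset.mem_univ _) h

/-- If a site other than the last one of its cycle is odd, its augmentation vanishes and both sides
are zero. Otherwise the two signs agree by `ksign_beadPerm`. -/
theorem beadContract_beadPerm (τ : Equiv.Perm I) (h : ∀ c, s (τ c) = s c)
    (z : CycT A (Beads s)) :
    beadContract A s (cycT (beadPerm τ h) z) = cycT τ (beadContract A s z) := by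
  refine super_ext (fun _ => Cyc.deg (-1)) (fun _ => Cyc.superDiff.inv)
    (φ := beadContract A s ∘ₗ cycT (beadPerm τ h)) (ψ := cycT τ ∘ₗ beadContract A s)
    (fun x p hx => ?_) z
  have h1 : ∀ x, beadContract A s (PiTensorProduct.tprod ℂ x) = PiTensorProduct.tprod ℂ fun c =>
      cycContract (s c) (PiTensorProduct.tprod ℂ fun i => x (toLex ⟨c, i⟩)) := fun x => by
    rw [beadContract, LinearMap.comp_apply, nestT_tprod, PiTensorProduct.map_tprod]
  have h2 : ∀ c, Cyc.deg (-1) (cycContract (s c) (PiTensorProduct.tprod ℂ fun i =>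
      x (toLex ⟨c, i⟩))) = (-1 : ℂ) ^ p (toLex ⟨c, Fin.last _⟩) •
        cycContract (s c) (PiTensorProduct.tprod ℂ fun i => x (toLex ⟨c, i⟩)) := fun c => by
    rw [cycContract_tprod, Cyc.deg_l, hx, map_smul]
  have h3 : ∀ c, cycContract (s c) (PiTensorProduct.tprod ℂ fun i =>
      x ((beadPerm τ h).symm (toLex ⟨c, i⟩))) = cycContract (s (τ.symm c))
        (PiTensorProduct.tprod ℂ fun i => x (toLex ⟨τ.symm c, i⟩)) := fun c =>
    cycContract_cast (by rw [← h (τ.symm c), Equiv.apply_symm_apply]) fun i => x (toLex ⟨τ.symm c, i⟩)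
  rw [LinearMap.comp_apply, LinearMap.comp_apply, cycT, koszulT_tprod _ _ x p hx, map_smul, h1, h1,
    cycT, koszulT_tprod _ _ _ _ h2]
  simp only [h3]
  by_cases hp : ∀ c (i : Fin (s c)), Even (p (toLex ⟨c, i.castSucc⟩))
  · rw [ksign_beadPerm τ h p hp]
  · push Not at hp
    obtain ⟨c, i, hi⟩ := hp
    have h4 : cycContract (s c) (PiTensorProduct.tprod ℂ fun i => x (toLex ⟨c, i⟩)) = 0 := by
      rw [cycContract_tprod, List.prod_eq_zero, map_zero, LinearMap.zero_apply]
      rw [List.mem_ofFn]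
      exact ⟨i, Cyc.aug_eq_zero_of_odd (hx _) (Nat.not_even_iff_odd.1 hi)⟩
    rw [tprod_eq_zero (τ c), smul_zero, smul_zero]
    rw [Equiv.symm_apply_apply, h4]

theorem beadHom_cycT {z : Equiv.Perm (Beads s)} (hz : z ∈ centralizers (beadRotate s)) :
    ∃ τ : Equiv.Perm I, (∀ c, s (τ c) = s c) ∧ ∀ x : Homology (closeD (A := A) (beadRotate s)),
      beadHom A s (Homology.map _ (hCompat_cycT hz) x) =
        Homology.map _ (hCompat_cycT_cycD τ) (beadHom A s x) := by
  obtain ⟨τ, h, k, rfl⟩ := exists_beadPerm hz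
  refine ⟨τ, h, fun x => ?_⟩
  have h1 : Homology.map _ (hCompat_cycT hz) x = Homology.map _
      (hCompat_cycT (beadPerm_mem_centralizers τ h))
        (Homology.map _ (hCompat_cycT (lexCongr_pow_mem_centralizers s k)) x) := by
    rw [Homology.map_comp]
    exact Homology.map_congr (LinearMap.ext fun x => (cycT_cycT _ _ x).symm) _ _ x
  rw [h1, ← beadHom_rotate s k x]
  exact Homology.map_square _ _ _ _ (fun x => beadContract_beadPerm τ h x) _

theorem beadHom_beadPerm (τ : Equiv.Perm I) (h : ∀ c, s (τ c) = s c)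
    (x : Homology (closeD (A := A) (beadRotate s))) :
    beadHom A s (Homology.map _ (hCompat_cycT (beadPerm_mem_centralizers τ h)) x) =
      Homology.map _ (hCompat_cycT_cycD τ) (beadHom A s x) :=
  Homology.map_square _ _ _ _ (fun x => beadContract_beadPerm τ h x) _

theorem map_cycAverage {Ω : Type} [Fintype Ω] [LinearOrder Ω] (c : Equiv.Perm Ω)
    (x : Homology (closeD (A := A) c)) :
    Homology.map _ (hCompat_cycAverage c) x = ((centralizers c).card : ℂ)⁻¹ •
      ∑ z : centralizers c, Homology.map _ (hCompat_cycT z.2) x := by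
  obtain ⟨x, hx, rfl⟩ := x.exists_rep
  simp only [Homology.map_mk]
  have h : ∀ (s : Finset (centralizers c)), ∑ z ∈ s, Homology.mk (closeD c) (cycT z.1 x)
      ((hCompat_cycT z.2).cycle x hx) = Homology.mk (closeD c) (∑ z ∈ s, cycT z.1 x)
        (by rw [map_sum]; exact Finset.sum_eq_zero fun z _ => (hCompat_cycT z.2).cycle x hx) := by
    intro s
    induction s using Finset.induction_on with
    | empty => exact (Homology.mk_eq_zero.2 ⟨0, by simp⟩).symm
    | insert a s ha ih =>
      rw [Finset.sum_insert ha, ih]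
      simp only [Finset.sum_insert ha]
      rfl
  rw [h]
  refine Homology.mk_eq_mk.2 ⟨0, ?_⟩
  rw [map_zero, cycAverage_apply, ← Finset.sum_coe_sort (centralizers c)]
  exact (sub_self _).symm

theorem map_cycAverage_cycT {Ω : Type} [Fintype Ω] [LinearOrder Ω] {c z : Equiv.Perm Ω}
    (hz : z ∈ centralizers c) (x : Homology (closeD (A := A) c)) :
    Homology.map _ (hCompat_cycAverage c) (Homology.map _ (hCompat_cycT hz) x) =
      Homology.map _ (hCompat_cycAverage c) x := by
  rw [Homology.map_comp]
  refine Homology.map_congr (LinearMap.ext fun x => ?_) _ _ x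
  rw [LinearMap.comp_apply, cycAverage_apply, cycAverage_apply]
  refine congrArg _ (Finset.sum_bij' (fun w _ => z.trans w) (fun w _ => z.symm.trans w)
    (fun w hw => ?_) (fun w hw => ?_) (fun w _ => by ext; simp) (fun w _ => by ext; simp)
    fun w hw => cycT_cycT _ _ x)
  · rw [mem_centralizers] at hw hz ⊢
    intro i
    simp [hw, hz]
  · have hz' := symm_mem_centralizers hz
    rw [mem_centralizers] at hw hz' ⊢
    intro i
    simp [hw, hz']

/-- Coinvariants of the homology of the contracted cycles are coinvariants of the homology of the
closed up tensors. -/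
theorem beadHom_coinvariants {X : Type u} [AddCommGroup X] [Module ℂ X]
    {q : Homology (cycD I A) →ₗ[ℂ] X}
    (hq : ∀ (τ : Equiv.Perm I), (∀ c, s (τ c) = s c) → ∀ x,
      q (Homology.map _ (hCompat_cycT_cycD τ) x) = q x)
    (hker : ∀ x, q x = 0 → x ∈ Submodule.span ℂ {y | ∃ (τ : Equiv.Perm I) (m : _),
      (∀ c, s (τ c) = s c) ∧ y = Homology.map _ (hCompat_cycT_cycD τ) m - m}) :
    (∀ x, q (beadHom A s (Homology.map _ (hCompat_cycAverage (beadRotate s)) x)) =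
      q (beadHom A s x)) ∧
      ∀ x, q (beadHom A s x) = 0 → Homology.map _ (hCompat_cycAverage (beadRotate s)) x = 0 := by
  constructor
  · intro x
    rw [map_cycAverage, map_smul, map_smul, map_sum, map_sum]
    have h : ∀ z : centralizers (beadRotate s),
        q (beadHom A s (Homology.map _ (hCompat_cycT z.2) x)) = q (beadHom A s x) := fun z => by
      obtain ⟨τ, hτ, h⟩ := beadHom_cycT (A := A) z.2
      rw [h, hq τ hτ]
    rw [Finset.sum_congr rfl fun z _ => h z, Finset.sum_const, Finset.card_univ,
      Fintype.card_coe, ← Nat.cast_smul_eq_nsmul ℂ, smul_smul,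
      inv_mul_cancel₀ (card_centralizers_ne_zero _), one_smul]
  · intro x hx
    let e := LinearEquiv.ofBijective (beadHom A s) (beadHom_bijective s)
    have h1 : ∀ y ∈ Submodule.span ℂ {y | ∃ (τ : Equiv.Perm I) (m : _),
        (∀ c, s (τ c) = s c) ∧ y = Homology.map _ (hCompat_cycT_cycD (A := A) τ) m - m},
        Homology.map _ (hCompat_cycAverage (beadRotate s)) (e.symm y) = 0 := by
      intro y hy
      induction hy using Submodule.span_induction with
      | zero => simp only [map_zero]
      | add x y _ _ hx hy => rw [map_add, map_add, hx, hy, add_zero]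
      | smul a x _ hx => rw [map_smul, map_smul, hx, smul_zero]
      | mem y hy =>
        obtain ⟨τ, m, hτ, rfl⟩ := hy
        obtain ⟨m, rfl⟩ := e.surjective m
        -- The permutation `τ` of the cycles lifts to the centralizer, and the average does not see
        -- elements of the centralizer.
        have h2 : Homology.map _ (hCompat_cycT_cycD τ) (e m) = e (Homology.map _
          (hCompat_cycT (beadPerm_mem_centralizers τ hτ)) m) := (beadHom_beadPerm τ hτ m).symm
        rw [h2, ← map_sub, LinearEquiv.symm_apply_apply, map_sub,
          map_cycAverage_cycT (beadPerm_mem_centralizers τ hτ), sub_self]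
    have h2 := h1 _ (hker _ hx)
    have h3 : e.symm (beadHom A s x) = x := e.symm_apply_apply x
    rwa [h3] at h2

end BeadPerm

end HochschildWreath

end

noncomputable section

namespace HochschildWreath

set_option linter.unusedSectionVars false

/-! ### Conjugacy classes of the symmetric group and partitions -/

section Partitions

variable {n : ℕ}

/-- The index set of the parts of a partition. -/
abbrev PartIdx (lam : n.Partition) : Type := Σₗ j : Fin n, Fin (mult lam ((j : ℕ) + 1))

/-- The part attached to an index, minus one. -/
def partSize (lam : n.Partition) (c : PartIdx lam) : ℕ := (ofLex c).1

theorem mult_zero (lam : n.Partition) : mult lam 0 = 0 :=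
  Multiset.count_eq_zero_of_notMem fun h => lt_irrefl 0 (lam.parts_pos h)

theorem mult_of_lt (lam : n.Partition) {a : ℕ} (h : n < a) : mult lam a = 0 :=
  Multiset.count_eq_zero_of_notMem fun h' => by
    have := Multiset.le_sum_of_mem h'
    rw [lam.parts_sum] at this
    omega

theorem sum_mult (lam : n.Partition) :
    ∑ j : Fin n, mult lam ((j : ℕ) + 1) * ((j : ℕ) + 1) = n := by
  rw [Fin.sum_univ_eq_sum_range (fun j => mult lam (j + 1) * (j + 1)) n]
  have h := Finset.sum_multiset_count_of_subset lam.parts (Finset.range (n + 1)) fun a ha => by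
    have := Multiset.le_sum_of_mem (Multiset.mem_toFinset.1 ha)
    rw [lam.parts_sum] at this
    exact Finset.mem_range.2 (by omega)
  rw [Finset.sum_range_succ', lam.parts_sum] at h
  simpa [mult] using h.symm

theorem sum_partIdx (lam : n.Partition) (f : ℕ → ℕ) :
    ∑ c : PartIdx lam, f (partSize lam c) = ∑ j : Fin n, mult lam ((j : ℕ) + 1) * f j := by
  rw [sum_lex]
  refine Finset.sum_congr rfl fun j _ => ?_
  simp [partSize]

theorem nonempty_beads_equiv (lam : n.Partition) : Nonempty (Beads (partSize lam) ≃ Fin n) := by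
  refine Fintype.card_eq.1 ?_
  rw [Fintype.card_fin, ← Finset.card_univ, Finset.card_eq_sum_ones, sum_lex]
  simp only [Finset.sum_const, Finset.card_univ, Fintype.card_fin, smul_eq_mul, mul_one]
  rw [sum_partIdx lam fun a => a + 1, sum_mult]

/-- A power of a cycle fixes all of its points or none. These counts serve as conjugation
invariants. -/
theorem card_fixed_beadRotate_pow {I : Type} [Fintype I] [LinearOrder I] (s : I → ℕ) (m : ℕ) :
    Fintype.card {x : Beads s // (beadRotate s ^ m) x = x} =
      ∑ c, if s c + 1 ∣ m then s c + 1 else 0 := by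
  rw [Fintype.card_subtype, Finset.card_filter, sum_lex]
  refine Finset.sum_congr rfl fun c _ => ?_
  have h : ∀ i : Fin (s c + 1), (beadRotate s ^ m) (toLex ⟨c, i⟩) = toLex ⟨c, i⟩ ↔
      s c + 1 ∣ m := fun i => by
    rw [beadRotate_pow, lex_eq_iff_snd, Fin.ext_iff, val_finRotate_pow]
    constructor
    · intro h
      have h2 : (i : ℕ) + m ≡ i + 0 [MOD (s c + 1)] := by
        rw [Nat.ModEq, h, add_zero, Nat.mod_eq_of_lt i.2]
      exact Nat.modEq_zero_iff_dvd.1 (Nat.ModEq.add_left_cancel' _ h2)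
    · intro h
      rw [Nat.add_mod, Nat.mod_eq_zero_of_dvd h, add_zero, Nat.mod_mod, Nat.mod_eq_of_lt i.2]
  simp only [h]
  split_ifs <;> simp

/-- Conjugate permutations have equally many fixed points in every power. Those of the `m`-th power
count the parts dividing `m`, weighted by size, so strong induction on the part recovers all
multiplicities. -/
theorem partition_eq_of_conj {lam mu : n.Partition}
    (E : Beads (partSize lam) ≃ Beads (partSize mu))
    (hE : ∀ x, E (beadRotate _ x) = beadRotate _ (E x)) : lam = mu := by
  have hpow : ∀ m x, E ((beadRotate _ ^ m) x) = (beadRotate _ ^ m) (E x) := fun m => by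
    induction m with
    | zero => exact fun x => rfl
    | succ m ih => exact fun x => by rw [pow_succ, Equiv.Perm.mul_apply, ih, hE]; rfl
  have hfix : ∀ m, ∑ j : Fin n, mult lam ((j : ℕ) + 1) * (if (j : ℕ) + 1 ∣ m then (j : ℕ) + 1 else 0) =
      ∑ j : Fin n, mult mu ((j : ℕ) + 1) * (if (j : ℕ) + 1 ∣ m then (j : ℕ) + 1 else 0) := fun m => by
    rw [← sum_partIdx lam fun a => if a + 1 ∣ m then a + 1 else 0,
      ← sum_partIdx mu fun a => if a + 1 ∣ m then a + 1 else 0, ← card_fixed_beadRotate_pow,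
      ← card_fixed_beadRotate_pow]
    exact Fintype.card_congr (E.subtypeEquiv fun x => by rw [← hpow, E.injective.eq_iff])
  have hmult : ∀ (a : ℕ) (h : a < n), mult lam (a + 1) = mult mu (a + 1) := fun a => by
    induction a using Nat.strong_induction_on with
    | _ a ih =>
      intro ha
      have h := hfix (a + 1)
      rw [← Finset.add_sum_erase _ _ (Finset.mem_univ (⟨a, ha⟩ : Fin n)),
        ← Finset.add_sum_erase _ _ (Finset.mem_univ (⟨a, ha⟩ : Fin n)),
        Finset.sum_congr rfl (g := fun j : Fin n => mult mu ((j : ℕ) + 1) *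
          (if (j : ℕ) + 1 ∣ a + 1 then (j : ℕ) + 1 else 0)) (fun j hj => ?_)] at h
      · simpa using h
      · have hne : (j : ℕ) ≠ a := fun h => Finset.ne_of_mem_erase hj (Fin.ext h)
        split_ifs with hd
        · rw [ih j (by have := Nat.le_of_dvd (Nat.succ_pos _) hd; omega) j.2]
        · simp
  refine Nat.Partition.ext (Multiset.ext.2 fun a => ?_)
  change mult lam a = mult mu a
  rcases a with _ | a
  · rw [mult_zero, mult_zero]
  · by_cases ha : a < n
    · exact hmult a ha
    · rw [mult_of_lt lam (by omega), mult_of_lt mu (by omega)]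

/-- Different partitions give nonconjugate permutations by `partition_eq_of_conj`. Taking cycle
types is thus an injection `F` between finite sets of the same size, hence surjective, and every
conjugacy class is reached without decomposing `g` into cycles by hand. -/
theorem classifies_beadRotate (n : ℕ) :
    Classifies n fun lam : n.Partition => beadRotate (partSize lam) where
  nonempty := nonempty_beads_equiv
  existsUnique g := by
    have e : ∀ lam : n.Partition, Beads (partSize lam) ≃ Fin n := fun lam =>
      (nonempty_beads_equiv lam).some
    let F : n.Partition → (Fintype.card (Fin n)).Partition := fun lam =>
      ((e lam).permCongr (beadRotate (partSize lam))).partition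
    have hinj : Function.Injective F := fun lam mu h => by
      obtain ⟨k, hk⟩ := isConj_iff.1 (Equiv.Perm.partition_eq_of_isConj.2 h)
      refine partition_eq_of_conj (((e lam).trans k).trans (e mu).symm) fun x => ?_
      have h1 := congrArg (fun g : Equiv.Perm (Fin n) => g (k (e lam x))) hk
      simp only [Equiv.Perm.mul_apply, Equiv.Perm.inv_def, Equiv.permCongr_apply,
        Equiv.symm_apply_apply] at h1
      simp [h1]
    have hsurj : Function.Surjective F :=
      (Finite.injective_iff_surjective_of_equiv (Equiv.cast (by rw [Fintype.card_fin]))).1 hinj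
    obtain ⟨lam, hlam⟩ := hsurj g.partition
    obtain ⟨k, hk⟩ := isConj_iff.1 (Equiv.Perm.partition_eq_of_isConj.2 hlam)
    refine ⟨lam, ⟨(e lam).trans k, fun x => ?_⟩, ?_⟩
    · have h1 := congrArg (fun g : Equiv.Perm (Fin n) => g (k (e lam x))) hk
      simp only [Equiv.Perm.mul_apply, Equiv.Perm.inv_def, Equiv.permCongr_apply,
        Equiv.symm_apply_apply] at h1
      exact h1
    · rintro mu ⟨e', he'⟩
      refine partition_eq_of_conj ((e'.trans k.symm).trans (e lam).symm) fun x => ?_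
      have h1 := congrArg (fun g : Equiv.Perm (Fin n) => g (e' x)) hk
      simp only [Equiv.Perm.mul_apply, Equiv.permCongr_apply] at h1
      simp [he', ← h1, Equiv.Perm.inv_def]

end Partitions

end HochschildWreath

end

/-! ### Graded tensor products and symmetric powers as quotients of ungraded tensor powers -/

noncomputable section

namespace HochschildWreath

set_option linter.unusedSectionVars false

/-! ### Graded tensor products -/

section Scatter

variable {ι : Type} [Fintype ι] [DecidableEq ι] (W : ι → ℕ → Type u)
  [∀ i d, AddCommGroup (W i d)] [∀ i d, Module ℂ (W i d)]

variable {W} in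
theorem gtensor_ext {X : Type u} [AddCommGroup X] [Module ℂ X] {f g : (⨁ k, GTensor W k) →ₗ[ℂ] X}
    (h : ∀ (k : ℕ) (d : Degrees ι k) (x : ∀ i, W i (d.1 i)),
      f (DirectSum.lof ℂ ℕ (GTensor W) k (DirectSum.lof ℂ (Degrees ι k)
        (fun d => ⨂[ℂ] i, W i (d.1 i)) d (PiTensorProduct.tprod ℂ x))) =
      g (DirectSum.lof ℂ ℕ (GTensor W) k (DirectSum.lof ℂ (Degrees ι k)
        (fun d => ⨂[ℂ] i, W i (d.1 i)) d (PiTensorProduct.tprod ℂ x))))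
    (x : ⨁ k, GTensor W k) : f x = g x :=
  directSum_ext (fun k x => LinearMap.congr_fun (DirectSum.linearMap_ext ℂ
    (ψ := f ∘ₗ DirectSum.lof ℂ ℕ (GTensor W) k) (ψ' := g ∘ₗ DirectSum.lof ℂ ℕ (GTensor W) k)
    fun d => PiTensorProduct.ext (MultilinearMap.ext fun x => h k d x)) x) x

/-- The decomposition of the tensor product of graded spaces by total degree. -/
def scatter : (⨁ k, GTensor W k) →ₗ[ℂ] ⨂[ℂ] i, ⨁ d, W i d :=
  DirectSum.toModule ℂ ℕ _ fun k => DirectSum.toModule ℂ (Degrees ι k) _ fun d =>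
    PiTensorProduct.map fun i => DirectSum.lof ℂ ℕ (W i) (d.1 i)

theorem scatter_lof (k : ℕ) (d : Degrees ι k) (x : ⨂[ℂ] i, W i (d.1 i)) :
    scatter W (DirectSum.lof ℂ ℕ (GTensor W) k (DirectSum.lof ℂ (Degrees ι k)
        (fun d => ⨂[ℂ] i, W i (d.1 i)) d x)) =
      PiTensorProduct.map (fun i => DirectSum.lof ℂ ℕ (W i) (d.1 i)) x := by
  rw [scatter, DirectSum.toModule_lof, DirectSum.toModule_lof]

theorem scatter_bijective : Function.Bijective (scatter W) := by
  -- The tensor product of direct sums decomposes over degree vectors, and `g` regroups these by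
  -- their total degree.
  let g : (⨁ p : ι → ℕ, ⨂[ℂ] i, W i (p i)) →ₗ[ℂ] ⨁ k, GTensor W k :=
    DirectSum.toModule ℂ (ι → ℕ) _ fun p => DirectSum.lof ℂ ℕ (GTensor W) (∑ i, p i) ∘ₗ
      DirectSum.lof ℂ (Degrees ι (∑ i, p i)) (fun d => ⨂[ℂ] i, W i (d.1 i)) ⟨p, rfl⟩
  let e := PiTensorProduct.ofDirectSumEquiv (R := ℂ) (M := W)
  have hs : ∀ x, e (scatter W x) = DirectSum.toModule ℂ ℕ _ (fun k =>
      DirectSum.toModule ℂ (Degrees ι k) _ fun d => DirectSum.lof ℂ (ι → ℕ)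
        (fun p => ⨂[ℂ] i, W i (p i)) d.1) x := fun x =>
    gtensor_ext (f := e.toLinearMap ∘ₗ scatter W) (fun k d x => by
      rw [LinearMap.comp_apply, scatter_lof, PiTensorProduct.map_tprod, LinearEquiv.coe_coe,
        PiTensorProduct.ofDirectSumEquiv_tprod_lof, DirectSum.toModule_lof,
        DirectSum.toModule_lof]) x
  refine Function.bijective_iff_has_inverse.2 ⟨fun y => g (e y), fun x => ?_, fun y => ?_⟩
  · refine gtensor_ext (X := ⨁ k, GTensor W k) (f := g ∘ₗ e.toLinearMap ∘ₗ scatter W) (g := LinearMap.id)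
      (fun k d x => ?_) x
    obtain ⟨d, rfl⟩ := d
    rw [LinearMap.comp_apply, LinearMap.comp_apply, LinearEquiv.coe_coe, hs,
      DirectSum.toModule_lof, DirectSum.toModule_lof, DirectSum.toModule_lof]
    rfl
  · obtain ⟨y, rfl⟩ := e.symm.surjective y
    dsimp only
    rw [LinearEquiv.apply_symm_apply, LinearEquiv.eq_symm_apply, hs]
    refine LinearMap.congr_fun (f := DirectSum.toModule ℂ ℕ _ (fun k =>
      DirectSum.toModule ℂ (Degrees ι k) _ fun d => DirectSum.lof ℂ (ι → ℕ)
        (fun p => ⨂[ℂ] i, W i (p i)) d.1) ∘ₗ g) (g := LinearMap.id)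
      (DirectSum.linearMap_ext ℂ fun p => LinearMap.ext fun x => ?_) y
    simp only [LinearMap.comp_apply, g, DirectSum.toModule_lof, LinearMap.id_apply]

/-- The decomposition of the tensor product of graded spaces by total degree. -/
def gather : (⨂[ℂ] i, ⨁ d, W i d) ≃ₗ[ℂ] ⨁ k, GTensor W k :=
  (LinearEquiv.ofBijective (scatter W) (scatter_bijective W)).symm

@[simp]
theorem gather_scatter (x : ⨁ k, GTensor W k) : gather W (scatter W x) = x :=
  (LinearEquiv.ofBijective (scatter W) (scatter_bijective W)).symm_apply_apply x

theorem scatter_degOp (w : ℂ) (x : ⨁ k, GTensor W k) :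
    scatter W (degOp (GTensor W) w x) =
      PiTensorProduct.map (fun i => degOp (W i) w) (scatter W x) := by
  refine gtensor_ext (f := scatter W ∘ₗ degOp (GTensor W) w)
    (g := PiTensorProduct.map (fun i => degOp (W i) w) ∘ₗ scatter W) (fun k d x => ?_) x
  simp only [LinearMap.comp_apply, degOp_lof, map_smul, scatter_lof, PiTensorProduct.map_tprod]
  rw [tprod_smul_prod, Finset.prod_pow_eq_pow_sum, d.2]

theorem gather_degOp (w : ℂ) (x : ⨂[ℂ] i, ⨁ d, W i d) :
    gather W (PiTensorProduct.map (fun i => degOp (W i) w) x) =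
      degOp (GTensor W) w (gather W x) := by
  obtain ⟨x, rfl⟩ := (scatter_bijective W).2 x
  rw [← scatter_degOp, gather_scatter, gather_scatter]

variable {W} {W' : ι → ℕ → Type u} [∀ i d, AddCommGroup (W' i d)] [∀ i d, Module ℂ (W' i d)]

theorem scatter_map (f : ∀ i d, W i d →ₗ[ℂ] W' i d) (x : ⨁ k, GTensor W k) :
    scatter W' (DirectSum.lmap (fun k => GTensor.map f k) x) =
      PiTensorProduct.map (fun i => DirectSum.lmap (f i)) (scatter W x) := by
  refine gtensor_ext (f := scatter W' ∘ₗ DirectSum.lmap fun k => GTensor.map f k)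
    (g := PiTensorProduct.map (fun i => DirectSum.lmap (f i)) ∘ₗ scatter W) (fun k d x => ?_) x
  simp only [LinearMap.comp_apply, DirectSum.lmap_lof, GTensor.map, scatter_lof,
    PiTensorProduct.map_tprod]

theorem gather_map (f : ∀ i d, W i d →ₗ[ℂ] W' i d) (x : ⨂[ℂ] i, ⨁ d, W i d) :
    gather W' (PiTensorProduct.map (fun i => DirectSum.lmap (f i)) x) =
      DirectSum.lmap (fun k => GTensor.map f k) (gather W x) := by
  obtain ⟨x, rfl⟩ := (scatter_bijective W).2 x
  rw [← scatter_map, gather_scatter, gather_scatter]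

end Scatter

/-! ### Symmetric powers -/

section Sym

variable (p : ℕ) (V : ℕ → Type u) [∀ d, AddCommGroup (V d)] [∀ d, Module ℂ (V d)]

/-- The direct sum of a family of vector spaces. -/
abbrev Total (V : ℕ → Type u) [∀ d, AddCommGroup (V d)] : Type u := ⨁ d, V d

/-- The projection from the tensor power to the symmetric power. -/
def symQ : (⨂[ℂ] _ : Fin p, ⨁ d, V d) →ₗ[ℂ] Total (GSym p V) :=
  DirectSum.lmap (fun k => (symRelations p V k).mkQ) ∘ₗ (gather fun _ : Fin p => V).toLinearMap

theorem symQ_scatter (x : ⨁ k, GTensor (fun _ : Fin p => V) k) :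
    symQ p V (scatter _ x) = DirectSum.lmap (fun k => (symRelations p V k).mkQ) x := by
  rw [symQ, LinearMap.comp_apply, LinearEquiv.coe_coe, gather_scatter]

theorem symQ_surjective : Function.Surjective (symQ p V) := by
  have h : Function.Surjective (DirectSum.lmap fun k => (symRelations p V k).mkQ) :=
    (DirectSum.lmap_surjective _).2 fun k => Submodule.mkQ_surjective _
  exact h.comp (gather fun _ : Fin p => V).surjective

/-- This identifies the action by degrees used in `symRelations` with the ungraded one, in which the
parity is read off from `degOp V (-1)`. -/
theorem koszulT_scatter (σ : Equiv.Perm (Fin p)) (k : ℕ) (d : Degrees (Fin p) k)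
    (x : ⨂[ℂ] i, V (d.1 i)) :
    koszulT (degOp V (-1)) σ (scatter (fun _ : Fin p => V) (DirectSum.lof ℂ ℕ _ k
      (DirectSum.lof ℂ (Degrees (Fin p) k) (fun d => ⨂[ℂ] i, V (d.1 i)) d x))) =
      scatter (fun _ : Fin p => V) (DirectSum.lof ℂ ℕ _ k (koszulSign σ d.1 •
        DirectSum.lof ℂ (Degrees (Fin p) k) (fun d => ⨂[ℂ] i, V (d.1 i)) (permDegrees σ d)
          (permTensor V σ d x))) := by
  simp only [map_smul, scatter_lof]
  refine pi_tensor_ext (φ := koszulT (degOp V (-1)) σ ∘ₗ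
      PiTensorProduct.map fun i => DirectSum.lof ℂ ℕ V (d.1 i))
    (ψ := koszulSign σ d.1 • (PiTensorProduct.map (fun i => DirectSum.lof ℂ ℕ V
      ((permDegrees σ d).1 i)) ∘ₗ (permTensor V σ d).toLinearMap)) (fun x => ?_) x
  have h : permTensor V σ d (PiTensorProduct.tprod ℂ x) = PiTensorProduct.tprod ℂ fun i =>
      (x (σ.symm i) : V ((permDegrees σ d).1 i)) := PiTensorProduct.reindex_tprod _ _
  rw [LinearMap.comp_apply, LinearMap.smul_apply, LinearMap.comp_apply, PiTensorProduct.map_tprod,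
    koszulT_tprod _ _ _ d.1 fun i => degOp_lof _ _ _, LinearEquiv.coe_coe, h]
  exact congrArg _ (PiTensorProduct.map_tprod _ _).symm

theorem symQ_koszulT (σ : Equiv.Perm (Fin p)) (x : ⨂[ℂ] _ : Fin p, ⨁ d, V d) :
    symQ p V (koszulT (degOp V (-1)) σ x) = symQ p V x := by
  obtain ⟨x, rfl⟩ := (scatter_bijective _).2 x
  refine gtensor_ext (X := Total (GSym p V)) (f := symQ p V ∘ₗ koszulT (degOp V (-1)) σ ∘ₗ scatter _)
    (g := symQ p V ∘ₗ scatter _) (fun k d x => ?_) x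
  simp only [LinearMap.comp_apply]
  rw [koszulT_scatter, symQ_scatter, symQ_scatter, DirectSum.lmap_lof, DirectSum.lmap_lof]
  congr 1
  rw [Submodule.mkQ_apply, Submodule.mkQ_apply, Submodule.Quotient.eq]
  exact Submodule.subset_span ⟨σ, d, _, rfl⟩

/-- The average of the Koszul action of the symmetric group. -/
def koszulAverage {M : Type u} [AddCommGroup M] [Module ℂ M] (ε : M →ₗ[ℂ] M) (p : ℕ) :
    (⨂[ℂ] _ : Fin p, M) →ₗ[ℂ] ⨂[ℂ] _ : Fin p, M :=
  (Fintype.card (Equiv.Perm (Fin p)) : ℂ)⁻¹ • ∑ σ : Equiv.Perm (Fin p), koszulT ε σ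

theorem koszulAverage_koszulT {M : Type u} [AddCommGroup M] [Module ℂ M] {ε : M →ₗ[ℂ] M}
    (hε : ∀ x, ε (ε x) = x) (p : ℕ) (σ : Equiv.Perm (Fin p)) (x : ⨂[ℂ] _ : Fin p, M) :
    koszulAverage ε p (koszulT ε σ x) = koszulAverage ε p x := by
  simp only [koszulAverage, LinearMap.smul_apply, LinearMap.sum_apply]
  refine congrArg _ (Fintype.sum_equiv (Equiv.mulRight σ) _ _ fun τ => ?_)
  rw [koszulT_comp hε]
  rfl

/-- The average kills the relations and so factors through the symmetric power. This gives control
of the kernel of `symQ`. -/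
theorem exists_symQ_section : ∃ a : Total (GSym p V) →ₗ[ℂ] ⨂[ℂ] _ : Fin p, ⨁ d, V d,
    ∀ x, a (symQ p V x) = koszulAverage (degOp V (-1)) p x := by
  have h : ∀ k, symRelations p V k ≤ LinearMap.ker (koszulAverage (degOp V (-1)) p ∘ₗ
      scatter (fun _ : Fin p => V) ∘ₗ DirectSum.lof ℂ ℕ (GTensor fun _ : Fin p => V) k) := fun k => by
    refine Submodule.span_le.2 ?_
    rintro _ ⟨σ, d, x, rfl⟩
    rw [SetLike.mem_coe, LinearMap.mem_ker, map_sub, sub_eq_zero]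
    simp only [LinearMap.comp_apply]
    rw [← koszulT_scatter, koszulAverage_koszulT degOp_neg_one_sq]
  refine ⟨DirectSum.toModule ℂ ℕ _ fun k => (symRelations p V k).liftQ _ (h k), fun x => ?_⟩
  obtain ⟨x, rfl⟩ := (scatter_bijective _).2 x
  rw [symQ_scatter]
  refine directSum_ext (f := DirectSum.toModule ℂ ℕ _ (fun k => (symRelations p V k).liftQ _ (h k)) ∘ₗ
    DirectSum.lmap fun k => (symRelations p V k).mkQ)
    (g := koszulAverage (degOp V (-1)) p ∘ₗ scatter _) (fun k x => ?_) x
  rw [LinearMap.comp_apply, DirectSum.lmap_lof, DirectSum.toModule_lof]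
  exact Submodule.liftQ_apply _ _ _

theorem symQ_degOp (w : ℂ) (x : ⨂[ℂ] _ : Fin p, ⨁ d, V d) :
    symQ p V (PiTensorProduct.map (fun _ => degOp V w) x) = degOp (GSym p V) w (symQ p V x) := by
  rw [symQ, LinearMap.comp_apply, LinearMap.comp_apply, LinearEquiv.coe_coe, ← degOp_lmap,
    ← gather_degOp]

variable {V} {V' : ℕ → Type u} [∀ d, AddCommGroup (V' d)] [∀ d, Module ℂ (V' d)]

theorem symQ_map (f : ∀ d, V d →ₗ[ℂ] V' d) (x : ⨂[ℂ] _ : Fin p, ⨁ d, V d) :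
    symQ p V' (PiTensorProduct.map (fun _ => DirectSum.lmap f) x) =
      DirectSum.lmap (fun k => GSym.map p f k) (symQ p V x) := by
  rw [symQ, LinearMap.comp_apply, symQ, LinearMap.comp_apply, LinearEquiv.coe_coe,
    LinearEquiv.coe_coe, gather_map (fun _ => f)]
  refine directSum_ext (W := Total (GSym p V')) (f := DirectSum.lmap (fun k => (symRelations p V' k).mkQ) ∘ₗ
    DirectSum.lmap (fun k => GTensor.map (fun _ => f) k)) (g := DirectSum.lmap (fun k => GSym.map p f k) ∘ₗ
      DirectSum.lmap (fun k => (symRelations p V k).mkQ)) (fun k x => ?_) _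
  simp only [LinearMap.comp_apply, DirectSum.lmap_lof]
  rfl

end Sym

end HochschildWreath

end

noncomputable section

namespace HochschildWreath

set_option linter.unusedSectionVars false

/-! ### Tensor products of symmetric powers -/

section SymTensor

variable {J : Type} [Fintype J] [LinearOrder J] (m : J → ℕ) (V : ℕ → Type u)
  [∀ d, AddCommGroup (V d)] [∀ d, Module ℂ (V d)]

/-- The projection from a tensor power to a tensor product of symmetric powers. -/
def gsymQ : (⨂[ℂ] _ : (Σₗ j, Fin (m j)), Total V) →ₗ[ℂ] Total (GTensor fun j => GSym (m j) V) :=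
  (gather fun j => GSym (m j) V).toLinearMap ∘ₗ
    PiTensorProduct.map (fun j => symQ (m j) V) ∘ₗ nestT (fun j => Fin (m j)) (Total V)

theorem gsymQ_apply (x : ⨂[ℂ] _ : (Σₗ j, Fin (m j)), Total V) :
    gsymQ m V x = gather (fun j => GSym (m j) V) (PiTensorProduct.map (fun j => symQ (m j) V)
      (nestT (fun j => Fin (m j)) (Total V) x)) := rfl

theorem map_map_congr {ι : Type} {M M₁ M₂ M₃ : ι → Type u} [∀ i, AddCommGroup (M i)]
    [∀ i, Module ℂ (M i)] [∀ i, AddCommGroup (M₁ i)] [∀ i, Module ℂ (M₁ i)]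
    [∀ i, AddCommGroup (M₂ i)] [∀ i, Module ℂ (M₂ i)] [∀ i, AddCommGroup (M₃ i)]
    [∀ i, Module ℂ (M₃ i)] {f : ∀ i, M i →ₗ[ℂ] M₁ i} {g : ∀ i, M₁ i →ₗ[ℂ] M₃ i}
    {f' : ∀ i, M i →ₗ[ℂ] M₂ i} {g' : ∀ i, M₂ i →ₗ[ℂ] M₃ i}
    (h : ∀ i x, g i (f i x) = g' i (f' i x)) (x : ⨂[ℂ] i, M i) :
    PiTensorProduct.map g (PiTensorProduct.map f x) =
      PiTensorProduct.map g' (PiTensorProduct.map f' x) := by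
  rw [← LinearMap.comp_apply, ← PiTensorProduct.map_comp, ← LinearMap.comp_apply,
    ← PiTensorProduct.map_comp]
  exact LinearMap.congr_fun (congrArg PiTensorProduct.map
    (funext fun i => LinearMap.ext (h i))) x

theorem map_surjective {ι : Type} {M M' : ι → Type u} [∀ i, AddCommGroup (M i)]
    [∀ i, Module ℂ (M i)] [∀ i, AddCommGroup (M' i)] [∀ i, Module ℂ (M' i)]
    (f : ∀ i, M i →ₗ[ℂ] M' i) (hf : ∀ i, Function.Surjective (f i)) :
    Function.Surjective (PiTensorProduct.map f) := fun y => by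
  induction y using PiTensorProduct.induction_on with
  | smul_tprod r y =>
    choose x hx using fun i => hf i (y i)
    exact ⟨r • PiTensorProduct.tprod ℂ x, by rw [map_smul, PiTensorProduct.map_tprod, funext hx]⟩
  | add y y' hy hy' =>
    obtain ⟨x, rfl⟩ := hy
    obtain ⟨x', rfl⟩ := hy'
    exact ⟨x + x', map_add _ _ _⟩

theorem gsymQ_surjective : Function.Surjective (gsymQ m V) :=
  (gather fun j => GSym (m j) V).surjective.comp
    ((map_surjective _ fun j => symQ_surjective (m j) V).comp (nestT_bijective (Total V)).2)

theorem gsymQ_koszulT (σ : ∀ j, Equiv.Perm (Fin (m j)))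
    (x : ⨂[ℂ] _ : (Σₗ j, Fin (m j)), Total V) :
    gsymQ m V (koszulT (degOp V (-1)) (lexCongr σ) x) = gsymQ m V x := by
  rw [gsymQ_apply, nestT_koszulT degOp_neg_one_sq, ← LinearMap.comp_apply,
    ← PiTensorProduct.map_comp, gsymQ_apply]
  have h : ∀ j, symQ (m j) V ∘ₗ koszulT (degOp V (-1)) (σ j) = symQ (m j) V := fun j =>
    LinearMap.ext fun x => symQ_koszulT (m j) V (σ j) x
  rw [funext h]

/-- Multilinear expansion turns a tensor product of averages into an average over the product of the
groups. -/
theorem map_koszulAverage {M : Type u} [AddCommGroup M] [Module ℂ M] (ε : M →ₗ[ℂ] M)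
    (x : ⨂[ℂ] j, ⨂[ℂ] _ : Fin (m j), M) :
    PiTensorProduct.map (fun j => koszulAverage ε (m j)) x =
      (∏ j, (Fintype.card (Equiv.Perm (Fin (m j))) : ℂ)⁻¹) •
        ∑ σ : ∀ j, Equiv.Perm (Fin (m j)), PiTensorProduct.map (fun j => koszulT ε (σ j)) x := by
  have h := (PiTensorProduct.mapMultilinear ℂ (fun j => ⨂[ℂ] _ : Fin (m j), M)
    (fun j => ⨂[ℂ] _ : Fin (m j), M)).map_smul_univ
      (fun j => (Fintype.card (Equiv.Perm (Fin (m j))) : ℂ)⁻¹)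
      (fun j => ∑ σ : Equiv.Perm (Fin (m j)), koszulT ε σ)
  rw [MultilinearMap.map_sum] at h
  exact (LinearMap.congr_fun h x).trans (by
    rw [LinearMap.smul_apply, LinearMap.sum_apply]; rfl)

/-- If `x` maps to zero, then so does its average over the product of symmetric groups, of order
`N`. Hence `x` is `-1/N` times the sum of the differences `σ x - x`. -/
theorem gsymQ_ker (x : ⨂[ℂ] _ : (Σₗ j, Fin (m j)), Total V) (hx : gsymQ m V x = 0) :
    x ∈ Submodule.span ℂ {y | ∃ (σ : ∀ j, Equiv.Perm (Fin (m j))) (z : _),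
      y = koszulT (degOp V (-1)) (lexCongr σ) z - z} := by
  choose a ha using fun j => exists_symQ_section (m j) V
  have h0 : PiTensorProduct.map (fun j => koszulAverage (degOp V (-1)) (m j))
      (nestT (fun j => Fin (m j)) (Total V) x) = 0 := by
    rw [gsymQ_apply, LinearEquiv.map_eq_zero_iff] at hx
    have h1 : ∀ j, a j ∘ₗ symQ (m j) V = koszulAverage (degOp V (-1)) (m j) := fun j =>
      LinearMap.ext (ha j)
    rw [← funext h1, PiTensorProduct.map_comp, LinearMap.comp_apply, hx, map_zero]
  rw [map_koszulAverage] at h0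
  have hc : ∏ j, (Fintype.card (Equiv.Perm (Fin (m j))) : ℂ)⁻¹ ≠ 0 :=
    Finset.prod_ne_zero_iff.2 fun j _ => inv_ne_zero (Nat.cast_ne_zero.2 Fintype.card_ne_zero)
  have h2 := (smul_eq_zero.1 h0).resolve_left hc
  simp only [← nestT_koszulT degOp_neg_one_sq] at h2
  rw [← map_sum] at h2
  have h3 : ∑ σ : ∀ j, Equiv.Perm (Fin (m j)), koszulT (degOp V (-1)) (lexCongr σ) x = 0 :=
    (nestT_bijective (Total V)).1 (h2.trans (map_zero _).symm)
  have hN : (Fintype.card (∀ j, Equiv.Perm (Fin (m j))) : ℂ) ≠ 0 :=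
    Nat.cast_ne_zero.2 Fintype.card_ne_zero
  have h4 : x = (-(Fintype.card (∀ j, Equiv.Perm (Fin (m j))) : ℂ)⁻¹) •
      ∑ σ : ∀ j, Equiv.Perm (Fin (m j)), (koszulT (degOp V (-1)) (lexCongr σ) x - x) := by
    rw [Finset.sum_sub_distrib, h3, zero_sub, Finset.sum_const, smul_neg, neg_smul, neg_neg,
      Finset.card_univ, ← Nat.cast_smul_eq_nsmul ℂ, smul_smul, inv_mul_cancel₀ hN, one_smul]
  rw [h4]
  exact Submodule.smul_mem _ _ (Submodule.sum_mem _ fun σ _ => Submodule.subset_span ⟨σ, x, rfl⟩)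

theorem gsymQ_degOp (w : ℂ) (x : ⨂[ℂ] _ : (Σₗ j, Fin (m j)), Total V) :
    gsymQ m V (PiTensorProduct.map (fun _ => degOp V w) x) =
      degOp (GTensor fun j => GSym (m j) V) w (gsymQ m V x) := by
  rw [gsymQ_apply, gsymQ_apply, nestT_map, ← gather_degOp]
  refine congrArg _ ?_
  exact map_map_congr (fun j x => symQ_degOp (m j) V w x) _

variable {V} {V' : ℕ → Type u} [∀ d, AddCommGroup (V' d)] [∀ d, Module ℂ (V' d)]

theorem gsymQ_map (f : ∀ d, V d →ₗ[ℂ] V' d) (x : ⨂[ℂ] _ : (Σₗ j, Fin (m j)), Total V) :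
    gsymQ m V' (PiTensorProduct.map (fun _ => DirectSum.lmap f) x) =
      DirectSum.lmap (fun k => GTensor.map (fun j d => GSym.map (m j) f d) k) (gsymQ m V x) := by
  rw [gsymQ_apply, gsymQ_apply, nestT_map, ← gather_map]
  refine congrArg _ ?_
  exact map_map_congr (fun j x => symQ_map (m j) f x) _

end SymTensor

end HochschildWreath

end

/-! ### Assembling the isomorphism, its grading and its naturality -/

noncomputable section

namespace HochschildWreath

set_option linter.unusedSectionVars false

/-! ### Hochschild homology and the cyclic total space -/

section Regular

variable (E : Type u) [Ring E] [Algebra ℂ E]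

/-- The identification of the Hochschild complex with the one with regular coefficients. -/
def regEquiv : HTot E ≃ₗ[ℂ] HC E E :=
  LinearEquiv.ofBijective (DirectSum.lmap fun k => (consEquiv E k).symm.toLinearMap)
    ⟨(DirectSum.lmap_injective _).2 fun k => (consEquiv E k).symm.injective,
      (DirectSum.lmap_surjective _).2 fun k => (consEquiv E k).symm.surjective⟩

theorem regEquiv_apply (x : HTot E) :
    regEquiv E x = DirectSum.lmap (fun k => (consEquiv E k).symm.toLinearMap) x := rfl

theorem regEquiv_d (x : HTot E) :
    regEquiv E (hTotD E x) = hcTotD (Bimod.regular E) (regEquiv E x) :=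
  shiftD_lmap (V' := HCk E E) _ (fun k x => by
    rw [LinearEquiv.coe_coe, LinearEquiv.symm_apply_eq, consEquiv_hcD, LinearEquiv.coe_coe,
      LinearEquiv.apply_symm_apply]) x

/-- Hochschild homology as the homology of the complex with regular coefficients. -/
def regHom : (⨁ k, HH E k) →ₗ[ℂ] Homology (hcTotD (Bimod.regular E)) :=
  Homology.map (regEquiv E).toLinearMap (.of_comm (regEquiv_d E)) ∘ₗ HH.total E

theorem regHom_bijective : Function.Bijective (regHom E) :=
  (Homology.map_bijective_of_equiv (regEquiv E) (regEquiv_d E) (.of_comm (regEquiv_d E))).comp HH.total_bijective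

theorem hcTotD_lof {k : ℕ} (x : hCycles E k) : hcTotD (Bimod.regular E)
    (DirectSum.lof ℂ ℕ (HCk E E) k ((consEquiv E k).symm x.1)) = 0 := by
  have h := regEquiv_d E (DirectSum.lof ℂ ℕ (fun k => TPow E (k + 1)) k x.1)
  rw [hCycles_spec, map_zero, regEquiv_apply, DirectSum.lmap_lof] at h
  exact h.symm

theorem regHom_lof (k : ℕ) (x : hCycles E k) :
    regHom E (DirectSum.lof ℂ ℕ (fun k => HH E k) k (HH.mk k x)) =
      Homology.mk _ (DirectSum.lof ℂ ℕ (HCk E E) k ((consEquiv E k).symm x.1))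
        (hcTotD_lof E x) := by
  rw [regHom, LinearMap.comp_apply, HH.total_lof, HH.incl_mk, Homology.map_mk]
  congr 1
  exact DirectSum.lmap_lof _ _ _

theorem span_lof_mk : Submodule.span ℂ {y : ⨁ k, HH E k | ∃ k x,
    y = DirectSum.lof ℂ ℕ (fun k => HH E k) k (HH.mk k x)} = ⊤ := by
  refine eq_top_iff.2 fun y _ => ?_
  induction y using DirectSum.induction_on with
  | zero => exact Submodule.zero_mem _
  | of k c =>
    obtain ⟨x, rfl⟩ := HH.mk_surjective k c
    exact Submodule.subset_span ⟨k, x, rfl⟩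
  | add x y hx hy => exact Submodule.add_mem _ (hx trivial) (hy trivial)

theorem hCompat_degOp {V : ℕ → Type u} [∀ k, AddCommGroup (V k)] [∀ k, Module ℂ (V k)]
    (d : ∀ k, V (k + 1) →ₗ[ℂ] V k) {w : ℂ} (hw : w ≠ 0) :
    HCompat (shiftD d) (shiftD d) (degOp V w) :=
  .of_smul_comm w (fun x => shiftD_degOp d w x) hw

theorem regHom_ext {X : Type u} [AddCommGroup X] [Module ℂ X] {f g : (⨁ k, HH E k) →ₗ[ℂ] X}
    (h : ∀ k (x : hCycles E k), f (DirectSum.lof ℂ ℕ (fun k => HH E k) k (HH.mk k x)) =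
      g (DirectSum.lof ℂ ℕ (fun k => HH E k) k (HH.mk k x))) (c : ⨁ k, HH E k) : f c = g c :=
  directSum_ext (fun k c => by
    obtain ⟨x, rfl⟩ := HH.mk_surjective k c
    exact h k x) c

theorem Homology.mk_smul {V : Type u} [AddCommGroup V] [Module ℂ V] (d : V →ₗ[ℂ] V) (r : ℂ)
    (x : V) (hx : d x = 0) (h : d (r • x) = 0) :
    Homology.mk d (r • x) h = r • Homology.mk d x hx := rfl

theorem regHom_degOp {w : ℂ} (hw : w ≠ 0) (c : ⨁ k, HH E k) :
    regHom E (degOp (fun k => HH E k) w c) =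
      Homology.map (degOp (HCk E E) w) (hCompat_degOp _ hw) (regHom E c) := by
  refine regHom_ext E (f := regHom E ∘ₗ degOp (fun k => HH E k) w)
    (g := Homology.map (degOp (HCk E E) w) (hCompat_degOp _ hw) ∘ₗ regHom E) (fun k x => ?_) c
  rw [LinearMap.comp_apply, LinearMap.comp_apply, degOp_lof, map_smul, regHom_lof, Homology.map_mk,
    ← Homology.mk_smul]
  · congr 1
    exact (degOp_lof _ _ _).symm
  · rw [map_smul, hcTotD_lof, smul_zero]

variable {E} {E' : Type u} [Ring E'] [Algebra ℂ E']

theorem hcHat_regEquiv (f : E →ₐ[ℂ] E') (x : HTot E) :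
    hcHat f f.toLinearMap (regEquiv E x) = regEquiv E' (hTotMap f x) := by
  refine directSum_ext (W := HC E' E') (f := hcHat f f.toLinearMap ∘ₗ (regEquiv E).toLinearMap)
    (g := (regEquiv E').toLinearMap ∘ₗ hTotMap f) (fun k x => ?_) x
  simp only [LinearMap.comp_apply, LinearEquiv.coe_coe, regEquiv_apply, hTotMap,
    DirectSum.lmap_lof, hcHat_lof]
  congr 1
  rw [LinearEquiv.eq_symm_apply, ← tpowMap_consEquiv, LinearEquiv.apply_symm_apply]

theorem hCompat_hcHat_regular (f : E →ₐ[ℂ] E') : HCompat (hcTotD (Bimod.regular E))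
    (hcTotD (Bimod.regular E')) (hcHat f f.toLinearMap) :=
  .of_comm fun x => by
    obtain ⟨x, rfl⟩ := (regEquiv E).surjective x
    rw [← regEquiv_d, hcHat_regEquiv, hcHat_regEquiv, hTotMap_d, regEquiv_d]

theorem regHom_map (f : E →ₐ[ℂ] E') (c : ⨁ k, HH E k) :
    regHom E' (DirectSum.lmap (HHMap f) c) =
      Homology.map (hcHat f f.toLinearMap) (hCompat_hcHat_regular f) (regHom E c) := by
  rw [regHom, LinearMap.comp_apply, HH.total_map]
  exact Homology.map_square _ _ (.of_comm (regEquiv_d E)) _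
    (fun x => (hcHat_regEquiv f x).symm) _

end Regular

/-! ### The Künneth isomorphism -/

section Tensor

variable (I : Type) [Fintype I] [LinearOrder I] (A : Type u) [Ring A] [Algebra ℂ A]

/-- Hochschild homology as the homology of the cyclic total space. -/
def cycHom : (⨁ k, HH A k) →ₗ[ℂ] Homology (Cyc.d (A := A)) := regHom A

theorem cycHom_bijective : Function.Bijective (cycHom A) := regHom_bijective A

variable {A} in
/-- A Hochschild cycle in the cyclic total space. -/
def cycOf (k : ℕ) (x : hCycles A k) : Cyc A :=
  DirectSum.lof ℂ ℕ (HCk A A) k ((consEquiv A k).symm x.1)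

variable {A} in
theorem Cyc.d_cycOf (k : ℕ) (x : hCycles A k) : Cyc.d (cycOf k x) = 0 := hcTotD_lof A x

variable {A} in
theorem Cyc.deg_cycOf (z : ℂ) (k : ℕ) (x : hCycles A k) :
    Cyc.deg z (cycOf k x) = z ^ k • cycOf k x := degOp_lof _ _ _

theorem cycHom_lof (k : ℕ) (x : hCycles A k) :
    cycHom A (DirectSum.lof ℂ ℕ (fun k => HH A k) k (HH.mk k x)) =
      Homology.mk Cyc.d (cycOf k x) (Cyc.d_cycOf k x) := regHom_lof A k x

theorem hCompat_deg {w : ℂ} (hw : w ≠ 0) : HCompat (Cyc.d (A := A)) Cyc.d (Cyc.deg w) :=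
  .of_smul_comm w (fun x => Cyc.d_deg w x) hw

theorem cycHom_degOp {w : ℂ} (hw : w ≠ 0) (c : ⨁ k, HH A k) :
    cycHom A (degOp (fun k => HH A k) w c) =
      Homology.map (Cyc.deg w) (hCompat_deg A hw) (cycHom A c) := regHom_degOp A hw c

/-- The Künneth map of the tensor powers of the cyclic total space. -/
def kunnethCyc : (⨂[ℂ] _ : I, Homology (Cyc.d (A := A))) →ₗ[ℂ] Homology (cycD I A) :=
  kunneth fun _ => Cyc.superDiff

/-- The Künneth isomorphism for tensor powers of Hochschild homology. -/
def cycTHom : (⨂[ℂ] _ : I, Total (fun k => HH A k)) →ₗ[ℂ] Homology (cycD I A) :=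
  kunnethCyc I A ∘ₗ PiTensorProduct.map fun _ => cycHom A

theorem cycTHom_bijective : Function.Bijective (cycTHom I A) :=
  (kunneth_bijective fun _ => Cyc.superDiff).comp
    (PiTensorProduct.congr fun _ : I => LinearEquiv.ofBijective _ (cycHom_bijective A)).bijective

variable {I}

variable {A} in
theorem cycD_tprod_cycOf (k : I → ℕ) (x : ∀ i, hCycles A (k i)) :
    cycD I A (PiTensorProduct.tprod ℂ fun i => cycOf (k i) (x i)) = 0 :=
  koszulD_tprod_cycle fun _ => Cyc.d_cycOf _ _

theorem cycTHom_tprod (k : I → ℕ) (x : ∀ i, hCycles A (k i)) :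
    cycTHom I A (PiTensorProduct.tprod ℂ fun i =>
      DirectSum.lof ℂ ℕ (fun k => HH A k) (k i) (HH.mk (k i) (x i))) =
      Homology.mk (cycD I A) (PiTensorProduct.tprod ℂ fun i => cycOf (k i) (x i))
        (cycD_tprod_cycOf k x) := by
  rw [cycTHom, LinearMap.comp_apply, PiTensorProduct.map_tprod]
  simp only [cycHom_lof]
  exact kunneth_tprod _ _ _

/-- On tensors of classes of homogeneous cycles both signs are computed from the same degrees, and
such tensors span. -/
theorem cycTHom_koszulT (τ : Equiv.Perm I) (m : ⨂[ℂ] _ : I, Total (fun k => HH A k)) :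
    cycTHom I A (koszulT (degOp (fun k => HH A k) (-1)) τ m) =
      Homology.map _ (hCompat_cycT_cycD τ) (cycTHom I A m) := by
  refine tensor_ext (φ := cycTHom I A ∘ₗ koszulT (degOp (fun k => HH A k) (-1)) τ)
    (ψ := Homology.map _ (hCompat_cycT_cycD τ) ∘ₗ cycTHom I A) _ (fun _ => span_lof_mk A)
    (fun y hy => ?_) m
  choose k x hx using hy
  obtain rfl := funext hx
  rw [LinearMap.comp_apply, LinearMap.comp_apply, koszulT_tprod _ _ _ k fun i => degOp_lof _ _ _,
    map_smul, cycTHom_tprod A (fun i => k (τ.symm i)) fun i => x (τ.symm i), cycTHom_tprod,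
    Homology.map_mk, ← Homology.mk_smul]
  · congr 1
    exact (koszulT_tprod (Cyc.deg (-1)) τ _ k fun i => Cyc.deg_cycOf _ _ _).symm
  · rw [map_smul, cycD_tprod_cycOf (fun i => k (τ.symm i)) fun i => x (τ.symm i), smul_zero]

theorem hCompat_cycDeg {w : ℂ} (hw : w ≠ 0) : HCompat (cycD I A) (cycD I A) (cycDeg w) :=
  .of_smul_comm w (fun x => koszulD_degree w (fun _ => Cyc.deg_comm _ _) (fun _ => Cyc.d_deg w) x) hw

theorem cycTHom_degOp {w : ℂ} (hw : w ≠ 0) (m : ⨂[ℂ] _ : I, Total (fun k => HH A k)) :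
    cycTHom I A (PiTensorProduct.map (fun _ => degOp (fun k => HH A k) w) m) =
      Homology.map _ (hCompat_cycDeg A hw) (cycTHom I A m) := by
  refine Eq.trans (congrArg (kunnethCyc I _)
    (map_map_congr (fun _ x => cycHom_degOp A hw x) m)) ?_
  exact kunneth_map _ _ _ _ _ _

variable {A} {B : Type u} [Ring B] [Algebra ℂ B]

theorem hCompat_cycMap (f : A →ₐ[ℂ] B) : HCompat (cycD I A) (cycD I B) (cycMap f) :=
  .of_comm fun x => koszulD_map _ (fun _ x => Cyc.map_d f x) (fun _ x => Cyc.map_deg f _ x) x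

theorem cycHom_map (f : A →ₐ[ℂ] B) (c : ⨁ k, HH A k) :
    cycHom B (DirectSum.lmap (HHMap f) c) =
      Homology.map (Cyc.map f) (.of_comm (Cyc.map_d f)) (cycHom A c) := regHom_map f c

theorem cycTHom_map (f : A →ₐ[ℂ] B) (m : ⨂[ℂ] _ : I, Total (fun k => HH A k)) :
    cycTHom I B (PiTensorProduct.map (fun _ => DirectSum.lmap (HHMap f)) m) =
      Homology.map _ (hCompat_cycMap f) (cycTHom I A m) := by
  refine Eq.trans (congrArg (kunnethCyc I _)
    (map_map_congr (fun _ x => cycHom_map f x) m)) ?_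
  exact kunneth_map _ _ _ _ _ _

end Tensor

end HochschildWreath

end

noncomputable section

namespace HochschildWreath

set_option linter.unusedSectionVars false

/-! ### The graded isomorphism -/

/-- Permutations of the parts that preserve sizes are thereby exactly the elements of the product of
the symmetric groups in the symmetric powers. -/
theorem exists_lexCongr {I : Type} {F : I → Type} [∀ c, Finite (F c)]
    (τ : Equiv.Perm (Σₗ c, F c)) (h : ∀ c, (ofLex (τ c)).1 = (ofLex c).1) :
    ∃ σ : ∀ c, Equiv.Perm (F c), τ = lexCongr σ := by
  have h1 : ∀ c (i : F c), ∃ i', τ (toLex ⟨c, i⟩) = toLex ⟨c, i'⟩ := fun c i => by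
    have h2 := h (toLex ⟨c, i⟩)
    generalize τ (toLex ⟨c, i⟩) = y at h2
    obtain ⟨c', i'⟩ := y
    obtain rfl : c' = c := h2
    exact ⟨i', rfl⟩
  choose g hg using h1
  have hinj : ∀ c, Function.Injective (g c) := fun c i j hij => by
    have h2 : τ (toLex ⟨c, i⟩) = τ (toLex ⟨c, j⟩) := by rw [hg, hg, hij]
    have h3 : (⟨c, i⟩ : Σ c, F c) = ⟨c, j⟩ := toLex.injective (τ.injective h2)
    exact eq_of_heq (Sigma.mk.inj h3).2
  refine ⟨fun c => Equiv.ofBijective (g c) (Finite.injective_iff_bijective.1 (hinj c)),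
    Equiv.ext fun x => ?_⟩
  obtain ⟨⟨c, i⟩, rfl⟩ := toLex.surjective x
  rw [hg, lexCongr_toLex, Equiv.ofBijective_apply]

section Graded

variable {L : Type} {V : ℕ → Type u} [∀ k, AddCommGroup (V k)] [∀ k, Module ℂ (V k)]
  {W : L → ℕ → Type u} [∀ l k, AddCommGroup (W l k)] [∀ l k, Module ℂ (W l k)]
  (T : Total V ≃ₗ[ℂ] ∀ l, Total (W l))

/-- The map in a given degree underlying a map of graded spaces. -/
def gradedPart (k : ℕ) : V k →ₗ[ℂ] ∀ l, W l k :=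
  LinearMap.pi fun l => DirectSum.component ℂ ℕ (W l) k ∘ₗ LinearMap.proj l ∘ₗ
    T.toLinearMap ∘ₗ DirectSum.lof ℂ ℕ V k

theorem gradedPart_apply (k : ℕ) (x : V k) (l : L) :
    gradedPart T k x l = (T (DirectSum.lof ℂ ℕ V k x) l : Total (W l)) k := rfl

/-- The degree `k` part is the eigenspace of `degOp V 2` for `2 ^ k`, so an isomorphism that
commutes with these operators preserves degrees. -/
theorem gradedPart_bijective (hT : ∀ x l, T (degOp V 2 x) l = degOp (W l) 2 (T x l)) (k : ℕ) :
    Function.Bijective (gradedPart T k) := by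
  have h : ∀ x l, DirectSum.lof ℂ ℕ (W l) k (gradedPart T k x l) = T (DirectSum.lof ℂ ℕ V k x) l :=
    fun x l => degOp_eigen k _ (by
      refine (hT (DirectSum.lof ℂ ℕ V k x) l).symm.trans ?_
      rw [degOp_lof, map_smul]
      rfl)
  have hinj : Function.Injective (DirectSum.lof ℂ ℕ V k) := DirectSum.of_injective k
  constructor
  · intro x y hxy
    refine hinj (T.injective (funext fun l => ?_))
    rw [← h, ← h, hxy]
  · intro z
    obtain ⟨w, hw⟩ := T.surjective fun l => DirectSum.lof ℂ ℕ (W l) k (z l)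
    have h1 : DirectSum.lof ℂ ℕ V k (w k) = w := degOp_eigen k w (T.injective (funext fun l => by
      rw [hT, hw, degOp_lof, map_smul, hw]; rfl))
    refine ⟨w k, funext fun l => ?_⟩
    rw [gradedPart_apply, h1, hw]
    exact DirectSum.lof_apply ℂ k (z l)

variable [Fintype L]

/-- The isomorphism in a given degree underlying an isomorphism of graded spaces. -/
def gradedEquiv (hT : ∀ x l, T (degOp V 2 x) l = degOp (W l) 2 (T x l)) (k : ℕ) :
    V k ≃ₗ[ℂ] ⨁ l, W l k :=
  (LinearEquiv.ofBijective _ (gradedPart_bijective T hT k)).trans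
    (DirectSum.linearEquivFunOnFintype ℂ L fun l => W l k).symm

theorem gradedEquiv_apply (hT : ∀ x l, T (degOp V 2 x) l = degOp (W l) 2 (T x l)) (k : ℕ)
    (x : V k) (l : L) :
    gradedEquiv T hT k x l = (T (DirectSum.lof ℂ ℕ V k x) l : Total (W l)) k := rfl

theorem gradedEquiv_map {V' : ℕ → Type u} [∀ k, AddCommGroup (V' k)] [∀ k, Module ℂ (V' k)]
    {W' : L → ℕ → Type u} [∀ l k, AddCommGroup (W' l k)] [∀ l k, Module ℂ (W' l k)]
    (hT : ∀ x l, T (degOp V 2 x) l = degOp (W l) 2 (T x l)) (T' : Total V' ≃ₗ[ℂ] ∀ l, Total (W' l))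
    (hT' : ∀ x l, T' (degOp V' 2 x) l = degOp (W' l) 2 (T' x l)) (g : ∀ k, V k →ₗ[ℂ] V' k)
    (f : ∀ l k, W l k →ₗ[ℂ] W' l k)
    (h : ∀ x l, T' (DirectSum.lmap g x) l = DirectSum.lmap (f l) (T x l)) (k : ℕ) (x : V k) :
    gradedEquiv T' hT' k (g k x) = DirectSum.lmap (fun l => f l k) (gradedEquiv T hT k x) := by
  refine DFinsupp.ext fun l => ?_
  rw [DirectSum.lmap_apply, gradedEquiv_apply, gradedEquiv_apply, ← DirectSum.lmap_lof, h,
    DirectSum.lmap_apply]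

end Graded

section Piece

variable {n : ℕ} (lam : n.Partition) (V : ℕ → Type u) [∀ d, AddCommGroup (V d)]
  [∀ d, Module ℂ (V d)]

/-- The summand attached to a partition, by degree. -/
def PieceDeg (k : ℕ) : Type u := GTensor (fun j : Fin n => GSym (mult lam ((j : ℕ) + 1)) V) k

instance (k : ℕ) : AddCommGroup (PieceDeg lam V k) :=
  inferInstanceAs (AddCommGroup (GTensor (fun j : Fin n => GSym (mult lam ((j : ℕ) + 1)) V) k))

instance (k : ℕ) : Module ℂ (PieceDeg lam V k) :=
  inferInstanceAs (Module ℂ (GTensor (fun j : Fin n => GSym (mult lam ((j : ℕ) + 1)) V) k))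

/-- The summand attached to a partition. -/
abbrev PartPiece : Type u := Total (PieceDeg lam V)

/-- The projection from the tensor power. -/
def partSym : (⨂[ℂ] _ : PartIdx lam, Total V) →ₗ[ℂ] PartPiece lam V :=
  gsymQ (fun j : Fin n => mult lam ((j : ℕ) + 1)) V

theorem partSym_surjective : Function.Surjective (partSym lam V) := gsymQ_surjective _ _

theorem partSym_koszulT (σ : ∀ j : Fin n, Equiv.Perm (Fin (mult lam ((j : ℕ) + 1))))
    (x : ⨂[ℂ] _ : PartIdx lam, Total V) :
    partSym lam V (koszulT (degOp V (-1)) (lexCongr σ) x) = partSym lam V x :=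
  gsymQ_koszulT _ _ σ x

theorem partSym_ker (x : ⨂[ℂ] _ : PartIdx lam, Total V) (hx : partSym lam V x = 0) :
    x ∈ Submodule.span ℂ {y | ∃ (σ : ∀ j : Fin n, Equiv.Perm (Fin (mult lam ((j : ℕ) + 1)))) (z : _),
      y = koszulT (degOp V (-1)) (lexCongr σ) z - z} := gsymQ_ker _ _ x hx

theorem partSym_degOp (w : ℂ) (x : ⨂[ℂ] _ : PartIdx lam, Total V) :
    partSym lam V (PiTensorProduct.map (fun _ => degOp V w) x) =
      degOp (PieceDeg lam V) w (partSym lam V x) := gsymQ_degOp _ _ w x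

variable {V} {V' : ℕ → Type u} [∀ d, AddCommGroup (V' d)] [∀ d, Module ℂ (V' d)]

/-- The map of summands induced by a map of graded spaces. -/
def pieceMap (f : ∀ d, V d →ₗ[ℂ] V' d) (k : ℕ) : PieceDeg lam V k →ₗ[ℂ] PieceDeg lam V' k :=
  GTensor.map (W := fun j : Fin n => GSym (mult lam ((j : ℕ) + 1)) V)
    (W' := fun j : Fin n => GSym (mult lam ((j : ℕ) + 1)) V') (fun (j : Fin n) d => GSym.map (mult lam ((j : ℕ) + 1)) f d) k

/-- The map of summands induced by a map of graded spaces. -/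
abbrev partMap (f : ∀ d, V d →ₗ[ℂ] V' d) : PartPiece lam V →ₗ[ℂ] PartPiece lam V' :=
  DirectSum.lmap (pieceMap lam f)

theorem partSym_map (f : ∀ d, V d →ₗ[ℂ] V' d) (x : ⨂[ℂ] _ : PartIdx lam, Total V) :
    partSym lam V' (PiTensorProduct.map (fun _ => DirectSum.lmap f) x) =
      partMap lam f (partSym lam V x) := gsymQ_map _ f x

variable {U U' : ℕ → Type u} [∀ k, AddCommGroup (U k)] [∀ k, Module ℂ (U k)]
  [∀ k, AddCommGroup (U' k)] [∀ k, Module ℂ (U' k)]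

/-- The isomorphism in a given degree underlying an isomorphism of graded spaces. -/
def partEquiv (T : Total U ≃ₗ[ℂ] ∀ lam : n.Partition, PartPiece lam V)
    (hT : ∀ x lam, T (degOp U 2 x) lam = degOp (PieceDeg lam V) 2 (T x lam)) (k : ℕ) :
    U k ≃ₗ[ℂ] PartitionSum n V k :=
  gradedEquiv (W := fun lam => PieceDeg lam V) T hT k

theorem partEquiv_map (T : Total U ≃ₗ[ℂ] ∀ lam : n.Partition, PartPiece lam V)
    (hT : ∀ x lam, T (degOp U 2 x) lam = degOp (PieceDeg lam V) 2 (T x lam))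
    (T' : Total U' ≃ₗ[ℂ] ∀ lam : n.Partition, PartPiece lam V')
    (hT' : ∀ x lam, T' (degOp U' 2 x) lam = degOp (PieceDeg lam V') 2 (T' x lam))
    (g : ∀ d, U d →ₗ[ℂ] U' d) (f : ∀ d, V d →ₗ[ℂ] V' d)
    (h : ∀ x lam, T' (DirectSum.lmap g x) lam = partMap lam f (T x lam)) (k : ℕ) (x : U k) :
    partEquiv T' hT' k (g k x) = PartitionSum.map n f k (partEquiv T hT k x) :=
  gradedEquiv_map (W := fun lam => PieceDeg lam V) (W' := fun lam => PieceDeg lam V') T hT T' hT' g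
    (fun lam k => pieceMap lam f k) h k x

end Piece

section Operators

variable {E Q Q' : Type u} [Ring E] [Algebra ℂ E] [AddCommGroup Q] [Module ℂ Q]
  [AddCommGroup Q'] [Module ℂ Q']

variable (E) in
/-- The operator `w ^ k` in total degree `k`, for a degree operator on the coefficients. -/
def hcDeg (w : ℂ) (θ : Q →ₗ[ℂ] Q) : HC E Q →ₗ[ℂ] HC E Q :=
  degOp (HCk E Q) w ∘ₗ hcHat (AlgHom.id ℂ E) θ

theorem hcHat_congr {φ ψ : Q →ₗ[ℂ] Q'} (h : ∀ q, φ q = ψ q) (x : HC E Q) :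
    hcHat (AlgHom.id ℂ E) φ x = hcHat (AlgHom.id ℂ E) ψ x := by rw [LinearMap.ext h]

/-- Both parts of the differential lower by one the total degree, the sum of the Hochschild degree
and the degree of the coefficients. -/
theorem totD_hcDeg {β : Bimod E Q} {dQ θ : Q →ₗ[ℂ] Q} {w : ℂ}
    (hβ : BimodHom β β (AlgHom.id ℂ E) θ) (h : ∀ q, dQ (θ q) = w • θ (dQ q)) (x : HC E Q) :
    totD β dQ (hcDeg E w θ x) = w • hcDeg E w θ (totD β dQ x) := by
  have h : ∀ x : HC E Q, hcHat (AlgHom.id ℂ _) dQ (hcHat (AlgHom.id ℂ _) θ x) =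
        w • hcHat (AlgHom.id ℂ _) θ (hcHat (AlgHom.id ℂ _) dQ x) := fun x => by
    rw [hcHat_comp, hcHat_comp, ← hcHat_smul]
    exact hcHat_congr h x
  rw [totD_apply, totD_apply, hcDeg, LinearMap.comp_apply, LinearMap.comp_apply,
    shiftD_degOp, ← hcHat_hcTotD hβ, hcHat_degOp, h, map_add, hcHat_degOp,
    degOp_comp, map_add, degOp_comp, smul_add, map_smul, mul_comm]

theorem hcHat_hcDeg {aug : Q →ₗ[ℂ] Q'} {θ : Q →ₗ[ℂ] Q} {w : ℂ} (h : ∀ q, aug (θ q) = aug q)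
    (x : HC E Q) : hcHat (AlgHom.id ℂ E) aug (hcDeg E w θ x) =
      degOp (HCk E Q') w (hcHat (AlgHom.id ℂ E) aug x) := by
  rw [hcDeg, LinearMap.comp_apply, hcHat_degOp, hcHat_comp]
  exact congrArg _ (hcHat_congr h x)

variable {E' P P' : Type u} [Ring E'] [Algebra ℂ E'] [AddCommGroup P] [Module ℂ P]
  [AddCommGroup P'] [Module ℂ P']

theorem hcBottom_hcHat_square (f : E →ₐ[ℂ] E') {T : Q →ₗ[ℂ] P} {p : Q →ₗ[ℂ] Q'} {p' : P →ₗ[ℂ] P'}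
    {T' : Q' →ₗ[ℂ] P'} (h : ∀ q, p' (T q) = T' (p q)) (x : HC E Q) :
    hcBottom E' p' (hcHat f T x) = T' (hcBottom E p x) := by
  rw [hcBottom_hcHat, ← hcBottom_comp]
  exact congrArg (fun φ => hcBottom _ φ x) (LinearMap.ext h)

theorem hcBottom_hcDeg {θ : Q →ₗ[ℂ] Q} {p : Q →ₗ[ℂ] Q'} {θ' : Q' →ₗ[ℂ] Q'} {w : ℂ}
    (h : ∀ q, p (θ q) = θ' (p q)) (x : HC E Q) :
    hcBottom E p (hcDeg E w θ x) = θ' (hcBottom E p x) := by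
  rw [hcDeg, LinearMap.comp_apply, hcBottom_degOp]
  exact hcBottom_hcHat_square _ h x

theorem hcHat_square (f : E →ₐ[ℂ] E') {T : Q →ₗ[ℂ] P} {p : Q →ₗ[ℂ] Q'} {p' : P →ₗ[ℂ] P'}
    {T' : Q' →ₗ[ℂ] P'} (h : ∀ q, p' (T q) = T' (p q)) (x : HC E Q) :
    hcHat (AlgHom.id ℂ E') p' (hcHat f T x) = hcHat f T' (hcHat (AlgHom.id ℂ E) p x) :=
  hc_ext (f := hcHat (AlgHom.id ℂ E') p' ∘ₗ hcHat f T)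
    (g := hcHat f T' ∘ₗ hcHat (AlgHom.id ℂ E) p) (fun k m a => by simp [h]) x

end Operators

section Part

variable {n : ℕ} (lam : n.Partition) (A : Type u) [Ring A] [Algebra ℂ A]

/-- The projection to the summand attached to a partition. -/
def partQ : Homology (cycD (PartIdx lam) A) →ₗ[ℂ] PartPiece lam (HH A) :=
  partSym lam (HH A) ∘ₗ
    (LinearEquiv.ofBijective _ (cycTHom_bijective (PartIdx lam) A)).symm.toLinearMap

theorem partQ_cycTHom (x : ⨂[ℂ] _ : PartIdx lam, Total (fun k => HH A k)) :
    partQ lam A (cycTHom _ A x) = partSym lam (HH A) x :=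
  congrArg (partSym lam (HH A)) ((LinearEquiv.ofBijective _
    (cycTHom_bijective (PartIdx lam) A)).symm_apply_apply x)

theorem partQ_surjective : Function.Surjective (partQ lam A) :=
  (partSym_surjective _ _).comp (LinearEquiv.surjective _)

theorem partQ_cycT (τ : Equiv.Perm (PartIdx lam)) (h : ∀ c, partSize lam (τ c) = partSize lam c)
    (x : Homology (cycD (PartIdx lam) A)) :
    partQ lam A (Homology.map _ (hCompat_cycT_cycD τ) x) = partQ lam A x := by
  obtain ⟨σ, rfl⟩ := exists_lexCongr τ fun c => Fin.ext (h c)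
  obtain ⟨x, rfl⟩ := (cycTHom_bijective (PartIdx lam) A).2 x
  rw [← cycTHom_koszulT, partQ_cycTHom, partQ_cycTHom]
  exact partSym_koszulT _ _ σ x

theorem partQ_ker (x : Homology (cycD (PartIdx lam) A)) (hx : partQ lam A x = 0) :
    x ∈ Submodule.span ℂ {y | ∃ (τ : Equiv.Perm (PartIdx lam)) (m : _),
      (∀ c, partSize lam (τ c) = partSize lam c) ∧
        y = Homology.map _ (hCompat_cycT_cycD τ) m - m} := by
  obtain ⟨x, rfl⟩ := (cycTHom_bijective (PartIdx lam) A).2 x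
  rw [partQ_cycTHom] at hx
  refine Submodule.span_mono ?_ ((Submodule.map_span _ _).le
    (Submodule.mem_map_of_mem (f := cycTHom _ A) (partSym_ker _ _ x hx)))
  rintro _ ⟨_, ⟨σ, z, rfl⟩, rfl⟩
  refine ⟨lexCongr σ, cycTHom _ A z, fun c => ?_, ?_⟩
  · obtain ⟨⟨j, i⟩, rfl⟩ := toLex.surjective c
    rw [lexCongr_toLex]
    rfl
  · rw [map_sub, cycTHom_koszulT]

theorem partQ_cycDeg {w : ℂ} (hw : w ≠ 0) (x : Homology (cycD (PartIdx lam) A)) :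
    partQ lam A (Homology.map _ (hCompat_cycDeg A hw) x) =
      degOp (PieceDeg lam (HH A)) w (partQ lam A x) := by
  obtain ⟨x, rfl⟩ := (cycTHom_bijective (PartIdx lam) A).2 x
  rw [← cycTHom_degOp A hw, partQ_cycTHom, partQ_cycTHom]
  exact partSym_degOp _ _ w x

theorem partQ_cycMap {A B : Type u} [Ring A] [Algebra ℂ A] [Ring B] [Algebra ℂ B] (f : A →ₐ[ℂ] B)
    (x : Homology (cycD (PartIdx lam) A)) :
    partQ lam B (Homology.map _ (hCompat_cycMap f) x) = partMap lam (HHMap f) (partQ lam A x) := by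
  obtain ⟨x, rfl⟩ := (cycTHom_bijective (PartIdx lam) A).2 x
  rw [← cycTHom_map, partQ_cycTHom, partQ_cycTHom]
  exact partSym_map _ (HHMap f) x

variable (n) in
/-- The components of the Hochschild homology of the crossed product. -/
def crossedParts : Homology (wrTot A n) →ₗ[ℂ] ∀ lam : n.Partition, PartPiece lam (HH A) :=
  LinearMap.pi fun lam =>
    (partQ lam A ∘ₗ beadHom A (partSize lam)) ∘ₗ wrHom A n (beadRotate (partSize lam))

theorem crossedParts_apply (y : Homology (wrTot A n)) : crossedParts n A y lam =
    partQ lam A (beadHom A (partSize lam) (wrHom A n (beadRotate (partSize lam)) y)) := rfl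

variable (n) in
-- For each partition, the coinvariants under permutations of equal parts correspond by
-- `beadHom_coinvariants` to the coinvariants under the centralizer.
theorem crossedParts_bijective : Function.Bijective (crossedParts n A) :=
  (classifies_beadRotate n).bijective (X := fun lam => PartPiece lam (HH A))
    (fun lam => partQ lam A ∘ₗ beadHom A (partSize lam))
    (fun lam => (partQ_surjective lam A).comp (beadHom_bijective _).2)
    (fun lam => (beadHom_coinvariants (partQ_cycT lam A) (partQ_ker lam A)).1)
    (fun lam => (beadHom_coinvariants (partQ_cycT lam A) (partQ_ker lam A)).2)

variable (n) in
/-- The augmentation to the Hochschild complex of the crossed product, on homology. -/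
def crossedAug : Homology (wrTot A n) →ₗ[ℂ]
    Homology (hcTotD (Bimod.regular (CrossedProduct A n))) :=
  Homology.map (hcHat (AlgHom.id ℂ _) (wrAug A n)) hCompat_wrAug

variable (n) in
theorem crossedAug_bijective : Function.Bijective (crossedAug n A) := wrAug_bijective

variable (n) in
/-- The isomorphism of total Hochschild homology. -/
def crossedTotal : (⨁ k, HH (CrossedProduct A n) k) ≃ₗ[ℂ] ∀ lam : n.Partition, PartPiece lam (HH A) :=
  (LinearEquiv.ofBijective _ (regHom_bijective (CrossedProduct A n))).trans
    ((LinearEquiv.ofBijective _ (crossedAug_bijective n A)).symm.trans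
      (LinearEquiv.ofBijective _ (crossedParts_bijective n A)))

variable {A}

/-- The isomorphism inverts `crossedAug`. Its compatibilities are therefore checked on a class `y`
of the total complex that lifts the given one. -/
theorem crossedTotal_eq {x : ⨁ k, HH (CrossedProduct A n) k} {y : Homology (wrTot A n)}
    (h : regHom _ x = crossedAug n A y) : crossedTotal n A x = crossedParts n A y := by
  exact congrArg (crossedParts n A) ((LinearEquiv.symm_apply_eq _).2 h)

theorem exists_crossedAug (x : ⨁ k, HH (CrossedProduct A n) k) :
    ∃ y, regHom _ x = crossedAug n A y :=
  ((crossedAug_bijective n A).2 (regHom _ x)).imp fun _ h => h.symm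

/-- The degree operator on the total complex. -/
def wrTotDeg (w : ℂ) : HC (CrossedProduct A n) (WrQ A n) →ₗ[ℂ] HC (CrossedProduct A n) (WrQ A n) :=
  hcDeg _ w (wrDeg w)

theorem bimodHom_wrDeg (w : ℂ) :
    BimodHom (wrBimod A n) (wrBimod A n) (AlgHom.id ℂ _) (wrDeg w) :=
  bimodHom_wrMap_id _ (resDeg_actL w) (resDeg_actR w) fun g p => (resT_resDeg g w p).symm

theorem hCompat_wrTotDeg {w : ℂ} (hw : w ≠ 0) :
    HCompat (wrTot A n) (wrTot A n) (wrTotDeg w) :=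
  .of_smul_comm w (fun x => totD_hcDeg (bimodHom_wrDeg w) (wrD_wrDeg w) x) hw

theorem crossedAug_deg {w : ℂ} (hw : w ≠ 0) (y : Homology (wrTot A n)) :
    crossedAug n A (Homology.map _ (hCompat_wrTotDeg hw) y) =
      Homology.map _ (hCompat_degOp _ hw) (crossedAug n A y) := by
  exact Homology.map_square _ _ _ _ (hcHat_hcDeg (wrAug_wrDeg w)) _

theorem hCompat_closeD_cycDeg {Ω : Type} [Fintype Ω] [LinearOrder Ω] (c : Equiv.Perm Ω) {w : ℂ}
    (hw : w ≠ 0) : HCompat (closeD (A := A) c) (closeD c) (cycDeg w) :=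
  .of_smul_comm w (fun x => closeD_cycDeg c w x) hw

theorem wrHom_deg {Ω : Type} [Fintype Ω] [LinearOrder Ω] (c : Equiv.Perm Ω) {w : ℂ}
    (hw : w ≠ 0) (y : Homology (wrTot A n)) :
    wrHom A n c (Homology.map _ (hCompat_wrTotDeg hw) y) =
      Homology.map _ (hCompat_closeD_cycDeg c hw) (wrHom A n c y) := by
  exact Homology.map_square _ _ _ _ (hcBottom_hcDeg (wrClose_wrDeg c w)) _

/-- Every map in the construction commutes with the operator `2 ^ k` in total degree `k`, so the
isomorphism preserves degrees. -/
theorem crossedTotal_degOp (x : ⨁ k, HH (CrossedProduct A n) k) (lam : n.Partition) :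
    crossedTotal n A (degOp (fun k => HH (CrossedProduct A n) k) 2 x) lam =
      degOp (PieceDeg lam (HH A)) 2 (crossedTotal n A x lam) := by
  have h2 : (2 : ℂ) ≠ 0 := two_ne_zero
  obtain ⟨y, hy⟩ := exists_crossedAug x
  rw [crossedTotal_eq hy, crossedTotal_eq (y := Homology.map _ (hCompat_wrTotDeg h2) y)
    (by rw [regHom_degOp _ h2, hy, crossedAug_deg h2]), crossedParts_apply, crossedParts_apply,
    wrHom_deg _ h2, ← partQ_cycDeg lam A h2]
  exact congrArg _ (Homology.map_square _ _ (hCompat_beadContract (partSize lam)) _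
    (fun x => beadContract_cycDeg _ _ x) _)

variable {B : Type u} [Ring B] [Algebra ℂ B] (f : A →ₐ[ℂ] B)

variable (n) in
theorem bimodHom_wrMap_resMap : BimodHom (wrBimod A n) (wrBimod B n) (crossedMap n f)
    (wrMap (resMap f)) :=
  bimodHom_wrMap f _ (resMap_actL f) (resMap_actR f) fun g => resMap_resT f g

variable (n) in
theorem hCompat_wrMap : HCompat (wrTot A n) (wrTot B n)
    (hcHat (crossedMap n f) (wrMap (resMap f))) :=
  .of_comm fun x => hcHat_totD (bimodHom_wrMap_resMap n f) (fun q => by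
    refine wrQ_ext (f := wrMap (resMap f) ∘ₗ wrD) (g := wrD ∘ₗ wrMap (resMap f)) (fun g p => ?_) q
    rw [LinearMap.comp_apply, LinearMap.comp_apply, wrD_single, wrMap_single, wrMap_single,
      wrD_single, resMap_resD]) x

theorem wrAug_wrMap (q : WrQ A n) :
    wrAug B n (wrMap (resMap f) q) = crossedMap n f (wrAug A n q) := by
  refine wrQ_ext (f := wrAug B n ∘ₗ wrMap (resMap f))
    (g := (crossedMap n f).toLinearMap ∘ₗ wrAug A n) (fun g p => ?_) q
  rw [LinearMap.comp_apply, LinearMap.comp_apply, wrMap_single, wrAug_single, wrAug_single,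
    AlgHom.toLinearMap_apply, crossedMap_single, resAug_resMap]
  rfl

theorem crossedAug_map (y : Homology (wrTot A n)) :
    crossedAug n B (Homology.map _ (hCompat_wrMap n f) y) =
      Homology.map _ (hCompat_hcHat_regular (crossedMap n f)) (crossedAug n A y) := by
  exact Homology.map_square _ _ _ _ (hcHat_square _ (wrAug_wrMap f)) _

theorem hCompat_closeD_cycMap {Ω : Type} [Fintype Ω] [LinearOrder Ω] (c : Equiv.Perm Ω) :
    HCompat (closeD (A := A) c) (closeD c) (cycMap f) :=
  .of_comm fun x => cycMap_closeD f c x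

theorem wrHom_map {Ω : Type} [Fintype Ω] [LinearOrder Ω] (c : Equiv.Perm Ω)
    (y : Homology (wrTot A n)) :
    wrHom B n c (Homology.map _ (hCompat_wrMap n f) y) =
      Homology.map _ (hCompat_closeD_cycMap f c) (wrHom A n c y) := by
  exact Homology.map_square _ _ _ _ (hcBottom_hcHat_square _ (wrClose_wrMap f c)) _

/-- Resolution, closing up, contraction of cycles and passage to symmetric powers are all functorial
in the algebra. A lift of a class is carried by `f` to a lift of its image. -/
theorem crossedTotal_map (x : ⨁ k, HH (CrossedProduct A n) k) (lam : n.Partition) :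
    crossedTotal n B (DirectSum.lmap (HHMap (crossedMap n f)) x) lam =
      partMap lam (HHMap f) (crossedTotal n A x lam) := by
  obtain ⟨y, hy⟩ := exists_crossedAug x
  rw [crossedTotal_eq hy, crossedTotal_eq (y := Homology.map _ (hCompat_wrMap n f) y)
    (by rw [regHom_map, hy, crossedAug_map]), crossedParts_apply, crossedParts_apply,
    wrHom_map, ← partQ_cycMap lam f]
  exact congrArg _ (Homology.map_square _ _ (hCompat_beadContract (partSize lam)) _
    (fun x => beadContract_map _ f x) _)

end Part

/-- The isomorphism in a given degree. -/
def crossedEquiv (n : ℕ) (A : Type u) [Ring A] [Algebra ℂ A] (k : ℕ) :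
    HH (CrossedProduct A n) k ≃ₗ[ℂ] PartitionSum n (HH A) k :=
  partEquiv (crossedTotal n A) crossedTotal_degOp k

theorem crossedEquiv_map (n : ℕ) {A B : Type u} [Ring A] [Algebra ℂ A] [Ring B] [Algebra ℂ B]
    (f : A →ₐ[ℂ] B) (k : ℕ) (x : HH (CrossedProduct A n) k) :
    crossedEquiv n B k (HHMap (crossedMap n f) k x) =
      PartitionSum.map n (HHMap f) k (crossedEquiv n A k x) :=
  partEquiv_map _ _ _ _ (HHMap (crossedMap n f)) (HHMap f) (crossedTotal_map f) k x

end HochschildWreath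

end

theorem theorem3p1 (n : ℕ) :
    ∃ Φ : ∀ (A : Type u) [Ring A] [Algebra ℂ A] (k : ℕ),
        HochschildWreath.HH (HochschildWreath.CrossedProduct A n) k ≃ₗ[ℂ]
          HochschildWreath.PartitionSum n (HochschildWreath.HH A) k,
      ∀ (A B : Type u) [Ring A] [Algebra ℂ A] [Ring B] [Algebra ℂ B] (f : A →ₐ[ℂ] B) (k : ℕ)
        (x : HochschildWreath.HH (HochschildWreath.CrossedProduct A n) k),
        Φ B k (HochschildWreath.HHMap (HochschildWreath.crossedMap n f) k x) =
          HochschildWreath.PartitionSum.map n (HochschildWreath.HHMap f) k (Φ A k x) :=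
  ⟨fun A _ _ k => HochschildWreath.crossedEquiv n A k, fun _ _ _ _ _ _ f k x =>
    HochschildWreath.crossedEquiv_map n f k x⟩
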